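/- Let $k$ be a field of characteristic $p \geq 3$, let $r, s \geq 1$, and let $G$ be an algebraic $k$-supergroup scheme, with coordinate Hopf superalgebra $k[G]$ (finitely generated as a $k$-algebra). *The supergroup $\mathbb{M}_{r;s}$.* Let $\mathbb{M}_{r;s}$ be the finite $k$-supergroup scheme whose coordinate superalgebra is the commutative superalgebra generated by an odd element $\tau$ and even elements $\theta, \sigma_0, \ldots, \sigma_{p^s-1}$, subject to the relations $\tau^2 = 0$, $\sigma_0 = 1$, $\theta^{p^{r-1}} = \sigma_1$ and $\sigma_i \sigma_j = \binom{i+j}{i} \sigma_{i+j}$ (where $\sigma_n = 0$ for $n \geq p^s$). The elements $\tau$ and $\theta$ are primitive, and $$\Delta(\sigma_i) = \sum_{u+v=i} \sigma_u \otimes \sigma_v + \sum_{u+v+p=i} \sigma_u\tau \otimes \sigma_v\tau.$$ *Cohomology.* Write $H^\bullet(G,k)$ for the cohomology ring of $G$, computed by the Hochschild complex $k[G]^{\otimes \bullet}$; it carries the cohomological grading and the internal $\mathbb{Z}/2$-grading induced by that of $k[G]$. Set $H(G,k) = H^{\mathrm{ev}}(G,k)_{\overline 0} \oplus H^{\mathrm{odd}}(G,k)_{\overline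 1}$. Consider the classes $$x_i = \Big[\sum_{j=1}^{p-1} \tfrac{(p-1)!}{j!(p-j)!} (\theta^{p^{i-1}})^j \otimes (\theta^{p^{i-1}})^{p-j}\Big], \qquad \lambda_i = [\theta^{p^{i-1}}] \quad (1 \leq i \leq r), \qquad y = [\tau],$$ and, if $s \geq 2$, also $w_s = -\big[\sum_{j=1}^{p^s-1} \sigma_j \otimes \sigma_{p^s-j} + \sum_{u+v+p=p^s} \sigma_u\tau \otimes \sigma_v\tau\big]$. These classes generate the ring $H^\bullet(\mathbb{M}_{r;s},k)$, and (this is part of the claim) there is exactly one homomorphism of $k$-algebras $\varepsilon : H^\bullet(\mathbb{M}_{r;s},k) \to k$ with $\varepsilon(y) = \varepsilon(x_r) = 1$, $\varepsilon(x_i) = 0$ for $i < r$, $\varepsilon(\lambda_i) = 0$ for all $i$ and, if $s \geq 2$, $\varepsilon(w_s) = 0$. *The scheme $V_{r;s}(G)$.* Let $V_{r;s}(G)$ be the affine $k$-scheme with $V_{r;s}(G)(A)$ the set of homomorphisms of $A$-supergroup schemes $\mathbb{M}_{r;s} \otimes_k A \to G \otimes_k A$ for every commutative (purely even) $k$-algebra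 $A$; let $A_G = k[V_{r;s}(G)]$ be its coordinate algebra, and let $u_G : \mathbb{M}_{r;s} \otimes_k A_G \to G \otimes_k A_G$ be the universal homomorphism. *The map $\psi_{r;s}$.* Let $\psi_{r;s} : H(G,k) \to A_G$ be the composite of the base change map $H(G,k) \to H^\bullet(G \otimes_k A_G, A_G)$, of $u_G^* : H^\bullet(G \otimes_k A_G, A_G) \to H^\bullet(\mathbb{M}_{r;s} \otimes_k A_G, A_G) = H^\bullet(\mathbb{M}_{r;s},k) \otimes_k A_G$, and of $\varepsilon \otimes A_G$; it is a homomorphism of $k$-algebras. *The grading of $k[V_{r;s}(G)]$.* Set $B = k[x,y]/(x^{p^r} - y^2)$, so that $\operatorname{Spec}(B)(A) = \{(\mu,a) \in A \times A : a^{p^r} = \mu^2\}$ is a monoid under componentwise multiplication (where $a$ and $\mu$ are the values of $x$ and $y$). For $(\mu,a) \in \operatorname{Spec}(B)(A)$ let $\rho_{(\mu,a)}$ be the endomorphism of $\mathbb{M}_{r;s} \otimes_k A$ with comorphism $\tau \mapsto \mu\tau$, $\theta \mapsto a\theta$, $\sigma_i \mapsto a^{ip^{r-1}}\sigma_i$.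 Then $(u,(\mu,a)) \mapsto u \circ \rho_{(\mu,a)}$ is a right action of $\operatorname{Spec}(B)$ on $V_{r;s}(G)$; let $f^* : A_G \to A_G \otimes B$ be its comorphism. For $d \in \mathbb{Z}[\tfrac{p^r}{2}] \subseteq \mathbb{Q}$ let the component of degree $d$ of $k[V_{r;s}(G)]$ be $\{a : f^*(a) = a \otimes x^i\}$ if $d = i$ with $i \in \mathbb{N}$, be $\{a : f^*(a) = a \otimes x^i y\}$ if $d = i + \tfrac{p^r}{2}$ with $i \in \mathbb{N}$, and be $0$ otherwise. **Claim.** The homomorphism $\varepsilon$ exists and is unique; the cohomological degree makes $H(G,k)$ an $\mathbb{N}$-graded $k$-algebra, with component $H^n(G,k)_{\overline n}$ in degree $n$; the components just defined make $k[V_{r;s}(G)]$ a $\mathbb{Z}[\tfrac{p^r}{2}]$-graded $k$-algebra; and $$\psi_{r;s} : H(G,k) \to k[V_{r;s}(G)]$$ is a homomorphism of graded $k$-algebras that multiplies degrees by $\tfrac{p^r}{2}$: if $z \in H(G,k)$ is homogeneous of degree $n$, then $\psi_{r;s}(z)$ is homogeneous of degree $n \cdot \tfrac{p^r}{2}$.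 -/

import Mathlib

open scoped TensorProduct

noncomputable section

namespace SuperCoh

set_option linter.unusedSectionVars false

section Hochschild

variable (R : Type*) (C : Type*) [CommRing R] [Ring C] [Algebra R C] [Coalgebra R C]

/-!
### The cohomology ring of a (super)bialgebra

`R` is a commutative ring and `C` is an `R`-algebra with an `R`-coalgebra structure (the
coordinate (super)algebra of a (super)monoid scheme over `R`). The Hochschild complex with trivial
coefficients is the tensor algebra of the `R`-module `C`; its part of degree `n` is `C ^ {⊗ n}`,
and the product is concatenation of tensors.
-/

/-- The underlying algebra of the Hochschild complex `C^•(G, R) = R[G] ^ {⊗ •}`. -/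
abbrev Cochains := TensorAlgebra R C

/-- `c ∈ C` as a cochain of degree one. -/
abbrev inj : C →ₗ[R] Cochains R C := TensorAlgebra.ι R

/-- The automorphism `t ↦ (-1) ^ (deg t) t`. -/
def sgn : Cochains R C →ₐ[R] Cochains R C := TensorAlgebra.lift R (-(inj R C))

/-- `C ⊗ C` as the part of degree two of the Hochschild complex. -/
def juxt : C ⊗[R] C →ₗ[R] Cochains R C :=
  LinearMap.mul' R (Cochains R C) ∘ₗ TensorProduct.map (inj R C) (inj R C)

/-- The differential in degree one, `c ↦ 1 ⊗ c + c ⊗ 1 - Δ c`. -/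
def diffOne : C →ₗ[R] Cochains R C :=
  LinearMap.mulLeft R (inj R C 1) ∘ₗ inj R C + LinearMap.mulRight R (inj R C 1) ∘ₗ inj R C
    - juxt R C ∘ₗ Coalgebra.comul

/-- The differential `d` is the derivation with `d (a b) = d (a) b + (-1) ^ (deg a) a d (b)` that
extends `diffOne`. To construct it, extend the linear map sending `c` to the matrix with rows
`(-c, diffOne c)`, `(0, c)` to an algebra homomorphism; `d` is the upper right entry. -/
def diffAuxOne : C →ₗ[R] Matrix (Fin 2) (Fin 2) (Cochains R C) where
  toFun c := !![-(inj R C c), diffOne R C c; 0, inj R C c]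
  map_add' a b := by
    ext i j; fin_cases i <;> fin_cases j <;> simp [add_comm]
  map_smul' r a := by
    ext i j; fin_cases i <;> fin_cases j <;> simp

/-- The algebra homomorphism with entries `(-1) ^ (deg t) t`, `d t`, `0`, `t`. -/
def diffAux : Cochains R C →ₐ[R] Matrix (Fin 2) (Fin 2) (Cochains R C) :=
  TensorAlgebra.lift R (diffAuxOne R C)

/-- The differential of the Hochschild complex, that is, the signed derivation with
`d c = 1 ⊗ c + c ⊗ 1 - Δ c` for `c ∈ C`. -/
def diff : Cochains R C →ₗ[R] Cochains R C where
  toFun t := diffAux R C t 0 1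
  map_add' a b := by simp
  map_smul' r a := by simp

theorem sgn_inj (c : C) : sgn R C (inj R C c) = - inj R C c := by
  simp [sgn]

theorem diff_inj (c : C) : diff R C (inj R C c) =
    inj R C 1 * inj R C c + inj R C c * inj R C 1 - juxt R C (Coalgebra.comul c) := by
  simp [diff, diffAux, diffAuxOne, diffOne]

theorem diffAux_apply (t : Cochains R C) :
    diffAux R C t = !![sgn R C t, diff R C t; 0, t] := by
  induction t using TensorAlgebra.induction with
  | algebraMap r =>
    ext i j; fin_cases i <;> fin_cases j <;> simp [diff, Matrix.algebraMap_matrix_apply]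
  | ι c =>
    ext i j; fin_cases i <;> fin_cases j <;> simp [diff, diffAux, diffAuxOne, sgn]
  | mul a b ha hb =>
    ext i j
    have h : diff R C (a * b) = sgn R C a * diff R C b + diff R C a * b := by
      change diffAux R C (a * b) 0 1 = _
      rw [map_mul, ha, hb]; simp [Matrix.mul_apply]
    rw [map_mul, ha, hb]
    fin_cases i <;> fin_cases j <;> simp [Matrix.mul_apply, h]
  | add a b ha hb =>
    ext i j
    rw [map_add, ha, hb]
    fin_cases i <;> fin_cases j <;> simp

theorem diff_mul (a b : Cochains R C) :
    diff R C (a * b) = diff R C a * b + sgn R C a * diff R C b := by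
  change diffAux R C (a * b) 0 1 = _
  rw [map_mul, diffAux_apply, diffAux_apply]; simp [Matrix.mul_apply, add_comm]

theorem diff_one : diff R C 1 = 0 := by simp [diff]

theorem diff_algebraMap (r : R) : diff R C (algebraMap R _ r) = 0 := by
  rw [Algebra.algebraMap_eq_smul_one, map_smul, diff_one, smul_zero]

theorem sgn_sgn (a : Cochains R C) : sgn R C (sgn R C a) = a := by
  have : (sgn R C).comp (sgn R C) = AlgHom.id R _ := by
    ext c; simp [sgn]
  exact DFunLike.congr_fun this a

theorem sgn_juxt (x : C ⊗[R] C) : sgn R C (juxt R C x) = juxt R C x := by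
  induction x with
  | zero => simp
  | add a b ha hb => simp [ha, hb]
  | tmul a b => simp [juxt, sgn]

theorem diff_sgn (a : Cochains R C) : diff R C (sgn R C a) = - sgn R C (diff R C a) := by
  induction a using TensorAlgebra.induction with
  | algebraMap r => simp [diff_algebraMap]
  | ι c =>
    rw [sgn_inj, map_neg, diff_inj]; simp [sgn_juxt, sgn_inj]
  | mul a b ha hb =>
    rw [map_mul, diff_mul, diff_mul, ha, hb]; simp
    abel
  | add a b ha hb => simp [ha, hb]; abel

theorem diff_juxt_comul (c : C) : diff R C (juxt R C (Coalgebra.comul c)) =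
    inj R C 1 * juxt R C (Coalgebra.comul c) - juxt R C (Coalgebra.comul c) * inj R C 1 := by
  let f : C ⊗[R] (C ⊗[R] C) →ₗ[R] Cochains R C :=
    LinearMap.mul' R (Cochains R C) ∘ₗ TensorProduct.map (inj R C) (juxt R C)
  have key : ∀ x : C ⊗[R] C, diff R C (juxt R C x) =
      inj R C 1 * juxt R C x - juxt R C x * inj R C 1
      - f (TensorProduct.assoc R C C C ((Coalgebra.comul (R := R)).rTensor C x))
      + f ((Coalgebra.comul (R := R)).lTensor C x) := by
    intro x
    induction x with
    | zero => simp
    | add a b ha hb => simp only [map_add, ha, hb]; simp only [mul_add, add_mul]; abel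
    | tmul a b =>
      have h1 : ∀ y : C ⊗[R] C, f (TensorProduct.assoc R C C C (y ⊗ₜ b)) =
          juxt R C y * inj R C b := by
        intro y
        induction y with
        | zero => simp
        | add u v hu hv => simp only [TensorProduct.add_tmul, map_add, hu, hv, add_mul]
        | tmul u v => simp [f, juxt, mul_assoc]
      have h2 : juxt R C (a ⊗ₜ b) = inj R C a * inj R C b := by simp [juxt]
      rw [LinearMap.rTensor_tmul, h1, LinearMap.lTensor_tmul, h2, diff_mul, diff_inj, diff_inj,
        sgn_inj]
      have h3 : f (a ⊗ₜ Coalgebra.comul b) = inj R C a * juxt R C (Coalgebra.comul b) := by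
        simp [f]
      rw [h3]; noncomm_ring
  rw [key, Coalgebra.coassoc_apply]; abel

theorem diff_diff (h1 : Coalgebra.comul (R := R) (1 : C) = 1 ⊗ₜ 1) (a : Cochains R C) : diff R C (diff R C a) = 0 := by
  induction a using TensorAlgebra.induction with
  | algebraMap r => simp [diff_algebraMap]
  | ι c =>
    rw [diff_inj]
    simp only [map_add, map_sub, diff_mul, diff_juxt_comul, diff_inj, sgn_inj]
    have : juxt R C (Coalgebra.comul 1) = inj R C 1 * inj R C 1 := by
      rw [h1]; simp [juxt]
    rw [this]
    noncomm_ring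
  | mul a b ha hb =>
    simp only [diff_mul, map_add, ha, hb, diff_sgn, sgn_sgn]; simp
  | add a b ha hb => simp [ha, hb]

/-- The algebra of cocycles. -/
def cocycles : Subalgebra R (Cochains R C) where
  carrier := {t | diff R C t = 0}
  mul_mem' {a b} ha hb := by
    change diff R C (a * b) = 0
    rw [diff_mul, show diff R C a = 0 from ha, show diff R C b = 0 from hb]; simp
  add_mem' {a b} ha hb := by
    change diff R C (a + b) = 0
    rw [map_add, show diff R C a = 0 from ha, show diff R C b = 0 from hb]; simp
  algebraMap_mem' r := diff_algebraMap R C r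

/-- The ideal of coboundaries in the algebra of cocycles. -/
def coboundaries : Ideal (cocycles R C) where
  carrier := {z | ∃ t, diff R C t = z}
  add_mem' := by
    rintro a b ⟨s, hs⟩ ⟨t, ht⟩
    exact ⟨s + t, by simp [hs, ht]⟩
  zero_mem' := ⟨0, by simp⟩
  smul_mem' := by
    rintro c x ⟨t, ht⟩
    refine ⟨sgn R C c * t, ?_⟩
    have hc : diff R C c = 0 := c.2
    rw [diff_mul, diff_sgn, hc, sgn_sgn, ht]; simp

instance : (coboundaries R C).IsTwoSided where
  mul_mem_of_left := by
    rintro a b ⟨t, ht⟩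
    refine ⟨t * b, ?_⟩
    have hb : diff R C b = 0 := b.2
    rw [diff_mul, hb, ht]; simp

/-- The cohomology ring `H^•(G, R)`: cocycles modulo coboundaries. -/
def Coh := cocycles R C ⧸ coboundaries R C

instance : Ring (Coh R C) := inferInstanceAs (Ring (cocycles R C ⧸ coboundaries R C))

instance {S : Type*} [CommRing S] [Algebra S R] [Module S C] [IsScalarTower S R C] :
    Algebra S (Coh R C) :=
  inferInstanceAs (Algebra S (cocycles R C ⧸ coboundaries R C))

instance {S : Type*} [CommRing S] [Algebra S R] [Module S C] [IsScalarTower S R C] :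
    IsScalarTower S R (Coh R C) :=
  inferInstanceAs (IsScalarTower S R (cocycles R C ⧸ coboundaries R C))

/-- The class of a cocycle. -/
def cocycleClass : cocycles R C →ₐ[R] Coh R C :=
  Ideal.Quotient.mkₐ R (coboundaries R C)

theorem cocycleClass_surjective : Function.Surjective (cocycleClass R C) :=
  Ideal.Quotient.mk_surjective

theorem cocycleClass_eq_zero (z : cocycles R C) :
    cocycleClass R C z = 0 ↔ ∃ t, diff R C t = z :=
  Ideal.Quotient.eq_zero_iff_mem

end Hochschild

section Functoriality

variable {R : Type*} {C C' : Type*} [CommRing R] [Ring C] [Algebra R C] [Coalgebra R C]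
  [Ring C'] [Algebra R C'] [Coalgebra R C']

/-- The map of Hochschild complexes induced by a homomorphism that respects products and
coproducts. -/
def cochainMap (f : C →ₐc[R] C') : Cochains R C →ₐ[R] Cochains R C' :=
  TensorAlgebra.lift R (inj R C' ∘ₗ (f : C →ₗ[R] C'))

theorem cochainMap_inj (f : C →ₐc[R] C') (c : C) :
    cochainMap f (inj R C c) = inj R C' (f c) := by
  simp [cochainMap]

theorem cochainMap_sgn (f : C →ₐc[R] C') (t : Cochains R C) :
    cochainMap f (sgn R C t) = sgn R C' (cochainMap f t) := by
  have : (cochainMap f).comp (sgn R C) = (sgn R C').comp (cochainMap f) := by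
    ext c; simp [cochainMap, sgn]
  exact DFunLike.congr_fun this t

theorem cochainMap_juxt (f : C →ₐc[R] C') (x : C ⊗[R] C) :
    cochainMap f (juxt R C x) =
      juxt R C' (TensorProduct.map (f : C →ₗ[R] C') (f : C →ₗ[R] C') x) := by
  induction x with
  | zero => simp
  | add a b ha hb => simp [ha, hb]
  | tmul a b => simp [juxt, cochainMap_inj]

theorem cochainMap_diff (f : C →ₐc[R] C') (t : Cochains R C) :
    cochainMap f (diff R C t) = diff R C' (cochainMap f t) := by
  induction t using TensorAlgebra.induction with
  | algebraMap r => simp [diff_algebraMap]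
  | ι c =>
    have h : TensorProduct.map (f : C →ₗ[R] C') (f : C →ₗ[R] C') (Coalgebra.comul c) =
      Coalgebra.comul (f c) := CoalgHomClass.map_comp_comul_apply f c
    rw [cochainMap_inj, diff_inj, diff_inj, map_sub, map_add, map_mul, map_mul, cochainMap_juxt,
      cochainMap_inj, cochainMap_inj, map_one, h]
  | mul a b ha hb => simp only [diff_mul, map_add, map_mul, ha, hb, cochainMap_sgn]
  | add a b ha hb => simp [ha, hb]

/-- The map on cocycles. -/
def cocycleMap (f : C →ₐc[R] C') : cocycles R C →ₐ[R] cocycles R C' :=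
  ((cochainMap f).comp (cocycles R C).val).codRestrict (cocycles R C') fun z => by
    change diff R C' (cochainMap f z) = 0
    rw [← cochainMap_diff, show diff R C z = 0 from z.2, map_zero]

/-- The homomorphism of cohomology rings induced by a homomorphism that respects products and
coproducts. -/
def cohMap (f : C →ₐc[R] C') : Coh R C →ₐ[R] Coh R C' :=
  Ideal.Quotient.liftₐ (coboundaries R C)
    ((cocycleClass R C').comp (cocycleMap f)) (by
      rintro z ⟨t, ht⟩
      refine (cocycleClass_eq_zero R C' _).mpr ⟨cochainMap f t, ?_⟩
      rw [← cochainMap_diff, ht]; rfl)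

end Functoriality

section BaseChange

variable (k : Type*) (A : Type*) (C : Type*) [Field k] [CommRing A] [Algebra k A]
  [Ring C] [Algebra k C] [Coalgebra k C]

/-- The map of Hochschild complexes induced by `C → A ⊗ C`, `c ↦ 1 ⊗ c`. -/
def cochainBase : Cochains k C →ₐ[k] Cochains A (A ⊗[k] C) :=
  TensorAlgebra.lift k ((inj A (A ⊗[k] C)).restrictScalars k ∘ₗ TensorProduct.mk k A C 1)

theorem cochainBase_inj (c : C) :
    cochainBase k A C (inj k C c) = inj A (A ⊗[k] C) (1 ⊗ₜ c) := by
  simp [cochainBase]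

theorem cochainBase_sgn (t : Cochains k C) :
    cochainBase k A C (sgn k C t) = sgn A (A ⊗[k] C) (cochainBase k A C t) := by
  have : (cochainBase k A C).comp (sgn k C) =
      ((sgn A (A ⊗[k] C)).restrictScalars k).comp (cochainBase k A C) := by
    ext c; simp [cochainBase, sgn]
  exact DFunLike.congr_fun this t

theorem cochainBase_juxt_comul (c : C) :
    cochainBase k A C (juxt k C (Coalgebra.comul c)) =
      juxt A (A ⊗[k] C) (Coalgebra.comul (1 ⊗ₜ c)) := by
  have key : ∀ x : C ⊗[k] C, cochainBase k A C (juxt k C x) =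
      juxt A (A ⊗[k] C) (TensorProduct.AlgebraTensorModule.tensorTensorTensorComm k A k A
        A A C C ((1 ⊗ₜ 1) ⊗ₜ x)) := by
    intro x
    induction x with
    | zero => simp
    | add a b ha hb => simp [TensorProduct.tmul_add, ha, hb]
    | tmul a b => simp [juxt, cochainBase_inj]
  rw [key, TensorProduct.comul_tmul]; simp

theorem cochainBase_diff (t : Cochains k C) :
    cochainBase k A C (diff k C t) = diff A (A ⊗[k] C) (cochainBase k A C t) := by
  induction t using TensorAlgebra.induction with
  | algebraMap r =>
    rw [diff_algebraMap, AlgHom.commutes, map_zero,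
      IsScalarTower.algebraMap_apply k A, diff_algebraMap]
  | ι c =>
    rw [cochainBase_inj, diff_inj, diff_inj, map_sub, map_add, map_mul, map_mul,
      cochainBase_juxt_comul, cochainBase_inj, cochainBase_inj, Algebra.TensorProduct.one_def]
  | mul a b ha hb => simp only [diff_mul, map_add, map_mul, ha, hb, cochainBase_sgn]
  | add a b ha hb => simp [ha, hb]

/-- The base change map on cocycles. -/
def cocycleBase : cocycles k C →ₐ[k] cocycles A (A ⊗[k] C) where
  toFun z := ⟨cochainBase k A C z, by
    change diff A _ (cochainBase k A C z) = 0
    rw [← cochainBase_diff, show diff k C z = 0 from z.2, map_zero]⟩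
  map_one' := Subtype.ext (map_one _)
  map_mul' a b := Subtype.ext (map_mul _ _ _)
  map_zero' := Subtype.ext (map_zero _)
  map_add' a b := Subtype.ext (map_add _ _ _)
  commutes' r := Subtype.ext ((cochainBase k A C).commutes r)

/-- The base change homomorphism `ι : H^•(G, k) → H^•(G ⊗ A, A)`. -/
def cohBase : Coh k C →ₐ[k] Coh A (A ⊗[k] C) :=
  Ideal.Quotient.liftₐ (coboundaries k C)
    (((cocycleClass A (A ⊗[k] C)).restrictScalars k).comp (cocycleBase k A C)) (by
      rintro z ⟨t, ht⟩
      refine (cocycleClass_eq_zero A (A ⊗[k] C) _).mpr ⟨cochainBase k A C t, ?_⟩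
      rw [← cochainBase_diff, ht]; rfl)

/-- The canonical map `A ⊗ H^•(G, k) → H^•(G ⊗ A, A)`; it is bijective. -/
def cohExtend : A ⊗[k] Coh k C →ₐ[A] Coh A (A ⊗[k] C) :=
  Algebra.TensorProduct.lift (Algebra.ofId A _) (cohBase k A C)
    (fun a _ => Algebra.commutes a _)

/-- The identification of cochains. -/
def cochainEquiv : A ⊗[k] Cochains k C ≃ₐ[A] Cochains A (A ⊗[k] C) :=
  AlgEquiv.ofAlgHom
    (Algebra.TensorProduct.lift (Algebra.ofId A _) (cochainBase k A C)
      (fun a _ => Algebra.commutes a _))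
    (TensorAlgebra.lift A ((inj k C).baseChange A))
    (by ext c; simp [cochainBase])
    (by ext c; simp [cochainBase])

theorem cochainEquiv_tmul (a : A) (t : Cochains k C) :
    cochainEquiv k A C (a ⊗ₜ t) = a • cochainBase k A C t := by
  rw [Algebra.smul_def]
  exact Algebra.TensorProduct.lift_tmul (Algebra.ofId A (Cochains A (A ⊗[k] C)))
    (cochainBase k A C) (fun a _ => Algebra.commutes a _) a t

theorem cochainEquiv_diff (x : A ⊗[k] Cochains k C) :
    cochainEquiv k A C ((diff k C).lTensor A x) =
      diff A (A ⊗[k] C) (cochainEquiv k A C x) := by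
  induction x with
  | zero => simp
  | add a b ha hb => simp only [map_add, ha, hb]
  | tmul a t =>
    rw [LinearMap.lTensor_tmul, cochainEquiv_tmul, cochainEquiv_tmul, map_smul, cochainBase_diff]

theorem cohExtend_tmul (a : A) (x : Coh k C) :
    cohExtend k A C (a ⊗ₜ x) = a • cohBase k A C x := by
  rw [Algebra.smul_def]
  exact Algebra.TensorProduct.lift_tmul (Algebra.ofId A (Coh A (A ⊗[k] C)))
    (cohBase k A C) (fun a _ => Algebra.commutes a _) a x

/-- The inclusion of the cocycles. -/
def cocycleIncl : cocycles k C →ₗ[k] Cochains k C := (cocycles k C).val.toLinearMap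

/-- The map `A ⊗ Z(C) → Z(A ⊗ C)` on cocycles. -/
def cocycleExtend : A ⊗[k] cocycles k C →ₐ[A] cocycles A (A ⊗[k] C) :=
  Algebra.TensorProduct.lift (Algebra.ofId A _) (cocycleBase k A C)
    (fun a _ => Algebra.commutes a _)

theorem cocycleExtend_tmul (a : A) (z : cocycles k C) :
    cocycleExtend k A C (a ⊗ₜ z) = a • cocycleBase k A C z := by
  rw [Algebra.smul_def]
  exact Algebra.TensorProduct.lift_tmul (Algebra.ofId A (cocycles A (A ⊗[k] C)))
    (cocycleBase k A C) (fun a _ => Algebra.commutes a _) a z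

theorem cocycleExtend_val (x : A ⊗[k] cocycles k C) :
    (cocycleExtend k A C x : Cochains A (A ⊗[k] C)) =
      cochainEquiv k A C ((cocycleIncl k C).lTensor A x) := by
  induction x with
  | zero => simp
  | add a b ha hb => simp only [map_add, ← ha, ← hb]; rfl
  | tmul a z =>
    rw [cocycleExtend_tmul, LinearMap.lTensor_tmul, cochainEquiv_tmul]; rfl

theorem cohExtend_class (x : A ⊗[k] cocycles k C) :
    cohExtend k A C ((cocycleClass k C).toLinearMap.lTensor A x) =
      cocycleClass A (A ⊗[k] C) (cocycleExtend k A C x) := by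
  induction x with
  | zero => simp
  | add a b ha hb => simp only [map_add, ha, hb]
  | tmul a z =>
    rw [cocycleExtend_tmul, LinearMap.lTensor_tmul, cohExtend_tmul, map_smul]; rfl

theorem cohExtend_bijective (h1 : Coalgebra.comul (R := k) (1 : C) = 1 ⊗ₜ 1) :
    Function.Bijective (cohExtend k A C) := by
  have hq : Function.Surjective (cocycleClass k C).toLinearMap := cocycleClass_surjective k C
  have hex : Function.Exact (cocycleIncl k C) (diff k C) := by
    intro t
    exact ⟨fun h => ⟨⟨t, h⟩, rfl⟩, by rintro ⟨z, rfl⟩; exact z.2⟩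
  constructor
  · rw [injective_iff_map_eq_zero]
    intro y hy
    obtain ⟨x, rfl⟩ := LinearMap.lTensor_surjective A hq y
    rw [cohExtend_class, cocycleClass_eq_zero] at hy
    obtain ⟨t, ht⟩ := hy
    let dZ : Cochains k C →ₗ[k] cocycles k C :=
      (diff k C).codRestrict (Subalgebra.toSubmodule (cocycles k C))
        (fun t => diff_diff k C h1 t)
    obtain ⟨t, rfl⟩ := (cochainEquiv k A C).surjective t
    rw [← cochainEquiv_diff, cocycleExtend_val] at ht
    have h2 : (diff k C).lTensor A t = (cocycleIncl k C).lTensor A (dZ.lTensor A t) := by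
      rw [← LinearMap.comp_apply, ← LinearMap.lTensor_comp]; rfl
    have ht' := (cochainEquiv k A C).injective ht
    rw [h2] at ht'
    have hinj : Function.Injective ((cocycleIncl k C).lTensor A) :=
      Module.Flat.lTensor_preserves_injective_linearMap _ Subtype.val_injective
    have hx : x = dZ.lTensor A t := (hinj ht').symm
    have h0 : (cocycleClass k C).toLinearMap ∘ₗ dZ = 0 := by
      refine LinearMap.ext fun t => ?_
      exact (cocycleClass_eq_zero k C _).mpr ⟨t, rfl⟩
    rw [hx, ← LinearMap.comp_apply, ← LinearMap.lTensor_comp, h0, LinearMap.lTensor_zero]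
    rfl
  · intro y
    obtain ⟨z, rfl⟩ := cocycleClass_surjective A (A ⊗[k] C) y
    obtain ⟨t, ht⟩ := (cochainEquiv k A C).surjective z
    have h0 : (diff k C).lTensor A t = 0 := by
      apply (cochainEquiv k A C).injective
      rw [cochainEquiv_diff, map_zero, ht]; exact z.2
    obtain ⟨x, rfl⟩ := (Module.Flat.lTensor_exact A hex t).mp h0
    refine ⟨(cocycleClass k C).toLinearMap.lTensor A x, ?_⟩
    rw [cohExtend_class]
    congr 1
    exact Subtype.ext (by rw [cocycleExtend_val, ht])

variable {k C}

/-- The extension of scalars `H^•(G ⊗ A, A) = A ⊗ H^•(G, k) → A ⊗ k = A` of a homomorphism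
`e : H^•(G, k) → k`. -/
def extendAug (h1 : Coalgebra.comul (R := k) (1 : C) = 1 ⊗ₜ 1) (e : Coh k C →ₐ[k] k) :
    Coh A (A ⊗[k] C) →ₐ[A] A :=
  ((Algebra.TensorProduct.rid k A A).toAlgHom.comp
    (Algebra.TensorProduct.map (AlgHom.id A A) e)).comp
    (AlgEquiv.ofBijective (cohExtend k A C) (cohExtend_bijective k A C h1)).symm.toAlgHom

end BaseChange

section Super

/-!
### Supergroup schemes and their homomorphisms
-/

/-- `C`, with its `ℤ/2`-grading `𝒞`, is a commutative Hopf superalgebra, that is, the coordinate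
superalgebra of an affine supergroup scheme. The product on `C ⊗ C` is the one with the sign
`(a ⊗ b) (a' ⊗ b') = (-1) ^ (|b| |a'|) a a' ⊗ b b'`. -/
structure IsCommHopfSuperalgebra (k : Type*) {C : Type*} [CommRing k] [Ring C] [Algebra k C]
    [Coalgebra k C] (𝒞 : ZMod 2 → Submodule k C) [GradedAlgebra 𝒞] : Prop where
  supercomm : ∀ (i j : ZMod 2), ∀ a ∈ 𝒞 i, ∀ b ∈ 𝒞 j, a * b = (-1) ^ (i.val * j.val) * (b * a)
  comul_mem : ∀ (i : ZMod 2), ∀ a ∈ 𝒞 i, Coalgebra.comul (R := k) a ∈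
    ⨆ j : ZMod 2, Submodule.map₂ (TensorProduct.mk k C C) (𝒞 j) (𝒞 (i - j))
  counit_odd : ∀ a ∈ 𝒞 1, Coalgebra.counit (R := k) a = 0
  comul_one : Coalgebra.comul (R := k) (1 : C) = 1 ⊗ₜ 1
  counit_one : Coalgebra.counit (R := k) (1 : C) = 1
  comul_mul : ∀ a b : C,
    GradedTensorProduct.of k 𝒞 𝒞 (Coalgebra.comul (a * b)) =
      GradedTensorProduct.of k 𝒞 𝒞 (Coalgebra.comul a) *
        GradedTensorProduct.of k 𝒞 𝒞 (Coalgebra.comul b)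
  counit_mul : ∀ a b : C, Coalgebra.counit (R := k) (a * b) =
    Coalgebra.counit (R := k) a * Coalgebra.counit (R := k) b
  exists_antipode : ∃ S : C →ₗ[k] C,
    (∀ a, LinearMap.mul' k C (S.rTensor C (Coalgebra.comul a)) =
      algebraMap k C (Coalgebra.counit a)) ∧
    (∀ a, LinearMap.mul' k C (S.lTensor C (Coalgebra.comul a)) =
      algebraMap k C (Coalgebra.counit a))

variable {k : Type*} [Field k] {C D : Type*} [Ring C] [Algebra k C] [Coalgebra k C]
  [Ring D] [Algebra k D] [Coalgebra k D]

/-- For a purely even commutative algebra `A`: homomorphisms of `A`-supergroup schemes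
`H ⊗ A → G ⊗ A`, where `C = k[G]` and `D = k[H]`, given by their comorphisms
`A ⊗ C → A ⊗ D`. These are the `A`-points of `Hom(H, G)`. -/
structure SHom (A : Type*) [CommRing A] [Algebra k A]
    (𝒞 : ZMod 2 → Submodule k C) (𝒟 : ZMod 2 → Submodule k D) where
  toHom : A ⊗[k] C →ₐc[A] A ⊗[k] D
  even : ∀ i, ∀ c ∈ 𝒞 i, toHom (1 ⊗ₜ c) ∈ (𝒟 i).baseChange A

variable {A B : Type*} [CommRing A] [Algebra k A] [CommRing B] [Algebra k B]

/-- Extension of scalars along `φ : A → B`. -/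
def scal (φ : A →ₐ[k] B) (N : Type*) [AddCommGroup N] [Module k N] : A ⊗[k] N →ₗ[k] B ⊗[k] N :=
  φ.toLinearMap.rTensor N

/-- `c ⊗ c' ↦ g (c) g (c')`, where `(a ⊗ d) (a' ⊗ d') = a a' ⊗ (d ⊗ d')`. -/
def conv (g : C →ₗ[k] A ⊗[k] D) : C ⊗[k] C →ₗ[k] A ⊗[k] (D ⊗[k] D) :=
  (LinearMap.mul' k A).rTensor (D ⊗[k] D) ∘ₗ
    (TensorProduct.tensorTensorTensorComm k A D A D).toLinearMap ∘ₗ TensorProduct.map g g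

/-- `g : C → A ⊗ D` is the restriction of the comorphism `A ⊗ C → A ⊗ D` of a homomorphism. -/
structure IsPoint (𝒞 : ZMod 2 → Submodule k C) (𝒟 : ZMod 2 → Submodule k D)
    (g : C →ₐ[k] A ⊗[k] D) : Prop where
  counit : ∀ c, (Coalgebra.counit (R := k)).lTensor A (g c) = 1 ⊗ₜ Coalgebra.counit c
  comul : ∀ c, (Coalgebra.comul (R := k)).lTensor A (g c) =
    conv g.toLinearMap (Coalgebra.comul c)
  even : ∀ i, ∀ c ∈ 𝒞 i, g c ∈ (𝒟 i).baseChange A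

theorem comul_tensor (x : A ⊗[k] D) : Coalgebra.comul (R := A) x =
    TensorProduct.AlgebraTensorModule.distribBaseChange k A D D
      ((Coalgebra.comul (R := k)).lTensor A x) := by
  induction x with
  | zero => simp
  | add a b ha hb => simp only [map_add, ha, hb]
  | tmul a d =>
    rw [TensorProduct.comul_tmul, LinearMap.lTensor_tmul]
    generalize Coalgebra.comul (R := k) d = y
    induction y with
    | zero => simp
    | add u v hu hv => simp only [TensorProduct.tmul_add, map_add, hu, hv]
    | tmul u v =>
      rw [TensorProduct.AlgebraTensorModule.distribBaseChange_tmul,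
        CommSemiring.comul_apply, TensorProduct.AlgebraTensorModule.tensorTensorTensorComm_tmul]
      have h1 : ∀ w : D, a ⊗ₜ[k] w = a • ((1 : A) ⊗ₜ[k] w) := fun w => by
        rw [TensorProduct.smul_tmul', smul_eq_mul, mul_one]
      rw [h1 u, h1 v]
      exact (TensorProduct.smul_tmul _ _ _).symm

theorem distrib_conv (F : A ⊗[k] C →ₗ[A] A ⊗[k] D) (y : C ⊗[k] C) :
    TensorProduct.AlgebraTensorModule.distribBaseChange k A D D
      (conv (F.restrictScalars k ∘ₗ TensorProduct.mk k A C 1) y) =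
    TensorProduct.map F F
      (TensorProduct.AlgebraTensorModule.distribBaseChange k A C C (1 ⊗ₜ y)) := by
  induction y with
  | zero => simp
  | add u v hu hv => simp only [TensorProduct.tmul_add, map_add, hu, hv]
  | tmul u v =>
    rw [TensorProduct.AlgebraTensorModule.distribBaseChange_tmul, TensorProduct.map_tmul]
    simp only [conv, LinearMap.comp_apply, TensorProduct.map_tmul, TensorProduct.mk_apply,
      LinearMap.coe_restrictScalars, LinearEquiv.coe_coe]
    generalize F (1 ⊗ₜ u) = x
    generalize F (1 ⊗ₜ v) = y
    induction x with
    | zero => simp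
    | add a b ha hb => simp only [TensorProduct.add_tmul, map_add, ha, hb]
    | tmul a d =>
      induction y with
      | zero => simp
      | add a b ha hb => simp only [TensorProduct.tmul_add, map_add, ha, hb]
      | tmul b e =>
        apply (TensorProduct.AlgebraTensorModule.distribBaseChange k A D D).symm.injective
        rw [LinearEquiv.symm_apply_apply,
          TensorProduct.AlgebraTensorModule.distribBaseChange_symm_tmul]
        simp

variable {𝒞 : ZMod 2 → Submodule k C} {𝒟 : ZMod 2 → Submodule k D}

/-- The restriction of a comorphism `A ⊗ C → A ⊗ D` along `c ↦ 1 ⊗ c`. -/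
def SHom.point (f : SHom A 𝒞 𝒟) : C →ₐ[k] A ⊗[k] D :=
  ((f.toHom : A ⊗[k] C →ₐ[A] A ⊗[k] D).restrictScalars k).comp
    Algebra.TensorProduct.includeRight

theorem SHom.point_apply (f : SHom A 𝒞 𝒟) (c : C) : f.point c = f.toHom (1 ⊗ₜ c) := rfl

theorem SHom.ext_point {f f' : SHom A 𝒞 𝒟} (h : ∀ c, f.point c = f'.point c) : f = f' := by
  obtain ⟨F, hF⟩ := f
  obtain ⟨F', hF'⟩ := f'
  congr 1
  apply DFunLike.ext
  intro x
  induction x with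
  | zero => rw [map_zero, map_zero]
  | add a b ha hb => rw [map_add, map_add, ha, hb]
  | tmul a c =>
    have h1 : a ⊗ₜ[k] c = a • (1 ⊗ₜ[k] c) := by
      rw [TensorProduct.smul_tmul', smul_eq_mul, mul_one]
    have h2 : F (1 ⊗ₜ c) = F' (1 ⊗ₜ c) := h c
    rw [h1, map_smul, map_smul, h2]

theorem SHom.isPoint (f : SHom A 𝒞 𝒟) : IsPoint 𝒞 𝒟 f.point where
  counit c := by
    have h : Coalgebra.counit (R := A) (f.toHom (1 ⊗ₜ c)) =
        Coalgebra.counit (R := A) ((1 : A) ⊗ₜ[k] c) :=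
      CoalgHomClass.counit_comp_apply f.toHom _
    rw [TensorProduct.counit_def, TensorProduct.counit_def, LinearMap.comp_apply,
      LinearMap.comp_apply] at h
    have h' := (TensorProduct.AlgebraTensorModule.rid k A A).injective h
    have e : ∀ x : A ⊗[k] D,
        TensorProduct.AlgebraTensorModule.map (Coalgebra.counit (R := A) (A := A))
          (Coalgebra.counit (R := k) (A := D)) x =
        (Coalgebra.counit (R := k) (A := D)).lTensor A x := fun x => by
      induction x with
      | zero => simp
      | add a b ha hb => simp only [map_add, ha, hb]
      | tmul a d => simp
    rw [e, TensorProduct.AlgebraTensorModule.map_tmul] at h'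
    rw [SHom.point_apply, h']; simp
  comul c := by
    have h : TensorProduct.map (f.toHom : A ⊗[k] C →ₗ[A] A ⊗[k] D)
        (f.toHom : A ⊗[k] C →ₗ[A] A ⊗[k] D) (Coalgebra.comul (1 ⊗ₜ c)) =
      Coalgebra.comul (f.toHom (1 ⊗ₜ c)) := CoalgHomClass.map_comp_comul_apply f.toHom _
    rw [comul_tensor, comul_tensor, LinearMap.lTensor_tmul, ← distrib_conv] at h
    exact ((TensorProduct.AlgebraTensorModule.distribBaseChange k A D D).injective h).symm
  even i c hc := f.even i c hc

/-- The homomorphism with a given restriction. -/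
def SHom.ofPoint (g : C →ₐ[k] A ⊗[k] D) (hg : IsPoint 𝒞 𝒟 g) : SHom A 𝒞 𝒟 :=
  let F : A ⊗[k] C →ₐ[A] A ⊗[k] D :=
    Algebra.TensorProduct.lift (Algebra.ofId A _) g (fun a _ => Algebra.commutes a _)
  have hF : ∀ c, F (1 ⊗ₜ c) = g c := fun c => by
    rw [Algebra.TensorProduct.lift_tmul (Algebra.ofId A _) g (fun a _ => Algebra.commutes a _) 1 c,
      map_one, one_mul]
  { toHom :=
      { F with
        map_smul' := fun a x => map_smul F a x
        counit_comp := by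
          refine TensorProduct.AlgebraTensorModule.curry_injective ?_
          ext c
          change Coalgebra.counit (R := A) (F (1 ⊗ₜ c)) = Coalgebra.counit (R := A) ((1 : A) ⊗ₜ[k] c)
          rw [hF, TensorProduct.counit_def, TensorProduct.counit_def]
          simp only [LinearMap.comp_apply, LinearEquiv.coe_coe]
          congr 1
          have e : ∀ (x : A ⊗[k] D),
              TensorProduct.AlgebraTensorModule.map (Coalgebra.counit (R := A) (A := A))
                (Coalgebra.counit (R := k) (A := D)) x =
              (Coalgebra.counit (R := k) (A := D)).lTensor A x := fun x => by
            induction x with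
            | zero => simp
            | add a b ha hb => simp only [map_add, ha, hb]
            | tmul a d => simp
          rw [e, hg.counit]; simp
        map_comp_comul := by
          refine TensorProduct.AlgebraTensorModule.curry_injective ?_
          ext c
          change TensorProduct.map F.toLinearMap F.toLinearMap (Coalgebra.comul (1 ⊗ₜ c)) =
            Coalgebra.comul (F (1 ⊗ₜ c))
          have e : F.toLinearMap.restrictScalars k ∘ₗ TensorProduct.mk k A C 1 =
              g.toLinearMap := LinearMap.ext hF
          rw [comul_tensor, comul_tensor, LinearMap.lTensor_tmul, ← distrib_conv, e, hF,
            hg.comul] }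
    even := fun i c hc => by
      change F (1 ⊗ₜ c) ∈ _
      rw [hF]; exact hg.even i c hc }

theorem SHom.point_ofPoint (g : C →ₐ[k] A ⊗[k] D) (hg : IsPoint 𝒞 𝒟 g) (c : C) :
    (SHom.ofPoint g hg).point c = g c := by
  change Algebra.TensorProduct.lift (Algebra.ofId A _) g (fun a _ => Algebra.commutes a _)
    (1 ⊗ₜ c) = g c
  rw [Algebra.TensorProduct.lift_tmul (Algebra.ofId A _) g (fun a _ => Algebra.commutes a _) 1 c,
      map_one, one_mul]

end Super

section Points

variable {k : Type*} [Field k] {C D D' : Type*} [Ring C] [Algebra k C] [Coalgebra k C]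
  [Ring D] [Algebra k D] [Coalgebra k D] [Ring D'] [Algebra k D'] [Coalgebra k D']
  {A B : Type*} [CommRing A] [Algebra k A] [CommRing B] [Algebra k B]
  {𝒞 : ZMod 2 → Submodule k C} {𝒟 : ZMod 2 → Submodule k D} {𝒟' : ZMod 2 → Submodule k D'}

/-- The algebra homomorphism `φ ⊗ id : A ⊗ D → B ⊗ D`. -/
def scalAlg (φ : A →ₐ[k] B) (D : Type*) [Ring D] [Algebra k D] : A ⊗[k] D →ₐ[k] B ⊗[k] D :=
  Algebra.TensorProduct.map φ (AlgHom.id k D)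

theorem scalAlg_apply (φ : A →ₐ[k] B) (x : A ⊗[k] D) : scalAlg φ D x = scal φ D x := rfl

theorem scal_lTensor (φ : A →ₐ[k] B) {M N : Type*} [AddCommGroup M] [Module k M]
    [AddCommGroup N] [Module k N] (f : M →ₗ[k] N) (x : A ⊗[k] M) :
    f.lTensor B (scal φ M x) = scal φ N (f.lTensor A x) := by
  induction x with
  | zero => simp
  | add a b ha hb => simp only [map_add, ha, hb]
  | tmul a d => simp [scal]

theorem scal_conv (φ : A →ₐ[k] B) (g : C →ₗ[k] A ⊗[k] D) (g' : C →ₗ[k] B ⊗[k] D)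
    (h : ∀ c, g' c = scal φ D (g c)) (y : C ⊗[k] C) :
    conv g' y = scal φ (D ⊗[k] D) (conv g y) := by
  induction y with
  | zero => simp
  | add a b ha hb => simp only [map_add, ha, hb]
  | tmul u v =>
    simp only [conv, LinearMap.comp_apply, TensorProduct.map_tmul, LinearEquiv.coe_coe, h]
    generalize g u = x
    generalize g v = z
    induction x with
    | zero => simp
    | add a b ha hb => simp only [TensorProduct.add_tmul, map_add, ha, hb]
    | tmul a d =>
      induction z with
      | zero => simp
      | add a b ha hb => simp only [TensorProduct.tmul_add, map_add, ha, hb]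
      | tmul b e => simp [scal]

theorem scal_mem (φ : A →ₐ[k] B) (N : Submodule k D) (x : A ⊗[k] D)
    (hx : x ∈ N.baseChange A) : scal φ D x ∈ N.baseChange B := by
  rw [Submodule.baseChange_eq_span] at hx
  refine Submodule.span_induction ?_ ?_ ?_ ?_ hx
  · rintro _ ⟨c, hc, rfl⟩
    simpa [scal] using Submodule.tmul_mem_baseChange_of_mem (1 : B) hc
  · simp
  · intro a b _ _ ha hb
    rw [map_add]; exact add_mem ha hb
  · intro a x _ hx
    have : ∀ y : A ⊗[k] D, scal φ D (a • y) = φ a • scal φ D y := by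
      intro y
      induction y with
      | zero => simp
      | add a b ha hb => simp only [map_add, smul_add, ha, hb]
      | tmul a d => simp [scal, TensorProduct.smul_tmul']
    rw [this]; exact Submodule.smul_mem _ _ hx

theorem IsPoint.map (φ : A →ₐ[k] B) {g : C →ₐ[k] A ⊗[k] D} (hg : IsPoint 𝒞 𝒟 g) :
    IsPoint 𝒞 𝒟 ((scalAlg φ D).comp g) where
  counit c := by
    rw [AlgHom.comp_apply, scalAlg_apply, scal_lTensor, hg.counit]; simp [scal]
  comul c := by
    rw [AlgHom.comp_apply, scalAlg_apply, scal_lTensor, hg.comul]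
    exact (scal_conv φ _ _ (fun _ => rfl) _).symm
  even i c hc := scal_mem φ _ _ (hg.even i c hc)

/-- Base change of a homomorphism along `φ : A → B`. -/
def SHom.map (φ : A →ₐ[k] B) (f : SHom A 𝒞 𝒟) : SHom B 𝒞 𝒟 :=
  SHom.ofPoint ((scalAlg φ D).comp f.point) (f.isPoint.map φ)

theorem SHom.point_map (φ : A →ₐ[k] B) (f : SHom A 𝒞 𝒟) (c : C) :
    (f.map φ).point c = scal φ D (f.point c) :=
  SHom.point_ofPoint _ _ c

/-- Composition of comorphisms. -/
def SHom.comp (g : SHom A 𝒟 𝒟') (f : SHom A 𝒞 𝒟) : SHom A 𝒞 𝒟' where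
  toHom := g.toHom.comp f.toHom
  even i c hc := by
    have h := f.even i c hc
    change g.toHom (f.toHom (1 ⊗ₜ c)) ∈ _
    rw [Submodule.baseChange_eq_span] at h
    refine Submodule.span_induction ?_ ?_ ?_ ?_ h
    · rintro _ ⟨d, hd, rfl⟩
      exact g.even i d hd
    · simp
    · intro a b _ _ ha hb
      rw [map_add]; exact add_mem ha hb
    · intro a x _ hx
      rw [map_smul]; exact Submodule.smul_mem _ _ hx

theorem mem_baseChange_iff [GradedAlgebra 𝒟] (i : ZMod 2) (x : A ⊗[k] D) :
    x ∈ (𝒟 i).baseChange A ↔ (GradedAlgebra.proj 𝒟 i).lTensor A x = x := by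
  constructor
  · intro hx
    rw [Submodule.baseChange_eq_span] at hx
    refine Submodule.span_induction ?_ ?_ ?_ ?_ hx
    · rintro _ ⟨c, hc, rfl⟩
      simp [GradedAlgebra.proj_apply, DirectSum.decompose_of_mem_same 𝒟 hc]
    · simp
    · intro a b _ _ ha hb
      rw [map_add, ha, hb]
    · intro a x _ hx
      rw [← LinearMap.baseChange_eq_ltensor] at hx ⊢
      rw [map_smul, hx]
  · intro hx
    rw [← hx]
    generalize x = y
    induction y with
    | zero => simp
    | add a b ha hb => rw [map_add]; exact add_mem ha hb
    | tmul a d =>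
      rw [LinearMap.lTensor_tmul]
      exact Submodule.tmul_mem_baseChange_of_mem a (SetLike.coe_mem _)

section Descend

variable {ι : Type*} {B : ι → Type*} [∀ i, CommRing (B i)] [∀ i, Algebra k (B i)]

theorem scal_eq (φ : ∀ i, A →ₐ[k] B i) (hφ : ∀ a, (∀ i, φ i a = 0) → a = 0) {N : Type*} [AddCommGroup N] [Module k N] (x y : A ⊗[k] N)
    (h : ∀ i, scal (φ i) N x = scal (φ i) N y) : x = y := by
  let b := Module.Basis.ofVectorSpace k N
  have key : ∀ (i) (x : A ⊗[k] N) (j), (b.baseChange (B i)).repr (scal (φ i) N x) j =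
      φ i ((b.baseChange A).repr x j) := by
    intro i x j
    induction x with
    | zero => simp
    | add u v hu hv => simp only [map_add, Finsupp.add_apply, hu, hv]
    | tmul a d => simp [scal]
  apply (b.baseChange A).repr.injective
  ext j
  rw [← sub_eq_zero]
  apply hφ
  intro i
  rw [map_sub, ← key, ← key, h, sub_self]

theorem exists_of_jointly [GradedAlgebra 𝒟] (φ : ∀ i, A →ₐ[k] B i)
    (hφ : ∀ a, (∀ i, φ i a = 0) → a = 0) (g : C → A ⊗[k] D)
    (h : ∀ i, ∃ f : SHom (B i) 𝒞 𝒟, ∀ c, f.point c = scal (φ i) D (g c)) :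
    ∃ f : SHom A 𝒞 𝒟, ∀ c, f.point c = g c := by
  choose f hf using h
  have hm : ∀ (i) (x y : A ⊗[k] D), scal (φ i) D (x * y) = scal (φ i) D x * scal (φ i) D y :=
    fun i x y => map_mul (scalAlg (φ i) D) x y
  have h1 : ∀ i, scal (φ i) D 1 = 1 := fun i => map_one (scalAlg (φ i) D)
  let G : C →ₐ[k] A ⊗[k] D := AlgHom.ofLinearMap
    { toFun := g
      map_add' := fun a b => scal_eq φ hφ _ _ fun i => by
        rw [map_add, ← hf, ← hf, ← hf, map_add]
      map_smul' := fun a b => scal_eq φ hφ _ _ fun i => by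
        rw [map_smul, ← hf, ← hf, map_smul]; rfl }
    (scal_eq φ hφ _ _ fun i => by
      change scal (φ i) D (g 1) = _
      rw [← hf, map_one, h1])
    (fun a b => scal_eq φ hφ _ _ fun i => by
      change scal (φ i) D (g (a * b)) = scal (φ i) D (g a * g b)
      rw [hm, ← hf, ← hf, ← hf, map_mul])
  have hG : ∀ i c, (f i).point c = scal (φ i) D (G c) := hf
  have hP : IsPoint 𝒞 𝒟 G :=
    { counit := fun c => scal_eq φ hφ _ _ fun i => by
        rw [← scal_lTensor, ← hG, (f i).isPoint.counit]; simp [scal]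
      comul := fun c => scal_eq φ hφ _ _ fun i => by
        rw [← scal_lTensor, ← hG, (f i).isPoint.comul]
        exact scal_conv (φ i) _ _ (hG i) _
      even := fun j c hc => by
        rw [mem_baseChange_iff]
        refine scal_eq φ hφ _ _ fun i => ?_
        rw [← scal_lTensor, ← hG]
        exact (mem_baseChange_iff j _).mp ((f i).isPoint.even j c hc) }
  exact ⟨SHom.ofPoint G hP, SHom.point_ofPoint G hP⟩

end Descend

end Points

section Representing

variable {k : Type*} [Field k] {C D : Type*} [Ring C] [Algebra k C] [Coalgebra k C]
  [Ring D] [Algebra k D] [Coalgebra k D]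
  {A B : Type*} [CommRing A] [Algebra k A] [CommRing B] [Algebra k B]

/-!
### The purely even scheme of homomorphisms

For `D` of finite dimension, the functor `A ↦ SHom A 𝒞 𝒟` on purely even commutative algebras is
represented by the algebra `CoordRing 𝒞 𝒟`: see `coordRing_universal`. This is the coordinate
algebra of the underlying purely even subscheme of `Hom(H, G)`.
-/

/-- The map `C → A ⊗ D` whose coefficients with respect to a basis of `D` are the images under `φ`
of the indeterminates. -/
def genericPoint (C D : Type*) [Ring D] [Algebra k D] [Module.Finite k D]
    {A : Type*} [CommRing A] [Algebra k A]
    (φ : MvPolynomial (C × Fin (Module.finrank k D)) k →ₐ[k] A) (c : C) : A ⊗[k] D :=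
  ∑ i, φ (MvPolynomial.X (c, i)) ⊗ₜ Module.finBasis k D i

variable [Module.Finite k D] (𝒞 : ZMod 2 → Submodule k C) (𝒟 : ZMod 2 → Submodule k D)

/-- The smallest ideal modulo which the generic map `C → A ⊗ D` is a homomorphism. -/
def relIdeal : Ideal (MvPolynomial (C × Fin (Module.finrank k D)) k) :=
  sInf {K | ∃ f : SHom (MvPolynomial (C × Fin (Module.finrank k D)) k ⧸ K) 𝒞 𝒟,
    ∀ c, f.point c = genericPoint C D (Ideal.Quotient.mkₐ k K) c}

/-- The coordinate algebra of the purely even scheme of homomorphisms. -/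
def CoordRing := MvPolynomial (C × Fin (Module.finrank k D)) k ⧸ relIdeal 𝒞 𝒟

instance : CommRing (CoordRing 𝒞 𝒟) :=
  inferInstanceAs (CommRing (MvPolynomial (C × Fin (Module.finrank k D)) k ⧸ relIdeal 𝒞 𝒟))

instance : Algebra k (CoordRing 𝒞 𝒟) :=
  inferInstanceAs (Algebra k (MvPolynomial (C × Fin (Module.finrank k D)) k ⧸ relIdeal 𝒞 𝒟))

/-- The quotient map. -/
def coordMk : MvPolynomial (C × Fin (Module.finrank k D)) k →ₐ[k] CoordRing 𝒞 𝒟 :=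
  Ideal.Quotient.mkₐ k (relIdeal 𝒞 𝒟)

theorem scal_genericPoint (φ : MvPolynomial (C × Fin (Module.finrank k D)) k →ₐ[k] A)
    (χ : A →ₐ[k] B) (c : C) :
    scal χ D (genericPoint C D φ c) = genericPoint C D (χ.comp φ) c := by
  simp [genericPoint, scal]

theorem exists_universal [GradedAlgebra 𝒟] :
    ∃ f : SHom (CoordRing 𝒞 𝒟) 𝒞 𝒟, ∀ c, f.point c = genericPoint C D (coordMk 𝒞 𝒟) c := by
  let S := {K | ∃ f : SHom (MvPolynomial (C × Fin (Module.finrank k D)) k ⧸ K) 𝒞 𝒟,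
    ∀ c, f.point c = genericPoint C D (Ideal.Quotient.mkₐ k K) c}
  have hle : ∀ K : S, relIdeal 𝒞 𝒟 ≤ K.1 := fun K => sInf_le K.2
  let φ : ∀ K : S, CoordRing 𝒞 𝒟 →ₐ[k]
      MvPolynomial (C × Fin (Module.finrank k D)) k ⧸ K.1 := fun K =>
    Ideal.Quotient.factorₐ k (hle K)
  refine exists_of_jointly φ ?_ _ ?_
  · intro a ha
    obtain ⟨a, rfl⟩ := Ideal.Quotient.mk_surjective a
    refine Ideal.Quotient.eq_zero_iff_mem.mpr ?_
    refine (Submodule.mem_sInf).mpr fun K hK => ?_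
    exact Ideal.Quotient.eq_zero_iff_mem.mp (ha ⟨K, hK⟩)
  · rintro ⟨K, f, hf⟩
    refine ⟨f, fun c => ?_⟩
    rw [hf, scal_genericPoint]
    congr 1

/-- The universal purely even homomorphism `u_G`. -/
def universalHom [GradedAlgebra 𝒟] : SHom (CoordRing 𝒞 𝒟) 𝒞 𝒟 := (exists_universal 𝒞 𝒟).choose

theorem universalHom_point [GradedAlgebra 𝒟] (c : C) :
    (universalHom 𝒞 𝒟).point c = genericPoint C D (coordMk 𝒞 𝒟) c :=
  (exists_universal 𝒞 𝒟).choose_spec c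

variable {𝒞 𝒟}

/-- The coefficients of `f` with respect to the basis of `D`. -/
def coeffHom (f : SHom B 𝒞 𝒟) : MvPolynomial (C × Fin (Module.finrank k D)) k →ₐ[k] B :=
  MvPolynomial.aeval fun q => ((Module.finBasis k D).baseChange B).repr (f.point q.1) q.2

theorem genericPoint_coeffHom (f : SHom B 𝒞 𝒟) (c : C) :
    genericPoint C D (coeffHom f) c = f.point c := by
  rw [← ((Module.finBasis k D).baseChange B).sum_repr (f.point c), genericPoint]
  refine Finset.sum_congr rfl fun i _ => ?_
  rw [coeffHom, MvPolynomial.aeval_X, Module.Basis.baseChange_apply, TensorProduct.smul_tmul',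
    smul_eq_mul, mul_one]

theorem relIdeal_le [GradedAlgebra 𝒟] (f : SHom B 𝒞 𝒟) :
    ∀ a ∈ relIdeal 𝒞 𝒟, coeffHom f a = 0 := by
  have h : relIdeal 𝒞 𝒟 ≤ RingHom.ker (coeffHom f) := by
    refine sInf_le ?_
    refine exists_of_jointly (ι := Unit) (fun _ => Ideal.kerLiftAlg (coeffHom f)) ?_ _ ?_
    · intro a ha
      exact (injective_iff_map_eq_zero _).mp (Ideal.kerLiftAlg_injective (coeffHom f)) a (ha ())
    · intro _
      refine ⟨f, fun c => ?_⟩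
      rw [scal_genericPoint, ← genericPoint_coeffHom]
      congr 1
  exact fun a ha => h ha

/-- The algebra homomorphism that classifies `f`. -/
def coordLift [GradedAlgebra 𝒟] (f : SHom B 𝒞 𝒟) : CoordRing 𝒞 𝒟 →ₐ[k] B :=
  Ideal.Quotient.liftₐ (relIdeal 𝒞 𝒟) (coeffHom f) (relIdeal_le f)

theorem map_coordLift [GradedAlgebra 𝒟] (f : SHom B 𝒞 𝒟) :
    (universalHom 𝒞 𝒟).map (coordLift f) = f := by
  refine SHom.ext_point fun c => ?_
  rw [SHom.point_map, universalHom_point, scal_genericPoint, ← genericPoint_coeffHom f]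
  congr 1

theorem coordLift_map [GradedAlgebra 𝒟] (χ : CoordRing 𝒞 𝒟 →ₐ[k] B) :
    coordLift ((universalHom 𝒞 𝒟).map χ) = χ := by
  refine Ideal.Quotient.algHom_ext k ?_
  refine MvPolynomial.algHom_ext fun q => ?_
  change coeffHom _ (MvPolynomial.X q) = χ (coordMk 𝒞 𝒟 (MvPolynomial.X q))
  rw [coeffHom, MvPolynomial.aeval_X, SHom.point_map, universalHom_point, scal_genericPoint,
    genericPoint, map_sum]
  simp [Finsupp.single_apply]

variable (𝒞 𝒟) in
/-- The universal property of the coordinate algebra. -/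
theorem coordRing_universal [GradedAlgebra 𝒟] (f : SHom B 𝒞 𝒟) :
    ∃! χ : CoordRing 𝒞 𝒟 →ₐ[k] B, (universalHom 𝒞 𝒟).map χ = f :=
  ⟨coordLift f, map_coordLift f, fun χ h => by rw [← h, coordLift_map]⟩

end Representing

section MultiparameterGroup

/-!
### The supergroup scheme `M_{r;s}`

`k[M_{r;s}]` is generated by the odd element `τ` and the even elements `θ`, `σ_i` for
`0 ≤ i < p ^ s`, with relations `τ ^ 2 = 0`, `σ_0 = 1`, `θ ^ (p ^ (r - 1)) = σ_1` and
`σ_i σ_j = binom(i + j, i) σ_{i+j}`; the comultiplication is given in `comul_tau`, `comul_theta`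
and `comul_sigma` below.
-/

theorem dvd_choose_of_lt (p : ℕ) [hp : Fact p.Prime] (s i j : ℕ) (hi : i < p ^ s) (hj : j < p ^ s)
    (hij : p ^ s ≤ i + j) : p ∣ (i + j).choose i := by
  have hs : 1 ≤ s := by
    rcases Nat.eq_zero_or_pos s with rfl | h
    · simp at hi hj hij; omega
    · exact h
  have hlog : Nat.log p (j + i) < s + 1 := by
    refine Nat.log_lt_of_lt_pow (by have := pow_pos hp.out.pos s; omega) ?_
    have : 2 * p ^ s ≤ p * p ^ s := Nat.mul_le_mul_right _ hp.out.two_le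
    rw [pow_succ']; omega
  have h := padicValNat_choose' (p := p) (n := j) (k := i) hlog
  have hmem : s ∈ {a ∈ Finset.Ico 1 (s + 1) | p ^ a ≤ i % p ^ a + j % p ^ a} := by
    simp only [Finset.mem_filter, Finset.mem_Ico]
    rw [Nat.mod_eq_of_lt hi, Nat.mod_eq_of_lt hj]
    exact ⟨⟨hs, by omega⟩, hij⟩
  have hpos : 1 ≤ padicValNat p ((j + i).choose i) := by
    rw [h]; exact Finset.card_pos.mpr ⟨s, hmem⟩
  rw [add_comm]
  exact dvd_of_one_le_padicValNat hpos

theorem choose_mod (k : Type*) [Field k] (p : ℕ) [Fact p.Prime] [CharP k p] (m i : ℕ) :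
    ((p + m).choose i : k) = m.choose i + if p ≤ i then (m.choose (i - p) : k) else 0 := by
  have h : ((1 + Polynomial.X : Polynomial k) ^ (p + m)) =
      (1 + Polynomial.X) ^ m + Polynomial.X ^ p * (1 + Polynomial.X) ^ m := by
    rw [pow_add, add_pow_char, one_pow, add_mul, one_mul]
  have h' := congrArg (fun q => Polynomial.coeff q i) h
  simp only [Polynomial.coeff_add, Polynomial.coeff_one_add_X_pow,
    Polynomial.coeff_X_pow_mul'] at h'
  exact h'

theorem add_pow_charP (k : Type*) [Field k] (p : ℕ) [Fact p.Prime] [CharP k p] {R : Type*}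
    [CommRing R] [Algebra k R] (x y : R) (n : ℕ) :
    (x + y) ^ p ^ n = x ^ p ^ n + y ^ p ^ n := by
  rcases subsingleton_or_nontrivial R with h | h
  · exact Subsingleton.elim _ _
  · have : CharP R p := charP_of_injective_algebraMap (algebraMap k R).injective p
    exact add_pow_char_pow ..

variable (k : Type*) [Field k] (p r s : ℕ)

/-- The defining relations of the even part of `k[M_{r;s}]`; the variable `none` is `θ` and the
variable `some i` is `σ_i`. For `i, j < p ^ s ≤ i + j` the coefficient `binom(i + j, i)` vanishes
in `k`, so one may set `σ_i = 0` for `i ≥ p ^ s`. -/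
inductive Rel : MvPolynomial (Option ℕ) k → Prop
  | zero : Rel (MvPolynomial.X (some 0) - 1)
  | one : Rel (MvPolynomial.X none ^ p ^ (r - 1) - MvPolynomial.X (some 1))
  | mul (i j : ℕ) : Rel (MvPolynomial.X (some i) * MvPolynomial.X (some j) -
      ((i + j).choose i : k) • MvPolynomial.X (some (i + j)))
  | trunc (i : ℕ) (hi : p ^ s ≤ i) : Rel (MvPolynomial.X (some i))

/-- The even part of `k[M_{r;s}]`. -/
def MEven := MvPolynomial (Option ℕ) k ⧸ Ideal.span {f | Rel k p r s f}

instance : CommRing (MEven k p r s) :=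
  inferInstanceAs (CommRing (MvPolynomial (Option ℕ) k ⧸ Ideal.span {f | Rel k p r s f}))

instance : Algebra k (MEven k p r s) :=
  inferInstanceAs (Algebra k (MvPolynomial (Option ℕ) k ⧸ Ideal.span {f | Rel k p r s f}))

/-- `θ` -/
def thetaE : MEven k p r s := Ideal.Quotient.mk _ (MvPolynomial.X none)

/-- `σ_i` -/
def sigmaE (i : ℕ) : MEven k p r s := Ideal.Quotient.mk _ (MvPolynomial.X (some i))

theorem rel_eq_zero {f : MvPolynomial (Option ℕ) k} (hf : Rel k p r s f) :
    (Ideal.Quotient.mkₐ k (Ideal.span {f | Rel k p r s f}) f : MEven k p r s) = 0 :=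
  Ideal.Quotient.eq_zero_iff_mem.mpr (Ideal.subset_span hf)

theorem sigmaE_zero : sigmaE k p r s 0 = 1 := by
  have h := rel_eq_zero k p r s (Rel.zero)
  rw [map_sub, map_one, sub_eq_zero] at h
  exact h

theorem thetaE_pow : thetaE k p r s ^ p ^ (r - 1) = sigmaE k p r s 1 := by
  have h := rel_eq_zero k p r s (Rel.one)
  rw [map_sub, map_pow, sub_eq_zero] at h
  exact h

theorem sigmaE_mul (i j : ℕ) : sigmaE k p r s i * sigmaE k p r s j =
    ((i + j).choose i : k) • sigmaE k p r s (i + j) := by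
  have h := rel_eq_zero k p r s (Rel.mul i j)
  rw [map_sub, map_mul, map_smul, sub_eq_zero] at h
  exact h

theorem sigmaE_trunc (i : ℕ) (hi : p ^ s ≤ i) : sigmaE k p r s i = 0 :=
  rel_eq_zero k p r s (Rel.trunc i hi)

theorem MEven.induction {motive : MEven k p r s → Prop} (x : MEven k p r s)
    (algebraMap : ∀ a : k, motive (algebraMap k _ a))
    (add : ∀ a b, motive a → motive b → motive (a + b))
    (theta : ∀ a, motive a → motive (a * thetaE k p r s))
    (sigma : ∀ a i, motive a → motive (a * sigmaE k p r s i)) : motive x := by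
  obtain ⟨f, rfl⟩ := Ideal.Quotient.mk_surjective x
  induction f using MvPolynomial.induction_on with
  | C a => exact algebraMap a
  | add f g hf hg => rw [map_add]; exact add _ _ hf hg
  | mul_X f i hf =>
    rw [map_mul]
    cases i with
    | none => exact theta _ hf
    | some i => exact sigma _ i hf

theorem MEven.algHom_ext {R : Type*} [Semiring R] [Algebra k R] {f g : MEven k p r s →ₐ[k] R}
    (hθ : f (thetaE k p r s) = g (thetaE k p r s))
    (hσ : ∀ i, i < p ^ s → f (sigmaE k p r s i) = g (sigmaE k p r s i)) : f = g := by
  refine AlgHom.ext fun x => ?_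
  induction x using MEven.induction with
  | algebraMap a => simp
  | add a b ha hb => rw [map_add, map_add, ha, hb]
  | theta a ha => rw [map_mul, map_mul, ha, hθ]
  | sigma a i ha =>
    rw [map_mul, map_mul, ha]
    by_cases hi : i < p ^ s
    · rw [hσ i hi]
    · rw [sigmaE_trunc k p r s i (by omega), map_zero, map_zero]

variable {k p r s} in
/-- Homomorphisms out of the even part. -/
def MEven.lift [Fact p.Prime] [CharP k p] {R : Type*} [CommRing R] [Algebra k R] (t : R)
    (a : ℕ → R) (h0 : a 0 = 1) (ht : t ^ p ^ (r - 1) = if 1 < p ^ s then a 1 else 0)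
    (ha : ∀ i j, a i * a j = ((i + j).choose i : k) • a (i + j)) : MEven k p r s →ₐ[k] R :=
  Ideal.Quotient.liftₐ _
    (MvPolynomial.aeval fun q : Option ℕ => q.elim t fun i => if i < p ^ s then a i else 0) (by
      intro f hf
      refine Submodule.span_induction ?_ ?_ ?_ ?_ hf
      · rintro f hf
        have hp : 0 < p ^ s := pow_pos (Fact.out : p.Prime).pos s
        cases hf with
        | zero => simp [h0, hp]
        | one => simp [ht]
        | trunc i hi => simp [hi]
        | mul i j =>
          simp only [map_sub, map_mul, map_smul, MvPolynomial.aeval_X, Option.elim_some]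
          by_cases hi : i < p ^ s
          · by_cases hj : j < p ^ s
            · by_cases hij : i + j < p ^ s
              · simp [hi, hj, hij, ha]
              · have h : ((i + j).choose i : k) = 0 :=
                  (CharP.cast_eq_zero_iff k p _).mpr (dvd_choose_of_lt p s i j hi hj (by omega))
                simp [hi, hj, hij, ha, h]
            · have : ¬ i + j < p ^ s := by omega
              simp [hj, this]
          · have : ¬ i + j < p ^ s := by omega
            simp [hi, this]
      · simp
      · intro x y _ _ hx hy
        rw [map_add, hx, hy, add_zero]
      · intro c x _ hx
        rw [smul_eq_mul, map_mul, hx, mul_zero])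

section LiftLemmas

variable [Fact p.Prime] [CharP k p] {R : Type*} [CommRing R] [Algebra k R] (t : R)
    (a : ℕ → R) (h0 : a 0 = 1) (ht : t ^ p ^ (r - 1) = if 1 < p ^ s then a 1 else 0)
    (ha : ∀ i j, a i * a j = ((i + j).choose i : k) • a (i + j))

theorem MEven.lift_theta : MEven.lift t a h0 ht ha (thetaE k p r s) = t := by
  change MvPolynomial.aeval _ (MvPolynomial.X none) = t
  rw [MvPolynomial.aeval_X]; rfl

theorem MEven.lift_sigma (i : ℕ) :
    MEven.lift t a h0 ht ha (sigmaE k p r s i) = if i < p ^ s then a i else 0 := by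
  change MvPolynomial.aeval _ (MvPolynomial.X (some i)) = _
  rw [MvPolynomial.aeval_X]; rfl

end LiftLemmas

theorem convolution_mul {R : Type*} [CommRing R] [Algebra k R] (a b : ℕ → R)
    (ha : ∀ i j, a i * a j = ((i + j).choose i : k) • a (i + j))
    (hb : ∀ i j, b i * b j = ((i + j).choose i : k) • b (i + j)) (i j : ℕ) :
    (∑ q ∈ Finset.HasAntidiagonal.antidiagonal i, a q.1 * b q.2) * (∑ q ∈ Finset.HasAntidiagonal.antidiagonal j, a q.1 * b q.2) =
      ((i + j).choose i : k) • ∑ q ∈ Finset.HasAntidiagonal.antidiagonal (i + j), a q.1 * b q.2 := by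
  rw [Finset.sum_mul_sum, Finset.smul_sum]
  have h1 : ∀ q ∈ Finset.HasAntidiagonal.antidiagonal (i + j), ((i + j).choose i : k) • (a q.1 * b q.2) =
      ∑ u ∈ Finset.HasAntidiagonal.antidiagonal i, ((q.1.choose u.1 * q.2.choose u.2 : ℕ) : k) •
        (a q.1 * b q.2) := by
    intro q hq
    rw [← Finset.sum_smul, ← Nat.cast_sum, ← Nat.add_choose_eq, Finset.HasAntidiagonal.mem_antidiagonal.mp hq]
  rw [Finset.sum_congr rfl h1]
  conv_rhs => rw [Finset.sum_comm]
  refine Finset.sum_congr rfl fun u hu => ?_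
  have h2 : ∀ q ∈ Finset.HasAntidiagonal.antidiagonal j, a u.1 * b u.2 * (a q.1 * b q.2) =
      (((u.1 + q.1).choose u.1 * (u.2 + q.2).choose u.2 : ℕ) : k) •
        (a (u.1 + q.1) * b (u.2 + q.2)) := by
    intro q _
    rw [mul_mul_mul_comm, ha, hb, smul_mul_smul_comm, Nat.cast_mul]
  rw [Finset.sum_congr rfl h2]
  have hu' := Finset.HasAntidiagonal.mem_antidiagonal.mp hu
  refine Finset.sum_bij_ne_zero (fun q _ _ => (u.1 + q.1, u.2 + q.2)) ?_ ?_ ?_ ?_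
  · intro q hq _
    have := Finset.HasAntidiagonal.mem_antidiagonal.mp hq
    exact Finset.HasAntidiagonal.mem_antidiagonal.mpr (by dsimp only; omega)
  · intro q _ _ q' _ _ h
    simp only [Prod.mk.injEq] at h
    ext <;> omega
  · intro q hq h
    have hq' := Finset.HasAntidiagonal.mem_antidiagonal.mp hq
    have h3 : q.1.choose u.1 * q.2.choose u.2 ≠ 0 := by
      intro h0
      rw [h0, Nat.cast_zero, zero_smul] at h
      exact h rfl
    have h4 : u.1 ≤ q.1 := by
      by_contra hc; exact h3 (by rw [Nat.choose_eq_zero_of_lt (by omega), zero_mul])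
    have h5 : u.2 ≤ q.2 := by
      by_contra hc; exact h3 (by rw [Nat.choose_eq_zero_of_lt (by omega : q.2 < u.2), mul_zero])
    have e1 : u.1 + (q.1 - u.1) = q.1 := by omega
    have e2 : u.2 + (q.2 - u.2) = q.2 := by omega
    refine ⟨(q.1 - u.1, q.2 - u.2), Finset.HasAntidiagonal.mem_antidiagonal.mpr (by dsimp only; omega), ?_, ?_⟩
    · simp only [e1, e2]; exact h
    · simp only [e1, e2]
  · intro q _ _; rfl

end MultiparameterGroup

section MultiparameterCoalgebra

variable (k : Type*) [Field k] (p : ℕ) [Fact p.Prime] [CharP k p] (r s : ℕ)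

theorem sum_triple {M : Type*} [AddCommMonoid M] (n : ℕ) (f : ℕ → ℕ → ℕ → M) :
    ∑ q ∈ Finset.HasAntidiagonal.antidiagonal n, ∑ q' ∈ Finset.HasAntidiagonal.antidiagonal q.1,
      f q'.1 q'.2 q.2 =
    ∑ q ∈ Finset.HasAntidiagonal.antidiagonal n, ∑ q' ∈ Finset.HasAntidiagonal.antidiagonal q.2,
      f q.1 q'.1 q'.2 := by
  rw [Finset.sum_sigma', Finset.sum_sigma']
  refine Finset.sum_nbij' (fun x => ⟨(x.2.1, x.2.2 + x.1.2), (x.2.2, x.1.2)⟩)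
    (fun x => ⟨(x.1.1 + x.2.1, x.2.2), (x.1.1, x.2.1)⟩) ?_ ?_ ?_ ?_ ?_
  · rintro ⟨⟨a, b⟩, ⟨c, d⟩⟩ h
    simp only [Finset.mem_sigma, Finset.HasAntidiagonal.mem_antidiagonal] at h ⊢
    exact ⟨by omega, trivial⟩
  · rintro ⟨⟨a, b⟩, ⟨c, d⟩⟩ h
    simp only [Finset.mem_sigma, Finset.HasAntidiagonal.mem_antidiagonal] at h ⊢
    exact ⟨by omega, trivial⟩
  · rintro ⟨⟨a, b⟩, ⟨c, d⟩⟩ h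
    simp only [Finset.mem_sigma, Finset.HasAntidiagonal.mem_antidiagonal] at h
    obtain ⟨h1, rfl⟩ := h
    rfl
  · rintro ⟨⟨a, b⟩, ⟨c, d⟩⟩ h
    simp only [Finset.mem_sigma, Finset.HasAntidiagonal.mem_antidiagonal] at h
    obtain ⟨h1, rfl⟩ := h
    rfl
  · rintro ⟨⟨a, b⟩, ⟨c, d⟩⟩ _
    rfl

/-- `Σ_{u+v=i} σ_u ⊗ σ_v`. -/
def sigmaSum (i : ℕ) : MEven k p r s ⊗[k] MEven k p r s :=
  ∑ q ∈ Finset.HasAntidiagonal.antidiagonal i, sigmaE k p r s q.1 ⊗ₜ sigmaE k p r s q.2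

theorem sigmaSum_zero : sigmaSum k p r s 0 = 1 := by
  simp [sigmaSum, sigmaE_zero, Algebra.TensorProduct.one_def]

theorem sigmaSum_one : sigmaSum k p r s 1 =
    1 ⊗ₜ sigmaE k p r s 1 + sigmaE k p r s 1 ⊗ₜ 1 := by
  simp [sigmaSum, Finset.Nat.antidiagonal_succ, sigmaE_zero]

theorem sigmaSum_mul (i j : ℕ) : sigmaSum k p r s i * sigmaSum k p r s j =
    ((i + j).choose i : k) • sigmaSum k p r s (i + j) := by
  have h := convolution_mul k (R := MEven k p r s ⊗[k] MEven k p r s)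
    (fun i => sigmaE k p r s i ⊗ₜ 1) (fun i => 1 ⊗ₜ sigmaE k p r s i)
    (fun i j => by
      rw [Algebra.TensorProduct.tmul_mul_tmul, sigmaE_mul, one_mul, TensorProduct.smul_tmul'])
    (fun i j => by
      rw [Algebra.TensorProduct.tmul_mul_tmul, sigmaE_mul, one_mul, TensorProduct.tmul_smul]) i j
  simpa only [Algebra.TensorProduct.tmul_mul_tmul, one_mul, mul_one, sigmaSum] using h

/-- The comultiplication of the even part modulo terms with `τ`. -/
def comulE : MEven k p r s →ₐ[k] MEven k p r s ⊗[k] MEven k p r s :=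
  MEven.lift (thetaE k p r s ⊗ₜ 1 + 1 ⊗ₜ thetaE k p r s) (sigmaSum k p r s)
    (sigmaSum_zero k p r s)
    (by
      rw [add_pow_charP k p, Algebra.TensorProduct.tmul_pow, Algebra.TensorProduct.tmul_pow,
        one_pow, thetaE_pow, sigmaSum_one]
      split_ifs with h
      · rw [add_comm]
      · rw [sigmaE_trunc k p r s 1 (by omega)]; simp)
    (sigmaSum_mul k p r s)

theorem comulE_theta : comulE k p r s (thetaE k p r s) =
    thetaE k p r s ⊗ₜ 1 + 1 ⊗ₜ thetaE k p r s := MEven.lift_theta ..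

theorem comulE_sigma (i : ℕ) : comulE k p r s (sigmaE k p r s i) =
    if i < p ^ s then sigmaSum k p r s i else 0 := MEven.lift_sigma ..

/-- The counit on the even part. -/
def counitE : MEven k p r s →ₐ[k] k :=
  MEven.lift 0 (fun i => if i = 0 then 1 else 0) rfl
    (by
      rw [zero_pow (pow_ne_zero _ (Fact.out : p.Prime).ne_zero)]; simp)
    (fun i j => by rcases i with _ | i <;> rcases j with _ | j <;> simp)

theorem counitE_theta : counitE k p r s (thetaE k p r s) = 0 := MEven.lift_theta ..

theorem counitE_sigma (i : ℕ) : counitE k p r s (sigmaE k p r s i) = if i = 0 then 1 else 0 := by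
  have hp : 0 < p ^ s := pow_pos (Fact.out : p.Prime).pos s
  refine (MEven.lift_sigma ..).trans ?_
  split_ifs <;> first | rfl | omega

instance : Bialgebra k (MEven k p r s) :=
  Bialgebra.ofAlgHom (comulE k p r s) (counitE k p r s)
    (by
      refine MEven.algHom_ext k p r s ?_ ?_
      · simp [comulE_theta, TensorProduct.add_tmul, TensorProduct.tmul_add,
          Algebra.TensorProduct.one_def, add_assoc]
      · intro i hi
        have h1 : ∀ q ∈ Finset.HasAntidiagonal.antidiagonal i,
          comulE k p r s (sigmaE k p r s q.1) = sigmaSum k p r s q.1 := fun q hq => by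
            have := Finset.HasAntidiagonal.mem_antidiagonal.mp hq
            rw [comulE_sigma, if_pos (by omega)]
        have h2 : ∀ q ∈ Finset.HasAntidiagonal.antidiagonal i,
          comulE k p r s (sigmaE k p r s q.2) = sigmaSum k p r s q.2 := fun q hq => by
            have := Finset.HasAntidiagonal.mem_antidiagonal.mp hq
            rw [comulE_sigma, if_pos (by omega)]
        change (Algebra.TensorProduct.assoc k k k _ _ _)
          (Algebra.TensorProduct.map (comulE k p r s) (.id k _)
            (comulE k p r s (sigmaE k p r s i))) =
          Algebra.TensorProduct.map (.id k _) (comulE k p r s)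
            (comulE k p r s (sigmaE k p r s i))
        rw [comulE_sigma, if_pos hi]
        conv_lhs => rw [sigmaSum]
        conv_rhs => rw [sigmaSum]
        simp only [map_sum, Algebra.TensorProduct.map_tmul, AlgHom.id_apply]
        rw [Finset.sum_congr rfl fun q hq => by rw [h1 q hq]]
        conv_rhs => rw [Finset.sum_congr rfl fun q hq => by rw [h2 q hq]]
        simp only [sigmaSum, TensorProduct.sum_tmul, TensorProduct.tmul_sum, map_sum,
          Algebra.TensorProduct.assoc_tmul]
        exact sum_triple i
          (fun a b c => sigmaE k p r s a ⊗ₜ[k] (sigmaE k p r s b ⊗ₜ[k] sigmaE k p r s c)))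
    (by
      refine MEven.algHom_ext k p r s ?_ ?_
      · simp [comulE_theta, counitE_theta]
      · intro i hi
        change Algebra.TensorProduct.map (counitE k p r s) (.id k _)
            (comulE k p r s (sigmaE k p r s i)) = 1 ⊗ₜ sigmaE k p r s i
        rw [comulE_sigma, if_pos hi, sigmaSum, map_sum, Finset.sum_eq_single (0, i)]
        · simp [counitE_sigma]
        · intro q hq hne
          have h := Finset.HasAntidiagonal.mem_antidiagonal.mp hq
          have : q.1 ≠ 0 := fun h0 => hne (Prod.ext h0 (by dsimp only; omega))
          simp [counitE_sigma, this]
        · simp)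
    (by
      refine MEven.algHom_ext k p r s ?_ ?_
      · simp [comulE_theta, counitE_theta]
      · intro i hi
        change Algebra.TensorProduct.map (.id k _) (counitE k p r s)
            (comulE k p r s (sigmaE k p r s i)) = sigmaE k p r s i ⊗ₜ 1
        rw [comulE_sigma, if_pos hi, sigmaSum, map_sum, Finset.sum_eq_single (i, 0)]
        · simp [counitE_sigma]
        · intro q hq hne
          have h := Finset.HasAntidiagonal.mem_antidiagonal.mp hq
          have : q.2 ≠ 0 := fun h0 => hne (Prod.ext (by dsimp only; omega) h0)
          simp [counitE_sigma, this]
        · simp)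

theorem comul_eq : (Coalgebra.comul : MEven k p r s →ₗ[k] _) = (comulE k p r s).toLinearMap := rfl

/-- `σ_{i-p}`, read as zero for `i < p`. -/
def sigmaShift (i : ℕ) : MEven k p r s := if p ≤ i then sigmaE k p r s (i - p) else 0

theorem sigmaShift_mul (i j : ℕ) : sigmaE k p r s i * sigmaShift k p r s j +
    sigmaShift k p r s i * sigmaE k p r s j =
    ((i + j).choose i : k) • sigmaShift k p r s (i + j) := by
  have e1 : ∀ m, sigmaShift k p r s (p + m) = sigmaE k p r s m := fun m => by
    rw [sigmaShift, if_pos (by omega), Nat.add_sub_cancel_left]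
  have e0 : ∀ m, ¬ p ≤ m → sigmaShift k p r s m = 0 := fun m hm => if_neg hm
  by_cases hi : p ≤ i
  · obtain ⟨i, rfl⟩ := Nat.exists_eq_add_of_le hi
    have h := choose_mod k p (i + j) (p + i)
    rw [← add_assoc, if_pos hi, Nat.add_sub_cancel_left] at h
    rw [h, e1, add_assoc, e1, add_smul, sigmaE_mul k p r s i j]
    congr 1
    by_cases hj : p ≤ j
    · obtain ⟨j, rfl⟩ := Nat.exists_eq_add_of_le hj
      rw [e1, sigmaE_mul, show p + i + j = i + (p + j) by omega]
    · rw [e0 j hj, mul_zero, Nat.choose_eq_zero_of_lt (by omega), Nat.cast_zero, zero_smul]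
  · rw [e0 i hi, zero_mul, add_zero]
    by_cases hij : p ≤ i + j
    · obtain ⟨m, hm⟩ := Nat.exists_eq_add_of_le hij
      have h := choose_mod k p m i
      rw [if_neg hi, add_zero] at h
      rw [hm, h, e1]
      by_cases hj : p ≤ j
      · obtain ⟨j, rfl⟩ := Nat.exists_eq_add_of_le hj
        rw [e1, sigmaE_mul, show i + j = m by omega]
      · rw [e0 j hj, mul_zero, Nat.choose_eq_zero_of_lt (by omega), Nat.cast_zero, zero_smul]
    · rw [e0 _ hij, e0 j (by omega), mul_zero, smul_zero]

/-- The algebra homomorphism `x ↦ x + δ(x) ε` into the dual numbers. -/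
def deltaHom : MEven k p r s →ₐ[k] DualNumber (MEven k p r s) :=
  MEven.lift (TrivSqZeroExt.inl (thetaE k p r s))
    (fun i => TrivSqZeroExt.inl (sigmaE k p r s i) + TrivSqZeroExt.inr (sigmaShift k p r s i))
    (by
      have : ¬ p ≤ 0 := by have := (Fact.out : p.Prime).pos; omega
      simp [sigmaE_zero, sigmaShift, this])
    (by
      have : ¬ p ≤ 1 := by have := (Fact.out : p.Prime).two_le; omega
      rw [TrivSqZeroExt.inl_pow, thetaE_pow]
      split_ifs with h
      · simp [sigmaShift, this]
      · rw [sigmaE_trunc k p r s 1 (by omega), TrivSqZeroExt.inl_zero])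
    (fun i j => by
      ext
      · simp [sigmaE_mul]
      · have := sigmaShift_mul k p r s i j
        simp only [TrivSqZeroExt.snd_mul, TrivSqZeroExt.fst_add, TrivSqZeroExt.fst_inl,
          TrivSqZeroExt.fst_inr, TrivSqZeroExt.snd_add, TrivSqZeroExt.snd_inl,
          TrivSqZeroExt.snd_inr, TrivSqZeroExt.snd_smul, add_zero, zero_add, smul_eq_mul,
          MulOpposite.smul_eq_mul_unop, MulOpposite.unop_op]
        exact this)

/-- The derivation `δ` with `δ θ = 0`, `δ σ_i = σ_{i-p}`. -/
def delta : MEven k p r s →ₗ[k] MEven k p r s :=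
  (TrivSqZeroExt.sndHom (MEven k p r s) (MEven k p r s)).restrictScalars k ∘ₗ
    (deltaHom k p r s).toLinearMap


theorem fst_deltaHom (x : MEven k p r s) : (deltaHom k p r s x).fst = x := by
  have : (TrivSqZeroExt.fstHom k (MEven k p r s) (MEven k p r s)).comp (deltaHom k p r s) =
      AlgHom.id k _ := by
    refine MEven.algHom_ext k p r s ?_ ?_
    · simp [deltaHom, MEven.lift_theta]
    · intro i hi
      simp [deltaHom, MEven.lift_sigma, hi]
  exact DFunLike.congr_fun this x

theorem delta_theta : delta k p r s (thetaE k p r s) = 0 := by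
  simp [delta, deltaHom, MEven.lift_theta]

theorem delta_sigma (i : ℕ) (hi : i < p ^ s) :
    delta k p r s (sigmaE k p r s i) = sigmaShift k p r s i := by
  simp [delta, deltaHom, MEven.lift_sigma, hi]

theorem delta_mul (x y : MEven k p r s) :
    delta k p r s (x * y) = x * delta k p r s y + delta k p r s x * y := by
  simp [delta, fst_deltaHom, TrivSqZeroExt.snd_mul]

theorem delta_algebraMap (a : k) : delta k p r s (algebraMap k _ a) = 0 := by
  have h : deltaHom k p r s (algebraMap k _ a) = algebraMap k _ a := AlgHom.commutes _ a
  simp [delta, h, TrivSqZeroExt.algebraMap_eq_inl']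

theorem rTensor_delta_mul (x y : MEven k p r s ⊗[k] MEven k p r s) :
    (delta k p r s).rTensor _ (x * y) =
      x * (delta k p r s).rTensor _ y + (delta k p r s).rTensor _ x * y := by
  induction x with
  | zero => simp
  | add a b ha hb => simp only [add_mul, map_add, ha, hb]; abel
  | tmul a b =>
    induction y with
    | zero => simp
    | add u v hu hv => simp only [mul_add, map_add, hu, hv]; abel
    | tmul c d => simp [delta_mul, TensorProduct.add_tmul]

theorem lTensor_delta_mul (x y : MEven k p r s ⊗[k] MEven k p r s) :
    (delta k p r s).lTensor _ (x * y) =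
      x * (delta k p r s).lTensor _ y + (delta k p r s).lTensor _ x * y := by
  induction x with
  | zero => simp
  | add a b ha hb => simp only [add_mul, map_add, ha, hb]; abel
  | tmul a b =>
    induction y with
    | zero => simp
    | add u v hu hv => simp only [mul_add, map_add, hu, hv]; abel
    | tmul c d => simp [delta_mul, TensorProduct.tmul_add]

theorem sum_shift {M : Type*} [AddCommMonoid M] (p n : ℕ) (f : ℕ → ℕ → M) :
    ∑ q ∈ Finset.HasAntidiagonal.antidiagonal n, (if p ≤ q.1 then f (q.1 - p) q.2 else 0) =
      if p ≤ n then ∑ q ∈ Finset.HasAntidiagonal.antidiagonal (n - p), f q.1 q.2 else 0 := by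
  split_ifs with h
  · rw [← Finset.sum_filter]
    refine Finset.sum_nbij' (fun q => (q.1 - p, q.2)) (fun q => (q.1 + p, q.2)) ?_ ?_ ?_ ?_ ?_
    · rintro ⟨a, b⟩ hq
      simp only [Finset.mem_filter, Finset.HasAntidiagonal.mem_antidiagonal] at hq ⊢
      omega
    · rintro ⟨a, b⟩ hq
      simp only [Finset.mem_filter, Finset.HasAntidiagonal.mem_antidiagonal] at hq ⊢
      omega
    · rintro ⟨a, b⟩ hq
      simp only [Finset.mem_filter, Finset.HasAntidiagonal.mem_antidiagonal] at hq
      simp only [Prod.mk.injEq, and_true]; omega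
    · rintro ⟨a, b⟩ _
      simp
    · rintro ⟨a, b⟩ _
      rfl
  · refine Finset.sum_eq_zero fun q hq => ?_
    have := Finset.HasAntidiagonal.mem_antidiagonal.mp hq
    rw [if_neg (by omega)]

theorem comulE_sigmaShift (i : ℕ) (hi : i < p ^ s) : comulE k p r s (sigmaShift k p r s i) =
    if p ≤ i then sigmaSum k p r s (i - p) else 0 := by
  unfold sigmaShift
  split_ifs
  · rw [comulE_sigma, if_pos (by omega)]
  · exact map_zero _

theorem comulE_delta_left (x : MEven k p r s) : comulE k p r s (delta k p r s x) =
    (delta k p r s).rTensor _ (comulE k p r s x) := by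
  induction x using MEven.induction with
  | algebraMap a =>
    rw [delta_algebraMap, map_zero, AlgHom.commutes, Algebra.TensorProduct.algebraMap_apply,
      LinearMap.rTensor_tmul, delta_algebraMap, TensorProduct.zero_tmul]
  | add a b ha hb => simp only [map_add, ha, hb]
  | theta a ha =>
    rw [delta_mul, delta_theta, map_mul, rTensor_delta_mul, comulE_theta, ← ha]
    have h1 := delta_algebraMap k p r s 1
    rw [map_one] at h1
    simp [delta_theta, h1, comulE_theta]
  | sigma a i ha =>
    by_cases hi : i < p ^ s
    · rw [delta_mul, map_mul, rTensor_delta_mul, ← ha, map_add, map_mul, map_mul, delta_sigma _ _ _ _ _ hi,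
        comulE_sigmaShift _ _ _ _ _ hi]
      congr 2
      rw [comulE_sigma, if_pos hi, sigmaSum, sigmaSum, map_sum,
        ← sum_shift p i (fun a b => sigmaE k p r s a ⊗ₜ[k] sigmaE k p r s b)]
      refine Finset.sum_congr rfl fun q hq => ?_
      have := Finset.HasAntidiagonal.mem_antidiagonal.mp hq
      rw [LinearMap.rTensor_tmul, delta_sigma _ _ _ _ _ (by omega), sigmaShift]
      split_ifs <;> simp
    · rw [sigmaE_trunc k p r s i (by omega)]; simp

theorem comulE_delta_right (x : MEven k p r s) : comulE k p r s (delta k p r s x) =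
    (delta k p r s).lTensor _ (comulE k p r s x) := by
  induction x using MEven.induction with
  | algebraMap a =>
    have h1 := delta_algebraMap k p r s 1
    rw [map_one] at h1
    rw [delta_algebraMap, map_zero, AlgHom.commutes, Algebra.TensorProduct.algebraMap_apply,
      LinearMap.lTensor_tmul, h1, TensorProduct.tmul_zero]
  | add a b ha hb => simp only [map_add, ha, hb]
  | theta a ha =>
    rw [delta_mul, delta_theta, map_mul, lTensor_delta_mul, comulE_theta, ← ha]
    have h1 := delta_algebraMap k p r s 1
    rw [map_one] at h1
    simp [delta_theta, h1, comulE_theta]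
  | sigma a i ha =>
    by_cases hi : i < p ^ s
    · rw [delta_mul, map_mul, lTensor_delta_mul, ← ha, map_add, map_mul, map_mul, delta_sigma _ _ _ _ _ hi,
        comulE_sigmaShift _ _ _ _ _ hi]
      congr 2
      have h := sum_shift p i (fun a b => sigmaE k p r s b ⊗ₜ[k] sigmaE k p r s a)
      rw [← Finset.Nat.sum_antidiagonal_swap] at h
      conv_rhs at h => rw [← Finset.Nat.sum_antidiagonal_swap]
      rw [comulE_sigma, if_pos hi, sigmaSum, sigmaSum, map_sum]
      refine (h.symm.trans ?_ :)
      refine Finset.sum_congr rfl fun q hq => ?_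
      have := Finset.HasAntidiagonal.mem_antidiagonal.mp hq
      rw [LinearMap.lTensor_tmul, delta_sigma _ _ _ _ _ (by omega), sigmaShift]
      dsimp only [Prod.swap]
      split_ifs <;> simp
    · rw [sigmaE_trunc k p r s i (by omega)]; simp

end MultiparameterCoalgebra

section MultiparameterHopf

variable (k : Type*) [Field k] (p : ℕ) (r s : ℕ)

/-- The algebra `k[M_{r;s}]`: it is `E ⊕ E τ` with `τ ^ 2 = 0`, where `E` is the even part. -/
abbrev MAlg := DualNumber (MEven k p r s)

/-- Inclusion of the even part. -/
def evenIncl : MEven k p r s →ₗ[k] MAlg k p r s :=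
  (TrivSqZeroExt.inlAlgHom k (MEven k p r s) (MEven k p r s)).toLinearMap

/-- Multiplication by `τ` on the even part. -/
def oddIncl : MEven k p r s →ₗ[k] MAlg k p r s :=
  (TrivSqZeroExt.inrHom (MEven k p r s) (MEven k p r s)).restrictScalars k

/-- Projection to the even part. -/
def evenProj : MAlg k p r s →ₗ[k] MEven k p r s :=
  (TrivSqZeroExt.fstHom k (MEven k p r s) (MEven k p r s)).toLinearMap

/-- Projection to the odd part `E τ ≅ E`. -/
def oddProj : MAlg k p r s →ₗ[k] MEven k p r s :=
  (TrivSqZeroExt.sndHom (MEven k p r s) (MEven k p r s)).restrictScalars k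

theorem evenProj_even (x : MEven k p r s) : evenProj k p r s (evenIncl k p r s x) = x := rfl
theorem evenProj_odd (x : MEven k p r s) : evenProj k p r s (oddIncl k p r s x) = 0 := rfl
theorem oddProj_even (x : MEven k p r s) : oddProj k p r s (evenIncl k p r s x) = 0 := rfl
theorem oddProj_odd (x : MEven k p r s) : oddProj k p r s (oddIncl k p r s x) = x := rfl

theorem even_add_odd (x : MAlg k p r s) :
    evenIncl k p r s (evenProj k p r s x) + oddIncl k p r s (oddProj k p r s x) = x :=
  TrivSqZeroExt.inl_fst_add_inr_snd_eq x

theorem MAlg.linear_ext {N : Type*} [AddCommGroup N] [Module k N] {f g : MAlg k p r s →ₗ[k] N}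
    (h0 : ∀ x, f (evenIncl k p r s x) = g (evenIncl k p r s x))
    (h1 : ∀ x, f (oddIncl k p r s x) = g (oddIncl k p r s x)) : f = g := by
  refine LinearMap.ext fun x => ?_
  rw [← even_add_odd k p r s x, map_add, map_add, h0, h1]

/-- `τ` -/
def tau : MAlg k p r s := oddIncl k p r s 1

/-- `θ` -/
def theta : MAlg k p r s := evenIncl k p r s (thetaE k p r s)

/-- `σ_i` -/
def sigma (i : ℕ) : MAlg k p r s := evenIncl k p r s (sigmaE k p r s i)

/-- The `ℤ/2`-grading of `k[M_{r;s}]`. -/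
def mParity (i : ZMod 2) : Submodule k (MAlg k p r s) :=
  if i = 0 then LinearMap.ker (oddProj k p r s) else LinearMap.ker (evenProj k p r s)

theorem mem_mParity_zero (x : MAlg k p r s) : x ∈ mParity k p r s 0 ↔ x.snd = 0 := Iff.rfl

theorem mem_mParity_one (x : MAlg k p r s) : x ∈ mParity k p r s 1 ↔ x.fst = 0 := Iff.rfl

/-- The even component. -/
def evenComp : MAlg k p r s →ₗ[k] mParity k p r s 0 :=
  (evenIncl k p r s ∘ₗ evenProj k p r s).codRestrict _ fun _ => rfl

/-- The odd component. -/
def oddComp : MAlg k p r s →ₗ[k] mParity k p r s 1 :=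
  (oddIncl k p r s ∘ₗ oddProj k p r s).codRestrict _ fun _ => rfl

instance : GradedAlgebra (mParity k p r s) where
  one_mem := by
    change (1 : MAlg k p r s).snd = 0
    simp
  mul_mem := by
    intro i j x y hx hy
    fin_cases i <;> fin_cases j
    · change (x * y).snd = 0
      rw [TrivSqZeroExt.snd_mul, show x.snd = 0 from hx, show y.snd = 0 from hy]; simp
    · change (x * y).fst = 0
      rw [TrivSqZeroExt.fst_mul, show y.fst = 0 from hy, mul_zero]
    · change (x * y).fst = 0
      rw [TrivSqZeroExt.fst_mul, show x.fst = 0 from hx, zero_mul]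
    · change (x * y).snd = 0
      rw [TrivSqZeroExt.snd_mul, show x.fst = 0 from hx, show y.fst = 0 from hy]; simp
  __ := DirectSum.Decomposition.ofLinearMap (mParity k p r s)
    (DirectSum.lof k _ (fun i => mParity k p r s i) 0 ∘ₗ evenComp k p r s +
      DirectSum.lof k _ (fun i => mParity k p r s i) 1 ∘ₗ oddComp k p r s)
    (LinearMap.ext fun x => by
      simp only [LinearMap.comp_apply, LinearMap.add_apply, map_add, DirectSum.coeLinearMap_lof]
      exact even_add_odd k p r s x)
    (by
      refine DirectSum.linearMap_ext _ fun i => LinearMap.ext fun x => ?_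
      simp only [LinearMap.comp_apply, LinearMap.add_apply, DirectSum.coeLinearMap_lof,
        LinearMap.id_apply]
      obtain ⟨x, hx⟩ := x
      fin_cases i
      · have hx' : oddProj k p r s x = 0 := hx
        have e1 : oddComp k p r s x = 0 := Subtype.ext (by
          change oddIncl k p r s (oddProj k p r s x) = 0
          rw [hx', map_zero])
        have e2 : evenComp k p r s x = ⟨x, hx⟩ := Subtype.ext (by
          change evenIncl k p r s (evenProj k p r s x) = x
          conv_rhs => rw [← even_add_odd k p r s x]
          rw [hx', map_zero, add_zero])
        change DirectSum.lof k _ (fun i => mParity k p r s i) 0 (evenComp k p r s x) +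
          DirectSum.lof k _ (fun i => mParity k p r s i) 1 (oddComp k p r s x) = _
        rw [e1, e2, map_zero, add_zero]; rfl
      · have hx' : evenProj k p r s x = 0 := hx
        have e1 : evenComp k p r s x = 0 := Subtype.ext (by
          change evenIncl k p r s (evenProj k p r s x) = 0
          rw [hx', map_zero])
        have e2 : oddComp k p r s x = ⟨x, hx⟩ := Subtype.ext (by
          change oddIncl k p r s (oddProj k p r s x) = x
          conv_rhs => rw [← even_add_odd k p r s x]
          rw [hx', map_zero, zero_add])
        change DirectSum.lof k _ (fun i => mParity k p r s i) 0 (evenComp k p r s x) +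
          DirectSum.lof k _ (fun i => mParity k p r s i) 1 (oddComp k p r s x) = _
        rw [e1, e2, map_zero, zero_add]; rfl)

variable [Fact p.Prime] [CharP k p]

/-- The comultiplication of `k[M_{r;s}]`: for `x` in the even part,
`Δ x = Δ' x + (Δ' δ x) (τ ⊗ τ)` and `Δ (x τ) = (Δ' x) (τ ⊗ 1 + 1 ⊗ τ)`, where `Δ'` is `comulE`. -/
def mComul : MAlg k p r s →ₗ[k] MAlg k p r s ⊗[k] MAlg k p r s :=
  TensorProduct.map (evenIncl k p r s) (evenIncl k p r s) ∘ₗ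
      (comulE k p r s).toLinearMap ∘ₗ evenProj k p r s +
    TensorProduct.map (oddIncl k p r s) (oddIncl k p r s) ∘ₗ
      (comulE k p r s).toLinearMap ∘ₗ delta k p r s ∘ₗ evenProj k p r s +
    (TensorProduct.map (oddIncl k p r s) (evenIncl k p r s) +
      TensorProduct.map (evenIncl k p r s) (oddIncl k p r s)) ∘ₗ
      (comulE k p r s).toLinearMap ∘ₗ oddProj k p r s

theorem mComul_even (x : MEven k p r s) : mComul k p r s (evenIncl k p r s x) =
    TensorProduct.map (evenIncl k p r s) (evenIncl k p r s) (comulE k p r s x) +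
    TensorProduct.map (oddIncl k p r s) (oddIncl k p r s) (comulE k p r s (delta k p r s x)) := by
  simp [mComul, evenProj_even, oddProj_even]

theorem mComul_odd (x : MEven k p r s) : mComul k p r s (oddIncl k p r s x) =
    TensorProduct.map (oddIncl k p r s) (evenIncl k p r s) (comulE k p r s x) +
    TensorProduct.map (evenIncl k p r s) (oddIncl k p r s) (comulE k p r s x) := by
  simp [mComul, evenProj_odd, oddProj_odd]

theorem comulE_coassoc (x : MEven k p r s) :
    TensorProduct.assoc k _ _ _ ((comulE k p r s).toLinearMap.rTensor _ (comulE k p r s x)) =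
      (comulE k p r s).toLinearMap.lTensor _ (comulE k p r s x) :=
  Coalgebra.coassoc_apply x

theorem assoc_map₃ {E F : Type*} [AddCommGroup E] [Module k E] [AddCommGroup F] [Module k F]
    (f g h : E →ₗ[k] F) (y : (E ⊗[k] E) ⊗[k] E) :
    TensorProduct.assoc k F F F (TensorProduct.map (TensorProduct.map f g) h y) =
      TensorProduct.map f (TensorProduct.map g h) (TensorProduct.assoc k E E E y) := by
  rw [← LinearEquiv.coe_coe, ← LinearMap.comp_apply, ← LinearEquiv.coe_coe, ← LinearMap.comp_apply]
  congr 1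
  ext; rfl

theorem rTensor_even (g : MEven k p r s →ₗ[k] MAlg k p r s) (y : MEven k p r s ⊗[k] MEven k p r s) :
    (mComul k p r s).rTensor _ (TensorProduct.map (evenIncl k p r s) g y) =
    TensorProduct.map (TensorProduct.map (evenIncl k p r s) (evenIncl k p r s)) g
      ((comulE k p r s).toLinearMap.rTensor _ y) +
    TensorProduct.map (TensorProduct.map (oddIncl k p r s) (oddIncl k p r s)) g
      ((comulE k p r s).toLinearMap.rTensor _ ((delta k p r s).rTensor _ y)) := by
  induction y with
  | zero => simp
  | add a b ha hb => simp only [map_add, ha, hb]; abel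
  | tmul a b => simp [mComul_even, TensorProduct.add_tmul]

theorem rTensor_odd (g : MEven k p r s →ₗ[k] MAlg k p r s) (y : MEven k p r s ⊗[k] MEven k p r s) :
    (mComul k p r s).rTensor _ (TensorProduct.map (oddIncl k p r s) g y) =
    TensorProduct.map (TensorProduct.map (oddIncl k p r s) (evenIncl k p r s)) g
      ((comulE k p r s).toLinearMap.rTensor _ y) +
    TensorProduct.map (TensorProduct.map (evenIncl k p r s) (oddIncl k p r s)) g
      ((comulE k p r s).toLinearMap.rTensor _ y) := by
  induction y with
  | zero => simp
  | add a b ha hb => simp only [map_add, ha, hb]; abel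
  | tmul a b => simp [mComul_odd, TensorProduct.add_tmul]

theorem lTensor_even (g : MEven k p r s →ₗ[k] MAlg k p r s) (y : MEven k p r s ⊗[k] MEven k p r s) :
    (mComul k p r s).lTensor _ (TensorProduct.map g (evenIncl k p r s) y) =
    TensorProduct.map g (TensorProduct.map (evenIncl k p r s) (evenIncl k p r s))
      ((comulE k p r s).toLinearMap.lTensor _ y) +
    TensorProduct.map g (TensorProduct.map (oddIncl k p r s) (oddIncl k p r s))
      ((comulE k p r s).toLinearMap.lTensor _ ((delta k p r s).lTensor _ y)) := by
  induction y with
  | zero => simp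
  | add a b ha hb => simp only [map_add, ha, hb]; abel
  | tmul a b => simp [mComul_even, TensorProduct.tmul_add]

theorem lTensor_odd (g : MEven k p r s →ₗ[k] MAlg k p r s) (y : MEven k p r s ⊗[k] MEven k p r s) :
    (mComul k p r s).lTensor _ (TensorProduct.map g (oddIncl k p r s) y) =
    TensorProduct.map g (TensorProduct.map (oddIncl k p r s) (evenIncl k p r s))
      ((comulE k p r s).toLinearMap.lTensor _ y) +
    TensorProduct.map g (TensorProduct.map (evenIncl k p r s) (oddIncl k p r s))
      ((comulE k p r s).toLinearMap.lTensor _ y) := by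
  induction y with
  | zero => simp
  | add a b ha hb => simp only [map_add, ha, hb]; abel
  | tmul a b => simp [mComul_odd, TensorProduct.tmul_add]

/-- The counit of `k[M_{r;s}]`. -/
def mCounit : MAlg k p r s →ₗ[k] k := (counitE k p r s).toLinearMap ∘ₗ evenProj k p r s

theorem mCounit_even (x : MEven k p r s) :
    mCounit k p r s (evenIncl k p r s x) = counitE k p r s x := rfl

theorem mCounit_odd (x : MEven k p r s) : mCounit k p r s (oddIncl k p r s x) = 0 :=
  map_zero (counitE k p r s)

theorem rTensor_counit (f g : MEven k p r s →ₗ[k] MAlg k p r s)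
    (y : MEven k p r s ⊗[k] MEven k p r s) :
    (mCounit k p r s).rTensor _ (TensorProduct.map f g y) =
      TensorProduct.map (mCounit k p r s ∘ₗ f) g y := by
  rw [LinearMap.rTensor, ← LinearMap.comp_apply, ← TensorProduct.map_comp, LinearMap.id_comp]

theorem lTensor_counit (f g : MEven k p r s →ₗ[k] MAlg k p r s)
    (y : MEven k p r s ⊗[k] MEven k p r s) :
    (mCounit k p r s).lTensor _ (TensorProduct.map f g y) =
      TensorProduct.map f (mCounit k p r s ∘ₗ g) y := by
  rw [LinearMap.lTensor, ← LinearMap.comp_apply, ← TensorProduct.map_comp, LinearMap.id_comp]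

theorem mCounit_comp_odd : mCounit k p r s ∘ₗ oddIncl k p r s = 0 :=
  LinearMap.ext (mCounit_odd k p r s)

theorem mCounit_comp_even :
    mCounit k p r s ∘ₗ evenIncl k p r s = (counitE k p r s).toLinearMap :=
  LinearMap.ext (mCounit_even k p r s)

theorem map_counitE_left (g : MEven k p r s →ₗ[k] MAlg k p r s) (x : MEven k p r s) :
    TensorProduct.map (counitE k p r s).toLinearMap g (comulE k p r s x) = 1 ⊗ₜ g x := by
  have h : (counitE k p r s).toLinearMap.rTensor _ (comulE k p r s x) = 1 ⊗ₜ x :=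
    Coalgebra.rTensor_counit_comul x
  rw [← LinearMap.lTensor_comp_rTensor, LinearMap.comp_apply, h, LinearMap.lTensor_tmul]

theorem map_counitE_right (g : MEven k p r s →ₗ[k] MAlg k p r s) (x : MEven k p r s) :
    TensorProduct.map g (counitE k p r s).toLinearMap (comulE k p r s x) = g x ⊗ₜ 1 := by
  have h : (counitE k p r s).toLinearMap.lTensor _ (comulE k p r s x) = x ⊗ₜ 1 :=
    Coalgebra.lTensor_counit_comul x
  rw [← LinearMap.rTensor_comp_lTensor, LinearMap.comp_apply, h, LinearMap.rTensor_tmul]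

instance : Coalgebra k (MAlg k p r s) where
  comul := mComul k p r s
  counit := mCounit k p r s
  coassoc := by
    refine MAlg.linear_ext k p r s (fun x => ?_) (fun x => ?_)
    · simp only [LinearMap.comp_apply, LinearEquiv.coe_coe, mComul_even, map_add, rTensor_even,
        rTensor_odd, lTensor_even, lTensor_odd, assoc_map₃, ← comulE_delta_left,
        ← comulE_delta_right, comulE_coassoc]
      abel
    · simp only [LinearMap.comp_apply, LinearEquiv.coe_coe, mComul_odd, map_add, rTensor_even,
        rTensor_odd, lTensor_even, lTensor_odd, assoc_map₃, ← comulE_delta_left,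
        ← comulE_delta_right, comulE_coassoc]
      abel
  rTensor_counit_comp_comul := by
    refine MAlg.linear_ext k p r s (fun x => ?_) (fun x => ?_)
    · simp only [LinearMap.comp_apply, mComul_even, map_add, rTensor_counit, mCounit_comp_odd,
        mCounit_comp_even, map_counitE_left]
      simp
    · simp only [LinearMap.comp_apply, mComul_odd, map_add, rTensor_counit, mCounit_comp_odd,
        mCounit_comp_even, map_counitE_left]
      simp
  lTensor_counit_comp_comul := by
    refine MAlg.linear_ext k p r s (fun x => ?_) (fun x => ?_)
    · simp only [LinearMap.comp_apply, mComul_even, map_add, lTensor_counit, mCounit_comp_odd,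
        mCounit_comp_even, map_counitE_right]
      simp
    · simp only [LinearMap.comp_apply, mComul_odd, map_add, lTensor_counit,
        mCounit_comp_odd, mCounit_comp_even, map_counitE_right]
      simp

theorem comul_evenIncl (x : MEven k p r s) : Coalgebra.comul (R := k) (evenIncl k p r s x) =
    TensorProduct.map (evenIncl k p r s) (evenIncl k p r s) (comulE k p r s x) +
    TensorProduct.map (oddIncl k p r s) (oddIncl k p r s) (comulE k p r s (delta k p r s x)) :=
  mComul_even k p r s x

theorem comul_oddIncl (x : MEven k p r s) : Coalgebra.comul (R := k) (oddIncl k p r s x) =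
    TensorProduct.map (oddIncl k p r s) (evenIncl k p r s) (comulE k p r s x) +
    TensorProduct.map (evenIncl k p r s) (oddIncl k p r s) (comulE k p r s x) :=
  mComul_odd k p r s x

theorem evenIncl_one : evenIncl k p r s 1 = 1 := rfl

theorem oddIncl_eq (x : MEven k p r s) : oddIncl k p r s x = evenIncl k p r s x * tau k p r s := by
  change TrivSqZeroExt.inr x = TrivSqZeroExt.inl x * TrivSqZeroExt.inr 1
  rw [TrivSqZeroExt.inl_mul_inr, smul_eq_mul, mul_one]

theorem delta_one : delta k p r s 1 = 0 := by
  have h1 := delta_algebraMap k p r s 1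
  rwa [map_one] at h1

theorem comul_one : Coalgebra.comul (R := k) (1 : MAlg k p r s) = 1 ⊗ₜ 1 := by
  rw [← evenIncl_one, comul_evenIncl, delta_one]
  simp [Algebra.TensorProduct.one_def]

theorem comul_tau : Coalgebra.comul (R := k) (tau k p r s) =
    tau k p r s ⊗ₜ 1 + 1 ⊗ₜ tau k p r s := by
  rw [tau, comul_oddIncl]
  simp [Algebra.TensorProduct.one_def, evenIncl_one]

theorem comul_theta : Coalgebra.comul (R := k) (theta k p r s) =
    theta k p r s ⊗ₜ 1 + 1 ⊗ₜ theta k p r s := by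
  rw [theta, comul_evenIncl, delta_theta, comulE_theta]
  simp [evenIncl_one]

/-- `Δ σ_i = Σ_{u+v=i} σ_u ⊗ σ_v + Σ_{u+v+p=i} σ_u τ ⊗ σ_v τ`. -/
theorem comul_sigma (i : ℕ) (hi : i < p ^ s) : Coalgebra.comul (R := k) (sigma k p r s i) =
    ∑ q ∈ Finset.HasAntidiagonal.antidiagonal i, sigma k p r s q.1 ⊗ₜ sigma k p r s q.2 +
    if p ≤ i then ∑ q ∈ Finset.HasAntidiagonal.antidiagonal (i - p),
      (sigma k p r s q.1 * tau k p r s) ⊗ₜ (sigma k p r s q.2 * tau k p r s) else 0 := by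
  rw [sigma, comul_evenIncl, delta_sigma _ _ _ _ _ hi, comulE_sigmaShift _ _ _ _ _ hi,
    comulE_sigma, if_pos hi]
  congr 1
  · simp [sigmaSum, sigma]
  · split_ifs
    · simp [sigmaSum, sigma, oddIncl_eq]
    · simp

theorem counit_tau : Coalgebra.counit (R := k) (tau k p r s) = 0 := mCounit_odd k p r s 1

theorem counit_theta : Coalgebra.counit (R := k) (theta k p r s) = 0 := counitE_theta k p r s

theorem counit_sigma (i : ℕ) :
    Coalgebra.counit (R := k) (sigma k p r s i) = if i = 0 then 1 else 0 := counitE_sigma k p r s i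


theorem span_MEven : Submodule.span k (Set.range fun q : Fin (p ^ (r - 1)) × Fin (p ^ s) =>
    thetaE k p r s ^ q.1.val * sigmaE k p r s q.2.val) = ⊤ := by
  have hp : 0 < p := (Fact.out : p.Prime).pos
  have hs : 0 < p ^ s := pow_pos hp s
  have hr : 0 < p ^ (r - 1) := pow_pos hp (r - 1)
  set S := Submodule.span k (Set.range fun q : Fin (p ^ (r - 1)) × Fin (p ^ s) =>
    thetaE k p r s ^ q.1.val * sigmaE k p r s q.2.val) with hS
  have mem : ∀ i, i < p ^ (r - 1) → ∀ j, thetaE k p r s ^ i * sigmaE k p r s j ∈ S := by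
    intro i hi j
    by_cases hj : j < p ^ s
    · exact Submodule.subset_span ⟨(⟨i, hi⟩, ⟨j, hj⟩), rfl⟩
    · rw [sigmaE_trunc k p r s j (by omega), mul_zero]; exact zero_mem _
  have key : ∀ (y : MEven k p r s),
      (∀ i, i < p ^ (r - 1) → ∀ j, thetaE k p r s ^ i * sigmaE k p r s j * y ∈ S) →
      ∀ x ∈ S, x * y ∈ S := by
    intro y hy x hx
    refine Submodule.span_induction ?_ ?_ ?_ ?_ hx
    · rintro _ ⟨q, rfl⟩; exact hy _ q.1.2 _
    · rw [zero_mul]; exact zero_mem _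
    · intro a b _ _ ha hb; rw [add_mul]; exact add_mem ha hb
    · intro c a _ ha; rw [smul_mul_assoc]; exact Submodule.smul_mem _ _ ha
  have hsig : ∀ m, ∀ x ∈ S, x * sigmaE k p r s m ∈ S := fun m => key _ fun i hi j => by
    rw [mul_assoc, sigmaE_mul, mul_smul_comm]
    exact Submodule.smul_mem _ _ (mem i hi _)
  have hth : ∀ x ∈ S, x * thetaE k p r s ∈ S := key _ fun i hi j => by
    rw [mul_right_comm, ← pow_succ]
    by_cases h : i + 1 < p ^ (r - 1)
    · exact mem _ h _
    · rw [show i + 1 = p ^ (r - 1) by omega, thetaE_pow, sigmaE_mul]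
      have := mem 0 hr (1 + j)
      rw [pow_zero, one_mul] at this
      exact Submodule.smul_mem _ _ this
  refine eq_top_iff.mpr fun x _ => ?_
  induction x using MEven.induction with
  | algebraMap a =>
    have := mem 0 hr 0
    rw [pow_zero, one_mul, sigmaE_zero] at this
    rw [Algebra.algebraMap_eq_smul_one]
    exact Submodule.smul_mem _ _ this
  | add a b ha hb => exact add_mem (ha trivial) (hb trivial)
  | theta a ha => exact hth a (ha trivial)
  | sigma a i ha => exact hsig i a (ha trivial)

instance : Module.Finite k (MEven k p r s) :=
  ⟨⟨(Set.finite_range _).toFinset, by rw [Set.Finite.coe_toFinset]; exact span_MEven k p r s⟩⟩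

instance : Module.Finite k (MAlg k p r s) :=
  inferInstanceAs (Module.Finite k (MEven k p r s × MEven k p r s))

end MultiparameterHopf

section Rho

/-!
### The endomorphisms `ρ_{(μ,a)}` of `M_{r;s}`
-/

variable {k : Type*} [Field k] {p : ℕ} [Fact p.Prime] [CharP k p] {r s : ℕ}
  {A : Type*} [CommRing A] [Algebra k A]

variable (k p r s) in
/-- The even part of `ρ_{(μ,a)}`: `θ ↦ a ⊗ θ`, `σ_i ↦ a ^ (i p ^ (r - 1)) ⊗ σ_i`. -/
def rhoE (a : A) : MEven k p r s →ₐ[k] A ⊗[k] MEven k p r s :=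
  MEven.lift (a ⊗ₜ thetaE k p r s) (fun i => (a ^ (i * p ^ (r - 1))) ⊗ₜ sigmaE k p r s i)
    (by simp [sigmaE_zero, Algebra.TensorProduct.one_def])
    (by
      rw [Algebra.TensorProduct.tmul_pow, thetaE_pow, one_mul]
      split_ifs with h
      · rfl
      · rw [sigmaE_trunc k p r s 1 (by omega), TensorProduct.tmul_zero])
    (fun i j => by
      rw [Algebra.TensorProduct.tmul_mul_tmul, sigmaE_mul, TensorProduct.tmul_smul, add_mul,
        pow_add])

theorem rhoE_theta (a : A) : rhoE k p r s a (thetaE k p r s) = a ⊗ₜ thetaE k p r s :=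
  MEven.lift_theta ..

theorem rhoE_sigma (a : A) (i : ℕ) : rhoE k p r s a (sigmaE k p r s i) =
    (a ^ (i * p ^ (r - 1))) ⊗ₜ sigmaE k p r s i := by
  refine (MEven.lift_sigma ..).trans ?_
  split_ifs with h
  · rfl
  · rw [sigmaE_trunc k p r s i (by omega), TensorProduct.tmul_zero]

variable (k p r s) in
/-- The comorphism of `ρ_{(μ,a)}`. -/
def rhoHom (a μ : A) : MAlg k p r s →ₐ[k] A ⊗[k] MAlg k p r s :=
  DualNumber.lift ⟨((Algebra.TensorProduct.map (AlgHom.id k A)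
      (TrivSqZeroExt.inlAlgHom k (MEven k p r s) (MEven k p r s))).comp (rhoE k p r s a),
    μ ⊗ₜ tau k p r s), by
      constructor
      · change (μ ⊗ₜ[k] tau k p r s) * (μ ⊗ₜ[k] tau k p r s) = 0
        rw [Algebra.TensorProduct.tmul_mul_tmul]
        have : tau k p r s * tau k p r s = 0 := TrivSqZeroExt.inr_mul_inr ..
        rw [this, TensorProduct.tmul_zero]
      · intro x; exact mul_comm (G := A ⊗[k] MAlg k p r s) _ _⟩

theorem rhoHom_even (a μ : A) (x : MEven k p r s) : rhoHom k p r s a μ (evenIncl k p r s x) =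
    (evenIncl k p r s).lTensor A (rhoE k p r s a x) :=
  DualNumber.lift_apply_inl _ x

theorem rhoHom_odd (a μ : A) (x : MEven k p r s) : rhoHom k p r s a μ (oddIncl k p r s x) =
    μ • (oddIncl k p r s).lTensor A (rhoE k p r s a x) := by
  have h : rhoHom k p r s a μ (tau k p r s) = μ ⊗ₜ tau k p r s := DualNumber.lift_apply_eps _
  rw [oddIncl_eq, map_mul, rhoHom_even, h]
  generalize rhoE k p r s a x = y
  induction y with
  | zero => simp
  | add u v hu hv => simp only [map_add, add_mul, smul_add, hu, hv]
  | tmul u v =>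
    rw [LinearMap.lTensor_tmul, LinearMap.lTensor_tmul, Algebra.TensorProduct.tmul_mul_tmul,
      ← oddIncl_eq, TensorProduct.smul_tmul', smul_eq_mul, mul_comm]

theorem conv_tmul {C D : Type*} [Ring C] [Algebra k C] [Ring D] [Algebra k D]
    (g : C →ₗ[k] A ⊗[k] D) (u v : C) : conv g (u ⊗ₜ v) =
    (LinearMap.mul' k A).rTensor (D ⊗[k] D)
      (TensorProduct.tensorTensorTensorComm k A D A D (g u ⊗ₜ g v)) := rfl

theorem conv_maps {E F : Type*} [AddCommGroup E] [Module k E] [AddCommGroup F] [Module k F]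
    (f f' : E →ₗ[k] F) (x z : A ⊗[k] E) :
    (LinearMap.mul' k A).rTensor (F ⊗[k] F)
      (TensorProduct.tensorTensorTensorComm k A F A F (f.lTensor A x ⊗ₜ f'.lTensor A z)) =
    (TensorProduct.map f f').lTensor A ((LinearMap.mul' k A).rTensor (E ⊗[k] E)
      (TensorProduct.tensorTensorTensorComm k A E A E (x ⊗ₜ z))) := by
  induction x with
  | zero => simp
  | add a b ha hb => simp only [TensorProduct.add_tmul, map_add, ha, hb]
  | tmul a d =>
    induction z with
    | zero => simp
    | add a b ha hb => simp only [TensorProduct.tmul_add, map_add, ha, hb]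
    | tmul b e => simp

theorem conv_smul {F : Type*} [AddCommGroup F] [Module k F] (a b : A) (x z : A ⊗[k] F) :
    (LinearMap.mul' k A).rTensor (F ⊗[k] F)
      (TensorProduct.tensorTensorTensorComm k A F A F ((a • x) ⊗ₜ (b • z))) =
    (a * b) • (LinearMap.mul' k A).rTensor (F ⊗[k] F)
      (TensorProduct.tensorTensorTensorComm k A F A F (x ⊗ₜ z)) := by
  induction x with
  | zero => simp
  | add u v hu hv => simp only [smul_add, TensorProduct.add_tmul, map_add, hu, hv]
  | tmul u d =>
    induction z with
    | zero => simp
    | add u v hu hv => simp only [smul_add, TensorProduct.tmul_add, map_add, hu, hv]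
    | tmul v e => simp [TensorProduct.smul_tmul', mul_mul_mul_comm]

/-- `conv` as an algebra homomorphism. -/
def convHom {E : Type*} [CommRing E] [Algebra k E] (g : E →ₐ[k] A ⊗[k] E) :
    E ⊗[k] E →ₐ[k] A ⊗[k] (E ⊗[k] E) :=
  ((Algebra.TensorProduct.map (Algebra.TensorProduct.lmul' k (S := A)) (AlgHom.id k (E ⊗[k] E))).comp
    (Algebra.TensorProduct.tensorTensorTensorComm k k k k A E A E).toAlgHom).comp
    (Algebra.TensorProduct.map g g)

theorem convHom_apply {E : Type*} [CommRing E] [Algebra k E] (g : E →ₐ[k] A ⊗[k] E)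
    (y : E ⊗[k] E) : convHom g y = conv g.toLinearMap y := rfl

theorem rhoE_comul (a : A) (x : MEven k p r s) :
    (comulE k p r s).toLinearMap.lTensor A (rhoE k p r s a x) =
      conv (rhoE k p r s a).toLinearMap (comulE k p r s x) := by
  have h : (Algebra.TensorProduct.map (AlgHom.id k A) (comulE k p r s)).comp (rhoE k p r s a) =
      (convHom (rhoE k p r s a)).comp (comulE k p r s) := by
    refine MEven.algHom_ext k p r s ?_ ?_
    · rw [AlgHom.comp_apply, AlgHom.comp_apply, rhoE_theta, comulE_theta, map_add, convHom_apply,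
        convHom_apply, conv_tmul, conv_tmul]
      simp [rhoE_theta, comulE_theta, TensorProduct.tmul_add, Algebra.TensorProduct.one_def]
    · intro i hi
      rw [AlgHom.comp_apply, AlgHom.comp_apply, rhoE_sigma, comulE_sigma, if_pos hi,
        Algebra.TensorProduct.map_tmul, comulE_sigma, if_pos hi, sigmaSum, map_sum,
        TensorProduct.tmul_sum]
      refine Finset.sum_congr rfl fun q hq => ?_
      rw [convHom_apply, conv_tmul]
      have := Finset.HasAntidiagonal.mem_antidiagonal.mp hq
      simp [rhoE_sigma, ← pow_add, ← add_mul, this]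
  exact DFunLike.congr_fun h x

theorem rhoE_counit (a : A) (x : MEven k p r s) :
    (counitE k p r s).toLinearMap.lTensor A (rhoE k p r s a x) = 1 ⊗ₜ counitE k p r s x := by
  have h : (Algebra.TensorProduct.map (AlgHom.id k A) (counitE k p r s)).comp (rhoE k p r s a) =
      Algebra.TensorProduct.includeRight.comp (counitE k p r s) := by
    refine MEven.algHom_ext k p r s ?_ ?_
    · simp [rhoE_theta, counitE_theta]
    · intro i hi
      simp only [AlgHom.comp_apply, rhoE_sigma, Algebra.TensorProduct.map_tmul, counitE_sigma,
        Algebra.TensorProduct.includeRight_apply, AlgHom.id_apply]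
      split_ifs with h
      · rw [h, zero_mul, pow_zero]
      · simp
  exact DFunLike.congr_fun h x

theorem rhoE_delta (hr : r ≠ 0) (a : A) (x : MEven k p r s) :
    (delta k p r s).lTensor A (rhoE k p r s a x) =
      a ^ p ^ r • rhoE k p r s a (delta k p r s x) := by
  have hmul : ∀ y z : A ⊗[k] MEven k p r s, (delta k p r s).lTensor A (y * z) =
      y * (delta k p r s).lTensor A z + (delta k p r s).lTensor A y * z := by
    intro y z
    induction y with
    | zero => simp
    | add a b ha hb => simp only [add_mul, map_add, ha, hb]; abel
    | tmul a b =>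
      induction z with
      | zero => simp
      | add u v hu hv => simp only [mul_add, map_add, hu, hv]; abel
      | tmul c d => simp [delta_mul, TensorProduct.tmul_add]
  induction x using MEven.induction with
  | algebraMap c =>
    rw [delta_algebraMap, map_zero, smul_zero, AlgHom.commutes,
      Algebra.TensorProduct.algebraMap_apply, LinearMap.lTensor_tmul, delta_one,
      TensorProduct.tmul_zero]
  | add x y hx hy => simp only [map_add, smul_add, hx, hy]
  | theta x hx =>
    rw [map_mul, hmul, delta_mul, hx, rhoE_theta, LinearMap.lTensor_tmul, delta_theta]
    simp [rhoE_theta]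
  | sigma x i hx =>
    by_cases hi : i < p ^ s
    · rw [map_mul, hmul, delta_mul, hx, map_add, map_mul, map_mul, smul_add, smul_mul_assoc,
        rhoE_sigma, LinearMap.lTensor_tmul, delta_sigma _ _ _ _ _ hi, ← mul_smul_comm]
      congr 2
      unfold sigmaShift
      split_ifs with h
      · obtain ⟨i, rfl⟩ := Nat.exists_eq_add_of_le h
        obtain ⟨r, rfl⟩ := Nat.exists_eq_succ_of_ne_zero hr
        rw [Nat.add_sub_cancel_left, rhoE_sigma, ← mul_smul_comm, TensorProduct.smul_tmul',
          smul_eq_mul, ← pow_add]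
        congr 3
        simp [pow_succ', add_mul]
      · simp
    · rw [sigmaE_trunc k p r s i (by omega)]; simp

theorem lTensor_smul' {E F : Type*} [AddCommGroup E] [Module k E] [AddCommGroup F] [Module k F]
    (f : E →ₗ[k] F) (a : A) (x : A ⊗[k] E) : f.lTensor A (a • x) = a • f.lTensor A x :=
  (f.baseChange A).map_smul a x

theorem conv_rho_ee (a μ : A) (w : MEven k p r s ⊗[k] MEven k p r s) :
    conv (rhoHom k p r s a μ).toLinearMap
      (TensorProduct.map (evenIncl k p r s) (evenIncl k p r s) w) =
    (TensorProduct.map (evenIncl k p r s) (evenIncl k p r s)).lTensor A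
      (conv (rhoE k p r s a).toLinearMap w) := by
  induction w with
  | zero => simp
  | add u v hu hv => simp only [map_add, hu, hv]
  | tmul u v =>
    rw [TensorProduct.map_tmul, conv_tmul, conv_tmul, ← conv_maps, AlgHom.toLinearMap_apply,
      AlgHom.toLinearMap_apply, rhoHom_even, rhoHom_even]; rfl

theorem conv_rho_oo (a μ : A) (w : MEven k p r s ⊗[k] MEven k p r s) :
    conv (rhoHom k p r s a μ).toLinearMap
      (TensorProduct.map (oddIncl k p r s) (oddIncl k p r s) w) =
    (μ * μ) • (TensorProduct.map (oddIncl k p r s) (oddIncl k p r s)).lTensor A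
      (conv (rhoE k p r s a).toLinearMap w) := by
  induction w with
  | zero => simp
  | add u v hu hv => simp only [map_add, smul_add, hu, hv]
  | tmul u v =>
    rw [TensorProduct.map_tmul, conv_tmul, conv_tmul, ← conv_maps, AlgHom.toLinearMap_apply,
      AlgHom.toLinearMap_apply, rhoHom_odd, rhoHom_odd, conv_smul]; rfl

theorem conv_rho_oe (a μ : A) (w : MEven k p r s ⊗[k] MEven k p r s) :
    conv (rhoHom k p r s a μ).toLinearMap
      (TensorProduct.map (oddIncl k p r s) (evenIncl k p r s) w) =
    μ • (TensorProduct.map (oddIncl k p r s) (evenIncl k p r s)).lTensor A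
      (conv (rhoE k p r s a).toLinearMap w) := by
  induction w with
  | zero => simp
  | add u v hu hv => simp only [map_add, smul_add, hu, hv]
  | tmul u v =>
    rw [TensorProduct.map_tmul, conv_tmul, conv_tmul, ← conv_maps, AlgHom.toLinearMap_apply,
      AlgHom.toLinearMap_apply, rhoHom_odd, rhoHom_even]
    have := conv_smul μ 1 ((oddIncl k p r s).lTensor A (rhoE k p r s a u))
      ((evenIncl k p r s).lTensor A (rhoE k p r s a v))
    rw [one_smul, mul_one] at this
    exact this

theorem conv_rho_eo (a μ : A) (w : MEven k p r s ⊗[k] MEven k p r s) :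
    conv (rhoHom k p r s a μ).toLinearMap
      (TensorProduct.map (evenIncl k p r s) (oddIncl k p r s) w) =
    μ • (TensorProduct.map (evenIncl k p r s) (oddIncl k p r s)).lTensor A
      (conv (rhoE k p r s a).toLinearMap w) := by
  induction w with
  | zero => simp
  | add u v hu hv => simp only [map_add, smul_add, hu, hv]
  | tmul u v =>
    rw [TensorProduct.map_tmul, conv_tmul, conv_tmul, ← conv_maps, AlgHom.toLinearMap_apply,
      AlgHom.toLinearMap_apply, rhoHom_odd, rhoHom_even]
    have := conv_smul 1 μ ((evenIncl k p r s).lTensor A (rhoE k p r s a u))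
      ((oddIncl k p r s).lTensor A (rhoE k p r s a v))
    rw [one_smul, one_mul] at this
    exact this

theorem lTensor_mComul_even (y : A ⊗[k] MEven k p r s) :
    (mComul k p r s).lTensor A ((evenIncl k p r s).lTensor A y) =
    (TensorProduct.map (evenIncl k p r s) (evenIncl k p r s)).lTensor A
      ((comulE k p r s).toLinearMap.lTensor A y) +
    (TensorProduct.map (oddIncl k p r s) (oddIncl k p r s)).lTensor A
      ((comulE k p r s).toLinearMap.lTensor A ((delta k p r s).lTensor A y)) := by
  induction y with
  | zero => simp
  | add a b ha hb => simp only [map_add, ha, hb]; abel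
  | tmul a b => simp [mComul_even, TensorProduct.tmul_add]

theorem lTensor_mComul_odd (y : A ⊗[k] MEven k p r s) :
    (mComul k p r s).lTensor A ((oddIncl k p r s).lTensor A y) =
    (TensorProduct.map (oddIncl k p r s) (evenIncl k p r s)).lTensor A
      ((comulE k p r s).toLinearMap.lTensor A y) +
    (TensorProduct.map (evenIncl k p r s) (oddIncl k p r s)).lTensor A
      ((comulE k p r s).toLinearMap.lTensor A y) := by
  induction y with
  | zero => simp
  | add a b ha hb => simp only [map_add, ha, hb]; abel
  | tmul a b => simp [mComul_odd, TensorProduct.tmul_add]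

theorem isPoint_rho (hr : r ≠ 0) (a μ : A) (h : a ^ p ^ r = μ ^ 2) :
    IsPoint (mParity k p r s) (mParity k p r s) (rhoHom k p r s a μ) where
  counit c := by
    change (mCounit k p r s).lTensor A _ = 1 ⊗ₜ mCounit k p r s c
    rw [← even_add_odd k p r s c, map_add, map_add, map_add, rhoHom_even, rhoHom_odd,
      mCounit_even, mCounit_odd, add_zero, lTensor_smul', ← LinearMap.comp_apply,
      ← LinearMap.comp_apply, ← LinearMap.lTensor_comp, ← LinearMap.lTensor_comp,
      mCounit_comp_odd, mCounit_comp_even, rhoE_counit]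
    simp
  comul c := by
    change (mComul k p r s).lTensor A _ = conv _ (mComul k p r s c)
    rw [← even_add_odd k p r s c]
    simp only [map_add]
    congr 1
    · rw [rhoHom_even, lTensor_mComul_even, mComul_even, map_add, conv_rho_ee, conv_rho_oo,
        rhoE_delta hr, lTensor_smul', lTensor_smul', rhoE_comul, rhoE_comul, h, sq]
    · rw [rhoHom_odd, lTensor_smul', lTensor_mComul_odd, mComul_odd, map_add, conv_rho_oe,
        conv_rho_eo, rhoE_comul, smul_add]
  even i c hc := by
    fin_cases i
    · have hc' : oddProj k p r s c = 0 := hc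
      rw [← even_add_odd k p r s c, hc', map_zero, add_zero, rhoHom_even]
      generalize rhoE k p r s a _ = y
      induction y with
      | zero => simp
      | add u v hu hv => rw [map_add]; exact add_mem hu hv
      | tmul u v =>
        exact Submodule.tmul_mem_baseChange_of_mem u (show _ ∈ mParity k p r s 0 from rfl)
    · have hc' : evenProj k p r s c = 0 := hc
      rw [← even_add_odd k p r s c, hc', map_zero, zero_add, rhoHom_odd]
      refine Submodule.smul_mem _ _ ?_
      generalize rhoE k p r s a _ = y
      induction y with
      | zero => simp
      | add u v hu hv => rw [map_add]; exact add_mem hu hv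
      | tmul u v =>
        exact Submodule.tmul_mem_baseChange_of_mem u (show _ ∈ mParity k p r s 1 from rfl)

variable (s) in
/-- The endomorphism `ρ_{(μ,a)}` of `M_{r;s} ⊗ A` for `a ^ (p ^ r) = μ ^ 2`, with comorphism
`τ ↦ μ τ`, `θ ↦ a θ`, `σ_i ↦ a ^ (i p ^ (r - 1)) σ_i`. -/
def rho (hr : r ≠ 0) (a μ : A) (h : a ^ p ^ r = μ ^ 2) :
    SHom A (mParity k p r s) (mParity k p r s) :=
  SHom.ofPoint (rhoHom k p r s a μ) (isPoint_rho hr a μ h)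

theorem rho_tau (hr : r ≠ 0) (a μ : A) (h : a ^ p ^ r = μ ^ 2) :
    (rho (k := k) s hr a μ h).toHom (1 ⊗ₜ tau k p r s) = μ ⊗ₜ tau k p r s :=
  (SHom.point_ofPoint _ (isPoint_rho hr a μ h) _).trans (DualNumber.lift_apply_eps _)

theorem rho_theta (hr : r ≠ 0) (a μ : A) (h : a ^ p ^ r = μ ^ 2) :
    (rho (k := k) s hr a μ h).toHom (1 ⊗ₜ theta k p r s) = a ⊗ₜ theta k p r s := by
  refine (SHom.point_ofPoint _ (isPoint_rho hr a μ h) _).trans ?_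
  rw [theta, rhoHom_even, rhoE_theta, LinearMap.lTensor_tmul]

theorem rho_sigma (hr : r ≠ 0) (a μ : A) (h : a ^ p ^ r = μ ^ 2) (i : ℕ) :
    (rho (k := k) s hr a μ h).toHom (1 ⊗ₜ sigma k p r s i) =
      (a ^ (i * p ^ (r - 1))) ⊗ₜ sigma k p r s i := by
  refine (SHom.point_ofPoint _ (isPoint_rho hr a μ h) _).trans ?_
  rw [sigma, rhoHom_even, rhoE_sigma, LinearMap.lTensor_tmul]

end Rho

section EvenScheme

/-!
### The scheme `V_{r;s}(G)`, its coordinate algebra and the grading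
-/

variable {k : Type*} [Field k] {C : Type*} [Ring C] [Algebra k C] [Coalgebra k C]
  (p : ℕ) [Fact p.Prime] [CharP k p] (r s : ℕ) (𝒞 : ZMod 2 → Submodule k C)

/-- The coordinate algebra `A_G = k[V_{r;s}(G)]`, where `C = k[G]`. -/
abbrev VRing := CoordRing 𝒞 (mParity k p r s)

variable (k) in
/-- The algebra `B = k[x, y] / (x ^ (p ^ r) - y ^ 2)`. -/
def BAlg := MvPolynomial (Fin 2) k ⧸
  Ideal.span {(MvPolynomial.X 0 ^ p ^ r - MvPolynomial.X 1 ^ 2 : MvPolynomial (Fin 2) k)}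

instance : CommRing (BAlg k p r) :=
  inferInstanceAs (CommRing (MvPolynomial (Fin 2) k ⧸
    Ideal.span {(MvPolynomial.X 0 ^ p ^ r - MvPolynomial.X 1 ^ 2 : MvPolynomial (Fin 2) k)}))

instance : Algebra k (BAlg k p r) :=
  inferInstanceAs (Algebra k (MvPolynomial (Fin 2) k ⧸
    Ideal.span {(MvPolynomial.X 0 ^ p ^ r - MvPolynomial.X 1 ^ 2 : MvPolynomial (Fin 2) k)}))

variable (k) in
/-- `x ∈ B` -/
def bX : BAlg k p r := Ideal.Quotient.mk _ (MvPolynomial.X 0)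

variable (k) in
/-- `y ∈ B` -/
def bY : BAlg k p r := Ideal.Quotient.mk _ (MvPolynomial.X 1)

theorem bX_pow : bX k p r ^ p ^ r = bY k p r ^ 2 :=
  Ideal.Quotient.eq.mpr (Ideal.subset_span rfl)

theorem tmul_bX_pow {A : Type*} [CommRing A] [Algebra k A] :
    ((1 : A) ⊗ₜ[k] bX k p r) ^ p ^ r = ((1 : A) ⊗ₜ[k] bY k p r) ^ 2 := by
  rw [Algebra.TensorProduct.tmul_pow, Algebra.TensorProduct.tmul_pow, one_pow, one_pow, bX_pow]

/-- The comorphism of the right action of the monoid `Spec B` on `V_{r;s}(G)`,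
`(u, (μ, a)) ↦ u ∘ ρ_{(μ,a)}`: over `A_G ⊗ B` it is the composite of the universal homomorphism
with `ρ_{(1 ⊗ y, 1 ⊗ x)}`. -/
def coaction [NeZero r] : VRing p r s 𝒞 →ₐ[k] VRing p r s 𝒞 ⊗[k] BAlg k p r :=
  coordLift ((rho s (NeZero.ne r) (1 ⊗ₜ bX k p r) (1 ⊗ₜ bY k p r) (tmul_bX_pow p r)).comp
    ((universalHom 𝒞 (mParity k p r s)).map Algebra.TensorProduct.includeLeft))

/-- The space of all `a` with `f*(a) = a ⊗ x ^ i y ^ e`, where `f*` is the coaction. -/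
def weightSpace [NeZero r] (i e : ℕ) : Submodule k (VRing p r s 𝒞) :=
  LinearMap.eqLocus (coaction p r s 𝒞).toLinearMap
    ((TensorProduct.mk k (VRing p r s 𝒞) (BAlg k p r)).flip (bX k p r ^ i * bY k p r ^ e))

theorem mem_weightSpace [NeZero r] (i e : ℕ) (a : VRing p r s 𝒞) :
    a ∈ weightSpace p r s 𝒞 i e ↔
      coaction p r s 𝒞 a = a ⊗ₜ (bX k p r ^ i * bY k p r ^ e) := Iff.rfl

/-- The ring `ℤ[p^r/2] ⊆ ℚ`. -/
abbrev HalfInt := Algebra.adjoin ℤ {((p : ℚ) ^ r / 2)}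

/-- The element `p^r/2`. -/
def halfPow : HalfInt p r := ⟨(p : ℚ) ^ r / 2, Algebra.subset_adjoin rfl⟩

/-- The component of degree `d` of `k[V_{r;s}(G)]`: the space of all `a` with `f*(a) = a ⊗ x ^ i` if
`d = i`, and with `f*(a) = a ⊗ x ^ i y` if `d = i + p^r/2`, where `i` is a natural number; all other
components are zero. -/
def vPiece [NeZero r] (d : HalfInt p r) : Submodule k (VRing p r s 𝒞) :=
  ⨆ (i : ℕ) (e : Fin 2) (_ : (i : HalfInt p r) + (e : ℕ) • halfPow p r = d),
    weightSpace p r s 𝒞 i e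

end EvenScheme

section CohomologyGrading

/-!
### The algebra `H(G, k)`
-/

variable {k : Type*} [Field k] {C : Type*} [Ring C] [Algebra k C] [Coalgebra k C]
  (𝒞 : ZMod 2 → Submodule k C)

/-- The space of `n`-cochains of internal degree `i`. -/
def cochainPart (n : ℕ) (i : ZMod 2) : Submodule k (Cochains k C) :=
  Submodule.span k {t | ∃ (c : Fin n → C) (e : Fin n → ZMod 2),
    (∀ j, c j ∈ 𝒞 (e j)) ∧ ∑ j, e j = i ∧ t = TensorAlgebra.tprod k C n c}

/-- The part `Hⁿ(G, k)_i` of cohomological degree `n` and internal degree `i`. -/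
def cohPart (n : ℕ) (i : ZMod 2) : Submodule k (Coh k C) :=
  ((cochainPart 𝒞 n i).comap (cocycles k C).val.toLinearMap).map (cocycleClass k C).toLinearMap

theorem cochainPart_mul {n m : ℕ} {i j : ZMod 2} {a b : Cochains k C}
    (ha : a ∈ cochainPart 𝒞 n i) (hb : b ∈ cochainPart 𝒞 m j) :
    a * b ∈ cochainPart 𝒞 (n + m) (i + j) := by
  have h := Submodule.mul_mem_mul ha hb
  refine (Submodule.mul_le.mpr ?_ :
    cochainPart 𝒞 n i * cochainPart 𝒞 m j ≤ cochainPart 𝒞 (n + m) (i + j)) h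
  clear h ha hb a b
  intro a ha b hb
  have h := Submodule.mul_mem_mul ha hb
  rw [cochainPart, cochainPart, Submodule.span_mul_span] at h
  refine Submodule.span_mono ?_ h
  rintro _ ⟨_, ⟨c, e, hc, rfl, rfl⟩, _, ⟨c', e', hc', rfl, rfl⟩, rfl⟩
  refine ⟨Fin.append c c', Fin.append e e', ?_, ?_, ?_⟩
  · intro j
    induction j using Fin.addCases with
    | left j => simpa using hc j
    | right j => simpa using hc' j
  · simp [Fin.sum_univ_add]
  · simp only [TensorAlgebra.tprod_apply]
    rw [← List.prod_append, ← List.ofFn_fin_append]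
    congr 2
    funext j
    induction j using Fin.addCases with
    | left j => simp
    | right j => simp

theorem one_mem_cochainPart : (1 : Cochains k C) ∈ cochainPart 𝒞 0 0 :=
  Submodule.subset_span ⟨Fin.elim0, Fin.elim0, fun j => j.elim0, by simp, by simp⟩

theorem cohPart_mul {n m : ℕ} {i j : ZMod 2} {a b : Coh k C}
    (ha : a ∈ cohPart 𝒞 n i) (hb : b ∈ cohPart 𝒞 m j) : a * b ∈ cohPart 𝒞 (n + m) (i + j) := by
  obtain ⟨x, hx, rfl⟩ := ha
  obtain ⟨y, hy, rfl⟩ := hb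
  exact ⟨x * y, cochainPart_mul 𝒞 hx hy, map_mul (cocycleClass k C) x y⟩

/-- The subalgebra `H(G, k) = H^ev(G, k)_0 ⊕ H^odd(G, k)_1` of `H^•(G, k)`, that is, the sum of the
parts `Hⁿ(G, k)_i` with `i = n mod 2`. -/
def evenCoh : Subalgebra k (Coh k C) :=
  (⨆ n : ℕ, cohPart 𝒞 n n).toSubalgebra
    (Submodule.mem_iSup_of_mem 0 ⟨1, by simpa using one_mem_cochainPart 𝒞, map_one (cocycleClass k C)⟩)
    (by
      intro a b ha hb
      have h := Submodule.mul_mem_mul ha hb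
      rw [Submodule.iSup_mul] at h
      refine Set.mem_of_subset_of_mem (SetLike.coe_subset_coe.mpr (iSup_le fun n => ?_)) h
      rw [Submodule.mul_iSup]
      refine iSup_le fun m => ?_
      refine le_trans ?_ (le_iSup (fun n : ℕ => cohPart 𝒞 n n) (n + m))
      refine Submodule.mul_le.mpr fun a ha b hb => ?_
      rw [Nat.cast_add]
      exact cohPart_mul 𝒞 ha hb)

/-- The component of cohomological degree `n` of `H(G, k)`. -/
def evenCohPart (n : ℕ) : Submodule k (evenCoh 𝒞) :=
  (cohPart 𝒞 n n).comap (evenCoh 𝒞).val.toLinearMap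

end CohomologyGrading

section Psi

/-!
### The homomorphism `ψ_{r;s}`
-/

variable (k : Type*) [Field k] (p : ℕ) [Fact p.Prime] [CharP k p] (r s : ℕ)

/-- The cochain `Σ_j (p-1)!/(j!(p-j)!) (θ ^ (p ^ (i-1))) ^ j ⊗ (θ ^ (p ^ (i-1))) ^ (p-j)` for `x_i`. -/
def xCochain (i : ℕ) : Cochains k (MAlg k p r s) :=
  ∑ j ∈ Finset.Ico 1 p,
    (((p - 1).factorial : k) / ((j.factorial : k) * ((p - j).factorial : k))) •
      (inj k (MAlg k p r s) ((theta k p r s ^ p ^ (i - 1)) ^ j) *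
        inj k (MAlg k p r s) ((theta k p r s ^ p ^ (i - 1)) ^ (p - j)))

/-- The cochain `θ ^ (p ^ (i-1))` for `λ_i`. -/
def lambdaCochain (i : ℕ) : Cochains k (MAlg k p r s) :=
  inj k (MAlg k p r s) (theta k p r s ^ p ^ (i - 1))

/-- The cochain `τ` for `y`. -/
def yCochain : Cochains k (MAlg k p r s) := inj k (MAlg k p r s) (tau k p r s)

/-- The cochain `-(Σ_{0<j<p^s} σ_j ⊗ σ_{p^s-j} + Σ_{u+v+p=p^s} σ_u τ ⊗ σ_v τ)` for `w_s`. -/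
def wCochain : Cochains k (MAlg k p r s) :=
  -(∑ j ∈ Finset.Ico 1 (p ^ s),
      inj k (MAlg k p r s) (sigma k p r s j) * inj k (MAlg k p r s) (sigma k p r s (p ^ s - j)) +
    ∑ q ∈ Finset.HasAntidiagonal.antidiagonal (p ^ s - p),
      inj k (MAlg k p r s) (sigma k p r s q.1 * tau k p r s) *
        inj k (MAlg k p r s) (sigma k p r s q.2 * tau k p r s))

variable {k p r s}

/-- `ε [z] = a`: the cochain `z` is a cocycle and `ε` maps its class to `a`. -/
def HasValue (ε : Coh k (MAlg k p r s) →ₐ[k] k) (z : Cochains k (MAlg k p r s)) (a : k) : Prop :=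
  ∃ h : z ∈ cocycles k (MAlg k p r s), ε (cocycleClass k (MAlg k p r s) ⟨z, h⟩) = a

/-- `ε : H(M_{r;s}, k) → k` maps the generators `y` and `x_r` to `1` and all other generators to
`0`. The generators are `x_1, …, x_r`, `λ_1, …, λ_r`, `y`, and, if `s ≥ 2`, also `w_s`. -/
structure IsEps (ε : Coh k (MAlg k p r s) →ₐ[k] k) : Prop where
  y : HasValue ε (yCochain k p r s) 1
  x_top : HasValue ε (xCochain k p r s r) 1
  x : ∀ i, 1 ≤ i → i < r → HasValue ε (xCochain k p r s i) 0
  lam : ∀ i, 1 ≤ i → i ≤ r → HasValue ε (lambdaCochain k p r s i) 0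
  w : 2 ≤ s → HasValue ε (wCochain k p r s) 0

variable {C : Type*} [Ring C] [Algebra k C] [Coalgebra k C] (𝒞 : ZMod 2 → Submodule k C)

/-- The homomorphism `ψ_{r;s}`: the composite of `H(G, k) ⊆ H^•(G, k) → H^•(G ⊗ A_G, A_G)`, the map
induced by the universal homomorphism `u_G`, and `ε ⊗ A_G`. -/
def psi (ε : Coh k (MAlg k p r s) →ₐ[k] k) : evenCoh 𝒞 →ₐ[k] VRing p r s 𝒞 :=
  (((extendAug (VRing p r s 𝒞) (comul_one k p r s) ε).restrictScalars k).comp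
    ((cohMap (universalHom 𝒞 (mParity k p r s)).toHom).restrictScalars k)).comp
    ((cohBase k (VRing p r s 𝒞) C).comp (evenCoh 𝒞).val)

end Psi

end SuperCoh

end

/-!
Write `M` for the coordinate algebra of `M_{r;s}`, with even part `E` and `M = E ⊕ E τ`, and `Ω(C)` for
the Hochschild complex of `C`, a tensor algebra.

*Generators.* The complex `Ω(M) ⊗ M` of left `Ω(M)`-modules (`resDiff`) is contractible onto `k`.
Consider the chain of subcomodules
`M ⊃ ⟨θ ^ i, θ ^ i τ⟩ ⊃ ⟨θ ^ i⟩ ⊃ ⟨θ ^ i | i < p ^ (r - 2)⟩ ⊃ … ⊃ ⟨1⟩`. Each member `N'` is, inside its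
predecessor `N`, the kernel of a comodule map `D : N → N` whose cokernel is again `N'`
(`PeriodicStep`). A diagram chase with `0 → N' → N → N → N' → 0` shows that the cocycles with
coefficients in `N'` are generated by those with coefficients in `N` and by one class of degree one and
one of degree two (`PeriodicStep.cocyclesGenerated`). These are `λ_r`, `w` for the first step, `y`,
`y ^ 2` for the second, and `λ_i`, `x_i` for the others. The classes of degree two come from sequences
of divided powers (`IsDividedSeq`); for `w` this is the sequence that merges `σ_j` and `σ_j τ`. At the
end of the chain all cocycles are generated by these classes (`exists_generators`), so that `ε` is
unique.

*Existence of `ε`.* For `α β = μ ^ 2` in a commutative `k`-algebra `A`, the assignment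
`σ_1 ↦ -α E₂₁`, `σ_{p-1} ↦ β E₁₂`, `τ ↦ μ (E₁₁ - E₂₂)`, zero on the other basis elements, extends to a
homomorphism `matRep α β μ : Ω(M) → Mat₂(A)` that annihilates all coboundaries. It maps the generators,
hence all cocycles, to lower triangular matrices, so that its upper left entry is a homomorphism on
cohomology (`matAug`). With `α = β = μ = 1` this entry is `ε` (`isEps_matAug`). On generators, and hence
everywhere, the entry depends on `μ` only (`matAug_eq`).

*Homogeneity of `ψ`.* For the universal homomorphism `u`, the value of `ψ` at a class is the upper left
entry of `matRep 1 1 1` after `u` (`psi_class`). The coaction composes `u` with `ρ_{(μ,a)}`, which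
replaces `(1, 1, 1)` by `(α, β, μ)` with `α β = a ^ p ^ r = μ ^ 2`. The entry is the same for
`(μ, μ, μ)`, where the linear map is `μ` times that for `(1, 1, 1)`. On a class of degree `n` the result
is multiplied by `μ ^ n` (`coaction_psi`), and in `B` the power `y ^ n` is a monomial of degree
`n p ^ r / 2`.

*Gradings.* The grading of `H(G, k)` is that of the tensor algebra, for which the differential has
degree one. For `k[V_{r;s}(G)]`, the universal property makes the coaction of `B` coassociative and
counital; `B` has a basis of grouplike elements `x ^ i y ^ e` with `e ∈ {0, 1}`, whose degrees are
distinct because `p` is odd, and whose products are again of this form because `y ^ 2 = x ^ p ^ r`.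
-/

open scoped TensorProduct

noncomputable section

namespace SuperCoh

set_option linter.unusedSectionVars false

/-! ### A basis of the even part of `k[M_{r;s}]` and contraction with functionals -/

section EvenBasis

variable (k : Type*) [Field k] (p : ℕ) [Fact p.Prime] [CharP k p] (r s : ℕ)

theorem one_lt_pow_prime [NeZero s] : 1 < p ^ s :=
  Nat.one_lt_pow (NeZero.ne s) (Fact.out : p.Prime).one_lt

theorem pow_prime_pos (n : ℕ) : 0 < p ^ n := pow_pos (Fact.out : p.Prime).pos n

/-- The homomorphism from the even part of `k[M_{r;s}]` to `k[t] / (t ^ (2 p ^ (r - 1)))` with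
`θ ↦ t`, `σ_1 ↦ t ^ (p ^ (r - 1))` and `σ_i ↦ 0` for `i ≥ 2`. -/
def truncHom [NeZero s] :
    MEven k p r s →ₐ[k] AdjoinRoot (Polynomial.X ^ (2 * p ^ (r - 1)) : Polynomial k) :=
  MEven.lift (AdjoinRoot.root _)
    (fun i => if i = 0 then 1 else if i = 1 then AdjoinRoot.root _ ^ p ^ (r - 1) else 0)
    (by simp) (by simp [one_lt_pow_prime p s])
    (fun i j => by
      have h0 : (AdjoinRoot.root (Polynomial.X ^ (2 * p ^ (r - 1)) : Polynomial k)) ^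
          p ^ (r - 1) * AdjoinRoot.root _ ^ p ^ (r - 1) = 0 := by
        rw [← pow_add, ← two_mul, ← AdjoinRoot.mk_X, ← map_pow, AdjoinRoot.mk_self]
      rcases i with _ | _ | i <;> rcases j with _ | _ | j <;> simp [h0]
      omega)

variable {k p r s} in
/-- The contraction `x ↦ Σ x₁ φ(x₂)` of the comultiplication with a functional. -/
def contract (φ : MEven k p r s →ₗ[k] k) : MEven k p r s →ₗ[k] MEven k p r s :=
  (TensorProduct.rid k (MEven k p r s)).toLinearMap ∘ₗ φ.lTensor _ ∘ₗ
    (comulE k p r s).toLinearMap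

section Contract

variable {k p r s}

theorem contract_apply (φ : MEven k p r s →ₗ[k] k) (x : MEven k p r s) :
    contract φ x = TensorProduct.rid k _ (φ.lTensor _ (comulE k p r s x)) := rfl

/-- Contractions are homomorphisms of comodules. -/
theorem comulE_contract (φ : MEven k p r s →ₗ[k] k) (x : MEven k p r s) :
    comulE k p r s (contract φ x) = (contract φ).lTensor _ (comulE k p r s x) := by
  have h1 : ∀ y : MEven k p r s ⊗[k] MEven k p r s,
      comulE k p r s (TensorProduct.rid k _ (φ.lTensor _ y)) =
        (TensorProduct.rid k _) (φ.lTensor _ ((comulE k p r s).toLinearMap.rTensor _ y)) := by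
    intro y
    induction y with
    | zero => simp
    | add a b ha hb => simp only [map_add, ha, hb]
    | tmul a b => simp
  have h2 : ∀ y : (MEven k p r s ⊗[k] MEven k p r s) ⊗[k] MEven k p r s,
      TensorProduct.rid k _ (φ.lTensor _ y) =
        ((TensorProduct.rid k _).toLinearMap ∘ₗ φ.lTensor _).lTensor _
          (TensorProduct.assoc k _ _ _ y) := by
    intro y
    induction y with
    | zero => simp
    | add a b ha hb => simp only [map_add, ha, hb]
    | tmul a b =>
      induction a with
      | zero => simp
      | add a b ha hb => simp only [TensorProduct.add_tmul, map_add, ha, hb]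
      | tmul a c => simp [TensorProduct.smul_tmul']
  rw [contract_apply, h1, h2, comulE_coassoc, ← LinearMap.comp_apply, ← LinearMap.lTensor_comp]
  rfl

theorem delta_contract (φ : MEven k p r s →ₗ[k] k) (x : MEven k p r s) :
    delta k p r s (contract φ x) = contract φ (delta k p r s x) := by
  have h1 : ∀ y : MEven k p r s ⊗[k] MEven k p r s,
      delta k p r s (TensorProduct.rid k _ (φ.lTensor _ y)) =
        (TensorProduct.rid k _) (φ.lTensor _ ((delta k p r s).rTensor _ y)) := by
    intro y
    induction y with
    | zero => simp
    | add a b ha hb => simp only [map_add, ha, hb]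
    | tmul a b => simp
  rw [contract_apply, contract_apply, h1, comulE_delta_left]

theorem comulE_theta_pow (i : ℕ) : comulE k p r s (thetaE k p r s ^ i) =
    ∑ l ∈ Finset.range (i + 1),
      (i.choose l : k) • ((thetaE k p r s ^ l) ⊗ₜ[k] (thetaE k p r s ^ (i - l))) := by
  rw [map_pow, comulE_theta, add_pow]
  refine Finset.sum_congr rfl fun l _ => ?_
  rw [Algebra.TensorProduct.tmul_pow, Algebra.TensorProduct.tmul_pow, one_pow, one_pow,
    Algebra.TensorProduct.tmul_mul_tmul, one_mul, mul_one, mul_comm, Nat.cast_smul_eq_nsmul,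
    nsmul_eq_mul]

theorem contract_theta_sigma (φ : MEven k p r s →ₗ[k] k) (i j : ℕ) (hj : j < p ^ s) :
    contract φ (thetaE k p r s ^ i * sigmaE k p r s j) =
      ∑ l ∈ Finset.range (i + 1), ∑ q ∈ Finset.HasAntidiagonal.antidiagonal j,
        ((i.choose l : k) * φ (thetaE k p r s ^ (i - l) * sigmaE k p r s q.2)) •
          (thetaE k p r s ^ l * sigmaE k p r s q.1) := by
  rw [contract_apply, map_mul, comulE_theta_pow, comulE_sigma, if_pos hj, sigmaSum, Finset.sum_mul_sum]
  simp [smul_smul]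

theorem contract_theta (φ : MEven k p r s →ₗ[k] k) (i : ℕ) :
    contract φ (thetaE k p r s ^ i) =
      ∑ l ∈ Finset.range (i + 1),
        ((i.choose l : k) * φ (thetaE k p r s ^ (i - l))) • thetaE k p r s ^ l := by
  have h := contract_theta_sigma φ i 0 (pow_prime_pos p s)
  simpa [sigmaE_zero] using h

end Contract

variable [NeZero s]

/-- The functional that takes the coefficient of `t ^ m` after `truncHom`. -/
def phi (m : ℕ) : MEven k p r s →ₗ[k] k :=
  Polynomial.lcoeff k m ∘ₗ
    AdjoinRoot.modByMonicHom (Polynomial.monic_X_pow (2 * p ^ (r - 1))) ∘ₗ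
      (truncHom k p r s).toLinearMap

theorem modByMonicHom_root_pow (n i : ℕ) (h : i < n) :
    AdjoinRoot.modByMonicHom (Polynomial.monic_X_pow (R := k) n) (AdjoinRoot.root _ ^ i) =
      Polynomial.X ^ i := by
  rw [← AdjoinRoot.mk_X, ← map_pow, AdjoinRoot.modByMonicHom_mk,
    (Polynomial.modByMonic_eq_self_iff (Polynomial.monic_X_pow n))]
  rw [Polynomial.degree_X_pow, Polynomial.degree_X_pow]
  exact_mod_cast h

theorem truncHom_theta : truncHom k p r s (thetaE k p r s) = AdjoinRoot.root _ :=
  MEven.lift_theta ..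

theorem truncHom_sigma (j : ℕ) : truncHom k p r s (sigmaE k p r s j) =
    if j = 0 then 1 else if j = 1 then AdjoinRoot.root _ ^ p ^ (r - 1) else 0 := by
  have h1 := one_lt_pow_prime p s
  refine (MEven.lift_sigma ..).trans ?_
  split_ifs <;> first | rfl | omega

theorem phi_theta (m i : ℕ) (hi : i < 2 * p ^ (r - 1)) :
    phi k p r s m (thetaE k p r s ^ i) = if m = i then 1 else 0 := by
  simp only [phi, LinearMap.comp_apply, AlgHom.toLinearMap_apply, map_pow, truncHom_theta]
  rw [modByMonicHom_root_pow k _ i hi, Polynomial.lcoeff_apply, Polynomial.coeff_X_pow]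

theorem phi_theta_sigma (m i j : ℕ) (hi : i < p ^ (r - 1)) :
    phi k p r s m (thetaE k p r s ^ i * sigmaE k p r s j) =
      if j ≤ 1 ∧ m = i + j * p ^ (r - 1) then 1 else 0 := by
  simp only [phi, LinearMap.comp_apply, AlgHom.toLinearMap_apply, map_mul, map_pow,
    truncHom_theta, truncHom_sigma]
  rcases j with _ | _ | j
  · rw [if_pos rfl, mul_one, modByMonicHom_root_pow k _ i (by omega), Polynomial.lcoeff_apply,
      Polynomial.coeff_X_pow]
    simp
  · rw [if_neg (by omega), if_pos rfl, ← pow_add, modByMonicHom_root_pow k _ _ (by omega),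
      Polynomial.lcoeff_apply, Polynomial.coeff_X_pow]
    simp
  · simp

variable {k p r s}

theorem contract_phi_theta (m i : ℕ) (hi : i < 2 * p ^ (r - 1)) :
    contract (phi k p r s m) (thetaE k p r s ^ i) =
      (i.choose m : k) • thetaE k p r s ^ (i - m) := by
  rw [contract_theta]
  have hl : ∀ l ∈ Finset.range (i + 1),
      ((i.choose l : k) * phi k p r s m (thetaE k p r s ^ (i - l))) • thetaE k p r s ^ l =
        if m = i - l then (i.choose l : k) • thetaE k p r s ^ l else 0 := by
    intro l _
    rw [phi_theta k p r s m (i - l) (by omega)]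
    split_ifs <;> simp
  rw [Finset.sum_congr rfl hl]
  by_cases hm : m ≤ i
  · rw [Finset.sum_eq_single (i - m), if_pos (by omega), Nat.choose_symm hm]
    · intro l hl hne
      rw [Finset.mem_range] at hl
      rw [if_neg (by omega)]
    · intro h; exact absurd (Finset.mem_range.mpr (by omega)) h
  · rw [Nat.choose_eq_zero_of_lt (by omega), Nat.cast_zero, zero_smul]
    exact Finset.sum_eq_zero fun l _ => if_neg (by omega)

variable (k p r s) in
/-- The operator on the even part dual to multiplication by the dual `u` of `σ_1`:
it sends `θ ^ i σ_j` to `θ ^ i σ_{j-1}` for `i < p ^ (r - 1)`. -/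
def lowerU : MEven k p r s →ₗ[k] MEven k p r s := contract (phi k p r s (p ^ (r - 1)))

theorem lowerU_theta_sigma (i j : ℕ) (hi : i < p ^ (r - 1)) (hj : j < p ^ s) :
    lowerU k p r s (thetaE k p r s ^ i * sigmaE k p r s j) =
      if j = 0 then 0 else thetaE k p r s ^ i * sigmaE k p r s (j - 1) := by
  rw [lowerU, contract_theta_sigma _ _ _ hj, Finset.sum_comm]
  have hl : ∀ q : ℕ × ℕ, ∑ l ∈ Finset.range (i + 1),
      ((i.choose l : k) * phi k p r s (p ^ (r - 1))
        (thetaE k p r s ^ (i - l) * sigmaE k p r s q.2)) •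
          (thetaE k p r s ^ l * sigmaE k p r s q.1) =
        if q.2 = 1 then thetaE k p r s ^ i * sigmaE k p r s q.1 else 0 := by
    intro q
    rw [Finset.sum_eq_single i]
    · rw [phi_theta_sigma k p r s _ _ _ (by omega)]
      have : q.2 ≤ 1 ∧ p ^ (r - 1) = i - i + q.2 * p ^ (r - 1) ↔ q.2 = 1 := by
        constructor
        · rintro ⟨h1, h2⟩
          rcases Nat.le_one_iff_eq_zero_or_eq_one.mp h1 with h | h
          · rw [h] at h2; omega
          · exact h
        · intro h; rw [h]; omega
      simp only [this]
      split_ifs <;> simp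
    · intro l hl hne
      rw [Finset.mem_range] at hl
      rw [phi_theta_sigma k p r s _ _ _ (by omega), if_neg, mul_zero, zero_smul]
      rintro ⟨h1, h2⟩
      rcases Nat.le_one_iff_eq_zero_or_eq_one.mp h1 with h | h <;> rw [h] at h2 <;> omega
    · intro h; exact absurd (Finset.mem_range.mpr (by omega)) h
  rw [Finset.sum_congr rfl fun q _ => hl q]
  split_ifs with h0
  · refine Finset.sum_eq_zero fun q hq => if_neg ?_
    have := Finset.HasAntidiagonal.mem_antidiagonal.mp hq
    omega
  · rw [Finset.sum_eq_single (j - 1, 1)]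
    · simp
    · intro q hq hne
      have := Finset.HasAntidiagonal.mem_antidiagonal.mp hq
      refine if_neg fun h => hne (Prod.ext ?_ h)
      dsimp only; omega
    · intro h
      exact absurd (Finset.HasAntidiagonal.mem_antidiagonal.mpr (by dsimp only; omega)) h

theorem lowerU_pow_theta_sigma (n i j : ℕ) (hi : i < p ^ (r - 1)) (hj : j < p ^ s) :
    (lowerU k p r s ^ n) (thetaE k p r s ^ i * sigmaE k p r s j) =
      if n ≤ j then thetaE k p r s ^ i * sigmaE k p r s (j - n) else 0 := by
  induction n with
  | zero => simp
  | succ n ih =>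
    rw [pow_succ', Module.End.mul_apply, ih]
    split_ifs with h1 h2 h2
    · rw [lowerU_theta_sigma _ _ hi (by omega), if_neg (by omega), Nat.sub_sub]
    · rw [lowerU_theta_sigma _ _ hi (by omega), if_pos (by omega)]
    · omega
    · exact map_zero _

/-- The functionals `φ_i ∘ u ^ j` are dual to the elements `θ ^ i σ_j`. -/
theorem phi_lowerU_pow (i j l m : ℕ) (hi : i < p ^ (r - 1)) (hl : l < p ^ (r - 1))
    (hm : m < p ^ s) :
    phi k p r s i ((lowerU k p r s ^ j) (thetaE k p r s ^ l * sigmaE k p r s m)) =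
      if l = i ∧ m = j then 1 else 0 := by
  rw [lowerU_pow_theta_sigma _ _ _ hl hm]
  split_ifs with h1 h2 h2
  · rw [phi_theta_sigma k p r s _ _ _ hl, if_pos]
    obtain ⟨rfl, rfl⟩ := h2
    simp
  · rw [phi_theta_sigma k p r s _ _ _ hl, if_neg]
    rintro ⟨h3, h4⟩
    rcases Nat.le_one_iff_eq_zero_or_eq_one.mp h3 with h | h <;> rw [h] at h4 <;> omega
  · omega
  · exact map_zero _

theorem linearIndependent_theta_sigma : LinearIndependent k
    fun q : Fin (p ^ (r - 1)) × Fin (p ^ s) =>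
      thetaE k p r s ^ q.1.val * sigmaE k p r s q.2.val := by
  rw [Fintype.linearIndependent_iff]
  intro g hg q
  have h := congrArg (fun x => phi k p r s q.1 ((lowerU k p r s ^ q.2.val) x)) hg
  simp only [map_sum, map_smul, map_zero] at h
  rw [Finset.sum_eq_single q] at h
  · rwa [phi_lowerU_pow _ _ _ _ q.1.2 q.1.2 q.2.2, if_pos ⟨rfl, rfl⟩, smul_eq_mul, mul_one] at h
  · intro q' _ hne
    rw [phi_lowerU_pow _ _ _ _ q.1.2 q'.1.2 q'.2.2, if_neg, smul_zero]
    rintro ⟨h1, h2⟩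
    exact hne (Prod.ext (Fin.ext h1) (Fin.ext h2))
  · simp

variable (k p r s) in
/-- The elements `θ ^ i σ_j` with `i < p ^ (r - 1)` and `j < p ^ s` are a basis of the even part. -/
def evenBasis : Module.Basis (Fin (p ^ (r - 1)) × Fin (p ^ s)) k (MEven k p r s) :=
  Module.Basis.mk linearIndependent_theta_sigma (span_MEven k p r s).ge

theorem evenBasis_apply (q : Fin (p ^ (r - 1)) × Fin (p ^ s)) :
    evenBasis k p r s q = thetaE k p r s ^ q.1.val * sigmaE k p r s q.2.val :=
  Module.Basis.mk_apply ..

variable (k p r s) in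
/-- The linear map on the even part with `θ ^ i σ_j ↦ f i j` for `i < p ^ (r - 1)`, `j < p ^ s`. -/
def evenConstr (f : ℕ → ℕ → MEven k p r s) : MEven k p r s →ₗ[k] MEven k p r s :=
  (evenBasis k p r s).constr k fun q => f q.1 q.2

theorem evenConstr_apply (f : ℕ → ℕ → MEven k p r s) (i j : ℕ) (hi : i < p ^ (r - 1))
    (hj : j < p ^ s) :
    evenConstr k p r s f (thetaE k p r s ^ i * sigmaE k p r s j) = f i j := by
  have h := (evenBasis k p r s).constr_basis k (fun q => f q.1 q.2) (⟨i, hi⟩, ⟨j, hj⟩)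
  rwa [evenBasis_apply] at h

theorem even_linear_ext {N : Type*} [AddCommGroup N] [Module k N] {f g : MEven k p r s →ₗ[k] N}
    (h : ∀ i j, i < p ^ (r - 1) → j < p ^ s →
      f (thetaE k p r s ^ i * sigmaE k p r s j) = g (thetaE k p r s ^ i * sigmaE k p r s j)) :
    f = g :=
  (evenBasis k p r s).ext fun q => by rw [evenBasis_apply]; exact h _ _ q.1.2 q.2.2

end EvenBasis

/-! ### The cobar resolution -/

section Resolution

variable (k : Type*) [Field k] (C : Type*) [Ring C] [Algebra k C] [Coalgebra k C]

/-- The endomorphism `(a, y) ↦ (a c, a ⊗ c)`. -/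
def snocStep (c : C) : Module.End k (Cochains k C × Cochains k C ⊗[k] C) :=
  (LinearMap.mulRight k (inj k C c) ∘ₗ LinearMap.fst k _ _).prod
    ((TensorProduct.mk k (Cochains k C) C).flip c ∘ₗ LinearMap.fst k _ _)

/-- The right action of the tensor algebra given by `snocStep`. -/
def snocAction : Cochains k C →ₐ[k] (Module.End k (Cochains k C × Cochains k C ⊗[k] C))ᵐᵒᵖ :=
  TensorAlgebra.lift k
    { toFun := fun c => MulOpposite.op (snocStep k C c)
      map_add' := fun a b => by
        rw [← MulOpposite.op_add]; congr 1
        ext <;> simp [snocStep, mul_add]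
      map_smul' := fun a b => by
        rw [RingHom.id_apply, ← MulOpposite.op_smul]; congr 1
        ext <;> simp [snocStep] }

/-- The map that splits off the last tensor factor, `t c ↦ t ⊗ c`; it vanishes on scalars. -/
def splitLast : Cochains k C →ₗ[k] Cochains k C ⊗[k] C :=
  LinearMap.snd k _ _ ∘ₗ LinearMap.applyₗ (1, 0) ∘ₗ
    (MulOpposite.opLinearEquiv k).symm.toLinearMap ∘ₗ (snocAction k C).toLinearMap

variable {k C}

theorem splitLast_apply (t : Cochains k C) :
    splitLast k C t = ((snocAction k C t).unop (1, 0)).2 := rfl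

theorem snocAction_inj (c : C) : snocAction k C (inj k C c) = MulOpposite.op (snocStep k C c) := by
  simp [snocAction]

theorem snocAction_fst (t : Cochains k C) (x : Cochains k C × Cochains k C ⊗[k] C) :
    ((snocAction k C t).unop x).1 = x.1 * t := by
  induction t using TensorAlgebra.induction generalizing x with
  | algebraMap r =>
    rw [AlgHom.commutes, MulOpposite.algebraMap_apply, MulOpposite.unop_op,
      Module.algebraMap_end_apply, Prod.smul_fst, Algebra.smul_def, Algebra.commutes]
  | ι c => rw [snocAction_inj]; rfl
  | mul a b ha hb =>
    rw [map_mul, MulOpposite.unop_mul, Module.End.mul_apply, hb, ha, mul_assoc]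
  | add a b ha hb =>
    rw [map_add, MulOpposite.unop_add, LinearMap.add_apply, Prod.fst_add, ha, hb, mul_add]

theorem splitLast_snoc (t : Cochains k C) (c : C) :
    splitLast k C (t * inj k C c) = t ⊗ₜ c := by
  rw [splitLast_apply, map_mul, MulOpposite.unop_mul, Module.End.mul_apply, snocAction_inj]
  change ((snocAction k C t).unop (1, 0)).1 ⊗ₜ[k] c = _
  rw [snocAction_fst, one_mul]

theorem splitLast_algebraMap (a : k) : splitLast k C (algebraMap k _ a) = 0 := by
  rw [splitLast_apply, AlgHom.commutes, MulOpposite.algebraMap_apply, MulOpposite.unop_op,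
    Module.algebraMap_end_apply]
  exact smul_zero a

variable (k C)

/-- The map `t ⊗ c ↦ t c`. -/
def joinLast : Cochains k C ⊗[k] C →ₗ[k] Cochains k C :=
  LinearMap.mul' k (Cochains k C) ∘ₗ (inj k C).lTensor _

/-- The map `t ⊗ (a ⊗ b) ↦ t a ⊗ b`. -/
def absorb : Cochains k C ⊗[k] (C ⊗[k] C) →ₗ[k] Cochains k C ⊗[k] C :=
  (joinLast k C).rTensor C ∘ₗ (TensorProduct.assoc k _ _ _).symm.toLinearMap

/-- The differential of the cobar resolution,
`t ⊗ c ↦ d t ⊗ c + (-1) ^ (deg t) (t 1 ⊗ c - t c₁ ⊗ c₂)`. -/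
def resDiff : Cochains k C ⊗[k] C →ₗ[k] Cochains k C ⊗[k] C :=
  (diff k C).rTensor C + absorb k C ∘ₗ
    TensorProduct.map (sgn k C).toLinearMap (TensorProduct.mk k C C 1 - Coalgebra.comul)

/-- The map `t ⊗ c ↦ (-1) ^ (deg t) t ⊗ c`. -/
def resSgn : Cochains k C ⊗[k] C →ₗ[k] Cochains k C ⊗[k] C := (sgn k C).toLinearMap.rTensor C

/-- The map `t ⊗ c ↦ ε(c) t`. -/
def resCounit : Cochains k C ⊗[k] C →ₗ[k] Cochains k C :=
  (TensorProduct.rid k (Cochains k C)).toLinearMap ∘ₗ (Coalgebra.counit (R := k)).lTensor _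

variable {k C}

@[simp] theorem joinLast_tmul (t : Cochains k C) (c : C) :
    joinLast k C (t ⊗ₜ c) = t * inj k C c := by simp [joinLast]

@[simp] theorem absorb_tmul (t : Cochains k C) (a b : C) :
    absorb k C (t ⊗ₜ (a ⊗ₜ b)) = (t * inj k C a) ⊗ₜ b := by simp [absorb]

@[simp] theorem resSgn_tmul (t : Cochains k C) (c : C) :
    resSgn k C (t ⊗ₜ c) = sgn k C t ⊗ₜ c := rfl

@[simp] theorem resCounit_tmul (t : Cochains k C) (c : C) :
    resCounit k C (t ⊗ₜ c) = Coalgebra.counit (R := k) c • t := by simp [resCounit]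

theorem resDiff_tmul (t : Cochains k C) (c : C) : resDiff k C (t ⊗ₜ c) =
    diff k C t ⊗ₜ c + absorb k C (sgn k C t ⊗ₜ (1 ⊗ₜ c - Coalgebra.comul c)) := rfl

theorem splitLast_joinLast (x : Cochains k C ⊗[k] C) : splitLast k C (joinLast k C x) = x := by
  induction x with
  | zero => simp
  | add a b ha hb => rw [map_add, map_add, ha, hb]
  | tmul t c => rw [joinLast_tmul, splitLast_snoc]

theorem joinLast_splitLast (t : Cochains k C) :
    joinLast k C (splitLast k C t) + algebraMap k _ (TensorAlgebra.algebraMapInv t) = t := by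
  have key : ∀ b a : Cochains k C,
      (joinLast k C (splitLast k C a) + algebraMap k _ (TensorAlgebra.algebraMapInv a) = a) →
      (joinLast k C (splitLast k C (a * b)) +
        algebraMap k _ (TensorAlgebra.algebraMapInv (a * b)) = a * b) := by
    intro b
    induction b using TensorAlgebra.induction with
    | algebraMap r =>
      intro a ha
      rw [← Algebra.commutes, ← Algebra.smul_def, map_smul, map_smul, map_smul, smul_eq_mul,
        map_mul, ← Algebra.smul_def, ← smul_add, ha]
    | ι c =>
      intro a ha
      change joinLast k C (splitLast k C (a * inj k C c)) + _ = _
      rw [splitLast_snoc, joinLast_tmul, map_mul]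
      simp [TensorAlgebra.algebraMapInv]
    | mul b b' hb hb' => intro a ha; rw [← mul_assoc]; exact hb' _ (hb _ ha)
    | add b b' hb hb' =>
      intro a ha
      rw [mul_add, map_add, map_add, map_add, map_add, add_add_add_comm, hb _ ha, hb' _ ha]
  have h := key t 1 (by
    have := splitLast_algebraMap (k := k) (C := C) 1
    rw [map_one] at this
    rw [this]; simp)
  rwa [one_mul] at h

theorem joinLast_absorb (t : Cochains k C) (y : C ⊗[k] C) :
    joinLast k C (absorb k C (t ⊗ₜ y)) = t * juxt k C y := by
  induction y with
  | zero => simp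
  | add a b ha hb => simp only [TensorProduct.tmul_add, map_add, ha, hb, mul_add]
  | tmul a b => simp [juxt, mul_assoc]

theorem joinLast_resSgn (x : Cochains k C ⊗[k] C) :
    joinLast k C (resSgn k C x) = - sgn k C (joinLast k C x) := by
  induction x with
  | zero => simp
  | add a b ha hb => simp only [map_add, ha, hb, neg_add]
  | tmul t c => rw [resSgn_tmul, joinLast_tmul, joinLast_tmul, map_mul, sgn_inj, mul_neg, neg_neg]

/-- Under `joinLast`, the differential of the resolution is `x ↦ d x + (-1) ^ (deg x) x 1`. -/
theorem joinLast_resDiff (x : Cochains k C ⊗[k] C) : joinLast k C (resDiff k C x) =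
    diff k C (joinLast k C x) + sgn k C (joinLast k C x) * inj k C 1 := by
  induction x with
  | zero => simp
  | add a b ha hb => simp only [map_add, ha, hb, add_mul]; abel
  | tmul t c =>
    have h : juxt k C (1 ⊗ₜ c) = inj k C 1 * inj k C c := by simp [juxt]
    rw [resDiff_tmul, map_add, joinLast_tmul, joinLast_absorb, joinLast_tmul, diff_mul, diff_inj,
      map_mul, sgn_inj, map_sub, h]
    noncomm_ring

theorem resDiff_resDiff (h1 : Coalgebra.comul (R := k) (1 : C) = 1 ⊗ₜ 1)
    (x : Cochains k C ⊗[k] C) : resDiff k C (resDiff k C x) = 0 := by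
  rw [← splitLast_joinLast (resDiff k C (resDiff k C x)), joinLast_resDiff, joinLast_resDiff]
  have h : juxt k C (Coalgebra.comul (R := k) (1 : C)) = inj k C 1 * inj k C 1 := by
    rw [h1]; simp [juxt]
  have : diff k C (diff k C (joinLast k C x) + sgn k C (joinLast k C x) * inj k C 1) +
      sgn k C (diff k C (joinLast k C x) + sgn k C (joinLast k C x) * inj k C 1) * inj k C 1
        = 0 := by
    rw [map_add, map_add, diff_diff k C h1, diff_mul, diff_sgn, diff_inj, h, map_mul, sgn_sgn,
      sgn_inj]
    noncomm_ring
  rw [this, map_zero]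

theorem absorb_smul (q t : Cochains k C) (y : C ⊗[k] C) :
    absorb k C ((q * t) ⊗ₜ y) = q • absorb k C (t ⊗ₜ y) := by
  induction y with
  | zero => simp
  | add a b ha hb => simp only [TensorProduct.tmul_add, map_add, ha, hb, smul_add]
  | tmul a b => simp [TensorProduct.smul_tmul', mul_assoc]

theorem resDiff_smul (q : Cochains k C) (x : Cochains k C ⊗[k] C) :
    resDiff k C (q • x) = diff k C q • x + sgn k C q • resDiff k C x := by
  induction x with
  | zero => simp
  | add a b ha hb => simp only [smul_add, map_add, ha, hb]; abel
  | tmul t c =>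
    rw [TensorProduct.smul_tmul', smul_eq_mul, resDiff_tmul, resDiff_tmul, diff_mul, map_mul,
      absorb_smul, TensorProduct.add_tmul, smul_add, TensorProduct.smul_tmul',
      TensorProduct.smul_tmul', smul_eq_mul, smul_eq_mul, add_assoc]

theorem resDiff_one_tmul (c : C) : resDiff k C (1 ⊗ₜ c) =
    inj k C 1 ⊗ₜ c - absorb k C (1 ⊗ₜ Coalgebra.comul c) := by
  rw [resDiff_tmul, diff_one, map_one, TensorProduct.zero_tmul, zero_add, TensorProduct.tmul_sub,
    map_sub, absorb_tmul, one_mul]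

theorem resDiff_tmul_one (h1 : Coalgebra.comul (R := k) (1 : C) = 1 ⊗ₜ 1) (t : Cochains k C) :
    resDiff k C (t ⊗ₜ 1) = diff k C t ⊗ₜ 1 := by
  rw [resDiff_tmul, h1, sub_self, TensorProduct.tmul_zero, map_zero, add_zero]

theorem resDiff_resSgn (x : Cochains k C ⊗[k] C) :
    resDiff k C (resSgn k C x) = - resSgn k C (resDiff k C x) := by
  rw [← splitLast_joinLast (resDiff k C (resSgn k C x)), joinLast_resDiff, joinLast_resSgn,
    ← splitLast_joinLast (resSgn k C (resDiff k C x)), joinLast_resSgn, joinLast_resDiff,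
    ← map_neg (splitLast k C)]
  congr 1
  simp only [map_neg, map_add, map_mul, diff_sgn, sgn_sgn, sgn_inj]
  noncomm_ring

theorem resSgn_resSgn (x : Cochains k C ⊗[k] C) : resSgn k C (resSgn k C x) = x := by
  induction x with
  | zero => simp
  | add a b ha hb => rw [map_add, map_add, ha, hb]
  | tmul t c => rw [resSgn_tmul, resSgn_tmul, sgn_sgn]

theorem resCounit_absorb (t : Cochains k C) (y : C ⊗[k] C) :
    resCounit k C (absorb k C (t ⊗ₜ y)) =
      t * inj k C (TensorProduct.rid k C ((Coalgebra.counit (R := k)).lTensor C y)) := by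
  induction y with
  | zero => simp
  | add a b ha hb => simp only [TensorProduct.tmul_add, map_add, ha, hb, mul_add]
  | tmul a b => simp

theorem resCounit_resDiff (x : Cochains k C ⊗[k] C) : resCounit k C (resDiff k C x) =
    diff k C (resCounit k C x) + sgn k C (resCounit k C x) * inj k C 1 -
      joinLast k C (resSgn k C x) := by
  induction x with
  | zero => simp
  | add a b ha hb => simp only [map_add, ha, hb, add_mul]; abel
  | tmul t c =>
    rw [resDiff_tmul, map_add, resCounit_absorb, map_sub, Coalgebra.lTensor_counit_comul]
    simp [mul_sub]
    abel

/-- The contraction of the cobar resolution, `t b ⊗ c ↦ - (-1) ^ (deg t) ε(c) t ⊗ b`. -/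
def resContract : Cochains k C ⊗[k] C →ₗ[k] Cochains k C ⊗[k] C :=
  -(resSgn k C ∘ₗ splitLast k C ∘ₗ resCounit k C)

/-- The cobar resolution is contractible onto its augmentation. -/
theorem resDiff_resContract_add (x : Cochains k C ⊗[k] C) :
    resDiff k C (resContract x) + resContract (resDiff k C x) =
      x - algebraMap k (Cochains k C) (TensorAlgebra.algebraMapInv (resCounit k C x)) ⊗ₜ 1 := by
  have h2 : ∀ y : Cochains k C, splitLast k C (diff k C y + sgn k C y * inj k C 1) =
      resDiff k C (splitLast k C y) +
        algebraMap k (Cochains k C) (TensorAlgebra.algebraMapInv y) ⊗ₜ 1 := by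
    intro y
    conv_lhs => rw [← joinLast_splitLast y]
    rw [map_add (diff k C), diff_algebraMap, add_zero, map_add (sgn k C), AlgHom.commutes, add_mul, ← add_assoc,
      ← joinLast_resDiff, map_add, splitLast_joinLast, splitLast_snoc]
  have h3 : resContract x = - resSgn k C (splitLast k C (resCounit k C x)) := rfl
  have h4 : resContract (resDiff k C x) =
      - resSgn k C (splitLast k C (resCounit k C (resDiff k C x))) := rfl
  rw [h3, h4, resCounit_resDiff, map_sub, splitLast_joinLast, h2, map_sub, map_add, map_neg,
    resDiff_resSgn, resSgn_resSgn, resSgn_tmul, AlgHom.commutes]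
  abel

end Resolution

/-! ### Generation of cocycles along a filtration of the coefficients -/

section Filtration

variable (k : Type*) [Field k] (C : Type*) [Ring C] [Algebra k C] [Coalgebra k C]

/-- The cochains of degree less than `n`. -/
def filt : ℕ → Submodule k (Cochains k C)
  | 0 => ⊥
  | n + 1 => (1 ⊔ LinearMap.range (inj k C)) ^ n

variable {k C}

theorem filt_succ (n : ℕ) : filt k C (n + 1) = (1 ⊔ LinearMap.range (inj k C)) ^ n := rfl

theorem one_le_unit_sup : (1 : Submodule k (Cochains k C)) ≤ 1 ⊔ LinearMap.range (inj k C) :=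
  le_sup_left

theorem filt_mono {m n : ℕ} (h : m ≤ n) : filt k C m ≤ filt k C n := by
  rcases m with _ | m
  · exact bot_le
  · obtain ⟨n, rfl⟩ := Nat.exists_eq_succ_of_ne_zero (by omega : n ≠ 0)
    exact pow_le_pow_right' one_le_unit_sup (by omega)

theorem filt_mul {m n : ℕ} {a b : Cochains k C} (ha : a ∈ filt k C m) (hb : b ∈ filt k C (n + 1)) :
    a * b ∈ filt k C (m + n) := by
  rcases m with _ | m
  · rw [show a = 0 from ha, zero_mul]; exact zero_mem _
  · rw [show m + 1 + n = (m + n) + 1 by omega, filt_succ, pow_add]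
    exact Submodule.mul_mem_mul ha hb

theorem algebraMap_mem_filt (a : k) : algebraMap k (Cochains k C) a ∈ filt k C 1 := by
  rw [filt_succ, pow_zero]
  exact Submodule.algebraMap_mem a

theorem inj_mem_filt (c : C) : inj k C c ∈ filt k C 2 := by
  rw [filt_succ, pow_one]
  exact Submodule.mem_sup_right ⟨c, rfl⟩

theorem filt_induction {motive : ℕ → Cochains k C → Prop} {n : ℕ} {t : Cochains k C}
    (ht : t ∈ filt k C (n + 1)) (algebraMap : ∀ a, motive 0 (algebraMap k _ a))
    (add : ∀ n a b, motive n a → motive n b → motive n (a + b))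
    (up : ∀ n a, motive n a → motive (n + 1) a)
    (snoc : ∀ n a c, a ∈ filt k C (n + 1) → motive n a → motive (n + 1) (a * inj k C c)) :
    motive n t := by
  induction n generalizing t with
  | zero =>
    rw [filt_succ, pow_zero] at ht
    obtain ⟨a, rfl⟩ := Submodule.mem_one.mp ht
    exact algebraMap a
  | succ n ih =>
    rw [filt_succ, pow_succ] at ht
    refine Submodule.mul_induction_on ht ?_ (add _)
    intro a ha b hb
    obtain ⟨b, hb', _, ⟨c, rfl⟩, rfl⟩ := Submodule.mem_sup.mp hb
    obtain ⟨b, rfl⟩ := Submodule.mem_one.mp hb'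
    rw [mul_add]
    refine add _ _ _ (up _ _ (ih ?_)) (snoc _ _ _ ha (ih ha))
    rw [← Algebra.commutes, ← Algebra.smul_def]
    exact Submodule.smul_mem _ _ ha

theorem sgn_mem_filt {n : ℕ} {t : Cochains k C} (ht : t ∈ filt k C n) :
    sgn k C t ∈ filt k C n := by
  rcases n with _ | n
  · rw [show t = 0 from ht, map_zero]; exact zero_mem _
  refine filt_induction (motive := fun n t => sgn k C t ∈ filt k C (n + 1)) ht ?_ ?_ ?_ ?_
  · intro a; rw [AlgHom.commutes]; exact algebraMap_mem_filt a
  · intro n a b ha hb; rw [map_add]; exact add_mem ha hb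
  · intro n a ha; exact filt_mono (by omega) ha
  · intro n a c _ ha
    rw [map_mul, sgn_inj, mul_neg]
    exact neg_mem (filt_mul ha (inj_mem_filt c))

theorem juxt_mem_filt (y : C ⊗[k] C) : juxt k C y ∈ filt k C 3 := by
  induction y with
  | zero => rw [map_zero]; exact zero_mem _
  | add a b ha hb => rw [map_add]; exact add_mem ha hb
  | tmul a b =>
    have h : juxt k C (a ⊗ₜ b) = inj k C a * inj k C b := by simp [juxt]
    rw [h]
    exact filt_mul (inj_mem_filt a) (inj_mem_filt b)

theorem diff_mem_filt {n : ℕ} {t : Cochains k C} (ht : t ∈ filt k C n) :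
    diff k C t ∈ filt k C (n + 1) := by
  rcases n with _ | n
  · rw [show t = 0 from ht, map_zero]; exact zero_mem _
  refine filt_induction (motive := fun n t => diff k C t ∈ filt k C (n + 2)) ht ?_ ?_ ?_ ?_
  · intro a; rw [diff_algebraMap]; exact zero_mem _
  · intro n a b ha hb; rw [map_add]; exact add_mem ha hb
  · intro n a ha; exact filt_mono (by omega) ha
  · intro n a c hn ha
    rw [diff_mul, diff_inj]
    refine add_mem (filt_mul (m := n + 2) (n := 1) ha (inj_mem_filt c))
      (filt_mul (m := n + 1) (n := 2) (sgn_mem_filt hn) ?_)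
    exact sub_mem (add_mem (filt_mul (inj_mem_filt _) (inj_mem_filt _))
      (filt_mul (inj_mem_filt _) (inj_mem_filt _))) (juxt_mem_filt _)

theorem exists_mem_filt (t : Cochains k C) : ∃ n, t ∈ filt k C (n + 1) := by
  induction t using TensorAlgebra.induction with
  | algebraMap r => exact ⟨0, algebraMap_mem_filt r⟩
  | ι c => exact ⟨1, inj_mem_filt c⟩
  | mul a b ha hb =>
    obtain ⟨m, hm⟩ := ha
    obtain ⟨n, hn⟩ := hb
    exact ⟨m + n, filt_mono (by omega) (filt_mul hm hn)⟩
  | add a b ha hb =>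
    obtain ⟨m, hm⟩ := ha
    obtain ⟨n, hn⟩ := hb
    exact ⟨m + n, add_mem (filt_mono (by omega) hm) (filt_mono (by omega) hn)⟩

/-- The elements of the cobar resolution of degree less than `n` with coefficients in `N`. -/
def resFilt (n : ℕ) (N : Submodule k C) : Submodule k (Cochains k C ⊗[k] C) :=
  Submodule.map₂ (TensorProduct.mk k _ _) (filt k C n) N

theorem tmul_mem_resFilt {n : ℕ} {N : Submodule k C} {t : Cochains k C} {c : C}
    (ht : t ∈ filt k C n) (hc : c ∈ N) : t ⊗ₜ c ∈ resFilt n N :=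
  Submodule.apply_mem_map₂ _ ht hc

theorem resFilt_mono {m n : ℕ} {N N' : Submodule k C} (h : m ≤ n) (hN : N ≤ N') :
    resFilt m N ≤ resFilt n N' :=
  Submodule.map₂_le_map₂ (filt_mono h) hN

theorem resFilt_zero {N : Submodule k C} {x : Cochains k C ⊗[k] C} (hx : x ∈ resFilt 0 N) :
    x = 0 := by
  have h : resFilt 0 N = ⊥ := Submodule.map₂_bot_left _ _
  rw [h] at hx; exact hx

theorem smul_mem_resFilt {m n : ℕ} {N : Submodule k C} {q : Cochains k C}
    {x : Cochains k C ⊗[k] C} (hq : q ∈ filt k C m) (hx : x ∈ resFilt (n + 1) N) :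
    q • x ∈ resFilt (m + n) N := by
  have h : resFilt (n + 1) N ≤ (resFilt (m + n) N).comap
      (LinearMap.rTensor C (LinearMap.mulLeft k q)) :=
    Submodule.map₂_le.mpr fun t ht c hc => tmul_mem_resFilt (filt_mul hq ht) hc
  have h2 : ∀ x : Cochains k C ⊗[k] C, q • x = LinearMap.rTensor C (LinearMap.mulLeft k q) x := by
    intro x
    induction x with
    | zero => simp
    | add a b ha hb => rw [smul_add, map_add, ha, hb]
    | tmul t c => rfl
  rw [h2]
  exact h hx

/-- `N` is a subcomodule. -/
def IsSubcomodule (N : Submodule k C) : Prop :=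
  ∀ c ∈ N, Coalgebra.comul (R := k) c ∈ Submodule.map₂ (TensorProduct.mk k C C) ⊤ N

theorem absorb_mem_resFilt {n : ℕ} {N : Submodule k C} {t : Cochains k C} {y : C ⊗[k] C}
    (ht : t ∈ filt k C n) (hy : y ∈ Submodule.map₂ (TensorProduct.mk k C C) ⊤ N) :
    absorb k C (t ⊗ₜ y) ∈ resFilt (n + 1) N := by
  have h : Submodule.map₂ (TensorProduct.mk k C C) ⊤ N ≤ (resFilt (n + 1) N).comap
      (absorb k C ∘ₗ TensorProduct.mk k _ _ t) :=
    Submodule.map₂_le.mpr fun a _ b hb => by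
      change absorb k C (t ⊗ₜ (a ⊗ₜ b)) ∈ resFilt (n + 1) N
      rw [absorb_tmul]
      exact tmul_mem_resFilt (filt_mul ht (inj_mem_filt a)) hb
  exact h hy

theorem resDiff_mem {n : ℕ} {N : Submodule k C} (hN : IsSubcomodule N)
    {x : Cochains k C ⊗[k] C} (hx : x ∈ resFilt n N) : resDiff k C x ∈ resFilt (n + 1) N := by
  have h : resFilt n N ≤ (resFilt (n + 1) N).comap (resDiff k C) :=
    Submodule.map₂_le.mpr fun t ht c hc => by
      change resDiff k C (t ⊗ₜ c) ∈ resFilt (n + 1) N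
      rw [resDiff_tmul]
      exact add_mem (tmul_mem_resFilt (diff_mem_filt ht) hc)
        (absorb_mem_resFilt (sgn_mem_filt ht)
          (sub_mem (Submodule.apply_mem_map₂ _ trivial hc) (hN c hc)))
  exact h hx

theorem resDiff_mem_pred {n : ℕ} {N : Submodule k C} (hN : IsSubcomodule N)
    {x : Cochains k C ⊗[k] C} (hx : x ∈ resFilt (n - 1) N) : resDiff k C x ∈ resFilt n N := by
  rcases n with _ | n
  · rw [resFilt_zero hx, map_zero]; exact zero_mem _
  · exact resDiff_mem hN hx

theorem lTensor_mem_resFilt {n : ℕ} {N N' : Submodule k C} {g : C →ₗ[k] C}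
    (hg : ∀ c ∈ N, g c ∈ N') {x : Cochains k C ⊗[k] C} (hx : x ∈ resFilt n N) :
    g.lTensor _ x ∈ resFilt n N' := by
  have h : resFilt n N ≤ (resFilt n N').comap (g.lTensor _) :=
    Submodule.map₂_le.mpr fun t ht c hc => tmul_mem_resFilt ht (hg c hc)
  exact h hx

theorem lTensor_congr {n : ℕ} {N : Submodule k C} {g g' : C →ₗ[k] C}
    (hg : ∀ c ∈ N, g c = g' c) {x : Cochains k C ⊗[k] C} (hx : x ∈ resFilt n N) :
    g.lTensor _ x = g'.lTensor _ x := by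
  have h : resFilt n N ≤ LinearMap.eqLocus (g.lTensor (Cochains k C)) (g'.lTensor _) :=
    Submodule.map₂_le.mpr fun t ht c hc => by
      change t ⊗ₜ g c = t ⊗ₜ g' c
      rw [hg c hc]
  exact h hx

theorem lTensor_resSmul (g : C →ₗ[k] C) (q : Cochains k C) (x : Cochains k C ⊗[k] C) :
    g.lTensor _ (q • x) = q • g.lTensor _ x := by
  induction x with
  | zero => simp
  | add a b ha hb => simp only [smul_add, map_add, ha, hb]
  | tmul t c => rfl

theorem absorb_lTensor (g : C →ₗ[k] C) (t : Cochains k C) (y : C ⊗[k] C) :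
    absorb k C (t ⊗ₜ g.lTensor C y) = g.lTensor _ (absorb k C (t ⊗ₜ y)) := by
  induction y with
  | zero => simp
  | add a b ha hb => simp only [map_add, TensorProduct.tmul_add, ha, hb]
  | tmul a b => simp

theorem resDiff_lTensor {n : ℕ} {N : Submodule k C} {g : C →ₗ[k] C}
    (hg : ∀ c ∈ N, Coalgebra.comul (R := k) (g c) = g.lTensor C (Coalgebra.comul c))
    {x : Cochains k C ⊗[k] C} (hx : x ∈ resFilt n N) :
    resDiff k C (g.lTensor _ x) = g.lTensor _ (resDiff k C x) := by
  have h : resFilt n N ≤ LinearMap.eqLocus (resDiff k C ∘ₗ g.lTensor (Cochains k C))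
      (g.lTensor _ ∘ₗ resDiff k C) :=
    Submodule.map₂_le.mpr fun t ht c hc => by
      change resDiff k C (t ⊗ₜ g c) = g.lTensor _ (resDiff k C (t ⊗ₜ c))
      rw [resDiff_tmul, resDiff_tmul, map_add, ← absorb_lTensor, map_sub, hg c hc]
      rfl
  exact h hx

theorem resCounit_mem {n : ℕ} {x : Cochains k C ⊗[k] C} (hx : x ∈ resFilt n ⊤) :
    resCounit k C x ∈ filt k C n := by
  have h : resFilt n ⊤ ≤ (filt k C n).comap (resCounit k C) :=
    Submodule.map₂_le.mpr fun t ht c _ => by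
      change resCounit k C (t ⊗ₜ c) ∈ filt k C n
      rw [resCounit_tmul]
      exact Submodule.smul_mem _ _ ht
  exact h hx

theorem splitLast_mem {n : ℕ} {t : Cochains k C} (ht : t ∈ filt k C n) :
    splitLast k C t ∈ resFilt (n - 1) ⊤ := by
  rcases n with _ | n
  · rw [show t = 0 from ht, map_zero]; exact zero_mem _
  refine filt_induction (motive := fun n t => splitLast k C t ∈ resFilt n ⊤) ht ?_ ?_ ?_ ?_
  · intro a; rw [splitLast_algebraMap]; exact zero_mem _
  · intro n a b ha hb; rw [map_add]; exact add_mem ha hb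
  · intro n a ha; exact resFilt_mono (by omega) le_rfl ha
  · intro n a c hn _
    rw [splitLast_snoc]; exact tmul_mem_resFilt hn trivial

theorem resSgn_mem {n : ℕ} {N : Submodule k C} {x : Cochains k C ⊗[k] C} (hx : x ∈ resFilt n N) :
    resSgn k C x ∈ resFilt n N := by
  have h : resFilt n N ≤ (resFilt n N).comap (resSgn k C) :=
    Submodule.map₂_le.mpr fun t ht c hc => tmul_mem_resFilt (sgn_mem_filt ht) hc
  exact h hx

/-- Every cocycle of degree less than `n` with coefficients in `N` is cohomologous to `q ⊗ 1` for
some `q` in `Q`. -/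
def CocyclesGenerated (Q : Subalgebra k (Cochains k C)) (N : Submodule k C) (n : ℕ) : Prop :=
  ∀ z ∈ resFilt n N, resDiff k C z = 0 → ∃ q ∈ Q, q ∈ filt k C n ∧
    ∃ w ∈ resFilt (n - 1) N, z = q • (1 ⊗ₜ 1) + resDiff k C w

/-- The cofree comodule has no cohomology in positive degrees. -/
theorem cocyclesGenerated_top (Q : Subalgebra k (Cochains k C)) (n : ℕ) :
    CocyclesGenerated Q (⊤ : Submodule k C) n := by
  intro z hz hdz
  rcases n with _ | n
  · exact ⟨0, zero_mem _, zero_mem _, 0, zero_mem _, by rw [resFilt_zero hz]; simp⟩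
  refine ⟨algebraMap k _ (TensorAlgebra.algebraMapInv (resCounit k C z)), Q.algebraMap_mem _,
    filt_mono (by omega) (algebraMap_mem_filt _), resContract z,
    neg_mem (resSgn_mem (splitLast_mem (resCounit_mem hz))), ?_⟩
  have h := resDiff_resContract_add z
  rw [hdz, map_zero, add_zero] at h
  rw [h, TensorProduct.smul_tmul', smul_eq_mul, mul_one]
  abel

/-- Suppose that `N' ⊆ N` are subcomodules with an exact sequence
`0 → N' → N → N → N' → 0`, where the maps are the inclusion, `D` and `L`; the operators `S` and
`T` provide linear splittings. The elements `f`, with `D f = 1`, and `h`, with `D h = d (T 1)`,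
describe the connecting maps: the classes `a` and `b` below generate the cohomology of `N'` over
that of `N`. -/
structure PeriodicStep (N N' : Submodule k C) (D L S T : C →ₗ[k] C) (a b : Cochains k C) :
    Prop where
  le : N' ≤ N
  comodule : IsSubcomodule N
  one_mem : 1 ∈ N'
  D_mem : ∀ c ∈ N, D c ∈ N
  L_mem : ∀ c ∈ N, L c ∈ N'
  S_mem : ∀ c ∈ N, S c ∈ N
  T_mem : ∀ c ∈ N', T c ∈ N
  D_comul : ∀ c ∈ N, Coalgebra.comul (R := k) (D c) = D.lTensor C (Coalgebra.comul c)
  L_comul : ∀ c ∈ N, Coalgebra.comul (R := k) (L c) = L.lTensor C (Coalgebra.comul c)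
  D_eq_zero : ∀ c ∈ N', D c = 0
  sub_S_D : ∀ c ∈ N, c - S (D c) ∈ N'
  D_S : ∀ c ∈ N, c = D (S c) + T (L c)
  L_T : ∀ c ∈ N', L (T c) = c
  L_D : ∀ c ∈ N, L (D c) = 0
  L_one : L 1 = 0
  exists_f : ∃ f ∈ N, D f = 1 ∧ resDiff k C (1 ⊗ₜ f) = a ⊗ₜ 1
  exists_h : ∃ h ∈ resFilt 2 N, D.lTensor _ h = resDiff k C (1 ⊗ₜ T 1) ∧ resDiff k C h = b ⊗ₜ 1

/-- If the cocycles over `N` are generated by `Q`, and `a, b ∈ Q`, then so are those over `N'`. The proof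
is by induction on the degree: the two connecting maps of the exact sequence together take a cocycle
over `N'` to one whose degree is smaller by two. -/
theorem PeriodicStep.cocyclesGenerated {N N' : Submodule k C} {D L S T : C →ₗ[k] C}
    {a b : Cochains k C} (H : PeriodicStep N N' D L S T a b)
    (h1 : Coalgebra.comul (R := k) (1 : C) = 1 ⊗ₜ 1)
    {Q : Subalgebra k (Cochains k C)} (hQ : ∀ q ∈ Q, diff k C q = 0)
    (hQs : ∀ q ∈ Q, sgn k C q ∈ Q) (haQ : a ∈ Q) (ha : a ∈ filt k C 2) (hbQ : b ∈ Q)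
    (hb : b ∈ filt k C 3) (hN : ∀ n, CocyclesGenerated Q N n) (n : ℕ) :
    CocyclesGenerated Q N' n := by
  induction n using Nat.strong_induction_on with
  | _ n ih =>
  intro z hz hdz
  rcases Nat.eq_zero_or_pos n with rfl | hn
  · exact ⟨0, zero_mem _, zero_mem _, 0, zero_mem _, by rw [resFilt_zero hz]; simp⟩
  have h11 : ((1 : Cochains k C) ⊗ₜ[k] (1 : C)) ∈ resFilt 1 N' :=
    tmul_mem_resFilt (by simpa using algebraMap_mem_filt (k := k) (C := C) 1) H.one_mem
  have hd11 : resDiff k C ((1 : Cochains k C) ⊗ₜ[k] (1 : C)) = 0 := by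
    rw [resDiff_tmul_one h1, diff_one, TensorProduct.zero_tmul]
  have hq : ∀ q ∈ Q, ∀ x, resDiff k C (q • x) = sgn k C q • resDiff k C x := fun q hq x => by
    rw [resDiff_smul, hQ q hq, zero_smul, zero_add]
  have hD1 : ∀ q : Cochains k C, D.lTensor _ (q • ((1 : Cochains k C) ⊗ₜ[k] (1 : C))) = 0 := by
    intro q
    rw [lTensor_resSmul, LinearMap.lTensor_tmul, H.D_eq_zero 1 H.one_mem, TensorProduct.tmul_zero,
      smul_zero]
  -- `z` is a coboundary `d w` in `N`, up to an element of `Q`.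
  obtain ⟨q, hqQ, hqn, w, hw, hzw⟩ := hN n z (resFilt_mono le_rfl H.le hz) hdz
  have hDz : D.lTensor _ z = 0 := by
    rw [lTensor_congr (g' := 0) H.D_eq_zero hz, LinearMap.lTensor_zero, LinearMap.zero_apply]
  have hDw : resDiff k C (D.lTensor _ w) = 0 := by
    rw [resDiff_lTensor H.D_comul hw]
    have := congrArg (D.lTensor (Cochains k C)) hzw
    rwa [map_add, hDz, hD1, zero_add, eq_comm] at this
  -- `D w` is a cocycle, hence a coboundary `d v` in `N`, up to an element of `Q`.
  obtain ⟨q', hq'Q, hq'n, v, hv, hwv⟩ := hN (n - 1) _ (lTensor_mem_resFilt H.D_mem hw) hDw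
  have hLD : L.lTensor _ (D.lTensor _ w) = 0 := by
    rw [← LinearMap.comp_apply, ← LinearMap.lTensor_comp,
      lTensor_congr (g' := 0) H.L_D hw, LinearMap.lTensor_zero, LinearMap.zero_apply]
  have hLv : resDiff k C (L.lTensor _ v) = 0 := by
    rw [resDiff_lTensor H.L_comul hv]
    have := congrArg (L.lTensor (Cochains k C)) hwv
    rw [map_add, hLD, lTensor_resSmul, LinearMap.lTensor_tmul, H.L_one, TensorProduct.tmul_zero,
      smul_zero, zero_add] at this
    exact this.symm
  -- By induction, `L v` is a coboundary in `N'`, up to an element of `Q`.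
  obtain ⟨q'', hq''Q, hq''n, y, hy, hvy⟩ :=
    ih (n - 1 - 1) (by omega) _ (lTensor_mem_resFilt H.L_mem hv) hLv
  obtain ⟨f, hf, hDf, hdf⟩ := H.exists_f
  obtain ⟨h, hh, hDh, hdh⟩ := H.exists_h
  have hTy : T.lTensor _ y ∈ resFilt (n - 1 - 1 - 1) N := lTensor_mem_resFilt H.T_mem hy
  have hLT : L.lTensor _ (T.lTensor _ y) = y := by
    rw [← LinearMap.comp_apply, ← LinearMap.lTensor_comp, lTensor_congr (g' := LinearMap.id) H.L_T hy,
      LinearMap.lTensor_id, LinearMap.id_apply]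
  have hT1 : T 1 ∈ N := H.T_mem 1 H.one_mem
  set x := v - resDiff k C (T.lTensor _ y) - q'' • (1 ⊗ₜ T 1) with hx
  have hxN : x ∈ resFilt (n - 1 - 1) N := by
    refine sub_mem (sub_mem hv (resDiff_mem_pred H.comodule hTy)) ?_
    exact smul_mem_resFilt (n := 0) hq''n (tmul_mem_resFilt
      (by simpa using algebraMap_mem_filt (k := k) (C := C) 1) hT1)
  have hLx : L.lTensor _ x = 0 := by
    rw [hx, map_sub, map_sub, hvy, ← resDiff_lTensor H.L_comul hTy, hLT, lTensor_resSmul,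
      LinearMap.lTensor_tmul, H.L_T 1 H.one_mem]
    abel
  have hSx : S.lTensor _ x ∈ resFilt (n - 1 - 1) N := lTensor_mem_resFilt H.S_mem hxN
  have hxD : x = D.lTensor _ (S.lTensor _ x) := by
    have := lTensor_congr (g := LinearMap.id) (g' := D ∘ₗ S + T ∘ₗ L) H.D_S hxN
    rw [LinearMap.lTensor_id, LinearMap.id_apply, LinearMap.lTensor_add, LinearMap.add_apply,
      LinearMap.lTensor_comp, LinearMap.lTensor_comp, LinearMap.comp_apply, LinearMap.comp_apply,
      hLx, map_zero, add_zero] at this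
    exact this
  -- Hence `w` differs by an element over `N'` from a combination of `f`, `h` and a coboundary.
  set u := w - q' • (1 ⊗ₜ f) - sgn k C q'' • h - resDiff k C (S.lTensor _ x) with hu
  have hdS : resDiff k C (S.lTensor _ x) ∈ resFilt (n - 1) N := resDiff_mem_pred H.comodule hSx
  have huN : u ∈ resFilt (n - 1) N := by
    refine sub_mem (sub_mem (sub_mem hw ?_) ?_) hdS
    · exact smul_mem_resFilt (n := 0) hq'n (tmul_mem_resFilt
        (by simpa using algebraMap_mem_filt (k := k) (C := C) 1) hf)
    · rcases Nat.lt_or_ge n 2 with h2 | h2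
      · have h0 : q'' = 0 := by
          rw [show n - 1 - 1 = 0 by omega] at hq''n
          exact hq''n
        rw [h0, map_zero, zero_smul]; exact zero_mem _
      · rw [show n - 1 = n - 1 - 1 + 1 by omega]
        exact smul_mem_resFilt (n := 1) (sgn_mem_filt hq''n) hh
  have hDu : D.lTensor _ u = 0 := by
    have e : v = x + resDiff k C (T.lTensor _ y) + q'' • (1 ⊗ₜ T 1) := by rw [hx]; abel
    rw [hu, map_sub, map_sub, map_sub, hwv, ← resDiff_lTensor H.D_comul hSx, ← hxD,
      lTensor_resSmul, lTensor_resSmul, LinearMap.lTensor_tmul, hDf, hDh, e, map_add, map_add,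
      resDiff_resDiff h1, hq q'' hq''Q]
    abel
  have huN' : u ∈ resFilt (n - 1) N' := by
    have h2 : LinearMap.lTensor (Cochains k C) (LinearMap.id - S ∘ₗ D) u ∈ resFilt (n - 1) N' :=
      lTensor_mem_resFilt H.sub_S_D huN
    rwa [LinearMap.lTensor_sub, LinearMap.sub_apply, LinearMap.lTensor_id, LinearMap.id_apply,
      LinearMap.lTensor_comp, LinearMap.comp_apply, hDu, map_zero, sub_zero] at h2
  refine ⟨q + sgn k C q' * a + q'' * b,
    add_mem (add_mem hqQ (mul_mem (hQs _ hq'Q) haQ)) (mul_mem hq''Q hbQ), ?_, u, huN', ?_⟩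
  · refine add_mem (add_mem hqn ?_) ?_
    · rw [show n = n - 1 + 1 by omega]
      exact filt_mul (sgn_mem_filt hq'n) ha
    · rcases Nat.lt_or_ge n 2 with h2 | h2
      · have h0 : q'' = 0 := by
          rw [show n - 1 - 1 = 0 by omega] at hq''n
          exact hq''n
        rw [h0, zero_mul]; exact zero_mem _
      · rw [show n = n - 1 - 1 + 2 by omega]
        exact filt_mul hq''n hb
  · have e : w = u + q' • (1 ⊗ₜ f) + sgn k C q'' • h + resDiff k C (S.lTensor _ x) := by
      rw [hu]; abel
    have ea : ∀ c : Cochains k C, c ⊗ₜ[k] (1 : C) = c • ((1 : Cochains k C) ⊗ₜ[k] (1 : C)) := by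
      intro c; rw [TensorProduct.smul_tmul', smul_eq_mul, mul_one]
    rw [hzw, e, map_add, map_add, map_add, resDiff_resDiff h1, hq q' hq'Q,
      hq _ (hQs _ hq''Q), sgn_sgn, hdf, hdh, ea a, ea b, smul_smul, smul_smul, add_smul, add_smul]
    abel

end Filtration

/-! ### Sequences of divided powers -/

section Divided

variable {k : Type*} [Field k] {C : Type*} [Ring C] [Algebra k C] [Coalgebra k C]

/-- A sequence with `g_0 = 1` and `Δ g_m = Σ_{a+b=m} g_a ⊗ g_b` for `m < n`. -/
structure IsDividedSeq (k : Type*) [Field k] {C : Type*} [Ring C] [Algebra k C] [Coalgebra k C]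
    (n : ℕ) (g : ℕ → C) : Prop where
  zero : g 0 = 1
  comul : ∀ m < n, Coalgebra.comul (R := k) (g m) =
    ∑ q ∈ Finset.HasAntidiagonal.antidiagonal m, g q.1 ⊗ₜ g q.2

/-- The sequence `g` with `g_0` replaced by zero. -/
def reduced (g : ℕ → C) (m : ℕ) : C := if m = 0 then 0 else g m

variable (k) in
/-- The cochain `Σ_{a+b=n} g_a ⊗ g_b`, where `a, b > 0`. -/
def pairCochain (g : ℕ → C) (n : ℕ) : Cochains k C :=
  ∑ q ∈ Finset.HasAntidiagonal.antidiagonal n,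
    inj k C (reduced g q.1) * inj k C (reduced g q.2)

variable (k) in
/-- The element `Σ_{a+b=n} g_a ⊗ g_b` of the cobar resolution, where `a, b > 0`. -/
def pairRes (g : ℕ → C) (n : ℕ) : Cochains k C ⊗[k] C :=
  ∑ q ∈ Finset.HasAntidiagonal.antidiagonal n, inj k C (reduced g q.1) ⊗ₜ reduced g q.2

theorem sum_antidiagonal_reduced {M : Type*} [AddCommMonoid M] (n : ℕ) (f f' : ℕ → ℕ → M)
    (h1 : ∀ b, f 0 b = 0) (h2 : ∀ a, f a 0 = 0) (h : ∀ a b, a ≠ 0 → b ≠ 0 → f a b = f' a b) :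
    ∑ q ∈ Finset.HasAntidiagonal.antidiagonal n, f q.1 q.2 =
      ∑ j ∈ Finset.Ico 1 n, f' j (n - j) := by
  rw [Finset.Nat.sum_antidiagonal_eq_sum_range_succ f]
  symm
  refine Finset.sum_subset_zero_on_sdiff ?_ ?_ ?_
  · intro j hj
    rw [Finset.mem_Ico] at hj
    rw [Finset.mem_range]; omega
  · intro j hj
    rw [Finset.mem_sdiff, Finset.mem_range, Finset.mem_Ico] at hj
    rcases Nat.eq_zero_or_pos j with rfl | h0
    · exact h1 _
    · rw [show n - j = 0 by omega]; exact h2 _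
  · intro j hj
    rw [Finset.mem_Ico] at hj
    exact (h _ _ (by omega) (by omega)).symm

theorem pairCochain_eq (g : ℕ → C) (n : ℕ) : pairCochain k g n =
    ∑ j ∈ Finset.Ico 1 n, inj k C (g j) * inj k C (g (n - j)) := by
  refine sum_antidiagonal_reduced n
    (fun a b => inj k C (reduced g a) * inj k C (reduced g b))
    (fun a b => inj k C (g a) * inj k C (g b)) ?_ ?_ ?_
  · intro b; simp [reduced]
  · intro a; simp [reduced]
  · intro a b ha hb; simp [reduced, ha, hb]

theorem pairCochain_mem (g : ℕ → C) (n : ℕ) : pairCochain k g n ∈ filt k C 3 :=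
  sum_mem fun _ _ => filt_mul (inj_mem_filt _) (inj_mem_filt _)

theorem sgn_pairCochain (g : ℕ → C) (n : ℕ) :
    sgn k C (pairCochain k g n) = pairCochain k g n := by
  simp only [pairCochain, map_sum, map_mul, sgn_inj, neg_mul_neg]

theorem pairRes_mem (g : ℕ → C) (n : ℕ) {N : Submodule k C}
    (h : ∀ m, 1 ≤ m → m < n → g m ∈ N) : pairRes k g n ∈ resFilt 2 N := by
  refine sum_mem fun q hq => ?_
  have hq := Finset.HasAntidiagonal.mem_antidiagonal.mp hq
  by_cases h1 : q.1 = 0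
  · rw [reduced, if_pos h1, map_zero, TensorProduct.zero_tmul]; exact zero_mem _
  by_cases h2 : q.2 = 0
  · rw [reduced.eq_1 g q.2, if_pos h2, TensorProduct.tmul_zero]; exact zero_mem _
  · refine tmul_mem_resFilt (inj_mem_filt _) ?_
    rw [reduced, if_neg h2]
    exact h _ (by omega) (by omega)

namespace IsDividedSeq

variable {n : ℕ} {g : ℕ → C} (hg : IsDividedSeq k n g)
include hg

theorem resDiff_one_tmul (m : ℕ) (hm : m < n) : resDiff k C (1 ⊗ₜ g m) =
    -∑ q ∈ Finset.HasAntidiagonal.antidiagonal m, inj k C (reduced g q.1) ⊗ₜ g q.2 := by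
  rw [SuperCoh.resDiff_one_tmul, hg.comul m hm, TensorProduct.tmul_sum, map_sum]
  have h : inj k C 1 ⊗ₜ[k] g m = ∑ q ∈ Finset.HasAntidiagonal.antidiagonal m,
      if q.1 = 0 then inj k C 1 ⊗ₜ[k] g q.2 else 0 := by
    rw [Finset.sum_eq_single (0, m)]
    · simp
    · intro q hq hne
      have := Finset.HasAntidiagonal.mem_antidiagonal.mp hq
      refine if_neg fun h => hne (Prod.ext h ?_)
      dsimp only; omega
    · simp
  rw [h, ← Finset.sum_sub_distrib, ← Finset.sum_neg_distrib]
  refine Finset.sum_congr rfl fun q _ => ?_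
  rw [absorb_tmul, one_mul, reduced]
  split_ifs with h0
  · rw [h0, hg.zero, map_zero, TensorProduct.zero_tmul, sub_self, neg_zero]
  · rw [zero_sub]

theorem resDiff_one_tmul_reduced (m : ℕ) (hm : m < n) : resDiff k C (1 ⊗ₜ reduced g m) =
    -∑ q ∈ Finset.HasAntidiagonal.antidiagonal m, inj k C (reduced g q.1) ⊗ₜ g q.2 := by
  rcases Nat.eq_zero_or_pos m with rfl | h
  · simp [reduced]
  · rw [reduced, if_neg (by omega), hg.resDiff_one_tmul m hm]

theorem diff_reduced (m : ℕ) (hm : m < n) : diff k C (inj k C (reduced g m)) =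
    -∑ q ∈ Finset.HasAntidiagonal.antidiagonal m,
      inj k C (reduced g q.1) * inj k C (reduced g q.2) := by
  rcases Nat.eq_zero_or_pos m with rfl | h
  · simp [reduced]
  have e1 : inj k C 1 * inj k C (g m) = ∑ q ∈ Finset.HasAntidiagonal.antidiagonal m,
      if q.1 = 0 then inj k C 1 * inj k C (g q.2) else 0 := by
    rw [Finset.sum_eq_single (0, m)]
    · simp
    · intro q hq hne
      have := Finset.HasAntidiagonal.mem_antidiagonal.mp hq
      refine if_neg fun h => hne (Prod.ext h ?_)
      dsimp only; omega
    · simp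
  have e2 : inj k C (g m) * inj k C 1 = ∑ q ∈ Finset.HasAntidiagonal.antidiagonal m,
      if q.2 = 0 then inj k C (g q.1) * inj k C 1 else 0 := by
    rw [Finset.sum_eq_single (m, 0)]
    · simp
    · intro q hq hne
      have := Finset.HasAntidiagonal.mem_antidiagonal.mp hq
      refine if_neg fun h => hne (Prod.ext ?_ h)
      dsimp only; omega
    · simp
  rw [reduced, if_neg (by omega), diff_inj, hg.comul m hm, map_sum, e1, e2,
    ← Finset.sum_add_distrib, ← Finset.sum_sub_distrib, ← Finset.sum_neg_distrib]
  refine Finset.sum_congr rfl fun q hq => ?_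
  have hq := Finset.HasAntidiagonal.mem_antidiagonal.mp hq
  have hj : juxt k C (g q.1 ⊗ₜ g q.2) = inj k C (g q.1) * inj k C (g q.2) := by simp [juxt]
  rw [hj, reduced, reduced]
  by_cases h1 : q.1 = 0
  · have h2 : q.2 ≠ 0 := by omega
    simp [h1, h2, hg.zero]
  · by_cases h2 : q.2 = 0
    · simp [h1, h2, hg.zero]
    · simp [h1, h2]

/-- The element `pairRes g n` exhibits `pairCochain g n ⊗ 1` as a coboundary of the resolution. It
plays the role of the divided power `g_n`, which need not exist. -/
theorem resDiff_pairRes :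
    resDiff k C (pairRes k g n) = pairCochain k g n ⊗ₜ 1 := by
  have e : ∀ q ∈ Finset.HasAntidiagonal.antidiagonal n,
      resDiff k C (inj k C (reduced g q.1) ⊗ₜ reduced g q.2) =
      -∑ u ∈ Finset.HasAntidiagonal.antidiagonal q.1,
        (inj k C (reduced g u.1) * inj k C (reduced g u.2)) ⊗ₜ reduced g q.2 +
      ∑ u ∈ Finset.HasAntidiagonal.antidiagonal q.2,
        (inj k C (reduced g q.1) * inj k C (reduced g u.1)) ⊗ₜ g u.2 := by
    intro q hq
    have hq := Finset.HasAntidiagonal.mem_antidiagonal.mp hq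
    have h0 : reduced g 0 = 0 := if_pos rfl
    by_cases hq1 : q.1 = 0
    · rw [hq1]; simp [h0]
    by_cases hq2 : q.2 = 0
    · rw [hq2]; simp [h0]
    have ht : inj k C (reduced g q.1) ⊗ₜ[k] reduced g q.2 =
        inj k C (reduced g q.1) • ((1 : Cochains k C) ⊗ₜ[k] reduced g q.2) := by
      rw [TensorProduct.smul_tmul', smul_eq_mul, mul_one]
    rw [ht, resDiff_smul, hg.diff_reduced _ (by omega),
      hg.resDiff_one_tmul_reduced _ (by omega), sgn_inj, neg_smul_neg, TensorProduct.smul_tmul',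
      smul_eq_mul, mul_one, TensorProduct.neg_tmul, TensorProduct.sum_tmul, Finset.smul_sum]
    rfl
  rw [pairRes, map_sum, Finset.sum_congr rfl e, Finset.sum_add_distrib, Finset.sum_neg_distrib,
    sum_triple n (fun a b c => (inj k C (reduced g a) * inj k C (reduced g b)) ⊗ₜ[k] reduced g c),
    ← Finset.sum_neg_distrib, ← Finset.sum_add_distrib, pairCochain, TensorProduct.sum_tmul]
  refine Finset.sum_congr rfl fun q hq => ?_
  rw [← Finset.sum_neg_distrib, ← Finset.sum_add_distrib, Finset.sum_eq_single (q.2, 0)]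
  · simp [reduced, hg.zero]
  · intro u hu hne
    have := Finset.HasAntidiagonal.mem_antidiagonal.mp hu
    have h2 : u.2 ≠ 0 := fun h => hne (Prod.ext (by dsimp only; omega) h)
    rw [reduced.eq_1 g u.2, if_neg h2, neg_add_cancel]
  · simp

theorem diff_pairCochain (h1 : Coalgebra.comul (R := k) (1 : C) = 1 ⊗ₜ 1)
    (h2 : Coalgebra.counit (R := k) (1 : C) = 1) : diff k C (pairCochain k g n) = 0 := by
  have h := resDiff_resDiff h1 (pairRes k g n)
  rw [hg.resDiff_pairRes, resDiff_tmul_one h1] at h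
  have h' := congrArg (resCounit k C) h
  rwa [resCounit_tmul, h2, one_smul, map_zero] at h'

end IsDividedSeq

/-- A sum over `antidiagonal (2 j)` whose terms vanish at odd indices below `p`. -/
theorem sum_antidiagonal_even {M : Type*} [AddCommMonoid M] (p j : ℕ) (hp : Odd p)
    (f : ℕ → ℕ → M) (h1 : ∀ a b, Odd a → a < p → f a b = 0)
    (h2 : ∀ a b, Odd b → b < p → f a b = 0) :
    ∑ q ∈ Finset.HasAntidiagonal.antidiagonal (2 * j), f q.1 q.2 =
      ∑ q ∈ Finset.HasAntidiagonal.antidiagonal j, f (2 * q.1) (2 * q.2) +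
      if p ≤ j then ∑ q ∈ Finset.HasAntidiagonal.antidiagonal (j - p),
        f (2 * q.1 + p) (2 * q.2 + p) else 0 := by
  obtain ⟨c, rfl⟩ := hp
  rw [← Finset.sum_filter_add_sum_filter_not _ (fun q => q.1 % 2 = 0)]
  congr 1
  · refine Finset.sum_nbij' (fun q => (q.1 / 2, q.2 / 2)) (fun q => (2 * q.1, 2 * q.2))
      ?_ ?_ ?_ ?_ ?_
    all_goals
      rintro ⟨a, b⟩ hq
      simp only [Finset.mem_filter, Finset.HasAntidiagonal.mem_antidiagonal] at hq ⊢
    · omega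
    · omega
    · simp only [Prod.mk.injEq]; omega
    · simp only [Prod.mk.injEq]; omega
    · rw [show 2 * (a / 2) = a by omega, show 2 * (b / 2) = b by omega]
  · split_ifs with hj
    · symm
      refine Finset.sum_of_injOn (fun q => (2 * q.1 + (2 * c + 1), 2 * q.2 + (2 * c + 1)))
        ?_ ?_ ?_ ?_
      · rintro ⟨a, b⟩ _ ⟨a', b'⟩ _ h
        simp only [Prod.mk.injEq] at h ⊢
        omega
      · rintro ⟨a, b⟩ hq
        simp only [Finset.mem_coe, Finset.mem_filter, Finset.HasAntidiagonal.mem_antidiagonal]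
          at hq ⊢
        omega
      · rintro ⟨a, b⟩ hq hn
        simp only [Finset.mem_filter, Finset.HasAntidiagonal.mem_antidiagonal] at hq
        by_cases ha : a < 2 * c + 1
        · exact h1 _ _ (Nat.odd_iff.mpr (by omega)) ha
        by_cases hb : b < 2 * c + 1
        · exact h2 _ _ (Nat.odd_iff.mpr (by omega)) hb
        · refine absurd ⟨((a - (2 * c + 1)) / 2, (b - (2 * c + 1)) / 2), ?_, ?_⟩ hn
          · simp only [Finset.mem_coe, Finset.HasAntidiagonal.mem_antidiagonal]; omega
          · simp only [Prod.mk.injEq]; omega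
      · rintro ⟨a, b⟩ _; rfl
    · refine Finset.sum_eq_zero ?_
      rintro ⟨a, b⟩ hq
      simp only [Finset.mem_filter, Finset.HasAntidiagonal.mem_antidiagonal] at hq
      by_cases ha : a < 2 * c + 1
      · exact h1 _ _ (Nat.odd_iff.mpr (by omega)) ha
      · exact h2 _ _ (Nat.odd_iff.mpr (by omega)) (by omega)

/-- A sum over an antidiagonal of odd order whose terms vanish at odd indices below `p`. -/
theorem sum_antidiagonal_odd {M : Type*} [AddCommMonoid M] (p m : ℕ) (hp : Odd p) (hm : Odd m)
    (f : ℕ → ℕ → M) (h1 : ∀ a b, Odd a → a < p → f a b = 0)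
    (h2 : ∀ a b, Odd b → b < p → f a b = 0) :
    ∑ q ∈ Finset.HasAntidiagonal.antidiagonal m, f q.1 q.2 =
      if p ≤ m then
        ∑ q ∈ Finset.HasAntidiagonal.antidiagonal ((m - p) / 2), f (2 * q.1 + p) (2 * q.2) +
        ∑ q ∈ Finset.HasAntidiagonal.antidiagonal ((m - p) / 2), f (2 * q.1) (2 * q.2 + p)
      else 0 := by
  obtain ⟨c, rfl⟩ := hp
  obtain ⟨d, rfl⟩ := hm
  split_ifs with hj
  · rw [← Finset.sum_filter_add_sum_filter_not _ (fun q => q.1 % 2 = 1)]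
    congr 1
    · symm
      refine Finset.sum_of_injOn (fun q => (2 * q.1 + (2 * c + 1), 2 * q.2)) ?_ ?_ ?_ ?_
      · rintro ⟨a, b⟩ _ ⟨a', b'⟩ _ h
        simp only [Prod.mk.injEq] at h ⊢
        omega
      · rintro ⟨a, b⟩ hq
        simp only [Finset.mem_coe, Finset.mem_filter, Finset.HasAntidiagonal.mem_antidiagonal]
          at hq ⊢
        omega
      · rintro ⟨a, b⟩ hq hn
        simp only [Finset.mem_filter, Finset.HasAntidiagonal.mem_antidiagonal] at hq
        by_cases ha : a < 2 * c + 1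
        · exact h1 _ _ (Nat.odd_iff.mpr (by omega)) ha
        · refine absurd ⟨((a - (2 * c + 1)) / 2, b / 2), ?_, ?_⟩ hn
          · simp only [Finset.mem_coe, Finset.HasAntidiagonal.mem_antidiagonal]; omega
          · simp only [Prod.mk.injEq]; omega
      · rintro ⟨a, b⟩ _; rfl
    · symm
      refine Finset.sum_of_injOn (fun q => (2 * q.1, 2 * q.2 + (2 * c + 1))) ?_ ?_ ?_ ?_
      · rintro ⟨a, b⟩ _ ⟨a', b'⟩ _ h
        simp only [Prod.mk.injEq] at h ⊢
        omega
      · rintro ⟨a, b⟩ hq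
        simp only [Finset.mem_coe, Finset.mem_filter, Finset.HasAntidiagonal.mem_antidiagonal]
          at hq ⊢
        omega
      · rintro ⟨a, b⟩ hq hn
        simp only [Finset.mem_filter, Finset.HasAntidiagonal.mem_antidiagonal] at hq
        by_cases hb : b < 2 * c + 1
        · exact h2 _ _ (Nat.odd_iff.mpr (by omega)) hb
        · refine absurd ⟨(a / 2, (b - (2 * c + 1)) / 2), ?_, ?_⟩ hn
          · simp only [Finset.mem_coe, Finset.HasAntidiagonal.mem_antidiagonal]; omega
          · simp only [Prod.mk.injEq]; omega
      · rintro ⟨a, b⟩ _; rfl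
  · refine Finset.sum_eq_zero ?_
    rintro ⟨a, b⟩ hq
    simp only [Finset.HasAntidiagonal.mem_antidiagonal] at hq
    by_cases ha : a % 2 = 1
    · exact h1 _ _ (Nat.odd_iff.mpr ha) (by omega)
    · exact h2 _ _ (Nat.odd_iff.mpr (by omega)) (by omega)

end Divided

section DividedSequences

variable (k : Type*) [Field k] (p : ℕ) [Fact p.Prime] [CharP k p] (r s : ℕ)

theorem delta_theta_pow (m : ℕ) : delta k p r s (thetaE k p r s ^ m) = 0 := by
  induction m with
  | zero => rw [pow_zero, delta_one]
  | succ m ih => rw [pow_succ, delta_mul, ih, delta_theta, mul_zero, zero_mul, add_zero]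

theorem evenIncl_pow (x : MEven k p r s) (m : ℕ) :
    evenIncl k p r s (x ^ m) = evenIncl k p r s x ^ m :=
  map_pow (TrivSqZeroExt.inlAlgHom k (MEven k p r s) (MEven k p r s)) x m

theorem theta_pow (m : ℕ) : theta k p r s ^ m = evenIncl k p r s (thetaE k p r s ^ m) :=
  (evenIncl_pow k p r s _ m).symm

theorem theta_pow_top : theta k p r s ^ p ^ (r - 1) = sigma k p r s 1 := by
  rw [theta_pow, thetaE_pow, sigma]

theorem counit_one : Coalgebra.counit (R := k) (1 : MAlg k p r s) = 1 :=
  map_one (counitE k p r s)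

/-- The powers of `θ ^ (p ^ a)` form, divided by factorials, a sequence of divided powers. -/
theorem isDividedSeq_theta (a : ℕ) : IsDividedSeq k p
    fun j => ((j.factorial : k))⁻¹ • (theta k p r s ^ p ^ a) ^ j where
  zero := by simp
  comul m hm := by
    have hf : ∀ j ≤ m, (j.factorial : k) ≠ 0 := fun j hj h => by
      rw [CharP.cast_eq_zero_iff k p, (Fact.out : p.Prime).dvd_factorial] at h
      omega
    rw [map_smul, ← pow_mul, theta_pow, comul_evenIncl, delta_theta_pow, map_zero, map_zero,
      add_zero, pow_mul, map_pow (comulE k p r s), map_pow (comulE k p r s), comulE_theta,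
      add_pow_charP k p,
      Algebra.TensorProduct.tmul_pow, Algebra.TensorProduct.tmul_pow, one_pow,
      (Commute.all _ _).add_pow', map_sum, Finset.smul_sum]
    refine Finset.sum_congr rfl fun q hq => ?_
    have hq := Finset.HasAntidiagonal.mem_antidiagonal.mp hq
    rw [Algebra.TensorProduct.tmul_pow, Algebra.TensorProduct.tmul_pow, one_pow, one_pow,
      Algebra.TensorProduct.tmul_mul_tmul, one_mul, mul_one, map_nsmul, TensorProduct.map_tmul,
      evenIncl_pow k p r s _ q.1, evenIncl_pow k p r s _ q.2, ← theta_pow, TensorProduct.smul_tmul_smul,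
      ← Nat.cast_smul_eq_nsmul k, smul_smul]
    congr 1
    have h := Nat.add_choose_mul_factorial_mul_factorial q.1 q.2
    rw [hq, ← Nat.choose_symm_of_eq_add hq.symm] at h
    have h' := congrArg (Nat.cast (R := k)) h
    push_cast at h'
    have := hf m le_rfl
    have := hf q.1 (by omega)
    have := hf q.2 (by omega)
    field_simp
    rw [← h']

/-- The sequence with `g_{2j} = σ_j` and `g_{2j+p} = σ_j τ`; its other terms are zero. Both sums in
the comultiplication of `σ_i` are then sums over pairs of indices with total `2 i`, so that this is a
sequence of divided powers. -/
def sigmaTau (n : ℕ) : MAlg k p r s :=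
  if n % 2 = 0 then sigma k p r s (n / 2)
  else if p ≤ n then oddIncl k p r s (sigmaE k p r s ((n - p) / 2)) else 0

theorem sigmaTau_even (j : ℕ) : sigmaTau k p r s (2 * j) = sigma k p r s j := by
  rw [sigmaTau, if_pos (by omega), Nat.mul_div_cancel_left _ (by omega)]

variable {p} in
theorem sigmaTau_odd (hp : Odd p) (j : ℕ) :
    sigmaTau k p r s (2 * j + p) = oddIncl k p r s (sigmaE k p r s j) := by
  obtain ⟨c, rfl⟩ := hp
  rw [sigmaTau, if_neg (by omega), if_pos (by omega), Nat.add_sub_cancel,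
    Nat.mul_div_cancel_left _ (by omega)]

theorem sigmaTau_eq_zero (n : ℕ) (hn : Odd n) (h : n < p) : sigmaTau k p r s n = 0 := by
  rw [sigmaTau, if_neg (by rw [Nat.odd_iff] at hn; omega), if_neg (by omega)]

variable {p}

theorem isDividedSeq_sigmaTau (hp : Odd p) : IsDividedSeq k (2 * p ^ s) (sigmaTau k p r s) where
  zero := by
    rw [← mul_zero 2, sigmaTau_even, sigma, sigmaE_zero, evenIncl_one]
  comul m hm := by
    have h1 : ∀ a b, Odd a → a < p →
        sigmaTau k p r s a ⊗ₜ[k] sigmaTau k p r s b = 0 := fun a b ha ha' => by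
      rw [sigmaTau_eq_zero k p r s a ha ha', TensorProduct.zero_tmul]
    have h2 : ∀ a b, Odd b → b < p →
        sigmaTau k p r s a ⊗ₜ[k] sigmaTau k p r s b = 0 := fun a b hb hb' => by
      rw [sigmaTau_eq_zero k p r s b hb hb', TensorProduct.tmul_zero]
    rcases Nat.even_or_odd' m with ⟨j, rfl | rfl⟩
    · rw [sum_antidiagonal_even p j hp _ h1 h2, sigmaTau_even, comul_sigma k p r s j (by omega)]
      simp only [sigmaTau_even, sigmaTau_odd k r s hp, oddIncl_eq, sigma]
    · rw [sum_antidiagonal_odd p _ hp ⟨j, rfl⟩ _ h1 h2]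
      split_ifs with h
      · obtain ⟨c, hc⟩ := hp
        obtain ⟨d, rfl⟩ : ∃ d, j = d + c := ⟨j - c, by omega⟩
        have e : (2 * (d + c) + 1 - p) / 2 = d := by omega
        have e' : 2 * (d + c) + 1 = 2 * d + p := by omega
        rw [e, e']
        simp only [sigmaTau_even, sigmaTau_odd k r s ⟨c, hc⟩]
        rw [comul_oddIncl, comulE_sigma, if_pos (by omega), sigmaSum, map_sum, map_sum]
        rfl
      · rw [sigmaTau_eq_zero k p r s _ ⟨j, rfl⟩ (by omega), map_zero]

theorem xCochain_eq (i : ℕ) : xCochain k p r s (i + 1) = ((p - 1).factorial : k) •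
    pairCochain k (fun j => ((j.factorial : k))⁻¹ • (theta k p r s ^ p ^ i) ^ j) p := by
  rw [xCochain, pairCochain_eq, Finset.smul_sum]
  refine Finset.sum_congr rfl fun j _ => ?_
  rw [Nat.add_sub_cancel, map_smul, map_smul, smul_mul_smul_comm, smul_smul, div_eq_mul_inv,
    mul_inv]

theorem wCochain_eq [NeZero s] (hp : Odd p) :
    wCochain k p r s = -pairCochain k (sigmaTau k p r s) (2 * p ^ s) := by
  have hps : p ≤ p ^ s := Nat.le_self_pow (NeZero.ne s) p
  have h0 : reduced (sigmaTau k p r s) 0 = 0 := if_pos rfl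
  have hodd : ∀ b, Odd b → b < p → reduced (sigmaTau k p r s) b = 0 := fun b hb hb' => by
    rw [reduced, sigmaTau_eq_zero k p r s b hb hb', ite_self]
  rw [wCochain, pairCochain, sum_antidiagonal_even p (p ^ s) hp
    (fun a b => inj k _ (reduced (sigmaTau k p r s) a) * inj k _ (reduced (sigmaTau k p r s) b)),
    if_pos hps]
  · congr 2
    · symm
      refine sum_antidiagonal_reduced (p ^ s)
        (fun a b => inj k _ (reduced (sigmaTau k p r s) (2 * a)) *
          inj k _ (reduced (sigmaTau k p r s) (2 * b)))
        (fun a b => inj k _ (sigma k p r s a) * inj k _ (sigma k p r s b)) ?_ ?_ ?_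
      · intro b; simp [h0]
      · intro a; simp [h0]
      · intro a b ha hb
        have ha' : 2 * a ≠ 0 := by omega
        have hb' : 2 * b ≠ 0 := by omega
        simp only [reduced, if_neg ha', if_neg hb', sigmaTau_even]
    · have hp0 : ∀ a, 2 * a + p ≠ 0 := fun a => by
        have := (Fact.out : p.Prime).pos; omega
      simp only [reduced, if_neg (hp0 _), sigmaTau_odd k r s hp, oddIncl_eq, sigma]
  · intro a b ha ha'
    rw [hodd a ha ha', map_zero, zero_mul]
  · intro a b hb hb'
    rw [hodd b hb hb', map_zero, mul_zero]

end DividedSequences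

/-! ### Generators of the cohomology ring of `M_{r;s}` -/

section Tower

variable {k : Type*} [Field k] {p : ℕ} [Fact p.Prime] [CharP k p] {r s : ℕ}

/-- The operator on `k[M_{r;s}] = E ⊕ E τ` that acts as `g` on both summands. -/
def bothMap (g : MEven k p r s →ₗ[k] MEven k p r s) : MAlg k p r s →ₗ[k] MAlg k p r s :=
  evenIncl k p r s ∘ₗ g ∘ₗ evenProj k p r s + oddIncl k p r s ∘ₗ g ∘ₗ oddProj k p r s

theorem bothMap_even (g : MEven k p r s →ₗ[k] MEven k p r s) (x : MEven k p r s) :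
    bothMap g (evenIncl k p r s x) = evenIncl k p r s (g x) := by
  simp [bothMap, evenProj_even, oddProj_even]

theorem bothMap_odd (g : MEven k p r s →ₗ[k] MEven k p r s) (x : MEven k p r s) :
    bothMap g (oddIncl k p r s x) = oddIncl k p r s (g x) := by
  simp [bothMap, evenProj_odd, oddProj_odd]

theorem bothMap_mul (g g' : MEven k p r s →ₗ[k] MEven k p r s) :
    bothMap (g ∘ₗ g') = bothMap g ∘ₗ bothMap g' := by
  refine MAlg.linear_ext k p r s (fun x => ?_) (fun x => ?_)
  · simp only [LinearMap.comp_apply, bothMap_even]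
  · simp only [LinearMap.comp_apply, bothMap_odd]

theorem comul_bothMap {g : MEven k p r s →ₗ[k] MEven k p r s}
    (hg : ∀ x, comulE k p r s (g x) = g.lTensor _ (comulE k p r s x))
    (hδ : ∀ x, delta k p r s (g x) = g (delta k p r s x)) (c : MAlg k p r s) :
    Coalgebra.comul (R := k) (bothMap g c) = (bothMap g).lTensor _ (Coalgebra.comul c) := by
  have h : ∀ f : MEven k p r s →ₗ[k] MAlg k p r s, ∀ y : MEven k p r s ⊗[k] MEven k p r s,
      (bothMap g).lTensor _ (TensorProduct.map f (evenIncl k p r s) y) =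
        TensorProduct.map f (evenIncl k p r s) (g.lTensor _ y) ∧
      (bothMap g).lTensor _ (TensorProduct.map f (oddIncl k p r s) y) =
        TensorProduct.map f (oddIncl k p r s) (g.lTensor _ y) := by
    intro f y
    induction y with
    | zero => simp
    | add a b ha hb => simp only [map_add, ha.1, hb.1, ha.2, hb.2, and_self]
    | tmul a b =>
      simp only [TensorProduct.map_tmul, LinearMap.lTensor_tmul, bothMap_even, bothMap_odd,
        and_self]
  rw [← even_add_odd k p r s c]
  simp only [map_add, bothMap_even, bothMap_odd, comul_evenIncl, comul_oddIncl, (h _ _).1,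
    (h _ _).2, hg, hδ]

theorem comul_bothMap_contract (φ : MEven k p r s →ₗ[k] k) (c : MAlg k p r s) :
    Coalgebra.comul (R := k) (bothMap (contract φ) c) =
      (bothMap (contract φ)).lTensor _ (Coalgebra.comul c) :=
  comul_bothMap (comulE_contract φ) (delta_contract φ) c

theorem comul_bothMap_lowerU_pow [NeZero s] (n : ℕ) (c : MAlg k p r s) :
    Coalgebra.comul (R := k) (bothMap (lowerU k p r s ^ n) c) =
      (bothMap (lowerU k p r s ^ n)).lTensor _ (Coalgebra.comul c) := by
  refine comul_bothMap ?_ ?_ c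
  · induction n with
    | zero => intro x; simp [Module.End.one_eq_id]
    | succ n ih =>
      intro x
      rw [pow_succ', Module.End.mul_eq_comp, LinearMap.comp_apply, lowerU, comulE_contract,
        ← lowerU, ih, LinearMap.lTensor_comp, LinearMap.comp_apply]
  · induction n with
    | zero => intro x; rfl
    | succ n ih =>
      intro x
      rw [pow_succ', Module.End.mul_apply, Module.End.mul_apply, lowerU, delta_contract,
        ← lowerU, ih]

variable (k p r s) in
/-- The span of the elements `θ ^ i` with `i < n`. -/
def thetaSpan (n : ℕ) : Submodule k (MAlg k p r s) :=
  Submodule.span k ((fun i => evenIncl k p r s (thetaE k p r s ^ i)) '' Set.Iio n)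

variable (k p r s) in
/-- The span of the elements `θ ^ i` and `θ ^ i τ` with `i < n`. -/
def thetaTauSpan (n : ℕ) : Submodule k (MAlg k p r s) :=
  thetaSpan k p r s n ⊔
    Submodule.span k ((fun i => oddIncl k p r s (thetaE k p r s ^ i)) '' Set.Iio n)

theorem theta_mem_thetaSpan {n i : ℕ} (hi : i < n) :
    evenIncl k p r s (thetaE k p r s ^ i) ∈ thetaSpan k p r s n :=
  Submodule.subset_span ⟨i, hi, rfl⟩

theorem thetaSpan_le {n : ℕ} {P : Submodule k (MAlg k p r s)}
    (h : ∀ i < n, evenIncl k p r s (thetaE k p r s ^ i) ∈ P) : thetaSpan k p r s n ≤ P :=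
  Submodule.span_le.mpr (by rintro _ ⟨i, hi, rfl⟩; exact h i hi)

theorem theta_mem_thetaTauSpan {n i : ℕ} (hi : i < n) :
    evenIncl k p r s (thetaE k p r s ^ i) ∈ thetaTauSpan k p r s n :=
  Submodule.mem_sup_left (theta_mem_thetaSpan hi)

theorem thetaTau_mem_thetaTauSpan {n i : ℕ} (hi : i < n) :
    oddIncl k p r s (thetaE k p r s ^ i) ∈ thetaTauSpan k p r s n :=
  Submodule.mem_sup_right (Submodule.subset_span ⟨i, hi, rfl⟩)

theorem thetaTauSpan_le {n : ℕ} {P : Submodule k (MAlg k p r s)}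
    (h : ∀ i < n, evenIncl k p r s (thetaE k p r s ^ i) ∈ P)
    (h' : ∀ i < n, oddIncl k p r s (thetaE k p r s ^ i) ∈ P) : thetaTauSpan k p r s n ≤ P :=
  sup_le (thetaSpan_le h) (Submodule.span_le.mpr (by rintro _ ⟨i, hi, rfl⟩; exact h' i hi))

theorem one_mem_thetaSpan {n : ℕ} (hn : 0 < n) : 1 ∈ thetaSpan k p r s n := by
  have := theta_mem_thetaSpan (k := k) (p := p) (r := r) (s := s) hn
  rwa [pow_zero, evenIncl_one] at this

theorem one_mem_thetaTauSpan {n : ℕ} (hn : 0 < n) : 1 ∈ thetaTauSpan k p r s n :=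
  Submodule.mem_sup_left (one_mem_thetaSpan hn)

theorem isSubcomodule_thetaSpan (n : ℕ) : IsSubcomodule (thetaSpan k p r s n) := by
  refine thetaSpan_le (P := (Submodule.map₂ (TensorProduct.mk k _ _) ⊤
    (thetaSpan k p r s n)).comap (Coalgebra.comul (R := k))) fun i hi => ?_
  rw [Submodule.mem_comap, comul_evenIncl, delta_theta_pow, map_zero, map_zero, add_zero,
    comulE_theta_pow, map_sum]
  refine sum_mem fun l _ => ?_
  rw [map_smul, TensorProduct.map_tmul]
  exact Submodule.smul_mem _ _
    (Submodule.apply_mem_map₂ _ trivial (theta_mem_thetaSpan (by omega)))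

theorem isSubcomodule_thetaTauSpan (n : ℕ) : IsSubcomodule (thetaTauSpan k p r s n) := by
  refine thetaTauSpan_le (P := (Submodule.map₂ (TensorProduct.mk k _ _) ⊤
    (thetaTauSpan k p r s n)).comap (Coalgebra.comul (R := k))) (fun i hi => ?_) (fun i hi => ?_)
  · exact Submodule.map₂_le_map₂_right le_sup_left
      (isSubcomodule_thetaSpan n _ (theta_mem_thetaSpan hi))
  · rw [Submodule.mem_comap, comul_oddIncl, comulE_theta_pow, map_sum, map_sum]
    refine add_mem (sum_mem fun l _ => ?_) (sum_mem fun l _ => ?_)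
    · rw [map_smul, TensorProduct.map_tmul]
      exact Submodule.smul_mem _ _
        (Submodule.apply_mem_map₂ _ trivial (theta_mem_thetaTauSpan (by omega)))
    · rw [map_smul, TensorProduct.map_tmul]
      exact Submodule.smul_mem _ _
        (Submodule.apply_mem_map₂ _ trivial (thetaTau_mem_thetaTauSpan (by omega)))

theorem resDiff_primitive {c : MAlg k p r s}
    (hc : Coalgebra.comul (R := k) c = c ⊗ₜ 1 + 1 ⊗ₜ c) :
    resDiff k (MAlg k p r s) (1 ⊗ₜ c) = (-inj k (MAlg k p r s) c) ⊗ₜ 1 := by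
  rw [resDiff_one_tmul, hc, TensorProduct.tmul_add, map_add, absorb_tmul, absorb_tmul,
    one_mul, one_mul, TensorProduct.neg_tmul]
  abel

theorem diff_primitive {c : MAlg k p r s}
    (hc : Coalgebra.comul (R := k) c = c ⊗ₜ 1 + 1 ⊗ₜ c) :
    diff k (MAlg k p r s) (inj k (MAlg k p r s) c) = 0 := by
  have h : juxt k (MAlg k p r s) (c ⊗ₜ 1 + 1 ⊗ₜ c) = inj k _ c * inj k _ 1 + inj k _ 1 * inj k _ c := by
    simp [juxt]
  rw [diff_inj, hc, h]
  abel

theorem comul_theta_pow (a : ℕ) : Coalgebra.comul (R := k) (theta k p r s ^ p ^ a) =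
    (theta k p r s ^ p ^ a) ⊗ₜ 1 + 1 ⊗ₜ (theta k p r s ^ p ^ a) := by
  rw [theta_pow, comul_evenIncl, delta_theta_pow, map_zero, map_zero, add_zero,
    map_pow (comulE k p r s), comulE_theta, add_pow_charP k p, Algebra.TensorProduct.tmul_pow,
    Algebra.TensorProduct.tmul_pow, one_pow]
  rfl

theorem resDiff_tau : resDiff k (MAlg k p r s) (1 ⊗ₜ tau k p r s) = (-yCochain k p r s) ⊗ₜ 1 :=
  resDiff_primitive (comul_tau k p r s)

theorem diff_yCochain : diff k (MAlg k p r s) (yCochain k p r s) = 0 :=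
  diff_primitive (comul_tau k p r s)

/-- The step from `span {θ ^ i}` to `span {θ ^ i, θ ^ i τ}`. -/
theorem periodicStep_tau [NeZero s] (n : ℕ) (hn : 0 < n) :
    PeriodicStep (thetaTauSpan k p r s n) (thetaSpan k p r s n)
      (evenIncl k p r s ∘ₗ oddProj k p r s) (evenIncl k p r s ∘ₗ oddProj k p r s)
      (oddIncl k p r s ∘ₗ evenProj k p r s) (oddIncl k p r s ∘ₗ evenProj k p r s)
      (-yCochain k p r s) (-(yCochain k p r s * yCochain k p r s)) := by
  set D := evenIncl k p r s ∘ₗ oddProj k p r s with hD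
  set S := oddIncl k p r s ∘ₗ evenProj k p r s with hS
  have De : ∀ x, D (evenIncl k p r s x) = 0 := fun x => by
    rw [hD, LinearMap.comp_apply, oddProj_even, map_zero]
  have Do : ∀ x, D (oddIncl k p r s x) = evenIncl k p r s x := fun x => rfl
  have Se : ∀ x, S (evenIncl k p r s x) = oddIncl k p r s x := fun x => rfl
  have So : ∀ x, S (oddIncl k p r s x) = 0 := fun x => by
    rw [hS, LinearMap.comp_apply, evenProj_odd, map_zero]
  have hD' : thetaTauSpan k p r s n ≤ (thetaSpan k p r s n).comap D :=
    thetaTauSpan_le (fun i _ => by rw [Submodule.mem_comap, De]; exact zero_mem _)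
      (fun i hi => by rw [Submodule.mem_comap, Do]; exact theta_mem_thetaSpan hi)
  have hcom : thetaTauSpan k p r s n ≤
      LinearMap.eqLocus (Coalgebra.comul (R := k) ∘ₗ D) (D.lTensor _ ∘ₗ Coalgebra.comul) := by
    refine thetaTauSpan_le (fun i _ => ?_) (fun i _ => ?_)
    · change Coalgebra.comul (R := k) (D _) = D.lTensor _ (Coalgebra.comul _)
      rw [De, comul_evenIncl, delta_theta_pow, map_zero, map_zero, map_zero, add_zero,
        comulE_theta_pow, map_sum, map_sum]
      symm
      refine Finset.sum_eq_zero fun l _ => ?_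
      rw [map_smul, map_smul, TensorProduct.map_tmul, LinearMap.lTensor_tmul, De,
        TensorProduct.tmul_zero, smul_zero]
    · change Coalgebra.comul (R := k) (D _) = D.lTensor _ (Coalgebra.comul _)
      have h : ∀ y : MEven k p r s ⊗[k] MEven k p r s,
          D.lTensor _ (TensorProduct.map (oddIncl k p r s) (evenIncl k p r s) y) +
          D.lTensor _ (TensorProduct.map (evenIncl k p r s) (oddIncl k p r s) y) =
            TensorProduct.map (evenIncl k p r s) (evenIncl k p r s) y := by
        intro y
        induction y with
        | zero => simp
        | add a b ha hb => simp only [map_add, ← ha, ← hb]; abel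
        | tmul a b =>
          simp only [TensorProduct.map_tmul, LinearMap.lTensor_tmul, De, Do,
            TensorProduct.tmul_zero, zero_add]
      rw [Do, comul_evenIncl, delta_theta_pow, map_zero, map_zero, add_zero, comul_oddIncl,
        map_add, h]
  have hone : (1 : MAlg k p r s) = evenIncl k p r s 1 := rfl
  refine
    { le := le_sup_left
      comodule := isSubcomodule_thetaTauSpan n
      one_mem := one_mem_thetaSpan hn
      D_mem := fun c hc => Submodule.mem_sup_left (hD' hc)
      L_mem := hD'
      S_mem := ?_
      T_mem := ?_
      D_comul := hcom
      L_comul := hcom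
      D_eq_zero := ?_
      sub_S_D := ?_
      D_S := ?_
      L_T := ?_
      L_D := ?_
      L_one := by rw [hone, De]
      exists_f := ⟨tau k p r s, ?_, rfl, resDiff_tau⟩
      exists_h := ⟨-(yCochain k p r s ⊗ₜ tau k p r s), ?_, ?_, ?_⟩ }
  · exact thetaTauSpan_le (P := (thetaTauSpan k p r s n).comap S)
      (fun i hi => thetaTau_mem_thetaTauSpan hi)
      (fun i hi => by rw [Submodule.mem_comap, So]; exact zero_mem _)
  · exact thetaSpan_le (P := (thetaTauSpan k p r s n).comap S)
      (fun i hi => thetaTau_mem_thetaTauSpan hi)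
  · exact thetaSpan_le (P := LinearMap.ker D) (fun i _ => De _)
  · exact thetaTauSpan_le (P := (thetaSpan k p r s n).comap (LinearMap.id - S ∘ₗ D))
      (fun i hi => by
        rw [Submodule.mem_comap, LinearMap.sub_apply, LinearMap.comp_apply, De, map_zero, sub_zero]
        exact theta_mem_thetaSpan hi)
      (fun i hi => by
        rw [Submodule.mem_comap, LinearMap.sub_apply, LinearMap.comp_apply, Do, Se,
          LinearMap.id_apply, sub_self]
        exact zero_mem _)
  · intro c _
    conv_lhs => rw [← even_add_odd k p r s c]
    rfl
  · exact thetaSpan_le (P := LinearMap.eqLocus (D ∘ₗ S) LinearMap.id) (fun i _ => rfl)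
  · intro c _; exact De _
  · have := thetaTau_mem_thetaTauSpan (k := k) (p := p) (r := r) (s := s) hn
    rwa [pow_zero] at this
  · refine neg_mem (tmul_mem_resFilt (inj_mem_filt _) ?_)
    have := thetaTau_mem_thetaTauSpan (k := k) (p := p) (r := r) (s := s) hn
    rwa [pow_zero] at this
  · rw [hone, Se, ← tau, resDiff_tau, map_neg, LinearMap.lTensor_tmul, tau, Do,
      TensorProduct.neg_tmul, hone]
  · have h : yCochain k p r s ⊗ₜ[k] tau k p r s = yCochain k p r s • (1 ⊗ₜ tau k p r s) := by
      rw [TensorProduct.smul_tmul', smul_eq_mul, mul_one]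
    rw [map_neg, h, resDiff_smul, diff_yCochain, zero_smul, zero_add, resDiff_tau,
      TensorProduct.smul_tmul', smul_eq_mul, yCochain, sgn_inj, neg_mul_neg,
      TensorProduct.neg_tmul]

end Tower

section DividedShift

variable {k : Type*} [Field k] {C : Type*} [Ring C] [Algebra k C] [Coalgebra k C]

/-- An operator that lowers the index of a sequence of divided powers by `m` maps `pairRes g n` to
a coboundary. -/
theorem IsDividedSeq.lTensor_pairRes {n : ℕ} {g : ℕ → C} (hg : IsDividedSeq k n g)
    {D : C →ₗ[k] C} {m : ℕ} (h0 : 0 < m) (hm : m ≤ n)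
    (hD : ∀ b, 1 ≤ b → b < n → D (g b) = if m ≤ b then g (b - m) else 0) :
    D.lTensor _ (pairRes k g n) = -resDiff k C (1 ⊗ₜ g (n - m)) := by
  rw [hg.resDiff_one_tmul _ (by omega), neg_neg, pairRes, map_sum]
  have h := sum_shift m n (fun b a => inj k C (reduced g a) ⊗ₜ[k] g b)
  rw [if_pos hm, ← Finset.Nat.sum_antidiagonal_swap] at h
  conv_rhs at h => rw [← Finset.Nat.sum_antidiagonal_swap]
  refine Eq.trans ?_ h
  refine Finset.sum_congr rfl fun q hq => ?_
  have hq := Finset.HasAntidiagonal.mem_antidiagonal.mp hq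
  rw [LinearMap.lTensor_tmul]
  dsimp only [Prod.swap]
  by_cases h1 : q.1 = 0
  · rw [reduced, if_pos h1, map_zero, TensorProduct.zero_tmul, TensorProduct.zero_tmul, ite_self]
  by_cases h2 : q.2 = 0
  · rw [reduced.eq_1 g q.2, if_pos h2, map_zero, TensorProduct.tmul_zero, if_neg (by omega)]
  · rw [reduced.eq_1 g q.2, if_neg h2, hD _ (by omega) (by omega)]
    split_ifs
    · rfl
    · rw [TensorProduct.tmul_zero]

end DividedShift

section SigmaStep

variable {k : Type*} [Field k] {p : ℕ} [Fact p.Prime] [CharP k p] {r s : ℕ} [NeZero s]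

variable (k p r s) in
/-- Raising the index of `σ`, a right inverse of `lowerU` away from the top. -/
def raiseU : MEven k p r s →ₗ[k] MEven k p r s :=
  evenConstr k p r s fun i j =>
    if j + 1 < p ^ s then thetaE k p r s ^ i * sigmaE k p r s (j + 1) else 0

variable (k p r s) in
/-- The map `θ ^ i ↦ θ ^ i σ_j`, where `j = p ^ s - 1`. -/
def raiseTop : MEven k p r s →ₗ[k] MEven k p r s :=
  evenConstr k p r s fun i j =>
    if j = 0 then thetaE k p r s ^ i * sigmaE k p r s (p ^ s - 1) else 0

theorem raiseTop_theta (i : ℕ) (hi : i < p ^ (r - 1)) :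
    raiseTop k p r s (thetaE k p r s ^ i) = thetaE k p r s ^ i * sigmaE k p r s (p ^ s - 1) := by
  have h := evenConstr_apply (k := k) (s := s) (fun i j =>
    if j = 0 then thetaE k p r s ^ i * sigmaE k p r s (p ^ s - 1) else 0) i 0 hi
    (pow_pos (Fact.out : p.Prime).pos s)
  rwa [sigmaE_zero, mul_one, if_pos rfl] at h

theorem mem_of_basis {P : Submodule k (MAlg k p r s)} {f : MAlg k p r s →ₗ[k] MAlg k p r s}
    (h : ∀ i j, i < p ^ (r - 1) → j < p ^ s →
      f (evenIncl k p r s (thetaE k p r s ^ i * sigmaE k p r s j)) ∈ P)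
    (h' : ∀ i j, i < p ^ (r - 1) → j < p ^ s →
      f (oddIncl k p r s (thetaE k p r s ^ i * sigmaE k p r s j)) ∈ P) (c : MAlg k p r s) :
    f c ∈ P := by
  rw [← Submodule.Quotient.mk_eq_zero]
  have e : P.mkQ ∘ₗ f = 0 := by
    refine MAlg.linear_ext k p r s
      (fun x => DFunLike.congr_fun (f := P.mkQ ∘ₗ f ∘ₗ evenIncl k p r s) (g := 0) ?_ x)
      (fun x => DFunLike.congr_fun (f := P.mkQ ∘ₗ f ∘ₗ oddIncl k p r s) (g := 0) ?_ x)
    · exact even_linear_ext fun i j hi hj => (Submodule.Quotient.mk_eq_zero P).mpr (h i j hi hj)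
    · exact even_linear_ext fun i j hi hj => (Submodule.Quotient.mk_eq_zero P).mpr (h' i j hi hj)
  exact DFunLike.congr_fun e c

/-- It suffices to check a property of `bothMap f` on the even part. -/
theorem bothMap_mem {f : MEven k p r s →ₗ[k] MEven k p r s} {n : ℕ} 
    (h : ∀ i j, i < p ^ (r - 1) → j < p ^ s →
      f (thetaE k p r s ^ i * sigmaE k p r s j) = 0 ∨
      ∃ l < n, f (thetaE k p r s ^ i * sigmaE k p r s j) = thetaE k p r s ^ l) (c : MAlg k p r s) :
    bothMap f c ∈ thetaTauSpan k p r s n := by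
  refine mem_of_basis (fun i j hi hj => ?_) (fun i j hi hj => ?_) c
  · rw [bothMap_even]
    rcases h i j hi hj with h | ⟨l, hl, h⟩
    · rw [h, map_zero]; exact zero_mem _
    · rw [h]; exact theta_mem_thetaTauSpan hl
  · rw [bothMap_odd]
    rcases h i j hi hj with h | ⟨l, hl, h⟩
    · rw [h, map_zero]; exact zero_mem _
    · rw [h]; exact thetaTau_mem_thetaTauSpan hl

theorem bothMap_id : bothMap (LinearMap.id : MEven k p r s →ₗ[k] MEven k p r s) = LinearMap.id :=
  LinearMap.ext fun c => even_add_odd k p r s c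

theorem bothMap_sub (f g : MEven k p r s →ₗ[k] MEven k p r s) :
    bothMap (f - g) = bothMap f - bothMap g := by
  refine MAlg.linear_ext k p r s (fun x => ?_) (fun x => ?_)
  · simp only [LinearMap.sub_apply, bothMap_even, map_sub]
  · simp only [LinearMap.sub_apply, bothMap_odd, map_sub]

theorem bothMap_add (f g : MEven k p r s →ₗ[k] MEven k p r s) :
    bothMap (f + g) = bothMap f + bothMap g := by
  refine MAlg.linear_ext k p r s (fun x => ?_) (fun x => ?_)
  · simp only [LinearMap.add_apply, bothMap_even, map_add]
  · simp only [LinearMap.add_apply, bothMap_odd, map_add]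

theorem bothMap_zero : bothMap (0 : MEven k p r s →ₗ[k] MEven k p r s) = 0 := by
  simp [bothMap]

theorem bothMap_one (f : MEven k p r s →ₗ[k] MEven k p r s) :
    bothMap f 1 = evenIncl k p r s (f 1) :=
  bothMap_even f 1

theorem lowerU_theta (i : ℕ) (hi : i < p ^ (r - 1)) :
    lowerU k p r s (thetaE k p r s ^ i) = 0 := by
  have h := lowerU_theta_sigma (k := k) (s := s) i 0 hi (pow_pos (Fact.out : p.Prime).pos s)
  rwa [sigmaE_zero, mul_one, if_pos rfl] at h

theorem lowerU_sigma (j : ℕ) : lowerU k p r s (sigmaE k p r s j) =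
    if j = 0 ∨ p ^ s ≤ j then 0 else sigmaE k p r s (j - 1) := by
  by_cases hj : j < p ^ s
  · have h := lowerU_theta_sigma (k := k) (s := s) 0 j (pow_pos (Fact.out : p.Prime).pos (r - 1)) hj
    rw [pow_zero, one_mul, one_mul] at h
    rw [h]
    split_ifs <;> first | rfl | omega
  · rw [sigmaE_trunc k p r s j (by omega), map_zero, if_pos (by omega)]

theorem lowerU_sigmaTau (hp : Odd p) (hp3 : 3 ≤ p) (b : ℕ) (h1 : 1 ≤ b) (h2 : b < 2 * p ^ s) :
    bothMap (lowerU k p r s) (sigmaTau k p r s b) =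
      if 2 ≤ b then sigmaTau k p r s (b - 2) else 0 := by
  have hps : p ≤ p ^ s := Nat.le_self_pow (NeZero.ne s) p
  rcases Nat.even_or_odd' b with ⟨j, rfl | rfl⟩
  · rw [sigmaTau_even, sigma, bothMap_even, lowerU_sigma, if_neg (by omega), if_pos (by omega),
      show 2 * j - 2 = 2 * (j - 1) by omega, sigmaTau_even, sigma]
  · by_cases hb : 2 * j + 1 < p
    · rw [sigmaTau_eq_zero k p r s _ ⟨j, rfl⟩ hb, map_zero]
      split_ifs with h
      · rw [sigmaTau_eq_zero k p r s _ (Nat.odd_iff.mpr (by omega)) (by omega)]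
      · rfl
    · obtain ⟨c, hc⟩ := id hp
      obtain ⟨d, rfl⟩ : ∃ d, j = d + c := ⟨j - c, by omega⟩
      rw [show 2 * (d + c) + 1 = 2 * d + p by omega, sigmaTau_odd k r s hp, bothMap_odd,
        lowerU_sigma, if_pos (show 2 ≤ 2 * d + p by omega)]
      rcases Nat.eq_zero_or_pos d with rfl | hd
      · rw [if_pos (Or.inl rfl), map_zero,
          sigmaTau_eq_zero k p r s _ (Nat.odd_iff.mpr (by omega)) (by omega)]
      · rw [if_neg (by omega), show 2 * d + p - 2 = 2 * (d - 1) + p by omega,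
          sigmaTau_odd k r s hp]

/-- The step from `span {θ ^ i, θ ^ i τ}` to the whole algebra. -/
theorem periodicStep_sigma [NeZero r] (hp : Odd p) (hp3 : 3 ≤ p) :
    PeriodicStep (⊤ : Submodule k (MAlg k p r s)) (thetaTauSpan k p r s (p ^ (r - 1)))
      (bothMap (lowerU k p r s)) (bothMap (lowerU k p r s ^ (p ^ s - 1)))
      (bothMap (raiseU k p r s)) (bothMap (raiseTop k p r s))
      (-lambdaCochain k p r s r) (wCochain k p r s) := by
  have hps : p ≤ p ^ s := Nat.le_self_pow (NeZero.ne s) p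
  have hr : 0 < p ^ (r - 1) := pow_pos (Fact.out : p.Prime).pos (r - 1)
  have hthe : ∀ i, thetaE k p r s ^ i = thetaE k p r s ^ i * sigmaE k p r s 0 := fun i => by
    rw [sigmaE_zero, mul_one]
  have hS : ∀ i j, i < p ^ (r - 1) → j < p ^ s →
      raiseU k p r s (thetaE k p r s ^ i * sigmaE k p r s j) =
        if j + 1 < p ^ s then thetaE k p r s ^ i * sigmaE k p r s (j + 1) else 0 :=
    fun i j hi hj => evenConstr_apply _ i j hi hj
  have hker : thetaTauSpan k p r s (p ^ (r - 1)) ≤ LinearMap.ker (bothMap (lowerU k p r s)) :=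
    thetaTauSpan_le
      (fun i hi => by rw [LinearMap.mem_ker, bothMap_even, lowerU_theta i hi, map_zero])
      (fun i hi => by rw [LinearMap.mem_ker, bothMap_odd, lowerU_theta i hi, map_zero])
  have hsub : ∀ c, c - bothMap (raiseU k p r s) (bothMap (lowerU k p r s) c) =
      bothMap (LinearMap.id - raiseU k p r s ∘ₗ lowerU k p r s) c := fun c => by
    rw [bothMap_sub, bothMap_id, bothMap_mul]; rfl
  refine
    { le := le_top
      comodule := fun c _ => ?_
      one_mem := one_mem_thetaTauSpan hr
      D_mem := fun _ _ => trivial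
      L_mem := fun c _ => bothMap_mem (fun i j hi hj => ?_) c
      S_mem := fun _ _ => trivial
      T_mem := fun _ _ => trivial
      D_comul := fun c _ => comul_bothMap_contract _ c
      L_comul := fun c _ => comul_bothMap_lowerU_pow _ c
      D_eq_zero := hker
      sub_S_D := fun c _ => ?_
      D_S := fun c _ => ?_
      L_T := ?_
      L_D := fun c _ => ?_
      L_one := ?_
      exists_f := ⟨sigma k p r s 1, trivial, ?_, ?_⟩
      exists_h := ⟨-pairRes k (sigmaTau k p r s) (2 * p ^ s), ?_, ?_, ?_⟩ }
  · rw [TensorProduct.map₂_mk_top_top_eq_top]; trivial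
  · rw [lowerU_pow_theta_sigma _ _ _ hi hj]
    split_ifs with h
    · rw [show j - (p ^ s - 1) = 0 by omega, sigmaE_zero, mul_one]
      exact Or.inr ⟨i, hi, rfl⟩
    · exact Or.inl rfl
  · rw [hsub]
    refine bothMap_mem (fun i j hi hj => ?_) c
    rw [LinearMap.sub_apply, LinearMap.comp_apply, lowerU_theta_sigma _ _ hi hj]
    split_ifs with h
    · rw [map_zero, sub_zero, h, sigmaE_zero, mul_one]
      exact Or.inr ⟨i, hi, rfl⟩
    · rw [hS _ _ hi (by omega), if_pos (by omega), show j - 1 + 1 = j by omega]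
      exact Or.inl (sub_self _)
  · have e : LinearMap.id = lowerU k p r s ∘ₗ raiseU k p r s +
        raiseTop k p r s ∘ₗ (lowerU k p r s ^ (p ^ s - 1)) := by
      refine even_linear_ext fun i j hi hj => ?_
      rw [LinearMap.add_apply, LinearMap.comp_apply, LinearMap.comp_apply, hS _ _ hi hj,
        lowerU_pow_theta_sigma _ _ _ hi hj, LinearMap.id_apply]
      split_ifs with h h' h'
      · omega
      · rw [map_zero, add_zero, lowerU_theta_sigma _ _ hi h, if_neg (by omega), Nat.add_sub_cancel]
      · rw [map_zero, zero_add, show j - (p ^ s - 1) = 0 by omega, ← hthe, raiseTop_theta i hi,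
          show p ^ s - 1 = j by omega]
      · omega
    have h := congrArg bothMap e
    rw [bothMap_id, bothMap_add, bothMap_mul, bothMap_mul] at h
    exact DFunLike.congr_fun h c
  · have key : ∀ i < p ^ (r - 1), (lowerU k p r s ^ (p ^ s - 1))
        (raiseTop k p r s (thetaE k p r s ^ i)) = thetaE k p r s ^ i := fun i hi => by
      rw [raiseTop_theta i hi, lowerU_pow_theta_sigma _ _ _ hi (by omega), if_pos le_rfl,
        Nat.sub_self, ← hthe]
    exact thetaTauSpan_le (P := LinearMap.eqLocus (bothMap (lowerU k p r s ^ (p ^ s - 1)) ∘ₗ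
        bothMap (raiseTop k p r s)) LinearMap.id)
      (fun i hi => by
        change bothMap _ (bothMap _ _) = _
        rw [bothMap_even, bothMap_even, key i hi]; rfl)
      (fun i hi => by
        change bothMap _ (bothMap _ _) = _
        rw [bothMap_odd, bothMap_odd, key i hi]; rfl)
  · have e : (lowerU k p r s ^ (p ^ s - 1)) ∘ₗ lowerU k p r s = 0 := by
      refine even_linear_ext fun i j hi hj => ?_
      rw [LinearMap.comp_apply, lowerU_theta_sigma _ _ hi hj]
      split_ifs with h
      · exact map_zero _
      · rw [lowerU_pow_theta_sigma _ _ _ hi (by omega), if_neg (by omega)]; rfl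
    have h := congrArg bothMap e
    rw [bothMap_mul, bothMap_zero] at h
    exact DFunLike.congr_fun h c
  · have h := lowerU_pow_theta_sigma (k := k) (s := s) (p ^ s - 1) 0 0 hr (by omega)
    rw [pow_zero, one_mul, sigmaE_zero, if_neg (by omega)] at h
    rw [bothMap_one, h, map_zero]
  · rw [sigma, bothMap_even, lowerU_sigma, if_neg (by omega), Nat.sub_self, sigmaE_zero]; rfl
  · rw [lambdaCochain, ← theta_pow_top]
    exact resDiff_primitive (comul_theta_pow _)
  · exact neg_mem (pairRes_mem _ _ fun _ _ _ => trivial)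
  · have hT : bothMap (raiseTop k p r s) 1 = sigmaTau k p r s (2 * p ^ s - 2) := by
      have h := raiseTop_theta (k := k) (s := s) 0 hr
      rw [pow_zero, one_mul] at h
      rw [bothMap_one, h, show 2 * p ^ s - 2 = 2 * (p ^ s - 1) by omega, sigmaTau_even, sigma]
    rw [hT, map_neg, (isDividedSeq_sigmaTau k r s hp).lTensor_pairRes (m := 2) (by omega)
      (by omega) (lowerU_sigmaTau hp hp3), neg_neg]
  · rw [map_neg, (isDividedSeq_sigmaTau k r s hp).resDiff_pairRes, wCochain_eq k r s hp,
      TensorProduct.neg_tmul]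

end SigmaStep

section ThetaStep

variable {k : Type*} [Field k] {p : ℕ} [Fact p.Prime] [CharP k p] {r s : ℕ} [NeZero s]

variable (k) in
/-- Lucas' theorem for a lower index divisible by `p ^ a`. -/
theorem choose_pow_mul (i a m : ℕ) : (i.choose (p ^ a * m) : k) = (i / p ^ a).choose m := by
  have h := Choose.choose_modEq_choose_mul_prod_range_choose (p := p) (n := i) (k := p ^ a * m) a
  have h0 : ∏ j ∈ Finset.range a, (i / p ^ j % p).choose (p ^ a * m / p ^ j % p) = 1 := by
    refine Finset.prod_eq_one fun j hj => ?_
    obtain ⟨c, rfl⟩ : ∃ c, a = j + (c + 1) := ⟨a - j - 1, by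
      have := Finset.mem_range.mp hj
      omega⟩
    have hp : 0 < p ^ j := pow_pos (Fact.out : p.Prime).pos j
    rw [pow_add, mul_assoc, Nat.mul_div_cancel_left _ hp, pow_succ', mul_assoc, Nat.mul_mod_right,
      Nat.choose_zero_right]
  rw [Nat.mul_div_cancel_left _ (pow_pos (Fact.out : p.Prime).pos a)] at h
  have h' := (CharP.intCast_eq_intCast k p).mpr h
  push_cast at h'
  have h0' := congrArg (Nat.cast (R := k)) h0
  push_cast at h0'
  rw [h', h0', mul_one]

theorem contract_phi_theta_pow (i a m : ℕ) (hi : i < p ^ (r - 1)) :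
    contract (phi k p r s (p ^ a * m)) (thetaE k p r s ^ i) =
      ((i / p ^ a).choose m : k) • thetaE k p r s ^ (i - p ^ a * m) := by
  rw [contract_phi_theta _ _ (by omega), choose_pow_mul]

variable (k p r s) in
/-- A right inverse of the operator `θ ^ i ↦ ⌊i / p ^ a⌋ θ ^ (i - p ^ a)` away from the top. -/
def raiseTheta (a : ℕ) : MEven k p r s →ₗ[k] MEven k p r s :=
  evenConstr k p r s fun i _ =>
    if i / p ^ a + 1 < p then ((i / p ^ a + 1 : ℕ) : k)⁻¹ • thetaE k p r s ^ (i + p ^ a) else 0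

variable (k p r s) in
/-- The map `θ ^ i ↦ θ ^ (i + p ^ a (p - 1))`. -/
def raiseThetaTop (a : ℕ) : MEven k p r s →ₗ[k] MEven k p r s :=
  evenConstr k p r s fun i _ => thetaE k p r s ^ (i + p ^ a * (p - 1))

theorem evenConstr_theta (f : ℕ → ℕ → MEven k p r s) (i : ℕ) (hi : i < p ^ (r - 1)) :
    evenConstr k p r s f (thetaE k p r s ^ i) = f i 0 := by
  have h := evenConstr_apply f i 0 hi (pow_pos (Fact.out : p.Prime).pos s)
  rwa [sigmaE_zero, mul_one] at h

theorem choose_pred (hp : 0 < p) {u : ℕ} (hu : u < p) :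
    u.choose (p - 1) = if u = p - 1 then 1 else 0 := by
  split_ifs with h
  · rw [h, Nat.choose_self]
  · exact Nat.choose_eq_zero_of_lt (by omega)

/-- The step from `span {θ ^ i | i < p ^ a}` to `span {θ ^ i | i < p ^ (a + 1)}`. -/
theorem periodicStep_theta (a : ℕ) (ha : a + 1 ≤ r - 1) :
    PeriodicStep (thetaSpan k p r s (p ^ (a + 1))) (thetaSpan k p r s (p ^ a))
      (bothMap (contract (phi k p r s (p ^ a * 1))))
      (bothMap (contract (phi k p r s (p ^ a * (p - 1)))))
      (bothMap (raiseTheta k p r s a)) (bothMap (raiseThetaTop k p r s a))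
      (-lambdaCochain k p r s (a + 1)) (-xCochain k p r s (a + 1)) := by
  have hp1 : 1 < p := (Fact.out : p.Prime).one_lt
  have hq : 0 < p ^ a := pow_pos (Fact.out : p.Prime).pos a
  have hn : p ^ (a + 1) = p ^ a * p := pow_succ p a
  have hle : p ^ (a + 1) ≤ p ^ (r - 1) := Nat.pow_le_pow_right (by omega) ha
  have hdiv : ∀ i < p ^ (a + 1), i / p ^ a < p := fun i hi => by
    rw [Nat.div_lt_iff_lt_mul hq, mul_comm]; omega
  have hmod : ∀ i, i = p ^ a * (i / p ^ a) + i % p ^ a := fun i => (Nat.div_add_mod i _).symm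
  have hcast : ∀ u, 0 < u → u < p → (u : k) ≠ 0 := fun u h0 h1 h => by
    rw [CharP.cast_eq_zero_iff k p] at h
    exact absurd (Nat.le_of_dvd h0 h) (by omega)
  set D := contract (phi k p r s (p ^ a * 1)) with hD
  set L := contract (phi k p r s (p ^ a * (p - 1))) with hL
  have hDt : ∀ i < p ^ (a + 1), D (thetaE k p r s ^ i) =
      ((i / p ^ a : ℕ) : k) • thetaE k p r s ^ (i - p ^ a) := fun i hi => by
    rw [hD, contract_phi_theta_pow _ _ _ (by omega), Nat.choose_one_right, mul_one]
  have hLt : ∀ i < p ^ (a + 1), L (thetaE k p r s ^ i) =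
      if i / p ^ a = p - 1 then thetaE k p r s ^ (i - p ^ a * (p - 1)) else 0 := fun i hi => by
    rw [hL, contract_phi_theta_pow _ _ _ (by omega), choose_pred (by omega) (hdiv i hi)]
    split_ifs <;> simp
  have hSt : ∀ i < p ^ (a + 1), raiseTheta k p r s a (thetaE k p r s ^ i) =
      if i / p ^ a + 1 < p then ((i / p ^ a + 1 : ℕ) : k)⁻¹ • thetaE k p r s ^ (i + p ^ a)
      else 0 := fun i hi => evenConstr_theta _ i (by omega)
  have hTt : ∀ i < p ^ (a + 1), raiseThetaTop k p r s a (thetaE k p r s ^ i) =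
      thetaE k p r s ^ (i + p ^ a * (p - 1)) := fun i hi => evenConstr_theta _ i (by omega)
  have htop : p ^ a * (p - 1) + p ^ a = p ^ (a + 1) := by
    rw [hn, ← mul_add_one, Nat.sub_add_cancel (by omega)]
  -- The quotient of `i` by `p ^ a` after a shift.
  have hsub : ∀ i, p ^ a ≤ i → (i - p ^ a) / p ^ a = i / p ^ a - 1 := fun i hi => by
    have := Nat.sub_mul_div i (p ^ a) 1
    rwa [mul_one] at this
  have hadd : ∀ i, (i + p ^ a) / p ^ a = i / p ^ a + 1 := fun i => Nat.add_div_right i hq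
  have hlt : ∀ i, i / p ^ a + 1 < p → i + p ^ a < p ^ (a + 1) := fun i hi => by
    rw [← hadd, Nat.div_lt_iff_lt_mul hq, mul_comm] at hi; omega
  have hDdiv0 : ∀ i < p ^ a, i / p ^ a = 0 := fun i hi => Nat.div_eq_of_lt hi
  have hmem : ∀ {n : ℕ} {f : MEven k p r s →ₗ[k] MEven k p r s} {m : ℕ},
      (∀ i < n, ∃ (b : k) (l : ℕ), (b = 0 ∨ l < m) ∧
        f (thetaE k p r s ^ i) = b • thetaE k p r s ^ l) →
      ∀ c ∈ thetaSpan k p r s n, bothMap f c ∈ thetaSpan k p r s m := by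
    intro n f m h
    refine thetaSpan_le (P := (thetaSpan k p r s m).comap (bothMap f)) fun i hi => ?_
    obtain ⟨b, l, hb, e⟩ := h i hi
    rw [Submodule.mem_comap, bothMap_even, e, map_smul]
    rcases hb with rfl | hl
    · rw [zero_smul]; exact zero_mem _
    · exact Submodule.smul_mem _ _ (theta_mem_thetaSpan hl)
  have heq : ∀ {n : ℕ} {f g : MEven k p r s →ₗ[k] MEven k p r s},
      (∀ i < n, f (thetaE k p r s ^ i) = g (thetaE k p r s ^ i)) →
      ∀ c ∈ thetaSpan k p r s n, bothMap f c = bothMap g c := by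
    intro n f g h
    refine thetaSpan_le (P := LinearMap.eqLocus (bothMap f) (bothMap g)) fun i hi => ?_
    change bothMap f _ = bothMap g _
    rw [bothMap_even, bothMap_even, h i hi]
  refine
    { le := thetaSpan_le fun i hi => theta_mem_thetaSpan (by omega)
      comodule := isSubcomodule_thetaSpan _
      one_mem := one_mem_thetaSpan hq
      D_mem := hmem fun i hi => ⟨_, _, Or.inr (by omega), hDt i hi⟩
      L_mem := hmem fun i hi => ?_
      S_mem := hmem fun i hi => ?_
      T_mem := hmem fun i hi => ⟨1, _, Or.inr ?_, by rw [one_smul, hTt i (by omega)]⟩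
      D_comul := fun c _ => comul_bothMap_contract _ c
      L_comul := fun c _ => comul_bothMap_contract _ c
      D_eq_zero := fun c hc => ?_
      sub_S_D := fun c hc => ?_
      D_S := fun c hc => ?_
      L_T := fun c hc => ?_
      L_D := fun c hc => ?_
      L_one := ?_
      exists_f := ⟨theta k p r s ^ p ^ a, ?_, ?_, resDiff_primitive (comul_theta_pow a)⟩
      exists_h := ⟨-(((p - 1).factorial : k) •
        pairRes k (fun j => ((j.factorial : k))⁻¹ • (theta k p r s ^ p ^ a) ^ j) p), ?_, ?_, ?_⟩ }
  · rw [hLt i hi]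
    split_ifs with h
    · refine ⟨1, _, Or.inr ?_, (one_smul k _).symm⟩
      have := hmod i
      rw [h] at this
      have := Nat.mod_lt i hq
      omega
    · exact ⟨0, 0, Or.inl rfl, by simp⟩
  · rw [hSt i hi]
    split_ifs with h
    · exact ⟨_, _, Or.inr (hlt i h), rfl⟩
    · exact ⟨0, 0, Or.inl rfl, by simp⟩
  · omega
  · rw [heq (g := 0) (fun i hi => ?_) c hc, bothMap_zero, LinearMap.zero_apply]
    rw [hDt i (by omega), hDdiv0 i hi, Nat.cast_zero, zero_smul]; rfl
  · have e : c - bothMap (raiseTheta k p r s a) (bothMap D c) =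
        bothMap (LinearMap.id - raiseTheta k p r s a ∘ₗ D) c := by
      rw [bothMap_sub, bothMap_id, bothMap_mul]; rfl
    rw [e]
    refine hmem (fun i hi => ?_) c hc
    rw [LinearMap.sub_apply, LinearMap.comp_apply, hDt i hi, map_smul, hSt _ (by omega),
      LinearMap.id_apply]
    by_cases h : i < p ^ a
    · exact ⟨1, i, Or.inr h, by rw [hDdiv0 i h]; simp⟩
    · refine ⟨0, 0, Or.inl rfl, ?_⟩
      have h1 := hdiv i hi
      have h2 : 0 < i / p ^ a := Nat.div_pos (by omega) hq
      rw [hsub i (by omega), if_pos (by omega), show i / p ^ a - 1 + 1 = i / p ^ a by omega,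
        show i - p ^ a + p ^ a = i by omega, smul_inv_smul₀ (hcast _ h2 h1), sub_self, zero_smul]
  · have e : bothMap D (bothMap (raiseTheta k p r s a) c) +
        bothMap (raiseThetaTop k p r s a) (bothMap L c) =
        bothMap (D ∘ₗ raiseTheta k p r s a + raiseThetaTop k p r s a ∘ₗ L) c := by
      rw [bothMap_add, bothMap_mul, bothMap_mul]; rfl
    rw [e, ← heq (f := LinearMap.id) (fun i hi => ?_) c hc, bothMap_id, LinearMap.id_apply]
    have h1 := hdiv i hi
    rw [LinearMap.add_apply, LinearMap.comp_apply, LinearMap.comp_apply, hSt i hi, hLt i hi,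
      LinearMap.id_apply]
    by_cases h : i / p ^ a + 1 < p
    · rw [if_pos h, if_neg (by omega), map_zero, add_zero, map_smul, hDt _ (hlt i h), hadd,
        Nat.add_sub_cancel, inv_smul_smul₀ (hcast _ (Nat.succ_pos _) h)]
    · have h2 : i / p ^ a = p - 1 := by
        generalize i / p ^ a = u at *
        omega
      have := Nat.zero_le (i % p ^ a)
      have := hmod i
      rw [h2] at this
      rw [if_neg h, if_pos h2, map_zero, zero_add, hTt _ (by omega),
        show i - p ^ a * (p - 1) + p ^ a * (p - 1) = i by omega]
  · rw [← LinearMap.comp_apply, ← bothMap_mul, heq (g := LinearMap.id) (fun i hi => ?_) c hc,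
      bothMap_id, LinearMap.id_apply]
    have h2 : (i + p ^ a * (p - 1)) / p ^ a = p - 1 := by
      rw [Nat.add_mul_div_left _ _ hq, hDdiv0 i hi, zero_add]
    rw [LinearMap.comp_apply, hTt i (by omega), hLt _ (by omega), if_pos h2, Nat.add_sub_cancel,
      LinearMap.id_apply]
  · rw [← LinearMap.comp_apply, ← bothMap_mul, heq (g := 0) (fun i hi => ?_) c hc,
      bothMap_zero, LinearMap.zero_apply]
    rw [LinearMap.comp_apply, hDt i hi, map_smul, hLt _ (by omega), LinearMap.zero_apply]
    by_cases h : i < p ^ a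
    · rw [hDdiv0 i h, Nat.cast_zero, zero_smul]
    · have := hdiv i hi
      rw [hsub i (by omega), if_neg (by omega), smul_zero]
  · have h := hLt 0 (by omega)
    rw [pow_zero, Nat.zero_div, if_neg (by omega)] at h
    rw [bothMap_one, h, map_zero]
  · rw [theta_pow]
    exact theta_mem_thetaSpan (Nat.pow_lt_pow_right hp1 (by omega))
  · rw [theta_pow, bothMap_even, hDt _ (Nat.pow_lt_pow_right hp1 (by omega)), Nat.div_self hq,
      Nat.cast_one, one_smul, Nat.sub_self, pow_zero]
    rfl
  · refine neg_mem (Submodule.smul_mem _ _ (pairRes_mem _ _ fun m _ hm => ?_))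
    rw [← pow_mul, theta_pow]
    refine Submodule.smul_mem _ _ (theta_mem_thetaSpan ?_)
    rw [hn]; exact Nat.mul_lt_mul_of_pos_left hm hq
  · have hf : ((p - 1).factorial : k) ≠ 0 := fun h => by
      rw [CharP.cast_eq_zero_iff k p, (Fact.out : p.Prime).dvd_factorial] at h
      omega
    rw [map_neg, map_smul, (isDividedSeq_theta k p r s a).lTensor_pairRes (m := 1) (by omega)
      (by omega), smul_neg, neg_neg, ← map_smul, ← TensorProduct.tmul_smul, smul_inv_smul₀ hf]
    · have h := hTt 0 (by omega)
      rw [pow_zero, zero_add] at h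
      rw [bothMap_one, h, ← pow_mul, theta_pow]
    · intro b hb hb'
      have h1 : p ^ a * b < p ^ (a + 1) := by rw [hn]; exact Nat.mul_lt_mul_of_pos_left hb' hq
      have hfb : (b : k) ≠ 0 := hcast b hb hb'
      rw [if_pos hb, map_smul, ← pow_mul, theta_pow, bothMap_even, hDt _ h1,
        Nat.mul_div_cancel_left _ hq, map_smul, smul_smul, ← pow_mul, theta_pow]
      obtain ⟨b, rfl⟩ : ∃ c, b = c + 1 := ⟨b - 1, by omega⟩
      rw [Nat.add_sub_cancel, mul_add, mul_one, Nat.add_sub_cancel, Nat.factorial_succ,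
        Nat.cast_mul, mul_inv, mul_comm, ← mul_assoc, mul_inv_cancel₀ hfb, one_mul]
  · rw [map_neg, map_smul, (isDividedSeq_theta k p r s a).resDiff_pairRes, xCochain_eq,
      TensorProduct.neg_tmul, TensorProduct.smul_tmul']

end ThetaStep

section Generation

variable {k : Type*} [Field k] {p : ℕ} [Fact p.Prime] [CharP k p] {r s : ℕ}

variable (k p r s) in
/-- The cochains that represent the generators of the cohomology ring; the cochain for `x_r` is not
needed. For `s = 1` the class of `wCochain` is `x_r - y ^ 2`, and for `s ≥ 2` the class `x_r` is
`y ^ 2`. -/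
def generators : Set (Cochains k (MAlg k p r s)) :=
  {z | (∃ i, 1 ≤ i ∧ i ≤ r ∧ z = lambdaCochain k p r s i) ∨
    (∃ i, 1 ≤ i ∧ i < r ∧ z = xCochain k p r s i) ∨ z = yCochain k p r s ∨ z = wCochain k p r s}

theorem diff_lambdaCochain (i : ℕ) :
    diff k (MAlg k p r s) (lambdaCochain k p r s i) = 0 :=
  diff_primitive (comul_theta_pow _)

theorem diff_xCochain (i : ℕ) (hi : 1 ≤ i) :
    diff k (MAlg k p r s) (xCochain k p r s i) = 0 := by
  obtain ⟨i, rfl⟩ : ∃ j, i = j + 1 := ⟨i - 1, by omega⟩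
  rw [xCochain_eq, map_smul,
    (isDividedSeq_theta k p r s i).diff_pairCochain (comul_one k p r s) (counit_one k p r s),
    smul_zero]

theorem diff_wCochain [NeZero s] (hp : Odd p) :
    diff k (MAlg k p r s) (wCochain k p r s) = 0 := by
  rw [wCochain_eq k r s hp, map_neg,
    (isDividedSeq_sigmaTau k r s hp).diff_pairCochain (comul_one k p r s) (counit_one k p r s),
    neg_zero]

theorem generators_subset_cocycles [NeZero s] (hp : Odd p) :
    generators k p r s ⊆ cocycles k (MAlg k p r s) := by
  rintro z (⟨i, _, _, rfl⟩ | ⟨i, hi, _, rfl⟩ | rfl | rfl)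
  · exact diff_lambdaCochain i
  · exact diff_xCochain i hi
  · exact diff_yCochain
  · exact diff_wCochain hp

theorem sgn_xCochain (i : ℕ) :
    sgn k (MAlg k p r s) (xCochain k p r s i) = xCochain k p r s i := by
  simp only [xCochain, map_sum, map_smul, map_mul, sgn_inj, neg_mul_neg]

theorem xCochain_mem_filt (i : ℕ) : xCochain k p r s i ∈ filt k (MAlg k p r s) 3 :=
  sum_mem fun _ _ => Submodule.smul_mem _ _ (filt_mul (inj_mem_filt _) (inj_mem_filt _))

theorem thetaSpan_one_le : thetaSpan k p r s (p ^ 0) ≤ Submodule.span k {1} :=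
  thetaSpan_le fun i hi => by
    rw [pow_zero, Nat.lt_one_iff] at hi
    rw [hi, pow_zero, evenIncl_one]
    exact Submodule.mem_span_singleton_self _

theorem resDiff_of_mem_thetaSpan_one {n : ℕ} {x : Cochains k (MAlg k p r s) ⊗[k] MAlg k p r s}
    (hx : x ∈ resFilt n (thetaSpan k p r s (p ^ 0))) :
    resDiff k _ x = diff k _ (resCounit k _ x) ⊗ₜ 1 := by
  have h : resFilt n (thetaSpan k p r s (p ^ 0)) ≤ LinearMap.eqLocus (resDiff k (MAlg k p r s))
      ((TensorProduct.mk k _ _).flip 1 ∘ₗ diff k _ ∘ₗ resCounit k _) := by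
    refine Submodule.map₂_le.mpr fun t _ c hc => ?_
    obtain ⟨a, rfl⟩ := Submodule.mem_span_singleton.mp (thetaSpan_one_le hc)
    change resDiff k _ (t ⊗ₜ (a • 1)) = diff k _ (resCounit k _ (t ⊗ₜ (a • 1))) ⊗ₜ 1
    rw [TensorProduct.tmul_smul, map_smul, map_smul, resDiff_tmul_one (comul_one k p r s),
      resCounit_tmul, counit_one, one_smul, map_smul, TensorProduct.smul_tmul']
  exact h hx

/-- Every cocycle is cohomologous to a noncommutative polynomial in the generators. -/
theorem exists_generators [NeZero r] [NeZero s] (hp : Odd p) (hp3 : 3 ≤ p)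
    (z : Cochains k (MAlg k p r s)) (hz : diff k _ z = 0) :
    ∃ q ∈ Algebra.adjoin k (generators k p r s), ∃ t, z = q + diff k _ t := by
  set Q := Algebra.adjoin k (generators k p r s) with hQdef
  have hQ : ∀ q ∈ Q, diff k _ q = 0 :=
    Algebra.adjoin_le (S := cocycles k (MAlg k p r s)) (generators_subset_cocycles hp)
  have hlam : ∀ i, 1 ≤ i → i ≤ r → lambdaCochain k p r s i ∈ Q := fun i h1 h2 =>
    Algebra.subset_adjoin (Or.inl ⟨i, h1, h2, rfl⟩)
  have hx : ∀ i, 1 ≤ i → i < r → xCochain k p r s i ∈ Q := fun i h1 h2 =>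
    Algebra.subset_adjoin (Or.inr (Or.inl ⟨i, h1, h2, rfl⟩))
  have hy : yCochain k p r s ∈ Q := Algebra.subset_adjoin (Or.inr (Or.inr (Or.inl rfl)))
  have hw : wCochain k p r s ∈ Q := Algebra.subset_adjoin (Or.inr (Or.inr (Or.inr rfl)))
  have hQs : ∀ q ∈ Q, sgn k _ q ∈ Q := by
    refine Algebra.adjoin_le (S := Q.comap (sgn k (MAlg k p r s))) ?_
    rintro z (⟨i, h1, h2, rfl⟩ | ⟨i, h1, h2, rfl⟩ | rfl | rfl)
    · change sgn k _ (lambdaCochain k p r s i) ∈ Q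
      rw [lambdaCochain, sgn_inj]; exact neg_mem (hlam i h1 h2)
    · change sgn k _ (xCochain k p r s i) ∈ Q
      rw [sgn_xCochain]; exact hx i h1 h2
    · change sgn k _ (yCochain k p r s) ∈ Q
      rw [yCochain, sgn_inj]; exact neg_mem hy
    · change sgn k _ (wCochain k p r s) ∈ Q
      rw [wCochain_eq k r s hp, map_neg, sgn_pairCochain, ← wCochain_eq k r s hp]; exact hw
  have hr1 : 1 ≤ r := Nat.one_le_iff_ne_zero.mpr (NeZero.ne r)
  have hpos : 0 < p ^ (r - 1) := pow_pos (Fact.out : p.Prime).pos _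
  have h1 := comul_one k p r s
  have top : ∀ n, CocyclesGenerated Q (thetaTauSpan k p r s (p ^ (r - 1))) n :=
    (periodicStep_sigma hp hp3).cocyclesGenerated h1 hQ hQs (neg_mem (hlam r hr1 le_rfl))
      (neg_mem (inj_mem_filt _)) hw
      (by rw [wCochain_eq k r s hp]; exact neg_mem (pairCochain_mem _ _))
      (cocyclesGenerated_top Q)
  have mid : ∀ n, CocyclesGenerated Q (thetaSpan k p r s (p ^ (r - 1))) n :=
    (periodicStep_tau _ hpos).cocyclesGenerated h1 hQ hQs (neg_mem hy)
      (neg_mem (inj_mem_filt _)) (neg_mem (mul_mem hy hy))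
      (neg_mem (filt_mul (inj_mem_filt _) (inj_mem_filt _))) top
  have low : ∀ m ≤ r - 1, ∀ n, CocyclesGenerated Q (thetaSpan k p r s (p ^ (r - 1 - m))) n := by
    intro m
    induction m with
    | zero => intro _; exact mid
    | succ m ih =>
      intro hm
      have e : r - 1 - m = r - 1 - (m + 1) + 1 := by omega
      have h := ih (by omega)
      rw [e] at h
      exact (periodicStep_theta (r - 1 - (m + 1)) (by omega)).cocyclesGenerated h1 hQ hQs
        (neg_mem (hlam _ (by omega) (by omega))) (neg_mem (inj_mem_filt _))
        (neg_mem (hx _ (by omega) (by omega))) (neg_mem (xCochain_mem_filt _)) h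
  obtain ⟨n, hn⟩ := exists_mem_filt z
  have h0 := low (r - 1) le_rfl (n + 1)
  rw [Nat.sub_self] at h0
  obtain ⟨q, hq, -, w, hw, e⟩ := h0 (z ⊗ₜ 1)
    (tmul_mem_resFilt hn (one_mem_thetaSpan (by simp)))
    (by rw [resDiff_tmul_one h1, hz, TensorProduct.zero_tmul])
  refine ⟨q, hq, resCounit k _ w, ?_⟩
  rw [resDiff_of_mem_thetaSpan_one hw, TensorProduct.smul_tmul', smul_eq_mul, mul_one] at e
  have e' := congrArg (resCounit k _) e
  simpa only [map_add, resCounit_tmul, counit_one, one_smul] using e'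

/-- A homomorphism out of the cohomology ring is determined by its values on the generators. -/
theorem coh_hom_ext [NeZero r] [NeZero s] (hp : Odd p) (hp3 : 3 ≤ p)
    {A : Type*} [Ring A] [Algebra k A] {f g : Coh k (MAlg k p r s) →ₐ[k] A}
    (h : ∀ (z) (hz : z ∈ cocycles k (MAlg k p r s)), z ∈ generators k p r s →
      f (cocycleClass k _ ⟨z, hz⟩) = g (cocycleClass k _ ⟨z, hz⟩)) : f = g := by
  refine AlgHom.ext fun x => ?_
  obtain ⟨z, rfl⟩ := cocycleClass_surjective k _ x
  let E : Subalgebra k (cocycles k (MAlg k p r s)) :=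
    AlgHom.equalizer (f.comp (cocycleClass k _)) (g.comp (cocycleClass k _))
  have hE : Algebra.adjoin k (generators k p r s) ≤ E.map (cocycles k _).val :=
    Algebra.adjoin_le fun z hz =>
      ⟨⟨z, generators_subset_cocycles hp hz⟩, h z _ hz, rfl⟩
  obtain ⟨q, hq, t, e⟩ := exists_generators hp hp3 z.1 z.2
  obtain ⟨q, hqE, rfl⟩ := hE hq
  have hzq : cocycleClass k _ z = cocycleClass k _ q := by
    rw [← sub_eq_zero, ← map_sub, cocycleClass_eq_zero]
    exact ⟨t, by
      change _ = (z : Cochains k (MAlg k p r s)) - q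
      rw [e]
      exact (add_sub_cancel_left _ _).symm⟩
  rw [hzq]
  exact hqE

theorem sigmaE_one_pow (j : ℕ) : sigmaE k p r s 1 ^ j = (j.factorial : k) • sigmaE k p r s j := by
  induction j with
  | zero => simp [sigmaE_zero]
  | succ j ih =>
    rw [pow_succ, ih, smul_mul_assoc, sigmaE_mul, smul_smul, Nat.choose_succ_self_right,
      Nat.factorial_succ, ← Nat.cast_mul, mul_comm]

/-- For `s = 1` the class `w` is `x_r - y ^ 2`. -/
theorem wCochain_one [NeZero r] : wCochain k p r 1 =
    xCochain k p r 1 r - yCochain k p r 1 * yCochain k p r 1 := by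
  have hfac : ∀ j < p, (j.factorial : k) ≠ 0 := fun j hj h => by
    rw [CharP.cast_eq_zero_iff k p, (Fact.out : p.Prime).dvd_factorial] at h
    omega
  have hw : ((p - 1).factorial : k) = -1 := by
    have h := congrArg (ZMod.castHom (dvd_refl p) k) (ZMod.wilsons_lemma p)
    rwa [map_natCast, map_neg, map_one] at h
  have h1 : sigma k p r 1 0 = 1 := by rw [sigma, sigmaE_zero, evenIncl_one]
  have h2 : ∀ j, (theta k p r 1 ^ p ^ (r - 1)) ^ j = (j.factorial : k) • sigma k p r 1 j := by
    intro j
    rw [theta_pow_top, sigma, ← evenIncl_pow, sigmaE_one_pow, map_smul, sigma]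
  rw [wCochain, xCochain, pow_one, Nat.sub_self, Finset.Nat.antidiagonal_zero, Finset.sum_singleton,
    h1, one_mul, neg_add, ← sub_eq_add_neg, yCochain, ← Finset.sum_neg_distrib]
  congr 1
  refine Finset.sum_congr rfl fun j hj => ?_
  rw [Finset.mem_Ico] at hj
  have e1 := hfac j (by omega)
  have e2 := hfac (p - j) (by omega)
  rw [h2, h2, map_smul, map_smul, smul_mul_smul_comm, smul_smul, div_mul_cancel₀ _ (mul_ne_zero e1 e2),
    hw, neg_one_smul]

theorem HasValue.mul {ε : Coh k (MAlg k p r s) →ₐ[k] k} {z z' : Cochains k (MAlg k p r s)}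
    {a a' : k} (h : HasValue ε z a) (h' : HasValue ε z' a') : HasValue ε (z * z') (a * a') := by
  obtain ⟨h, rfl⟩ := h
  obtain ⟨h', rfl⟩ := h'
  exact ⟨mul_mem h h', by rw [← map_mul, ← map_mul]; rfl⟩

theorem HasValue.sub {ε : Coh k (MAlg k p r s) →ₐ[k] k} {z z' : Cochains k (MAlg k p r s)}
    {a a' : k} (h : HasValue ε z a) (h' : HasValue ε z' a') : HasValue ε (z - z') (a - a') := by
  obtain ⟨h, rfl⟩ := h
  obtain ⟨h', rfl⟩ := h'
  exact ⟨sub_mem h h', by rw [← map_sub, ← map_sub]; rfl⟩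

theorem IsEps.w_eq_zero [NeZero r] [NeZero s] {ε : Coh k (MAlg k p r s) →ₐ[k] k}
    (h : IsEps ε) : HasValue ε (wCochain k p r s) 0 := by
  rcases Nat.lt_or_ge s 2 with hs | hs
  · obtain rfl : s = 1 := by have := NeZero.ne s; omega
    have := h.x_top.sub (h.y.mul h.y)
    rwa [← wCochain_one, mul_one, sub_self] at this
  · exact h.w hs

theorem IsEps.eq [NeZero r] [NeZero s] (hp : Odd p) (hp3 : 3 ≤ p)
    {ε ε' : Coh k (MAlg k p r s) →ₐ[k] k} (h : IsEps ε) (h' : IsEps ε') : ε = ε' := by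
  have key : ∀ {z a}, HasValue ε z a → HasValue ε' z a → ∀ hz,
      ε (cocycleClass k _ ⟨z, hz⟩) = ε' (cocycleClass k _ ⟨z, hz⟩) := by
    rintro z a ⟨h1, rfl⟩ ⟨h2, h3⟩ _
    exact h3.symm
  refine coh_hom_ext hp hp3 ?_
  rintro z hz (⟨i, h1, h2, rfl⟩ | ⟨i, h1, h2, rfl⟩ | rfl | rfl)
  · exact key (h.lam i h1 h2) (h'.lam i h1 h2) hz
  · exact key (h.x i h1 h2) (h'.x i h1 h2) hz
  · exact key h.y h'.y hz
  · exact key h.w_eq_zero h'.w_eq_zero hz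

end Generation

/-! ### Representations of the Hochschild complex of `M_{r;s}` -/

section Functionals

variable {k : Type*} [Field k] {p : ℕ} [Fact p.Prime] [CharP k p] {r s : ℕ} [NeZero s]

variable (k p r s) in
/-- The functional on the even part with value `1` at `σ_n` and value `0` at all other elements of
the basis `θ ^ i σ_j`. -/
def chi (n : ℕ) : MEven k p r s →ₗ[k] k := (counitE k p r s).toLinearMap ∘ₗ (lowerU k p r s ^ n)

theorem chi_theta_sigma (n i j : ℕ) (hi : i < p ^ (r - 1)) (hj : j < p ^ s) :
    chi k p r s n (thetaE k p r s ^ i * sigmaE k p r s j) = if i = 0 ∧ j = n then 1 else 0 := by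
  rw [chi, LinearMap.comp_apply, lowerU_pow_theta_sigma _ _ _ hi hj]
  split_ifs with h1 h2 h2
  · rw [AlgHom.toLinearMap_apply, map_mul, h2.1, h2.2, pow_zero, map_one, one_mul, Nat.sub_self,
      counitE_sigma, if_pos rfl]
  · rw [AlgHom.toLinearMap_apply, map_mul, map_pow, counitE_theta, counitE_sigma]
    by_cases hi0 : i = 0
    · rw [if_neg (by omega), mul_zero]
    · rw [zero_pow hi0, zero_mul]
  · omega
  · exact map_zero _

theorem chi_sigma (n j : ℕ) (hj : j < p ^ s) :
    chi k p r s n (sigmaE k p r s j) = if j = n then 1 else 0 := by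
  have h := chi_theta_sigma (k := k) n 0 j (pow_pos (Fact.out : p.Prime).pos (r - 1)) hj
  rw [pow_zero, one_mul] at h
  rw [h]
  simp

theorem chi_theta (n i : ℕ) (hn : n ≠ 0) (hi : i < p ^ (r - 1)) :
    chi k p r s n (thetaE k p r s ^ i) = 0 := by
  have h := chi_theta_sigma (k := k) (s := s) n i 0 hi (pow_pos (Fact.out : p.Prime).pos s)
  rwa [sigmaE_zero, mul_one, if_neg (by omega)] at h

theorem chi_one (n : ℕ) (hn : n ≠ 0) : chi k p r s n 1 = 0 := by
  have h := chi_theta (k := k) (s := s) n 0 hn (pow_pos (Fact.out : p.Prime).pos (r - 1))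
  rwa [pow_zero] at h

theorem comulE_lowerU_pow (n : ℕ) (x : MEven k p r s) :
    comulE k p r s ((lowerU k p r s ^ n) x) =
      (lowerU k p r s ^ n).lTensor _ (comulE k p r s x) := by
  induction n generalizing x with
  | zero => simp [Module.End.one_eq_id]
  | succ n ih =>
    rw [pow_succ, Module.End.mul_eq_comp, LinearMap.comp_apply, ih, lowerU, comulE_contract,
      ← lowerU, LinearMap.lTensor_comp, LinearMap.comp_apply]

/-- The functionals `chi n` multiply like the powers of `chi 1`. -/
theorem map_chi_comulE (a b : ℕ) (x : MEven k p r s) :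
    TensorProduct.map (chi k p r s a) (chi k p r s b) (comulE k p r s x) =
      chi k p r s (a + b) x ⊗ₜ 1 := by
  have h : TensorProduct.map (chi k p r s a) (chi k p r s b) (comulE k p r s x) =
      TensorProduct.map (chi k p r s a) (counitE k p r s).toLinearMap
        (comulE k p r s ((lowerU k p r s ^ b) x)) := by
    rw [comulE_lowerU_pow, LinearMap.lTensor, ← LinearMap.comp_apply, ← TensorProduct.map_comp,
      LinearMap.comp_id]
    rfl
  have h2 : (counitE k p r s).toLinearMap.lTensor _ (comulE k p r s ((lowerU k p r s ^ b) x)) =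
      ((lowerU k p r s ^ b) x) ⊗ₜ 1 := Coalgebra.lTensor_counit_comul _
  rw [h, ← LinearMap.rTensor_comp_lTensor, LinearMap.comp_apply, h2, LinearMap.rTensor_tmul,
    chi, chi, pow_add, Module.End.mul_eq_comp]
  rfl

theorem delta_eq_lowerU_pow : delta k p r s = lowerU k p r s ^ p := by
  refine even_linear_ext fun i j hi hj => ?_
  rw [lowerU_pow_theta_sigma _ _ _ hi hj, delta_mul, delta_theta_pow, zero_mul, add_zero,
    delta_sigma _ _ _ _ _ hj, sigmaShift]
  split_ifs
  · rfl
  · exact mul_zero _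

theorem chi_delta (x : MEven k p r s) : chi k p r s 0 (delta k p r s x) = chi k p r s p x := by
  rw [delta_eq_lowerU_pow, chi, pow_zero]
  rfl

end Functionals

section Representation

variable {k : Type*} [Field k] {p : ℕ} [Fact p.Prime] [CharP k p] {r s : ℕ} [NeZero s]
  {T : Type*} [Ring T] [Algebra k T]

variable (p r s) in
/-- The linear map with `σ_1 ↦ P`, `σ_{p-1} ↦ Q` and `τ ↦ R` that vanishes on all other elements
of the basis. -/
def repLin (P Q R : T) : MAlg k p r s →ₗ[k] T :=
  ((chi k p r s 1).smulRight P + (chi k p r s (p - 1)).smulRight Q) ∘ₗ evenProj k p r s +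
    ((chi k p r s 0).smulRight R) ∘ₗ oddProj k p r s

theorem repLin_even (P Q R : T) (x : MEven k p r s) : repLin p r s P Q R (evenIncl k p r s x) =
    chi k p r s 1 x • P + chi k p r s (p - 1) x • Q := by
  simp [repLin, evenProj_even, oddProj_even]

theorem repLin_odd (P Q R : T) (x : MEven k p r s) : repLin p r s P Q R (oddIncl k p r s x) =
    chi k p r s 0 x • R := by
  simp [repLin, evenProj_odd, oddProj_odd]

theorem repLin_comp_even (P Q R : T) : repLin p r s P Q R ∘ₗ evenIncl k p r s =
    (chi k p r s 1).smulRight P + (chi k p r s (p - 1)).smulRight Q :=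
  LinearMap.ext fun x => repLin_even P Q R x

theorem repLin_comp_odd (P Q R : T) : repLin p r s P Q R ∘ₗ oddIncl k p r s =
    (chi k p r s 0).smulRight R :=
  LinearMap.ext fun x => repLin_odd P Q R x

theorem mul_map_chi (a b : ℕ) (P Q : T) (x : MEven k p r s) :
    LinearMap.mul' k T (TensorProduct.map ((chi k p r s a).smulRight P)
      ((chi k p r s b).smulRight Q) (comulE k p r s x)) = chi k p r s (a + b) x • (P * Q) := by
  have h : ∀ y : MEven k p r s ⊗[k] MEven k p r s,
      LinearMap.mul' k T (TensorProduct.map ((chi k p r s a).smulRight P)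
        ((chi k p r s b).smulRight Q) y) =
      TensorProduct.lid k k (TensorProduct.map (chi k p r s a) (chi k p r s b) y) • (P * Q) := by
    intro y
    induction y with
    | zero => simp
    | add u v hu hv => simp only [map_add, hu, hv, add_smul]
    | tmul u v => simp [smul_smul, mul_comm]
  rw [h, map_chi_comulE, TensorProduct.lid_tmul, smul_eq_mul, mul_one]

theorem map_map_apply {E F : Type*} [AddCommGroup E] [Module k E] [AddCommGroup F] [Module k F]
    {N : Type*} [AddCommGroup N] [Module k N] (l : F →ₗ[k] N) (f g : E →ₗ[k] F) (y : E ⊗[k] E) :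
    TensorProduct.map l l (TensorProduct.map f g y) =
      TensorProduct.map (l ∘ₗ f) (l ∘ₗ g) y := by
  rw [TensorProduct.map_comp, LinearMap.comp_apply]

/-- The relations under which `repLin P Q R` extends to a homomorphism of differential algebras
into an algebra without differential. -/
structure RepRel (P Q R : T) : Prop where
  P_sq : P * P = 0
  Q_sq : Q * Q = 0
  PQ : P * Q + Q * P + R * R = 0
  RP : R * P + P * R = 0
  RQ : R * Q + Q * R = 0

theorem RepRel.mul_map_comul {P Q R : T} (h : RepRel P Q R) (hp3 : 3 ≤ p) (c : MAlg k p r s) :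
    LinearMap.mul' k T (TensorProduct.map (repLin p r s P Q R) (repLin p r s P Q R)
      (Coalgebra.comul c)) = 0 := by
  have e : LinearMap.mul' k T ∘ₗ TensorProduct.map (repLin p r s P Q R) (repLin p r s P Q R) ∘ₗ
      Coalgebra.comul = 0 := by
    refine MAlg.linear_ext k p r s (fun x => ?_) (fun x => ?_)
    · rw [LinearMap.comp_apply, LinearMap.comp_apply, comul_evenIncl, map_add, map_add,
        map_map_apply, map_map_apply, repLin_comp_even, repLin_comp_odd]
      simp only [TensorProduct.map_add_left, TensorProduct.map_add_right, LinearMap.add_apply,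
        map_add, mul_map_chi, h.P_sq, h.Q_sq, smul_zero, zero_add, add_zero, chi_delta,
        LinearMap.zero_apply, show 1 + (p - 1) = p by omega, show p - 1 + 1 = p by omega,
        ← smul_add]
      rw [add_comm (Q * P), h.PQ, smul_zero]
    · rw [LinearMap.comp_apply, LinearMap.comp_apply, comul_oddIncl, map_add, map_add,
        map_map_apply, map_map_apply, repLin_comp_even, repLin_comp_odd]
      simp only [TensorProduct.map_add_left, TensorProduct.map_add_right, LinearMap.add_apply,
        map_add, mul_map_chi, LinearMap.zero_apply, zero_add, add_zero]
      rw [add_add_add_comm, ← smul_add, ← smul_add, h.RP, h.RQ, smul_zero, smul_zero, add_zero]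
  exact DFunLike.congr_fun e c

theorem repLin_one (hp3 : 3 ≤ p) (P Q R : T) : repLin (k := k) p r s P Q R 1 = 0 := by
  rw [← evenIncl_one, repLin_even, chi_one _ (by omega), chi_one _ (by omega), zero_smul,
    zero_smul, add_zero]

variable (p r s) in
/-- The homomorphism of algebras that extends `repLin P Q R`. -/
def rep (P Q R : T) : Cochains k (MAlg k p r s) →ₐ[k] T :=
  TensorAlgebra.lift k (repLin p r s P Q R)

theorem rep_inj (P Q R : T) (c : MAlg k p r s) :
    rep p r s P Q R (inj k _ c) = repLin p r s P Q R c := TensorAlgebra.lift_ι_apply _ _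

theorem RepRel.rep_diff {P Q R : T} (h : RepRel P Q R) (hp3 : 3 ≤ p)
    (t : Cochains k (MAlg k p r s)) : rep p r s P Q R (diff k _ t) = 0 := by
  induction t using TensorAlgebra.induction with
  | algebraMap a => rw [diff_algebraMap, map_zero]
  | ι c =>
    have hj : ∀ y, rep p r s P Q R (juxt k (MAlg k p r s) y) = LinearMap.mul' k T
        (TensorProduct.map (repLin p r s P Q R) (repLin p r s P Q R) y) := by
      intro y
      induction y with
      | zero => simp
      | add u v hu hv => simp only [map_add, hu, hv]
      | tmul u v => simp [juxt, rep]
    rw [diff_inj, map_sub, map_add, map_mul, map_mul, hj, h.mul_map_comul hp3, rep_inj, rep_inj,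
      repLin_one hp3, zero_mul, mul_zero, add_zero, sub_zero]
  | mul a b ha hb => rw [diff_mul, map_add, map_mul, map_mul, ha, hb, zero_mul, mul_zero, add_zero]
  | add a b ha hb => rw [map_add, map_add, ha, hb, add_zero]

section Values

variable (P Q R : T)

theorem rep_yCochain : rep p r s P Q R (yCochain k p r s) = R := by
  rw [yCochain, rep_inj, tau, repLin_odd, chi, pow_zero, LinearMap.comp_apply,
    Module.End.one_apply, AlgHom.toLinearMap_apply, map_one, one_smul]

theorem repLin_theta_pow (hp3 : 3 ≤ p) (m : ℕ) (hm : m < p ^ (r - 1)) :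
    repLin p r s P Q R (theta k p r s ^ m) = 0 := by
  rw [theta_pow, repLin_even, chi_theta _ _ (by omega) hm, chi_theta _ _ (by omega) hm, zero_smul,
    zero_smul, add_zero]

theorem repLin_sigma (j : ℕ) (hj : j < p ^ s) : repLin p r s P Q R (sigma k p r s j) =
    (if j = 1 then P else 0) + (if j = p - 1 then Q else 0) := by
  rw [sigma, repLin_even, chi_sigma _ _ hj, chi_sigma _ _ hj]
  split_ifs <;> simp

theorem rep_lambdaCochain (hp3 : 3 ≤ p) (i : ℕ) (h1 : 1 ≤ i) (h2 : i ≤ r) :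
    rep p r s P Q R (lambdaCochain k p r s i) = if i = r then P else 0 := by
  have hps : p ≤ p ^ s := Nat.le_self_pow (NeZero.ne s) p
  rw [lambdaCochain, rep_inj]
  split_ifs with h
  · rw [h, theta_pow_top, repLin_sigma _ _ _ _ (by omega), if_pos rfl, if_neg (by omega), add_zero]
  · exact repLin_theta_pow _ _ _ hp3 _ (Nat.pow_lt_pow_right (by omega) (by omega))

theorem rep_xCochain (hp3 : 3 ≤ p) (i : ℕ) (h1 : 1 ≤ i) (h2 : i < r) :
    rep p r s P Q R (xCochain k p r s i) = 0 := by
  rw [xCochain, map_sum]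
  refine Finset.sum_eq_zero fun j hj => ?_
  rw [Finset.mem_Ico] at hj
  have hlt : p ^ (i - 1) * j < p ^ (r - 1) := calc
    p ^ (i - 1) * j < p ^ (i - 1) * p :=
      Nat.mul_lt_mul_of_pos_left hj.2 (pow_pos (by omega) _)
    _ = p ^ (i - 1 + 1) := (pow_succ _ _).symm
    _ ≤ p ^ (r - 1) := Nat.pow_le_pow_right (by omega) (by omega)
  rw [map_smul, map_mul, rep_inj, ← pow_mul, repLin_theta_pow _ _ _ hp3 _ hlt, zero_mul, smul_zero]

variable {P Q R}

theorem RepRel.rep_xCochain_top [NeZero r] (h : RepRel P Q R) (hp3 : 3 ≤ p) :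
    rep p r s P Q R (xCochain k p r s r) = R * R := by
  have hps : p ≤ p ^ s := Nat.le_self_pow (NeZero.ne s) p
  have hfac : ∀ j < p, (j.factorial : k) ≠ 0 := fun j hj h => by
    rw [CharP.cast_eq_zero_iff k p, (Fact.out : p.Prime).dvd_factorial] at h
    omega
  have hw : ((p - 1).factorial : k) = -1 := by
    have h := congrArg (ZMod.castHom (dvd_refl p) k) (ZMod.wilsons_lemma p)
    rwa [map_natCast, map_neg, map_one] at h
  have h2 : ∀ j, (theta k p r s ^ p ^ (r - 1)) ^ j = (j.factorial : k) • sigma k p r s j := by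
    intro j
    rw [theta_pow_top, sigma, ← evenIncl_pow, sigmaE_one_pow, map_smul, sigma]
  have e : ∀ j ∈ Finset.Ico 1 p, rep p r s P Q R
      ((((p - 1).factorial : k) / ((j.factorial : k) * ((p - j).factorial : k))) •
        (inj k (MAlg k p r s) ((theta k p r s ^ p ^ (r - 1)) ^ j) *
        inj k (MAlg k p r s) ((theta k p r s ^ p ^ (r - 1)) ^ (p - j)))) =
      (if j = 1 then -(P * Q) else 0) + (if j = p - 1 then -(Q * P) else 0) := by
    intro j hj
    rw [Finset.mem_Ico] at hj
    have e1 := hfac j (by omega)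
    have e2 := hfac (p - j) (by omega)
    rw [h2, h2, map_smul (inj k (MAlg k p r s)), map_smul (inj k (MAlg k p r s)),
      smul_mul_smul_comm, smul_smul,
      div_mul_cancel₀ _ (mul_ne_zero e1 e2), hw, map_smul, map_mul, rep_inj, rep_inj,
      repLin_sigma _ _ _ _ (by omega), repLin_sigma _ _ _ _ (by omega)]
    by_cases hj1 : j = 1
    · subst hj1
      rw [if_pos rfl, if_neg (by omega), if_neg (by omega), if_pos rfl, if_pos rfl,
        if_neg (by omega)]
      simp
    · by_cases hj2 : j = p - 1
      · subst hj2
        rw [if_neg hj1, if_pos rfl, if_pos (by omega), if_neg (by omega), if_neg hj1, if_pos rfl]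
        simp
      · rw [if_neg hj1, if_neg hj2, if_neg hj1, if_neg hj2]
        simp
  rw [xCochain, map_sum, Finset.sum_congr rfl e, Finset.sum_add_distrib, Finset.sum_ite_eq',
    Finset.sum_ite_eq', if_pos (Finset.mem_Ico.mpr (by omega)),
    if_pos (Finset.mem_Ico.mpr (by omega)), ← neg_add, neg_eq_iff_add_eq_zero, h.PQ]

theorem RepRel.rep_wCochain [NeZero r] (h : RepRel P Q R) (hp3 : 3 ≤ p) :
    rep p r s P Q R (wCochain k p r s) = 0 := by
  by_cases hs : s = 1
  · subst hs
    rw [wCochain_one, map_sub, h.rep_xCochain_top hp3, map_mul, rep_yCochain, sub_self]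
  have h2 : p * p ≤ p ^ s := by
    rw [← sq]
    exact Nat.pow_le_pow_right (by omega) (by have := NeZero.ne s; omega)
  have h3 : 3 * p ≤ p * p := Nat.mul_le_mul_right p hp3
  rw [wCochain, map_neg, map_add, map_sum, map_sum, Finset.sum_eq_zero, Finset.sum_eq_zero,
    add_zero, neg_zero]
  · intro q hq
    have hq := Finset.HasAntidiagonal.mem_antidiagonal.mp hq
    have e : ∀ u < p ^ s, rep p r s P Q R (inj k _ (sigma k p r s u * tau k p r s)) =
        (if u = 0 then R else 0) := fun u hu => by
      rw [rep_inj, sigma, ← oddIncl_eq, repLin_odd, chi_sigma _ _ hu]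
      split_ifs <;> simp
    rw [map_mul, e _ (by omega), e _ (by omega)]
    by_cases h0 : q.1 = 0
    · rw [if_neg (by omega : ¬ q.2 = 0), mul_zero]
    · rw [if_neg h0, zero_mul]
  · intro j hj
    rw [Finset.mem_Ico] at hj
    rw [map_mul, rep_inj, rep_inj, repLin_sigma _ _ _ _ (by omega), repLin_sigma _ _ _ _ (by omega)]
    by_cases hj1 : j < p
    · rw [if_neg (by omega : ¬ p ^ s - j = 1), if_neg (by omega : ¬ p ^ s - j = p - 1), add_zero,
        mul_zero]
    · rw [if_neg (by omega : ¬ j = 1), if_neg (by omega : ¬ j = p - 1), add_zero, zero_mul]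

end Values

end Representation

section MatrixRepresentation

variable {k : Type*} [Field k] {p : ℕ} [Fact p.Prime] [CharP k p] {r s : ℕ} [NeZero r] [NeZero s]
  {A : Type*} [CommRing A] [Algebra k A]

theorem repRel_matrix {α β μ : A} (h : α * β = μ ^ 2) :
    RepRel !![0, 0; -α, 0] !![0, β; 0, 0] !![μ, 0; 0, -μ] := by
  constructor <;> ext i j <;> fin_cases i <;> fin_cases j <;>
    simp [Matrix.mul_apply, Fin.sum_univ_two]
  · linear_combination -h
  · linear_combination -h
  · ring
  · ring

variable (p r s) in
/-- The linear map to matrices with `σ_1 ↦ -α E_{21}`, `σ_{p-1} ↦ β E_{12}` and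
`τ ↦ μ (E_{11} - E_{22})`. -/
abbrev matLin (α β μ : A) : MAlg k p r s →ₗ[k] Matrix (Fin 2) (Fin 2) A :=
  repLin p r s !![0, 0; -α, 0] !![0, β; 0, 0] !![μ, 0; 0, -μ]

variable (p r s) in
/-- The extension of `matLin` to the Hochschild complex. -/
abbrev matRep (α β μ : A) : Cochains k (MAlg k p r s) →ₐ[k] Matrix (Fin 2) (Fin 2) A :=
  rep p r s !![0, 0; -α, 0] !![0, β; 0, 0] !![μ, 0; 0, -μ]

/-- The generators are mapped to lower triangular matrices and coboundaries to zero, so all cocycles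
are mapped to lower triangular matrices. Hence the upper left entry is multiplicative on cocycles. -/
theorem matRep_cocycle (hp : Odd p) (hp3 : 3 ≤ p) {α β μ : A} (h : α * β = μ ^ 2)
    (z : Cochains k (MAlg k p r s)) (hz : diff k _ z = 0) : matRep p r s α β μ z 0 1 = 0 := by
  let L : Subalgebra k (Matrix (Fin 2) (Fin 2) A) :=
    { carrier := {m | m 0 1 = 0}
      mul_mem' := fun {m n} hm hn => by
        change (m * n) 0 1 = 0
        rw [Matrix.mul_apply, Fin.sum_univ_two, show m 0 1 = 0 from hm, show n 0 1 = 0 from hn,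
          mul_zero, zero_mul, add_zero]
      add_mem' := fun {m n} hm hn => by
        change m 0 1 + n 0 1 = 0
        rw [show m 0 1 = 0 from hm, show n 0 1 = 0 from hn, add_zero]
      algebraMap_mem' := fun a => by simp [Matrix.algebraMap_matrix_apply] }
  have hrel := repRel_matrix h
  have hL : Algebra.adjoin k (generators k p r s) ≤ L.comap (matRep p r s α β μ) := by
    refine Algebra.adjoin_le ?_
    rintro z (⟨i, h1, h2, rfl⟩ | ⟨i, h1, h2, rfl⟩ | rfl | rfl)
    · change matRep p r s α β μ _ 0 1 = 0
      rw [rep_lambdaCochain _ _ _ hp3 i h1 h2]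
      split_ifs <;> rfl
    · change matRep p r s α β μ _ 0 1 = 0
      rw [rep_xCochain _ _ _ hp3 i h1 h2]; rfl
    · change matRep p r s α β μ _ 0 1 = 0
      rw [rep_yCochain]; rfl
    · change matRep p r s α β μ _ 0 1 = 0
      rw [hrel.rep_wCochain hp3]; rfl
  obtain ⟨q, hq, t, rfl⟩ := exists_generators hp hp3 z hz
  rw [map_add, hrel.rep_diff hp3, add_zero]
  exact hL hq

variable (p r s) in
/-- The upper left entry of `matRep`, as a homomorphism on cocycles. -/
def matVal (hp : Odd p) (hp3 : 3 ≤ p) {α β μ : A} (h : α * β = μ ^ 2) :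
    cocycles k (MAlg k p r s) →ₐ[k] A where
  toFun z := matRep p r s α β μ z.1 0 0
  map_one' := by
    change matRep p r s α β μ (1 : Cochains k (MAlg k p r s)) 0 0 = 1
    rw [map_one]; rfl
  map_zero' := by
    change matRep p r s α β μ (0 : Cochains k (MAlg k p r s)) 0 0 = 0
    rw [map_zero]; rfl
  map_add' x y := by
    change matRep p r s α β μ (x.1 + y.1) 0 0 = _
    rw [map_add]; rfl
  map_mul' x y := by
    change matRep p r s α β μ (x.1 * y.1) 0 0 = _
    rw [map_mul, Matrix.mul_apply, Fin.sum_univ_two, matRep_cocycle hp hp3 h x.1 x.2, zero_mul,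
      add_zero]
  commutes' a := by
    change matRep p r s α β μ (algebraMap k (Cochains k (MAlg k p r s)) a) 0 0 = _
    rw [AlgHom.commutes, Matrix.algebraMap_matrix_apply, if_pos rfl]

variable (p r s) in
/-- The upper left entry of `matRep`, as a homomorphism on the cohomology ring. -/
def matAug (hp : Odd p) (hp3 : 3 ≤ p) {α β μ : A} (h : α * β = μ ^ 2) :
    Coh k (MAlg k p r s) →ₐ[k] A :=
  Ideal.Quotient.liftₐ (coboundaries k (MAlg k p r s)) (matVal p r s hp hp3 h) (by
    rintro z ⟨t, ht⟩
    change matRep p r s α β μ z.1 0 0 = 0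
    rw [← ht, (repRel_matrix h).rep_diff hp3]; rfl)

theorem matAug_class (hp : Odd p) (hp3 : 3 ≤ p) {α β μ : A} (h : α * β = μ ^ 2)
    (z : cocycles k (MAlg k p r s)) :
    matAug p r s hp hp3 h (cocycleClass k _ z) = matRep p r s α β μ z.1 0 0 := rfl

/-- The upper left entry of `matRep α β μ` on cohomology depends on `μ` only. -/
theorem matAug_eq (hp : Odd p) (hp3 : 3 ≤ p) {α β α' β' μ : A} (h : α * β = μ ^ 2)
    (h' : α' * β' = μ ^ 2) :
    matAug (k := k) p r s hp hp3 h = matAug p r s hp hp3 h' := by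
  refine coh_hom_ext hp hp3 ?_
  rintro z hz (⟨i, h1, h2, rfl⟩ | ⟨i, h1, h2, rfl⟩ | rfl | rfl)
  · rw [matAug_class, matAug_class, rep_lambdaCochain _ _ _ hp3 i h1 h2,
      rep_lambdaCochain _ _ _ hp3 i h1 h2]
    split_ifs <;> rfl
  · rw [matAug_class, matAug_class, rep_xCochain _ _ _ hp3 i h1 h2, rep_xCochain _ _ _ hp3 i h1 h2]
  · rw [matAug_class, matAug_class, rep_yCochain, rep_yCochain]
  · rw [matAug_class, matAug_class, (repRel_matrix h).rep_wCochain hp3,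
      (repRel_matrix h').rep_wCochain hp3]

/-- The homomorphism `ε` is the upper left entry of `matRep 1 1 1`. -/
theorem isEps_matAug (hp : Odd p) (hp3 : 3 ≤ p) :
    IsEps (matAug (k := k) (A := k) p r s hp hp3 (α := 1) (β := 1) (μ := 1) (by simp)) := by
  have h : (1 : k) * 1 = 1 ^ 2 := by simp
  have hr : 1 ≤ r := Nat.one_le_iff_ne_zero.mpr (NeZero.ne r)
  refine ⟨⟨diff_yCochain, ?_⟩, ⟨diff_xCochain r hr, ?_⟩, fun i h1 h2 => ⟨diff_xCochain i h1, ?_⟩,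
    fun i h1 h2 => ⟨diff_lambdaCochain i, ?_⟩, fun _ => ⟨diff_wCochain hp, ?_⟩⟩
  · rw [matAug_class, rep_yCochain]; rfl
  · rw [matAug_class, (repRel_matrix h).rep_xCochain_top hp3]
    simp [Matrix.mul_apply, Fin.sum_univ_two]
  · rw [matAug_class, rep_xCochain _ _ _ hp3 i h1 h2]; rfl
  · rw [matAug_class, rep_lambdaCochain _ _ _ hp3 i h1 h2]
    split_ifs <;> rfl
  · rw [matAug_class, (repRel_matrix h).rep_wCochain hp3]; rfl

variable (k p r s) in
theorem existsUnique_isEps (hp : Odd p) (hp3 : 3 ≤ p) :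
    ∃! ε : Coh k (MAlg k p r s) →ₐ[k] k, IsEps ε :=
  ⟨_, isEps_matAug hp hp3, fun _ h => h.eq hp hp3 (isEps_matAug hp hp3)⟩

end MatrixRepresentation

/-! ### The homomorphism `ψ_{r;s}` on homogeneous elements -/

section BaseChangeCocycles

variable (k : Type*) (A : Type*) (C : Type*) [Field k] [CommRing A] [Algebra k A]
  [Ring C] [Algebra k C] [Coalgebra k C]

/-- The cocycles over `A` are generated by cocycles over `k`. -/
theorem cocycleExtend_surjective : Function.Surjective (cocycleExtend k A C) := by
  intro z
  have hex : Function.Exact (cocycleIncl k C) (diff k C) := by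
    intro t
    exact ⟨fun h => ⟨⟨t, h⟩, rfl⟩, by rintro ⟨z, rfl⟩; exact z.2⟩
  obtain ⟨t, ht⟩ := (cochainEquiv k A C).surjective z
  have h0 : (diff k C).lTensor A t = 0 := by
    apply (cochainEquiv k A C).injective
    rw [cochainEquiv_diff, map_zero, ht]; exact z.2
  obtain ⟨x, rfl⟩ := (Module.Flat.lTensor_exact A hex t).mp h0
  exact ⟨x, Subtype.ext (by rw [cocycleExtend_val, ht])⟩

variable {k A C}

/-- Two `A`-linear maps on cochains that agree on cocycles over `k` agree on cocycles over `A`. -/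
theorem eq_of_cocycleBase {N : Type*} [AddCommGroup N] [Module A N]
    {f g : Cochains A (A ⊗[k] C) →ₗ[A] N}
    (h : ∀ z, diff k C z = 0 → f (cochainBase k A C z) = g (cochainBase k A C z))
    (z : cocycles A (A ⊗[k] C)) : f z.1 = g z.1 := by
  obtain ⟨x, rfl⟩ := cocycleExtend_surjective k A C z
  rw [cocycleExtend_val]
  induction x with
  | zero => simp
  | add a b ha hb => simp only [map_add, ha, hb]
  | tmul a z =>
    rw [LinearMap.lTensor_tmul, cochainEquiv_tmul, map_smul, map_smul]
    congr 1
    exact h z.1 z.2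

theorem extendAug_cohBase (h1 : Coalgebra.comul (R := k) (1 : C) = 1 ⊗ₜ 1) (e : Coh k C →ₐ[k] k)
    (x : Coh k C) : extendAug A h1 e (cohBase k A C x) = algebraMap k A (e x) := by
  have h : (AlgEquiv.ofBijective (cohExtend k A C) (cohExtend_bijective k A C h1)).symm
      (cohBase k A C x) = 1 ⊗ₜ x := by
    rw [AlgEquiv.symm_apply_eq]
    change _ = cohExtend k A C (1 ⊗ₜ x)
    rw [cohExtend_tmul, one_smul]
  change (Algebra.TensorProduct.rid k A A) (Algebra.TensorProduct.map (AlgHom.id A A) e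
    ((AlgEquiv.ofBijective (cohExtend k A C) (cohExtend_bijective k A C h1)).symm
      (cohBase k A C x))) = _
  rw [h, Algebra.TensorProduct.map_tmul, Algebra.TensorProduct.rid_tmul, AlgHom.id_apply,
    Algebra.algebraMap_eq_smul_one]

/-- To identify `extendAug` on cocycles over `A`, it suffices to consider cocycles over `k`. -/
theorem extendAug_class (h1 : Coalgebra.comul (R := k) (1 : C) = 1 ⊗ₜ 1) (e : Coh k C →ₐ[k] k)
    {f : Cochains A (A ⊗[k] C) →ₗ[A] A}
    (h : ∀ z : cocycles k C, f (cochainBase k A C z.1) = algebraMap k A (e (cocycleClass k C z)))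
    (z : cocycles A (A ⊗[k] C)) : extendAug A h1 e (cocycleClass A _ z) = f z.1 := by
  obtain ⟨x, rfl⟩ := cocycleExtend_surjective k A C z
  induction x with
  | zero => simp
  | add a b ha hb =>
    rw [map_add, map_add, map_add, ha, hb, ← map_add]
    rfl
  | tmul a z =>
    rw [cocycleExtend_tmul, map_smul, map_smul]
    have h2 : cocycleClass A _ (cocycleBase k A C z) = cohBase k A C (cocycleClass k C z) := rfl
    rw [h2, extendAug_cohBase, ← h z, ← map_smul]
    rfl

end BaseChangeCocycles

section Points

variable {k : Type*} [Field k] {A B : Type*} [CommRing A] [Algebra k A] [CommRing B] [Algebra k B]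
  {C D : Type*} [Ring C] [Algebra k C] [Coalgebra k C] [Ring D] [Algebra k D] [Coalgebra k D]
  {𝒞 : ZMod 2 → Submodule k C} {𝒟 : ZMod 2 → Submodule k D}

/-- The `A`-linear extension of `l : D → Mat_2(A)` to the Hochschild complex over `A`. -/
def extRep (l : D →ₗ[k] Matrix (Fin 2) (Fin 2) A) :
    Cochains A (A ⊗[k] D) →ₐ[A] Matrix (Fin 2) (Fin 2) A :=
  TensorAlgebra.lift A (l.liftBaseChange A)

theorem extRep_inj (l : D →ₗ[k] Matrix (Fin 2) (Fin 2) A) (x : A ⊗[k] D) :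
    extRep l (inj A _ x) = l.liftBaseChange A x :=
  TensorAlgebra.lift_ι_apply _ _

theorem extRep_cochainBase (l : D →ₗ[k] Matrix (Fin 2) (Fin 2) A) (t : Cochains k D) :
    extRep l (cochainBase k A D t) = TensorAlgebra.lift k l t := by
  have h : ((extRep l).restrictScalars k).comp (cochainBase k A D) = TensorAlgebra.lift k l := by
    ext c : 2
    simp only [LinearMap.comp_apply, AlgHom.toLinearMap_apply, AlgHom.comp_apply,
      AlgHom.restrictScalars_apply, TensorAlgebra.lift_ι_apply]
    rw [cochainBase_inj, extRep_inj, LinearMap.liftBaseChange_tmul, one_smul]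
  exact DFunLike.congr_fun h t

/-- The homomorphism on the Hochschild complex of `G` that a homomorphism `f` into `G` and a linear
map `l` on the coordinate algebra of its source define. -/
def pointRep (f : SHom A 𝒞 𝒟) (l : D →ₗ[k] Matrix (Fin 2) (Fin 2) A) :
    Cochains k C →ₐ[k] Matrix (Fin 2) (Fin 2) A :=
  TensorAlgebra.lift k ((l.liftBaseChange A).restrictScalars k ∘ₗ f.point.toLinearMap)

theorem pointRep_inj (f : SHom A 𝒞 𝒟) (l : D →ₗ[k] Matrix (Fin 2) (Fin 2) A) (c : C) :
    pointRep f l (inj k _ c) = l.liftBaseChange A (f.point c) :=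
  TensorAlgebra.lift_ι_apply _ _

theorem extRep_cochainMap (f : SHom A 𝒞 𝒟) (l : D →ₗ[k] Matrix (Fin 2) (Fin 2) A)
    (t : Cochains k C) :
    extRep l (cochainMap f.toHom (cochainBase k A C t)) = pointRep f l t := by
  have h : (((extRep l).comp (cochainMap f.toHom)).restrictScalars k).comp (cochainBase k A C) =
      pointRep f l := by
    ext c : 2
    simp only [LinearMap.comp_apply, AlgHom.toLinearMap_apply, AlgHom.comp_apply,
      AlgHom.restrictScalars_apply]
    rw [cochainBase_inj, cochainMap_inj, extRep_inj, pointRep_inj]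
    rfl
  exact DFunLike.congr_fun h t

theorem mapMatrix_pointRep (φ : A →ₐ[k] B) (f : SHom A 𝒞 𝒟)
    {l : D →ₗ[k] Matrix (Fin 2) (Fin 2) A} {l' : D →ₗ[k] Matrix (Fin 2) (Fin 2) B}
    (h : ∀ d, φ.mapMatrix (l d) = l' d) (t : Cochains k C) :
    φ.mapMatrix (pointRep f l t) = pointRep (f.map φ) l' t := by
  have e : φ.mapMatrix.comp (pointRep f l) = pointRep (f.map φ) l' := by
    ext c : 2
    simp only [LinearMap.comp_apply, AlgHom.toLinearMap_apply, AlgHom.comp_apply]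
    rw [pointRep_inj, pointRep_inj, SHom.point_map]
    generalize f.point c = x
    induction x with
    | zero => simp
    | add a b ha hb => simp only [map_add, ha, hb]
    | tmul a d =>
      rw [LinearMap.liftBaseChange_tmul, scal, LinearMap.rTensor_tmul,
        LinearMap.liftBaseChange_tmul, ← h]
      ext i j
      simp
  exact DFunLike.congr_fun e t

theorem pointRep_smul (f : SHom A 𝒞 𝒟) (l : D →ₗ[k] Matrix (Fin 2) (Fin 2) A) (μ : A)
    {n : ℕ} {i : ZMod 2} {t : Cochains k C} (ht : t ∈ cochainPart 𝒞 n i) :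
    pointRep f (μ • l) t = μ ^ n • pointRep f l t := by
  have h : cochainPart 𝒞 n i ≤ LinearMap.eqLocus (pointRep f (μ • l)).toLinearMap
      (μ ^ n • (pointRep f l).toLinearMap) := by
    refine Submodule.span_le.mpr ?_
    rintro _ ⟨c, e, -, -, rfl⟩
    change pointRep f (μ • l) _ = μ ^ n • pointRep f l _
    clear e
    have hl : ∀ x : A ⊗[k] D, (μ • l).liftBaseChange A x = μ • l.liftBaseChange A x := by
      intro x
      induction x with
      | zero => simp
      | add a b ha hb => simp only [map_add, smul_add, ha, hb]
      | tmul a d =>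
        rw [LinearMap.liftBaseChange_tmul, LinearMap.liftBaseChange_tmul, LinearMap.smul_apply,
          smul_comm]
    rw [TensorAlgebra.tprod_apply, map_list_prod, map_list_prod, List.map_ofFn, List.map_ofFn]
    have hc : ∀ j, pointRep f (μ • l) (TensorAlgebra.ι k (c j)) =
        μ • pointRep f l (TensorAlgebra.ι k (c j)) := fun j => by
      rw [pointRep_inj, pointRep_inj, hl]
    clear ht
    induction n with
    | zero => simp
    | succ n ih =>
      rw [List.ofFn_succ, List.ofFn_succ, List.prod_cons, List.prod_cons]
      have := ih (fun j => c j.succ) (fun j => hc j.succ)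
      simp only [Function.comp_def] at this ⊢
      rw [this, hc, smul_mul_smul_comm, pow_succ']
  exact h ht

theorem extRep_eq {l l' : D →ₗ[k] Matrix (Fin 2) (Fin 2) A}
    (h : ∀ z, diff k D z = 0 → TensorAlgebra.lift k l z 0 0 = TensorAlgebra.lift k l' z 0 0)
    (z : cocycles A (A ⊗[k] D)) : extRep l z.1 0 0 = extRep l' z.1 0 0 := by
  refine eq_of_cocycleBase (f := Matrix.entryLinearMap A A 0 0 ∘ₗ (extRep l).toLinearMap)
    (g := Matrix.entryLinearMap A A 0 0 ∘ₗ (extRep l').toLinearMap) (fun t ht => ?_) z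
  rw [LinearMap.comp_apply, LinearMap.comp_apply, AlgHom.toLinearMap_apply,
    AlgHom.toLinearMap_apply, extRep_cochainBase, extRep_cochainBase]
  exact h t ht

theorem extendAug_eq_extRep (h1 : Coalgebra.comul (R := k) (1 : D) = 1 ⊗ₜ 1)
    (e : Coh k D →ₐ[k] k) {l : D →ₗ[k] Matrix (Fin 2) (Fin 2) A}
    (h : ∀ z : cocycles k D,
      TensorAlgebra.lift k l z.1 0 0 = algebraMap k A (e (cocycleClass k D z)))
    (z : cocycles A (A ⊗[k] D)) : extendAug A h1 e (cocycleClass A _ z) = extRep l z.1 0 0 := by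
  refine extendAug_class (f := Matrix.entryLinearMap A A 0 0 ∘ₗ (extRep l).toLinearMap) h1 e
    (fun t => ?_) z
  rw [LinearMap.comp_apply, AlgHom.toLinearMap_apply, extRep_cochainBase]
  exact h t

end Points

theorem coe_halfPow (p r : ℕ) : ((halfPow p r : HalfInt p r) : ℚ) = (p : ℚ) ^ r / 2 := rfl

section Homogeneous

variable {k : Type*} [Field k] {p : ℕ} [Fact p.Prime] [CharP k p] {r s : ℕ} [NeZero r] [NeZero s]
  {A B : Type*} [CommRing A] [Algebra k A] [CommRing B] [Algebra k B]

theorem mapMatrix_matLin (φ : A →ₐ[k] B) (α β μ : A) (c : MAlg k p r s) :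
    φ.mapMatrix (matLin p r s α β μ c) = matLin p r s (φ α) (φ β) (φ μ) c := by
  rw [← even_add_odd k p r s c, map_add, map_add, map_add, matLin, matLin, repLin_even, repLin_odd,
    repLin_even, repLin_odd]
  ext i j
  fin_cases i <;> fin_cases j <;> simp

theorem mapMatrix_matRep (φ : A →ₐ[k] B) (α β μ : A) (t : Cochains k (MAlg k p r s)) :
    φ.mapMatrix (matRep p r s α β μ t) = matRep p r s (φ α) (φ β) (φ μ) t := by
  have h : φ.mapMatrix.comp (matRep p r s α β μ) =
      matRep (k := k) p r s (φ α) (φ β) (φ μ) := by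
    ext c : 2
    simp only [LinearMap.comp_apply, AlgHom.toLinearMap_apply, AlgHom.comp_apply]
    rw [rep_inj, rep_inj]
    exact mapMatrix_matLin φ α β μ c
  exact DFunLike.congr_fun h t

theorem matLin_smul (μ : A) : matLin (k := k) p r s μ μ μ = μ • matLin p r s 1 1 1 := by
  refine MAlg.linear_ext k p r s (fun x => ?_) (fun x => ?_)
  · rw [LinearMap.smul_apply, matLin, matLin, repLin_even, repLin_even, smul_add, smul_comm μ,
      smul_comm μ]
    congr 2 <;> ext i j <;> fin_cases i <;> fin_cases j <;> simp
  · rw [LinearMap.smul_apply, matLin, matLin, repLin_odd, repLin_odd, smul_comm μ]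
    congr 1
    ext i j
    fin_cases i <;> fin_cases j <;> simp

/-- The upper left entry of the extension of `matLin α β μ` depends on `μ` only. -/
theorem extRep_matLin_eq (hp : Odd p) (hp3 : 3 ≤ p) {α β α' β' μ : A} (h : α * β = μ ^ 2)
    (h' : α' * β' = μ ^ 2) (z : cocycles A (A ⊗[k] MAlg k p r s)) :
    extRep (matLin p r s α β μ) z.1 0 0 = extRep (matLin p r s α' β' μ) z.1 0 0 := by
  refine extRep_eq (fun t ht => ?_) z
  have := DFunLike.congr_fun (matAug_eq (k := k) (r := r) (s := s) hp hp3 h h')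
    (cocycleClass k _ ⟨t, ht⟩)
  rwa [matAug_class, matAug_class] at this

theorem extendAug_eps (hp : Odd p) (hp3 : 3 ≤ p) {ε : Coh k (MAlg k p r s) →ₐ[k] k}
    (hε : IsEps ε) (z : cocycles A (A ⊗[k] MAlg k p r s)) :
    extendAug A (comul_one k p r s) ε (cocycleClass A _ z) =
      extRep (matLin p r s 1 1 1) z.1 0 0 := by
  refine extendAug_eq_extRep _ _ (fun t => ?_) z
  have h := mapMatrix_matRep (r := r) (s := s) (Algebra.ofId k A) 1 1 1 t.1
  rw [map_one] at h
  rw [hε.eq hp hp3 (isEps_matAug hp hp3), matAug_class]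
  exact (congrFun (congrFun h 0) 0).symm

/-- The endomorphism `ρ_{(μ,a)}` changes the parameters `(1, 1, 1)` of `matLin` to
`(a ^ p ^ (r - 1), a ^ ((p - 1) p ^ (r - 1)), μ)`. -/
theorem liftBaseChange_rho (hp3 : 3 ≤ p) (hr : r ≠ 0) (a μ : A) (h : a ^ p ^ r = μ ^ 2)
    (x : A ⊗[k] MAlg k p r s) :
    (matLin p r s 1 1 1).liftBaseChange A ((rho s hr a μ h).toHom x) =
      (matLin p r s (a ^ p ^ (r - 1)) (a ^ ((p - 1) * p ^ (r - 1))) μ).liftBaseChange A x := by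
  have key : ∀ c : MAlg k p r s, (matLin p r s 1 1 1).liftBaseChange A (rhoHom k p r s a μ c) =
      matLin p r s (a ^ p ^ (r - 1)) (a ^ ((p - 1) * p ^ (r - 1))) μ c := by
    have hE : ∀ i j, rhoE k p r s a (thetaE k p r s ^ i * sigmaE k p r s j) =
        (a ^ i * a ^ (j * p ^ (r - 1))) ⊗ₜ (thetaE k p r s ^ i * sigmaE k p r s j) := by
      intro i j
      rw [map_mul, map_pow, rhoE_theta, rhoE_sigma, Algebra.TensorProduct.tmul_pow,
        Algebra.TensorProduct.tmul_mul_tmul]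
    refine fun c => DFunLike.congr_fun (f := ((matLin p r s 1 1 1).liftBaseChange A).restrictScalars k
      ∘ₗ (rhoHom k p r s a μ).toLinearMap) ?_ c
    refine MAlg.linear_ext k p r s
      (fun x => DFunLike.congr_fun (f := (((matLin p r s 1 1 1).liftBaseChange A).restrictScalars k
        ∘ₗ (rhoHom k p r s a μ).toLinearMap) ∘ₗ evenIncl k p r s) (g := matLin p r s
        (a ^ p ^ (r - 1)) (a ^ ((p - 1) * p ^ (r - 1))) μ ∘ₗ evenIncl k p r s) ?_ x)
      (fun x => DFunLike.congr_fun (f := (((matLin p r s 1 1 1).liftBaseChange A).restrictScalars k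
        ∘ₗ (rhoHom k p r s a μ).toLinearMap) ∘ₗ oddIncl k p r s) (g := matLin p r s
        (a ^ p ^ (r - 1)) (a ^ ((p - 1) * p ^ (r - 1))) μ ∘ₗ oddIncl k p r s) ?_ x)
    · refine even_linear_ext fun i j hi hj => ?_
      change (matLin p r s 1 1 1).liftBaseChange A (rhoHom k p r s a μ (evenIncl k p r s _)) =
        matLin p r s _ _ μ (evenIncl k p r s _)
      rw [rhoHom_even, hE, LinearMap.lTensor_tmul, LinearMap.liftBaseChange_tmul, matLin, matLin,
        repLin_even, repLin_even, chi_theta_sigma _ _ _ hi hj, chi_theta_sigma _ _ _ hi hj]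
      by_cases h1 : i = 0 ∧ j = 1
      · rw [if_pos h1, if_neg (by omega), h1.1, h1.2]
        ext u v
        fin_cases u <;> fin_cases v <;> simp
      · by_cases h2 : i = 0 ∧ j = p - 1
        · rw [if_neg h1, if_pos h2, h2.1, h2.2]
          ext u v
          fin_cases u <;> fin_cases v <;> simp
        · rw [if_neg h1, if_neg h2]
          simp
    · refine even_linear_ext fun i j hi hj => ?_
      change (matLin p r s 1 1 1).liftBaseChange A (rhoHom k p r s a μ (oddIncl k p r s _)) =
        matLin p r s _ _ μ (oddIncl k p r s _)
      rw [rhoHom_odd, hE, LinearMap.lTensor_tmul, map_smul, LinearMap.liftBaseChange_tmul, matLin,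
        matLin, repLin_odd, repLin_odd, chi_theta_sigma _ _ _ hi hj]
      by_cases h1 : i = 0 ∧ j = 0
      · rw [if_pos h1, h1.1, h1.2]
        ext u v
        fin_cases u <;> fin_cases v <;> simp
      · rw [if_neg h1]
        simp
  induction x with
  | zero => simp
  | add u v hu hv => simp only [map_add, hu, hv]
  | tmul b c =>
    have e : b ⊗ₜ[k] c = b • ((1 : A) ⊗ₜ[k] c) := by
      rw [TensorProduct.smul_tmul', smul_eq_mul, mul_one]
    rw [e, map_smul, map_smul, map_smul]
    congr 1
    have h2 : (rho s hr a μ h).toHom (1 ⊗ₜ c) = rhoHom k p r s a μ c :=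
      SHom.point_ofPoint _ (isPoint_rho hr a μ h) c
    rw [h2, key, LinearMap.liftBaseChange_tmul, one_smul]

variable {C : Type*} [Ring C] [Algebra k C] [Coalgebra k C] {𝒞 : ZMod 2 → Submodule k C}

/-- On the class of a cocycle `t`, the homomorphism `ψ_{r;s}` is the upper left entry of the matrix
that the universal homomorphism and `matLin 1 1 1` assign to `t`. -/
theorem psi_class (hp : Odd p) (hp3 : 3 ≤ p) {ε : Coh k (MAlg k p r s) →ₐ[k] k} (hε : IsEps ε)
    (z : evenCoh 𝒞) (t : cocycles k C) (hz : z.1 = cocycleClass k C t) :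
    psi 𝒞 ε z = pointRep (universalHom 𝒞 (mParity k p r s)) (matLin p r s 1 1 1) t.1 0 0 := by
  change extendAug (VRing p r s 𝒞) (comul_one k p r s) ε
    (cohMap (universalHom 𝒞 (mParity k p r s)).toHom (cohBase k (VRing p r s 𝒞) C z.1)) = _
  rw [hz, ← extRep_cochainMap]
  exact extendAug_eps hp hp3 hε (cocycleMap (universalHom 𝒞 (mParity k p r s)).toHom
    (cocycleBase k (VRing p r s 𝒞) C t))

/-- Over `A_G ⊗ B` the parameters of `matLin` become `(α, β, μ)` with `α β = μ ^ 2`. As the upper left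
entry depends on `μ` only, they can be replaced by `(μ, μ, μ)`, and `matLin μ μ μ = μ • matLin 1 1 1`
yields the factor `μ ^ n`. -/
theorem coaction_psi (hp : Odd p) (hp3 : 3 ≤ p) {ε : Coh k (MAlg k p r s) →ₐ[k] k} (hε : IsEps ε)
    (n : ℕ) (z : evenCoh 𝒞) (hz : z ∈ evenCohPart 𝒞 n) :
    coaction p r s 𝒞 (psi 𝒞 ε z) = psi 𝒞 ε z ⊗ₜ (bY k p r ^ n) := by
  obtain ⟨t, ht, htz⟩ := hz
  rw [psi_class hp hp3 hε z t htz.symm]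
  set u := universalHom 𝒞 (mParity k p r s) with hu
  set a : VRing p r s 𝒞 ⊗[k] BAlg k p r := 1 ⊗ₜ bX k p r
  set μ : VRing p r s 𝒞 ⊗[k] BAlg k p r := 1 ⊗ₜ bY k p r with hμ
  have haμ : a ^ p ^ r = μ ^ 2 := tmul_bX_pow p r
  set v := u.map (Algebra.TensorProduct.includeLeft (R := k) (S := k) (A := VRing p r s 𝒞)
    (B := BAlg k p r)) with hv
  have hfu : u.map (coaction p r s 𝒞) = (rho s (NeZero.ne r) a μ haμ).comp v := map_coordLift _
  have hone : ∀ φ : VRing p r s 𝒞 →ₐ[k] VRing p r s 𝒞 ⊗[k] BAlg k p r, ∀ d,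
      φ.mapMatrix (matLin p r s 1 1 1 d) = matLin p r s 1 1 1 d := fun φ d => by
    rw [mapMatrix_matLin, map_one]
  have h1 := mapMatrix_pointRep (coaction p r s 𝒞) u (hone _) t.1
  have h2 := mapMatrix_pointRep (Algebra.TensorProduct.includeLeft (R := k) (S := k)
    (A := VRing p r s 𝒞) (B := BAlg k p r)) u (hone _) t.1
  have h1' := congrFun (congrFun h1 0) 0
  have h2' := congrFun (congrFun h2 0) 0
  -- The action of `ρ` changes the parameters `α` and `β`, which do not affect the entry.
  have hαβ : a ^ p ^ (r - 1) * a ^ ((p - 1) * p ^ (r - 1)) = μ ^ 2 := by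
    rw [← pow_add, ← haμ]
    congr 1
    obtain ⟨m, hm⟩ : ∃ m, r = m + 1 := ⟨r - 1, by have := NeZero.ne r; omega⟩
    rw [hm, Nat.add_sub_cancel, pow_succ', add_comm, ← Nat.succ_mul, Nat.succ_eq_add_one,
      Nat.sub_add_cancel (by omega)]
  have h3 : pointRep ((rho s (NeZero.ne r) a μ haμ).comp v) (matLin p r s 1 1 1) t.1 =
      pointRep v (matLin p r s (a ^ p ^ (r - 1)) (a ^ ((p - 1) * p ^ (r - 1))) μ) t.1 := by
    refine congrArg (fun F : Cochains k C →ₐ[k] _ => F t.1) ?_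
    ext c : 2
    simp only [LinearMap.comp_apply, AlgHom.toLinearMap_apply]
    rw [pointRep_inj, pointRep_inj]
    exact liftBaseChange_rho hp3 (NeZero.ne r) a μ haμ _
  have ht' : t.1 ∈ cochainPart 𝒞 n n := ht
  have h4 := extRep_matLin_eq hp hp3 hαβ (sq μ).symm
    (cocycleMap v.toHom (cocycleBase k _ C t))
  change extRep _ (cochainMap v.toHom (cochainBase k _ C t.1)) 0 0 =
    extRep _ (cochainMap v.toHom (cochainBase k _ C t.1)) 0 0 at h4
  rw [extRep_cochainMap, extRep_cochainMap, matLin_smul, pointRep_smul v _ μ ht'] at h4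
  refine h1'.trans ?_
  rw [hfu, h3, h4, Matrix.smul_apply, ← h2']
  change μ ^ n * (pointRep u (matLin p r s 1 1 1) t.1 0 0 ⊗ₜ 1) = _
  rw [hμ, Algebra.TensorProduct.tmul_pow, Algebra.TensorProduct.tmul_mul_tmul, one_pow, one_mul,
    mul_one]

/-- The homomorphism `ψ_{r;s}` multiplies degrees by `p ^ r / 2`. -/
theorem psi_mem_vPiece (hp : Odd p) (hp3 : 3 ≤ p) {ε : Coh k (MAlg k p r s) →ₐ[k] k}
    (hε : IsEps ε) (n : ℕ) (z : evenCoh 𝒞) (hz : z ∈ evenCohPart 𝒞 n) :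
    psi 𝒞 ε z ∈ vPiece p r s 𝒞 (n • halfPow p r) := by
  have key : ∀ e : Fin 2, ∀ m, n = 2 * m + e →
      psi 𝒞 ε z ∈ vPiece p r s 𝒞 (n • halfPow p r) := by
    intro e m hn
    refine Submodule.mem_iSup_of_mem (m * p ^ r) (Submodule.mem_iSup_of_mem e
      (Submodule.mem_iSup_of_mem ?_ ?_))
    · refine Subtype.ext ?_
      rw [hn]
      push_cast [coe_halfPow]
      simp only [nsmul_eq_mul]
      push_cast
      ring
    · rw [mem_weightSpace, coaction_psi hp hp3 hε n z hz, hn, pow_add, pow_mul, ← bX_pow, ← pow_mul,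
        mul_comm m]
  obtain ⟨m, h | h⟩ := Nat.even_or_odd' n
  · exact key 0 m (by simpa using h)
  · exact key 1 m (by simpa using h)

end Homogeneous

/-! ### The grading of `H(G, k)` -/

section GradedOfProjections

variable {k : Type*} [Field k] {ι : Type*} [DecidableEq ι] {M : Type*} [AddCommGroup M] [Module k M]

/-- Submodules that are separated by a family of linear maps are independent. -/
theorem iSupIndep_of_projections {V : ι → Submodule k M} (π : ι → M →ₗ[k] M)
    (h : ∀ i, ∀ x ∈ V i, π i x = x) (h0 : ∀ i j, j ≠ i → ∀ x ∈ V j, π i x = 0) :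
    iSupIndep V := by
  intro i
  rw [Submodule.disjoint_def]
  intro x hx hx'
  have hle : ⨆ j, ⨆ _ : j ≠ i, V j ≤ LinearMap.ker (π i) :=
    iSup₂_le fun j hj y hy => h0 i j hj y hy
  rw [← h i x hx]
  exact hle hx'

theorem nonempty_gradedAlgebra [AddMonoid ι] {A : Type*} [Ring A] [Algebra k A]
    {V : ι → Submodule k A} (h1 : 1 ∈ V 0)
    (hm : ∀ i j a b, a ∈ V i → b ∈ V j → a * b ∈ V (i + j)) (hind : iSupIndep V)
    (htop : ⨆ i, V i = ⊤) : Nonempty (GradedAlgebra V) := by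
  have hV : SetLike.GradedMonoid V :=
    { one_mem := h1, mul_mem := fun i j a b ha hb => hm i j a b ha hb }
  let _ : DirectSum.Decomposition V :=
    (DirectSum.isInternal_submodule_of_iSupIndep_of_iSup_eq_top hind htop).chooseDecomposition
  exact ⟨{ }⟩

end GradedOfProjections

section CohomologicalDegree

variable {k : Type*} [Field k] {C : Type*} [Ring C] [Algebra k C] [Coalgebra k C]

variable (k C) in
/-- The space of `n`-cochains. -/
abbrev cochainDegree (n : ℕ) : Submodule k (Cochains k C) := LinearMap.range (inj k C) ^ n

theorem inj_mem_cochainDegree (c : C) : inj k C c ∈ cochainDegree k C 1 := by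
  rw [cochainDegree, pow_one]
  exact ⟨c, rfl⟩

theorem juxt_mem_cochainDegree (x : C ⊗[k] C) : juxt k C x ∈ cochainDegree k C 2 := by
  induction x with
  | zero => rw [map_zero]; exact zero_mem _
  | add a b ha hb => rw [map_add]; exact add_mem ha hb
  | tmul a b =>
    have h : juxt k C (a ⊗ₜ b) = inj k C a * inj k C b := by simp [juxt]
    rw [h]
    exact SetLike.mul_mem_graded (A := cochainDegree k C) (inj_mem_cochainDegree a)
      (inj_mem_cochainDegree b)

theorem diff_mem_cochainDegree {n : ℕ} {t : Cochains k C} (ht : t ∈ cochainDegree k C n) :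
    diff k C t ∈ cochainDegree k C (n + 1) := by
  induction ht using Submodule.pow_induction_on_left' with
  | algebraMap r => rw [diff_algebraMap]; exact zero_mem _
  | add x y i hx hy ihx ihy => rw [map_add]; exact add_mem ihx ihy
  | mem_mul m hm i x hx ih =>
    obtain ⟨c, rfl⟩ := hm
    have h1 : inj k C 1 ∈ cochainDegree k C 1 := inj_mem_cochainDegree 1
    have hc : inj k C c ∈ cochainDegree k C 1 := inj_mem_cochainDegree c
    have hd : diff k C (inj k C c) ∈ cochainDegree k C 2 := by
      rw [diff_inj]
      exact sub_mem (add_mem (SetLike.mul_mem_graded (A := cochainDegree k C) h1 hc)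
        (SetLike.mul_mem_graded (A := cochainDegree k C) hc h1)) (juxt_mem_cochainDegree _)
    rw [diff_mul, sgn_inj]
    refine add_mem ?_ ?_
    · rw [show i + 1 + 1 = 2 + i by omega]
      exact SetLike.mul_mem_graded (A := cochainDegree k C) hd hx
    · rw [show i + 1 + 1 = 1 + (i + 1) by omega]
      exact SetLike.mul_mem_graded (A := cochainDegree k C) (neg_mem hc) ih

/-- The component of degree `n` of a coboundary is a coboundary. -/
theorem exists_proj_diff (n : ℕ) (t : Cochains k C) :
    ∃ u, GradedAlgebra.proj (cochainDegree k C) n (diff k C t) = diff k C u := by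
  induction t using DirectSum.Decomposition.inductionOn (cochainDegree k C) with
  | zero => exact ⟨0, by simp⟩
  | @homogeneous i t =>
    have h := diff_mem_cochainDegree t.2
    by_cases hi : i + 1 = n
    · subst hi
      exact ⟨t, by rw [GradedAlgebra.proj_apply, DirectSum.decompose_of_mem_same _ h]⟩
    · exact ⟨0, by rw [GradedAlgebra.proj_apply, DirectSum.decompose_of_mem_ne _ h hi, map_zero]⟩
  | add a b ha hb =>
    obtain ⟨u, hu⟩ := ha
    obtain ⟨v, hv⟩ := hb
    exact ⟨u + v, by rw [map_add, map_add, hu, hv, map_add]⟩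

variable (𝒞 : ZMod 2 → Submodule k C)

theorem cochainPart_le (n : ℕ) (i : ZMod 2) : cochainPart 𝒞 n i ≤ cochainDegree k C n := by
  refine Submodule.span_le.mpr ?_
  rintro _ ⟨c, -, -, -, rfl⟩
  rw [SetLike.mem_coe, TensorAlgebra.tprod_apply]
  have := SetLike.list_prod_ofFn_mem_graded (A := cochainDegree k C) (fun _ : Fin n => 1)
    (fun j => TensorAlgebra.ι k (c j)) (fun j => inj_mem_cochainDegree (c j))
  simpa using this

theorem iSupIndep_cohPart (i : ℕ → ZMod 2) : iSupIndep fun n => cohPart 𝒞 n (i n) := by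
  intro n
  rw [Submodule.disjoint_def]
  rintro _ ⟨t, ht, rfl⟩ hx
  -- The classes in the other summands are represented by cocycles without component in degree `n`.
  have hle : ⨆ m, ⨆ _ : m ≠ n, cohPart 𝒞 m (i m) ≤
      Submodule.map (cocycleClass k C).toLinearMap (Submodule.comap (cocycles k C).val.toLinearMap
        (LinearMap.ker (GradedAlgebra.proj (cochainDegree k C) n))) := by
    refine iSup₂_le fun m hm => Submodule.map_mono (Submodule.comap_mono fun u hu => ?_)
    rw [LinearMap.mem_ker, GradedAlgebra.proj_apply,
      DirectSum.decompose_of_mem_ne _ (cochainPart_le 𝒞 m _ hu) hm]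
  obtain ⟨t', ht', h⟩ := hle hx
  have h0 : cocycleClass k C (t - t') = 0 := by
    rw [map_sub, sub_eq_zero]
    exact h.symm
  obtain ⟨u, hu⟩ := (cocycleClass_eq_zero k C _).mp h0
  obtain ⟨v, hv⟩ := exists_proj_diff n u
  refine (cocycleClass_eq_zero k C t).mpr ⟨v, ?_⟩
  have ht2 : t.1 ∈ cochainDegree k C n := cochainPart_le 𝒞 n _ ht
  have ht3 : GradedAlgebra.proj (cochainDegree k C) n t'.1 = 0 := ht'
  rw [← hv, hu]
  change GradedAlgebra.proj (cochainDegree k C) n (t.1 - t'.1) = _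
  rw [map_sub, ht3, sub_zero, GradedAlgebra.proj_apply, DirectSum.decompose_of_mem_same _ ht2]

theorem evenCoh_toSubmodule :
    Subalgebra.toSubmodule (evenCoh 𝒞) = ⨆ n : ℕ, cohPart 𝒞 n n := rfl

theorem nonempty_gradedAlgebra_evenCohPart : Nonempty (GradedAlgebra (evenCohPart 𝒞)) := by
  have hmap : ∀ n, (evenCohPart 𝒞 n).map (evenCoh 𝒞).val.toLinearMap = cohPart 𝒞 n n := by
    intro n
    rw [evenCohPart, Submodule.map_comap_eq, inf_eq_right]
    intro x hx
    have hx' : x ∈ Subalgebra.toSubmodule (evenCoh 𝒞) := by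
      rw [evenCoh_toSubmodule]
      exact Submodule.mem_iSup_of_mem n hx
    exact ⟨⟨x, hx'⟩, rfl⟩
  have hinj : Function.Injective (evenCoh 𝒞).val.toLinearMap := Subtype.val_injective
  refine nonempty_gradedAlgebra ?_ ?_ ?_ ?_
  · refine ⟨1, ?_, map_one (cocycleClass k C)⟩
    rw [Nat.cast_zero]
    exact one_mem_cochainPart 𝒞
  · intro m n a b ha hb
    change a.1 * b.1 ∈ cohPart 𝒞 (m + n) ((m + n : ℕ) : ZMod 2)
    rw [Nat.cast_add]
    exact cohPart_mul 𝒞 ha hb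
  · intro n
    rw [Submodule.disjoint_def]
    intro x hx hx'
    refine hinj ?_
    rw [map_zero]
    refine Submodule.disjoint_def.mp (iSupIndep_cohPart 𝒞 (fun n => (n : ZMod 2)) n) _ hx ?_
    have h := Submodule.mem_map_of_mem (f := (evenCoh 𝒞).val.toLinearMap) hx'
    simpa only [Submodule.map_iSup, hmap] using h
  · refine Submodule.map_injective_of_injective hinj ?_
    rw [Submodule.map_iSup, Submodule.map_top]
    simp only [hmap]
    rw [← evenCoh_toSubmodule]
    exact (Submodule.range_subtype _).symm

end CohomologicalDegree

/-! ### Functoriality of homomorphisms and composition of the endomorphisms `ρ_{(μ,a)}` -/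

section Functoriality

variable {k : Type*} [Field k] {C D D' : Type*} [Ring C] [Algebra k C] [Coalgebra k C]
  [Ring D] [Algebra k D] [Coalgebra k D] [Ring D'] [Algebra k D'] [Coalgebra k D']
  {A B E : Type*} [CommRing A] [Algebra k A] [CommRing B] [Algebra k B] [CommRing E] [Algebra k E]
  {𝒞 : ZMod 2 → Submodule k C} {𝒟 : ZMod 2 → Submodule k D} {𝒟' : ZMod 2 → Submodule k D'}

theorem scal_smul (φ : A →ₐ[k] B) {N : Type*} [AddCommGroup N] [Module k N] (a : A)
    (y : A ⊗[k] N) : scal φ N (a • y) = φ a • scal φ N y := by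
  induction y with
  | zero => simp
  | add a b ha hb => simp only [map_add, smul_add, ha, hb]
  | tmul a d => simp [scal, TensorProduct.smul_tmul']

theorem SHom.comp_point (g : SHom A 𝒟 𝒟') (f : SHom A 𝒞 𝒟) (c : C) :
    (g.comp f).point c = g.toHom (f.point c) := rfl

theorem SHom.toHom_tmul (g : SHom A 𝒞 𝒟) (a : A) (c : C) :
    g.toHom (a ⊗ₜ c) = a • g.point c := by
  have e : a ⊗ₜ[k] c = a • ((1 : A) ⊗ₜ[k] c) := by
    rw [TensorProduct.smul_tmul', smul_eq_mul, mul_one]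
  rw [e, map_smul, SHom.point_apply]

theorem SHom.map_toHom_scal (g : SHom A 𝒞 𝒟) (φ : A →ₐ[k] B) (x : A ⊗[k] C) :
    (g.map φ).toHom (scal φ C x) = scal φ D (g.toHom x) := by
  induction x with
  | zero => simp
  | add a b ha hb => simp only [map_add, ha, hb]
  | tmul a c =>
    rw [SHom.toHom_tmul, scal_smul, scal, LinearMap.rTensor_tmul, SHom.toHom_tmul,
      SHom.point_map]
    rfl

theorem SHom.map_comp (g : SHom A 𝒟 𝒟') (f : SHom A 𝒞 𝒟) (φ : A →ₐ[k] B) :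
    (g.comp f).map φ = (g.map φ).comp (f.map φ) :=
  SHom.ext_point fun c => by
    rw [SHom.point_map, SHom.comp_point, SHom.comp_point, SHom.point_map, SHom.map_toHom_scal]

theorem SHom.map_map (f : SHom A 𝒞 𝒟) (φ : A →ₐ[k] B) (ψ : B →ₐ[k] E) :
    (f.map φ).map ψ = f.map (ψ.comp φ) :=
  SHom.ext_point fun c => by
    rw [SHom.point_map, SHom.point_map, SHom.point_map]
    exact (DFunLike.congr_fun (LinearMap.rTensor_comp D ψ.toLinearMap φ.toLinearMap) _).symm

end Functoriality

section Rho

variable {k : Type*} [Field k] {p : ℕ} [Fact p.Prime] [CharP k p] {r s : ℕ}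
  {A B : Type*} [CommRing A] [Algebra k A] [CommRing B] [Algebra k B]

theorem basis_linear_ext [NeZero r] [NeZero s] {N : Type*} [AddCommGroup N] [Module k N]
    {f g : MAlg k p r s →ₗ[k] N}
    (h0 : ∀ i j, f (evenIncl k p r s (thetaE k p r s ^ i * sigmaE k p r s j)) =
      g (evenIncl k p r s (thetaE k p r s ^ i * sigmaE k p r s j)))
    (h1 : ∀ i j, f (oddIncl k p r s (thetaE k p r s ^ i * sigmaE k p r s j)) =
      g (oddIncl k p r s (thetaE k p r s ^ i * sigmaE k p r s j))) : f = g := by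
  refine MAlg.linear_ext k p r s (fun x => ?_) (fun x => ?_)
  · exact DFunLike.congr_fun (f := f ∘ₗ evenIncl k p r s) (g := g ∘ₗ evenIncl k p r s)
      (even_linear_ext fun i j _ _ => h0 i j) x
  · exact DFunLike.congr_fun (f := f ∘ₗ oddIncl k p r s) (g := g ∘ₗ oddIncl k p r s)
      (even_linear_ext fun i j _ _ => h1 i j) x

theorem rhoE_theta_sigma (a : A) (i j : ℕ) :
    rhoE k p r s a (thetaE k p r s ^ i * sigmaE k p r s j) =
      (a ^ (i + j * p ^ (r - 1))) ⊗ₜ (thetaE k p r s ^ i * sigmaE k p r s j) := by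
  rw [map_mul, map_pow, rhoE_theta, rhoE_sigma, Algebra.TensorProduct.tmul_pow,
    Algebra.TensorProduct.tmul_mul_tmul, pow_add]

theorem rho_point_even (hr : r ≠ 0) (a μ : A) (h : a ^ p ^ r = μ ^ 2) (i j : ℕ) :
    (rho s hr a μ h).point (evenIncl k p r s (thetaE k p r s ^ i * sigmaE k p r s j)) =
      (a ^ (i + j * p ^ (r - 1))) ⊗ₜ
        evenIncl k p r s (thetaE k p r s ^ i * sigmaE k p r s j) := by
  refine (SHom.point_ofPoint _ (isPoint_rho hr a μ h) _).trans ?_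
  rw [rhoHom_even, rhoE_theta_sigma, LinearMap.lTensor_tmul]

theorem rho_point_odd (hr : r ≠ 0) (a μ : A) (h : a ^ p ^ r = μ ^ 2) (i j : ℕ) :
    (rho s hr a μ h).point (oddIncl k p r s (thetaE k p r s ^ i * sigmaE k p r s j)) =
      (μ * a ^ (i + j * p ^ (r - 1))) ⊗ₜ
        oddIncl k p r s (thetaE k p r s ^ i * sigmaE k p r s j) := by
  refine (SHom.point_ofPoint _ (isPoint_rho hr a μ h) _).trans ?_
  rw [rhoHom_odd, rhoE_theta_sigma, LinearMap.lTensor_tmul, TensorProduct.smul_tmul', smul_eq_mul]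

theorem rho_ext [NeZero r] [NeZero s] {f g : SHom A (mParity k p r s) (mParity k p r s)}
    (h0 : ∀ i j, f.point (evenIncl k p r s (thetaE k p r s ^ i * sigmaE k p r s j)) =
      g.point (evenIncl k p r s (thetaE k p r s ^ i * sigmaE k p r s j)))
    (h1 : ∀ i j, f.point (oddIncl k p r s (thetaE k p r s ^ i * sigmaE k p r s j)) =
      g.point (oddIncl k p r s (thetaE k p r s ^ i * sigmaE k p r s j))) : f = g :=
  SHom.ext_point fun c => DFunLike.congr_fun
    (basis_linear_ext (f := f.point.toLinearMap) (g := g.point.toLinearMap) h0 h1) c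

theorem rho_map [NeZero r] [NeZero s] (hr : r ≠ 0) (a μ : A) (h : a ^ p ^ r = μ ^ 2)
    (φ : A →ₐ[k] B) :
    (rho (k := k) s hr a μ h).map φ =
      rho s hr (φ a) (φ μ) (by rw [← map_pow, h, map_pow]) := by
  refine rho_ext (fun i j => ?_) (fun i j => ?_)
  · rw [SHom.point_map, rho_point_even, rho_point_even, scal, LinearMap.rTensor_tmul]
    simp
  · rw [SHom.point_map, rho_point_odd, rho_point_odd, scal, LinearMap.rTensor_tmul]
    simp

theorem rho_comp [NeZero r] [NeZero s] (hr : r ≠ 0) (a μ b ν : A) (h : a ^ p ^ r = μ ^ 2)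
    (h' : b ^ p ^ r = ν ^ 2) :
    (rho (k := k) s hr a μ h).comp (rho s hr b ν h') =
      rho s hr (a * b) (μ * ν) (by rw [mul_pow, h, h', mul_pow]) := by
  refine rho_ext (fun i j => ?_) (fun i j => ?_)
  · rw [SHom.comp_point, rho_point_even, rho_point_even, SHom.toHom_tmul, rho_point_even,
      TensorProduct.smul_tmul', smul_eq_mul, mul_pow, mul_comm]
  · rw [SHom.comp_point, rho_point_odd, rho_point_odd, SHom.toHom_tmul, rho_point_odd,
      TensorProduct.smul_tmul', smul_eq_mul, mul_pow]
    congr 1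
    ring

variable {C : Type*} [Ring C] [Algebra k C] [Coalgebra k C] {𝒞 : ZMod 2 → Submodule k C}

theorem SHom.comp_assoc {D₁ D₂ D₃ : Type*} [Ring D₁] [Algebra k D₁] [Coalgebra k D₁]
    [Ring D₂] [Algebra k D₂] [Coalgebra k D₂] [Ring D₃] [Algebra k D₃] [Coalgebra k D₃]
    {𝒟₁ : ZMod 2 → Submodule k D₁} {𝒟₂ : ZMod 2 → Submodule k D₂} {𝒟₃ : ZMod 2 → Submodule k D₃}
    (h : SHom A 𝒟₂ 𝒟₃) (g : SHom A 𝒟₁ 𝒟₂) (f : SHom A 𝒞 𝒟₁) :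
    (h.comp g).comp f = h.comp (g.comp f) := SHom.ext_point fun _ => rfl

theorem rho_one_comp [NeZero r] [NeZero s] (hr : r ≠ 0) (h : (1 : A) ^ p ^ r = 1 ^ 2)
    (f : SHom A 𝒞 (mParity k p r s)) : (rho s hr 1 1 h).comp f = f := by
  have key : ∀ c, (rho (k := k) (p := p) s hr (1 : A) 1 h).point c = 1 ⊗ₜ c := fun c =>
    DFunLike.congr_fun (basis_linear_ext (f := (rho (k := k) (p := p) s hr (1 : A) 1 h).point.toLinearMap)
      (g := TensorProduct.mk k A (MAlg k p r s) 1)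
      (fun i j => (rho_point_even hr 1 1 h i j).trans (by rw [one_pow]; rfl))
      (fun i j => (rho_point_odd hr 1 1 h i j).trans (by rw [one_pow, one_mul]; rfl))) c
  refine SHom.ext_point fun c => ?_
  rw [SHom.comp_point]
  generalize f.point c = x
  induction x with
  | zero => simp
  | add a b ha hb => rw [map_add, ha, hb]
  | tmul a c => rw [SHom.toHom_tmul, key, TensorProduct.smul_tmul', smul_eq_mul, mul_one]

end Rho

/-! ### The grading of `k[V_{r;s}(G)]` -/

section MonoidAlgebra

variable {k : Type*} [Field k] {p : ℕ} [Fact p.Prime] [CharP k p] {r : ℕ} {S : Type*} [CommRing S] [Algebra k S]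

variable (k p r) in
/-- The quotient map onto `B`. -/
def bMk : MvPolynomial (Fin 2) k →ₐ[k] BAlg k p r := Ideal.Quotient.mkₐ k _

theorem bMk_surjective : Function.Surjective (bMk k p r) := Ideal.Quotient.mk_surjective

/-- The homomorphism `B → S` that a point `(μ, a)` of `Spec B` over `S` defines. -/
def bLift (a μ : S) (h : a ^ p ^ r = μ ^ 2) : BAlg k p r →ₐ[k] S :=
  Ideal.Quotient.liftₐ _ (MvPolynomial.aeval ![a, μ]) (fun x hx => by
    refine (Ideal.span_singleton_le_iff_mem (I := RingHom.ker (MvPolynomial.aeval ![a, μ]))).mpr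
      ?_ hx
    rw [RingHom.mem_ker]
    simp [h])

theorem bLift_bX (a μ : S) (h : a ^ p ^ r = μ ^ 2) : bLift (k := k) a μ h (bX k p r) = a := by
  change MvPolynomial.aeval ![a, μ] (MvPolynomial.X 0 : MvPolynomial (Fin 2) k) = a
  simp

theorem bLift_bY (a μ : S) (h : a ^ p ^ r = μ ^ 2) : bLift (k := k) a μ h (bY k p r) = μ := by
  change MvPolynomial.aeval ![a, μ] (MvPolynomial.X 1 : MvPolynomial (Fin 2) k) = μ
  simp

variable (k p r) in
/-- The element `x ^ i y ^ e` of the basis of `B`, where `q = (i, e)`. -/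
def bMon (q : ℕ × Fin 2) : BAlg k p r := bX k p r ^ q.1 * bY k p r ^ (q.2 : ℕ)

theorem bX_mul_bMon (q : ℕ × Fin 2) : bMon k p r q * bX k p r = bMon k p r (q.1 + 1, q.2) := by
  simp only [bMon]
  ring

theorem exists_bMon_mul_bY (q : ℕ × Fin 2) : ∃ q', bMon k p r q * bY k p r = bMon k p r q' := by
  obtain ⟨i, e⟩ := q
  fin_cases e
  · exact ⟨(i, 1), by simp [bMon]⟩
  · refine ⟨(i + p ^ r, 0), ?_⟩
    change bX k p r ^ i * bY k p r ^ 1 * bY k p r = bX k p r ^ (i + p ^ r) * bY k p r ^ 0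
    rw [pow_add, bX_pow]
    ring

theorem span_bMon : Submodule.span k (Set.range (bMon k p r)) = ⊤ := by
  rw [eq_top_iff]
  rintro b -
  obtain ⟨f, rfl⟩ := bMk_surjective b
  induction f using MvPolynomial.induction_on with
  | C c =>
    have h : bMk k p r (MvPolynomial.C c) = c • bMon k p r (0, 0) := by
      have h1 : bMon k p r (0, 0) = 1 := by
        change bX k p r ^ 0 * bY k p r ^ 0 = 1
        rw [pow_zero, pow_zero, one_mul]
      rw [h1, ← Algebra.algebraMap_eq_smul_one]
      exact (bMk k p r).commutes c
    rw [h]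
    exact Submodule.smul_mem _ _ (Submodule.subset_span ⟨_, rfl⟩)
  | add f g hf hg => rw [map_add]; exact add_mem hf hg
  | mul_X f n hf =>
    rw [map_mul]
    generalize bMk k p r f = b at hf ⊢
    induction hf using Submodule.span_induction with
    | zero => rw [zero_mul]; exact zero_mem _
    | add x y _ _ hx hy => rw [add_mul]; exact add_mem hx hy
    | smul c x _ hx => rw [smul_mul_assoc]; exact Submodule.smul_mem _ _ hx
    | mem x hx =>
      obtain ⟨q, rfl⟩ := hx
      fin_cases n
      · exact Submodule.subset_span ⟨_, (bX_mul_bMon q).symm⟩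
      · obtain ⟨q', hq'⟩ := exists_bMon_mul_bY (k := k) (p := p) (r := r) q
        exact Submodule.subset_span ⟨q', hq'.symm⟩

variable (p r) in
/-- The degree of `x ^ i y ^ e`. -/
def monDegree (q : ℕ × Fin 2) : HalfInt p r := (q.1 : HalfInt p r) + (q.2 : ℕ) • halfPow p r

theorem pow_smul_one_eq : p ^ r • (1 : HalfInt p r) = 2 • halfPow p r := by
  refine Subtype.ext ?_
  push_cast [coe_halfPow]
  simp
  ring

theorem monDegree_injective (hp : Odd p) : Function.Injective (monDegree p r) := by
  rintro ⟨i, e⟩ ⟨i', e'⟩ h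
  have h2 : 2 * i + e.1 * p ^ r = 2 * i' + e'.1 * p ^ r := by
    have h3 := congrArg (fun x : HalfInt p r => (2 * x : ℚ)) h
    simp only [monDegree] at h3
    push_cast [coe_halfPow] at h3
    simp only [nsmul_eq_mul] at h3
    have : ((2 * i + e.1 * p ^ r : ℕ) : ℚ) = (2 * i' + e'.1 * p ^ r : ℕ) := by
      push_cast
      linarith
    exact_mod_cast this
  obtain ⟨m, hm⟩ := hp.pow (n := r)
  rw [hm] at h2
  fin_cases e <;> fin_cases e' <;> simp at h2 ⊢ <;> omega

variable (k p r) in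
/-- The homomorphism from `B` to a monoid algebra that maps `x` and `y` to their degrees. -/
def bGrading : BAlg k p r →ₐ[k] AddMonoidAlgebra k (HalfInt p r) :=
  bLift (AddMonoidAlgebra.single 1 1) (AddMonoidAlgebra.single (halfPow p r) 1) (by
    rw [AddMonoidAlgebra.single_pow, AddMonoidAlgebra.single_pow, pow_smul_one_eq, one_pow,
      one_pow])

theorem bGrading_bMon (q : ℕ × Fin 2) :
    bGrading k p r (bMon k p r q) = AddMonoidAlgebra.single (monDegree p r q) 1 := by
  rw [bMon, map_mul, map_pow, map_pow, bGrading, bLift_bX, bLift_bY, AddMonoidAlgebra.single_pow,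
    AddMonoidAlgebra.single_pow, AddMonoidAlgebra.single_mul_single, one_pow, one_pow, mul_one,
    nsmul_one, monDegree]

variable (k) in
/-- The linear form on `B` that maps monomials of degree `d` to `1` and all others to `0`. -/
def bCoeff (d : HalfInt p r) : BAlg k p r →ₗ[k] k where
  toFun b := (bGrading k p r b).coeff d
  map_add' a b := by rw [map_add, AddMonoidAlgebra.coeff_add, Finsupp.add_apply]
  map_smul' c b := by rw [map_smul, AddMonoidAlgebra.coeff_smul, Finsupp.smul_apply, RingHom.id_apply]

theorem bCoeff_bMon_self (q : ℕ × Fin 2) : bCoeff k (monDegree p r q) (bMon k p r q) = 1 := by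
  change (bGrading k p r (bMon k p r q)).coeff _ = 1
  rw [bGrading_bMon, AddMonoidAlgebra.coeff_single, Finsupp.single_eq_same]

theorem bCoeff_bMon_of_ne {d : HalfInt p r} {q : ℕ × Fin 2} (h : monDegree p r q ≠ d) :
    bCoeff k d (bMon k p r q) = 0 := by
  change (bGrading k p r (bMon k p r q)).coeff _ = 0
  rw [bGrading_bMon, AddMonoidAlgebra.coeff_single, Finsupp.single_eq_of_ne h.symm]

end MonoidAlgebra

section Coaction

variable {k : Type*} [Field k] {p : ℕ} [Fact p.Prime] [CharP k p] {r s : ℕ} [NeZero r] [NeZero s]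
  {C : Type*} [Ring C] [Algebra k C] [Coalgebra k C] {𝒞 : ZMod 2 → Submodule k C}
  {S : Type*} [CommRing S] [Algebra k S]

theorem coordRing_hom_ext {f g : VRing p r s 𝒞 →ₐ[k] S}
    (h : (universalHom 𝒞 (mParity k p r s)).map f = (universalHom 𝒞 (mParity k p r s)).map g) :
    f = g := by
  rw [← coordLift_map f, h, coordLift_map]

/-- The action of a point of `Spec B` on a point of `V_{r;s}(G)`. -/
theorem map_comp_coaction (ψ : VRing p r s 𝒞 ⊗[k] BAlg k p r →ₐ[k] S)
    {a μ : S} (ha : ψ (1 ⊗ₜ bX k p r) = a) (hμ : ψ (1 ⊗ₜ bY k p r) = μ) (h : a ^ p ^ r = μ ^ 2) :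
    (universalHom 𝒞 (mParity k p r s)).map (ψ.comp (coaction p r s 𝒞)) =
      (rho s (NeZero.ne r) a μ h).comp ((universalHom 𝒞 (mParity k p r s)).map
        (ψ.comp Algebra.TensorProduct.includeLeft)) := by
  subst ha hμ
  rw [← SHom.map_map, ← SHom.map_map, coaction, map_coordLift, SHom.map_comp, rho_map]

/-- The comultiplication of `B`, for which `x` and `y` are grouplike, as a homomorphism from
`A_G ⊗ B` to `A_G ⊗ B ⊗ B`. -/
def doubling : VRing p r s 𝒞 ⊗[k] BAlg k p r →ₐ[k]
    (VRing p r s 𝒞 ⊗[k] BAlg k p r) ⊗[k] BAlg k p r :=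
  Algebra.TensorProduct.productMap
    (Algebra.TensorProduct.includeLeft.comp Algebra.TensorProduct.includeLeft)
    (bLift ((1 ⊗ₜ bX k p r) ⊗ₜ bX k p r) ((1 ⊗ₜ bY k p r) ⊗ₜ bY k p r) (by
      rw [Algebra.TensorProduct.tmul_pow, Algebra.TensorProduct.tmul_pow,
        Algebra.TensorProduct.tmul_pow, Algebra.TensorProduct.tmul_pow, bX_pow, one_pow, one_pow]))

theorem doubling_bMon (v : VRing p r s 𝒞) (q : ℕ × Fin 2) :
    doubling (v ⊗ₜ bMon k p r q) = (v ⊗ₜ bMon k p r q) ⊗ₜ bMon k p r q := by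
  rw [doubling, Algebra.TensorProduct.productMap_apply_tmul, bMon, map_mul, map_pow, map_pow,
    bLift_bX, bLift_bY, AlgHom.comp_apply, Algebra.TensorProduct.includeLeft_apply,
    Algebra.TensorProduct.includeLeft_apply]
  simp only [Algebra.TensorProduct.tmul_pow, Algebra.TensorProduct.tmul_mul_tmul, one_pow, one_mul,
    mul_one]

theorem coaction_coassoc (v : VRing p r s 𝒞) :
    Algebra.TensorProduct.map (coaction p r s 𝒞) (AlgHom.id k (BAlg k p r)) (coaction p r s 𝒞 v) =
      doubling (coaction p r s 𝒞 v) := by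
  refine DFunLike.congr_fun (f := (Algebra.TensorProduct.map (coaction p r s 𝒞)
    (AlgHom.id k (BAlg k p r))).comp (coaction p r s 𝒞))
    (g := doubling.comp (coaction p r s 𝒞)) (coordRing_hom_ext ?_) v
  have h1 : ((1 : VRing p r s 𝒞 ⊗[k] BAlg k p r) ⊗ₜ[k] bX k p r) ^ p ^ r =
      (1 ⊗ₜ bY k p r) ^ 2 := tmul_bX_pow p r
  have h2 : (((1 : VRing p r s 𝒞) ⊗ₜ[k] bX k p r) ⊗ₜ[k] (1 : BAlg k p r)) ^ p ^ r =
      ((1 ⊗ₜ bY k p r) ⊗ₜ 1) ^ 2 := by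
    rw [Algebra.TensorProduct.tmul_pow, tmul_bX_pow, Algebra.TensorProduct.tmul_pow,
      Algebra.TensorProduct.tmul_pow, Algebra.TensorProduct.tmul_pow, one_pow, one_pow, one_pow]
  have e1 : (Algebra.TensorProduct.map (coaction p r s 𝒞) (AlgHom.id k (BAlg k p r))).comp
      Algebra.TensorProduct.includeLeft = Algebra.TensorProduct.includeLeft.comp
        (coaction p r s 𝒞) := AlgHom.ext fun v => by simp
  have e2 : (doubling (𝒞 := 𝒞) (s := s)).comp Algebra.TensorProduct.includeLeft =
      (Algebra.TensorProduct.includeLeft (R := k) (S := k) (A := VRing p r s 𝒞 ⊗[k] BAlg k p r)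
        (B := BAlg k p r)).comp Algebra.TensorProduct.includeLeft :=
    AlgHom.ext fun v => by simp [doubling]
  rw [map_comp_coaction (Algebra.TensorProduct.map (coaction p r s 𝒞)
      (AlgHom.id k (BAlg k p r))) (a := 1 ⊗ₜ bX k p r) (μ := 1 ⊗ₜ bY k p r) ?_ ?_ h1, e1,
    map_comp_coaction Algebra.TensorProduct.includeLeft (a := (1 ⊗ₜ bX k p r) ⊗ₜ 1)
      (μ := (1 ⊗ₜ bY k p r) ⊗ₜ 1) rfl rfl h2, ← SHom.comp_assoc, rho_comp,
    map_comp_coaction (doubling (𝒞 := 𝒞) (s := s)) (a := (1 ⊗ₜ bX k p r) * ((1 ⊗ₜ bX k p r) ⊗ₜ 1))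
      (μ := (1 ⊗ₜ bY k p r) * ((1 ⊗ₜ bY k p r) ⊗ₜ 1)) ?_ ?_ (by rw [mul_pow, h1, h2, mul_pow]), e2]
  · simp [doubling, bLift_bX]
  · simp [doubling, bLift_bY]
  · simp
  · simp

theorem coaction_counit (v : VRing p r s 𝒞) :
    Algebra.TensorProduct.productMap (AlgHom.id k (VRing p r s 𝒞))
      (bLift (p := p) (r := r) 1 1 (by rw [one_pow, one_pow])) (coaction p r s 𝒞 v) = v := by
  refine DFunLike.congr_fun (f := (Algebra.TensorProduct.productMap (AlgHom.id k (VRing p r s 𝒞))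
      (bLift (p := p) (r := r) 1 1 (by rw [one_pow, one_pow]))).comp (coaction p r s 𝒞))
    (g := AlgHom.id k _) (coordRing_hom_ext ?_) v
  rw [map_comp_coaction _ (a := 1) (μ := 1) ?_ ?_ (by rw [one_pow, one_pow]), rho_one_comp]
  · congr 1
    exact AlgHom.ext fun v => by simp
  · simp [bLift_bX]
  · simp [bLift_bY]

/-- The map `v ⊗ b ↦ l(b) v`. -/
def contractB (N : Type*) [AddCommGroup N] [Module k N] (l : BAlg k p r →ₗ[k] k) :
    N ⊗[k] BAlg k p r →ₗ[k] N :=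
  (TensorProduct.rid k N).toLinearMap ∘ₗ l.lTensor N

theorem contractB_tmul (N : Type*) [AddCommGroup N] [Module k N] (l : BAlg k p r →ₗ[k] k) (v : N)
    (b : BAlg k p r) : contractB N l (v ⊗ₜ b) = l b • v := by
  rw [contractB, LinearMap.comp_apply, LinearMap.lTensor_tmul]
  exact TensorProduct.rid_tmul _ _

theorem weightSpace_le_vPiece (q : ℕ × Fin 2) :
    weightSpace p r s 𝒞 q.1 q.2 ≤ vPiece p r s 𝒞 (monDegree p r q) := fun _ hv =>
  Submodule.mem_iSup_of_mem q.1 (Submodule.mem_iSup_of_mem q.2 (Submodule.mem_iSup_of_mem rfl hv))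

theorem vPiece_le {d : HalfInt p r} {N : Submodule k (VRing p r s 𝒞)}
    (h : ∀ q : ℕ × Fin 2, monDegree p r q = d → ∀ v,
      coaction p r s 𝒞 v = v ⊗ₜ bMon k p r q → v ∈ N) : vPiece p r s 𝒞 d ≤ N :=
  iSup_le fun i => iSup_le fun e => iSup_le fun he v hv => h (i, e) he v hv

theorem exists_monomials {N : Type*} [AddCommGroup N] [Module k N] (x : N ⊗[k] BAlg k p r) :
    ∃ c : ℕ × Fin 2 →₀ N, x = c.sum fun q v => v ⊗ₜ bMon k p r q := by
  let L : (ℕ × Fin 2 →₀ N) →ₗ[k] N ⊗[k] BAlg k p r :=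
    Finsupp.lsum k fun q => (TensorProduct.mk k N (BAlg k p r)).flip (bMon k p r q)
  have hL : x ∈ LinearMap.range L := by
    induction x with
    | zero => exact zero_mem _
    | add a b ha hb => exact add_mem ha hb
    | tmul v b =>
      have h : Submodule.span k (Set.range (bMon k p r)) ≤
          (LinearMap.range L).comap (TensorProduct.mk k N (BAlg k p r) v) := by
        refine Submodule.span_le.mpr ?_
        rintro _ ⟨q, rfl⟩
        exact ⟨Finsupp.single q v, by simp [L]⟩
      exact h (span_bMon (k := k) (p := p) (r := r) ▸ Submodule.mem_top)
  obtain ⟨c, hc⟩ := hL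
  exact ⟨c, hc.symm⟩

theorem iSupIndep_vPiece : iSupIndep (vPiece p r s 𝒞) := by
  refine iSupIndep_of_projections
    (fun d => contractB (VRing p r s 𝒞) (bCoeff k d) ∘ₗ (coaction p r s 𝒞).toLinearMap)
    (fun d => ?_) (fun d d' hd => ?_)
  · refine vPiece_le (N := LinearMap.eqLocus _ LinearMap.id) ?_
    rintro q rfl v hv
    change contractB _ _ (coaction p r s 𝒞 v) = v
    rw [hv, contractB_tmul, bCoeff_bMon_self, one_smul]
  · refine vPiece_le (N := LinearMap.ker _) ?_
    rintro q rfl v hv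
    change contractB _ _ (coaction p r s 𝒞 v) = 0
    rw [hv, contractB_tmul, bCoeff_bMon_of_ne hd, zero_smul]

/-- The coefficients of the coaction of `v` at the monomials `x ^ i y ^ e` are homogeneous, by
coassociativity, and their sum is `v`, by the counit. As `p` is odd, distinct monomials have distinct
degrees. -/
theorem iSup_vPiece (hp : Odd p) : ⨆ d, vPiece p r s 𝒞 d = ⊤ := by
  rw [eq_top_iff]
  rintro v -
  obtain ⟨c, hc⟩ := exists_monomials (coaction p r s 𝒞 v)
  have hw : ∀ q, coaction p r s 𝒞 (c q) = c q ⊗ₜ bMon k p r q := by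
    intro q
    -- Compare the coefficients of `bMon q` in the last factor of the coassociativity identity.
    have h := congrArg (contractB (VRing p r s 𝒞 ⊗[k] BAlg k p r) (bCoeff k (monDegree p r q)))
      (coaction_coassoc v)
    rw [hc, Finsupp.sum, map_sum, map_sum, map_sum, map_sum,
      Finset.sum_eq_single q, Finset.sum_eq_single q] at h
    · rw [Algebra.TensorProduct.map_tmul, AlgHom.id_apply, contractB_tmul, doubling_bMon,
        contractB_tmul, bCoeff_bMon_self, one_smul, one_smul] at h
      exact h
    · intro q' _ hq
      rw [doubling_bMon, contractB_tmul,
        bCoeff_bMon_of_ne fun e => hq (monDegree_injective hp e), zero_smul]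
    · intro hq
      rw [Finsupp.notMem_support_iff.mp hq, TensorProduct.zero_tmul, map_zero, map_zero]
    · intro q' _ hq
      rw [Algebra.TensorProduct.map_tmul, AlgHom.id_apply, contractB_tmul,
        bCoeff_bMon_of_ne fun e => hq (monDegree_injective hp e), zero_smul]
    · intro hq
      rw [Finsupp.notMem_support_iff.mp hq, TensorProduct.zero_tmul, map_zero, map_zero]
  have hv : v = c.sum fun _ u => u := by
    have h := coaction_counit v
    rw [hc, Finsupp.sum, map_sum] at h
    rw [← h]
    refine Finset.sum_congr rfl fun q _ => ?_
    rw [Algebra.TensorProduct.productMap_apply_tmul, bMon, map_mul, map_pow, map_pow, bLift_bX,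
      bLift_bY, one_pow, one_pow, one_mul, mul_one, AlgHom.id_apply]
  rw [hv]
  exact Submodule.sum_mem _ fun q _ =>
    Submodule.mem_iSup_of_mem (monDegree p r q) (weightSpace_le_vPiece q (hw q))

theorem one_mem_vPiece : (1 : VRing p r s 𝒞) ∈ vPiece p r s 𝒞 0 := by
  have h : monDegree p r (0, 0) = 0 := by simp [monDegree]
  rw [← h]
  refine weightSpace_le_vPiece (0, 0) ?_
  rw [mem_weightSpace, map_one, Algebra.TensorProduct.one_def]
  simp

theorem exists_bMon_mul_bMon (q q' : ℕ × Fin 2) : ∃ q'', bMon k p r q * bMon k p r q' =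
    bMon k p r q'' ∧ monDegree p r q'' = monDegree p r q + monDegree p r q' := by
  obtain ⟨i, e⟩ := q
  obtain ⟨i', e'⟩ := q'
  have hh := pow_smul_one_eq (p := p) (r := r)
  rw [nsmul_one, two_nsmul] at hh
  fin_cases e <;> fin_cases e'
  · exact ⟨(i + i', 0), by simp [bMon, pow_add], by simp [monDegree]⟩
  · exact ⟨(i + i', 1), by simp [bMon, pow_add, mul_assoc], by simp [monDegree, add_assoc]⟩
  · exact ⟨(i + i', 1), by simp [bMon, pow_add, mul_right_comm],
      by simp [monDegree, add_right_comm]⟩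
  · refine ⟨(i + i' + p ^ r, 0), ?_, ?_⟩
    · change bX k p r ^ i * bY k p r ^ 1 * (bX k p r ^ i' * bY k p r ^ 1) =
        bX k p r ^ (i + i' + p ^ r) * bY k p r ^ 0
      rw [pow_add, pow_add, bX_pow]
      ring
    · simp only [monDegree]
      rw [Nat.cast_add, hh, Nat.cast_add]
      simp
      abel

theorem mul_mem_vPiece {d d' : HalfInt p r} {a b : VRing p r s 𝒞} (ha : a ∈ vPiece p r s 𝒞 d)
    (hb : b ∈ vPiece p r s 𝒞 d') : a * b ∈ vPiece p r s 𝒞 (d + d') := by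
  refine vPiece_le (N := (vPiece p r s 𝒞 (d + d')).comap (LinearMap.mulRight k b)) ?_ ha
  rintro q rfl v hv
  refine vPiece_le (N := (vPiece p r s 𝒞 (monDegree p r q + d')).comap (LinearMap.mulLeft k v))
    ?_ hb
  rintro q' rfl w hw
  obtain ⟨q'', h1, h2⟩ := exists_bMon_mul_bMon (k := k) (r := r) q q'
  rw [← h2]
  refine weightSpace_le_vPiece q'' ?_
  change coaction p r s 𝒞 (v * w) = (v * w) ⊗ₜ bMon k p r q''
  rw [map_mul, hv, hw, Algebra.TensorProduct.tmul_mul_tmul, h1]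

theorem nonempty_gradedAlgebra_vPiece (hp : Odd p) :
    Nonempty (GradedAlgebra (vPiece p r s 𝒞)) := by
  classical
  have h := nonempty_gradedAlgebra (V := vPiece p r s 𝒞) one_mem_vPiece
    (fun _ _ _ _ => mul_mem_vPiece) iSupIndep_vPiece (iSup_vPiece hp)
  convert h

end Coaction

end SuperCoh

end

theorem propositionP {k : Type*} [Field k] {p : ℕ} [Fact p.Prime] [CharP k p] (hp : 3 ≤ p)
    (r s : ℕ) [NeZero r] [NeZero s]
    {C : Type*} [Ring C] [Algebra k C] [Coalgebra k C] [Algebra.FiniteType k C]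
    (𝒞 : ZMod 2 → Submodule k C) [GradedAlgebra 𝒞] (hG : SuperCoh.IsCommHopfSuperalgebra k 𝒞) :
    (∃! ε : SuperCoh.Coh k (SuperCoh.MAlg k p r s) →ₐ[k] k, SuperCoh.IsEps ε) ∧
    Nonempty (GradedAlgebra (SuperCoh.evenCohPart 𝒞)) ∧
    Nonempty (GradedAlgebra (SuperCoh.vPiece p r s 𝒞)) ∧
    ∀ ε : SuperCoh.Coh k (SuperCoh.MAlg k p r s) →ₐ[k] k, SuperCoh.IsEps ε →
      ∀ n : ℕ, ∀ z ∈ SuperCoh.evenCohPart 𝒞 n,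
        SuperCoh.psi 𝒞 ε z ∈ SuperCoh.vPiece p r s 𝒞 (n • SuperCoh.halfPow p r) := by
  have hodd : Odd p := (Fact.out : p.Prime).odd_of_ne_two (by omega)
  refine ⟨SuperCoh.existsUnique_isEps k p r s hodd hp,
    SuperCoh.nonempty_gradedAlgebra_evenCohPart 𝒞, ?_, fun ε hε n z hz =>
    SuperCoh.psi_mem_vPiece hodd hp hε n z hz⟩
  exact SuperCoh.nonempty_gradedAlgebra_vPiece hodd
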